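/- **Setting.** Let $M$ be a compact $C^\infty$ three-dimensional manifold without boundary, $1\le r\le\infty$, and let $\mathrm{Diff}^r(M)$ carry the $C^r$ topology. A *blender-horseshoe* of $f\in\mathrm{Diff}^r(M)$ is given by a $C^1$ chart of $M$ with coordinates $(x_s,x_c,x_u)$, a closed box $\overline\Delta=I_s\times I_c\times I_u$ in it (the product of three compact nondegenerate intervals), and $\alpha\in(0,1)$; the cone fields $C^{s},C^{u},C^{uu}$ on $\overline\Delta$ are $\{|(v_c,v_u)|\le\alpha|v_s|\}$, $\{|v_s|\le\alpha|(v_c,v_u)|\}$, $\{|(v_s,v_c)|\le\alpha|v_u|\}$ (Euclidean norms in the chart). A *$uu$-disc* is a $C^1$ arc in $\overline\Delta$ tangent to $C^{uu}$ and joining the two faces of $\overline\Delta$ orthogonal to the $x_u$-axis. The following is required. 1. The set of points of $\overline\Delta$ that $f$ maps into the part $\{x_u\in I_u\}$ of the chart is the union of two disjoint, compact, connected, nonempty sets $A$, $B$. Moreover $x_s\circ f$ takes values in the interior of $I_s$ on $A\cup B$, and $x_u$ takes values in the interior of $I_u$ on $A\cup B$. 2. There are $\alpha'\in(0,\alpha)$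 and $c>1$ such that, at the points of $A\cup B$, $Df$ maps $C^{u}$, $C^{uu}$ into the corresponding cones of aperture $\alpha'$, $Df^{-1}$ maps $C^{s}$ into the cone of aperture $\alpha'$, and $Df$ on $C^{u}$ and $Df^{-1}$ on $C^{s}$ expand Euclidean norms at least by the factor $c$. 3. If $x\in A\cup B$ and $f(x)\in\overline\Delta$, then $x_c$ is in the interior of $I_c$. 4. $f$ has fixed points $P^-\in A$ and $P^+\in B$ (the *reference saddles*). Let $W^s_{loc}(\Gamma_f,f)=\{x: f^i(x)\in\overline\Delta\ \forall i\ge0\}$, and let $W^s_{loc}(P^\pm,f)$ be its connected component that contains $P^\pm$. An arc $D$ is at the *right* (*left*) of $W^s_{loc}(P^\pm,f)$ if $x_c(p)>x_c(q)$ (resp. $<$) for all $p\in D$, $q\in W^s_{loc}(P^\pm,f)$ with $x_s(p)=x_s(q)$ and $x_u(p)=x_u(q)$. If $D$, $D'$ are $uu$-discs that meet $W^s_{loc}(P^-,f)$ and $W^s_{loc}(P^+,f)$ respectively, then $D\cap D'=\emptyset$, both are disjoint from the faces of $\overline\Delta$ orthogonal to the $x_c$-axis, $D$ is at the left of $W^s_{loc}(P^+,f)$,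 and $D'$ is at the right of $W^s_{loc}(P^-,f)$. 5. For each $uu$-disc $D$: if $D$ is at the right (left) of $W^s_{loc}(P^-,f)$, so is $f(D\cap A)$; if $D$ is at the right (left) of $W^s_{loc}(P^+,f)$, so is $f(D\cap B)$; if $D$ is at the left of $W^s_{loc}(P^-,f)$ or meets it, then $f(D\cap B)$ is at its left; if $D$ is at the right of $W^s_{loc}(P^+,f)$ or meets it, then $f(D\cap A)$ is at its right. 6. Call a $uu$-disc *in-between* if it is at the right of $W^s_{loc}(P^-,f)$ and at the left of $W^s_{loc}(P^+,f)$. If $D$ is in-between, then $f(D\cap A)$ or $f(D\cap B)$ is a $uu$-disc in-between. The blender-horseshoe is $\Gamma_f=\bigcap_{i\in\mathbb Z}f^i(\overline\Delta)$. For $g$ near $f$, $\Gamma_g$ and $W^s_{loc}(\Gamma_g,g)$ are defined with the same $\overline\Delta$. A *$uu$-tube in-between* is a $C^1$ surface with boundary $T=\bigcup_{t\in[0,1]}D_t$, where $(D_t)$ is a continuous family of $uu$-discs in-between, pairwise disjoint for $t\in[0,1)$, with $D_0=D_1$, and where the boundary of $T$ consists of the end points of the $D_t$. A *tangency point* of $W^s_{loc}(\Gamma_f,f)$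 and a surface is a common point at which they have a common nonzero tangent vector. **Statement.** Let $\Gamma_f$ be a blender-horseshoe of $f\in\mathrm{Diff}^r(M)$ and let $T$ be a $uu$-tube in-between. (1) $W^s_{loc}(\Gamma_f,f)$ and $T$ have a tangency point. (2) If in addition $T$ is contained in the unstable manifold $W^u(R_f,f)$ of a hyperbolic periodic point $R_f$ of index two (unstable bundle of dimension two), as a compact subset of this immersed manifold, then there is a $C^r$ neighbourhood $\mathcal V$ of $f$ on which the continuation $g\mapsto R_g$ of $R_f$ is defined and such that, for every $g\in\mathcal V$, $W^s_{loc}(\Gamma_g,g)$ and $W^u(R_g,g)$ have a tangency point. -/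

import Mathlib

open Set Filter Topology
open scoped Manifold ContDiff

noncomputable section

namespace BlenderTube

/-- Three-dimensional Euclidean space. Coordinate `0` is the stable, `1` the center-unstable and
`2` the strong unstable direction. -/
abbrev E3 : Type := EuclideanSpace ℝ (Fin 3)

/-! ### The space of `C^r` diffeomorphisms -/

/-- `C^r` diffeomorphisms of a three-dimensional manifold without boundary. -/
abbrev Diff (r : ℕ∞) (M : Type*) [TopologicalSpace M] [ChartedSpace E3 M] : Type _ :=
  Diffeomorph (𝓡 3) (𝓡 3) M M (r : WithTop ℕ∞)

section Topology

variable {M : Type*} [TopologicalSpace M] [ChartedSpace E3 M]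

/-- Basic `C^r` neighbourhood of `f`: the diffeomorphisms `g` mapping the compact set `K` into the
domain of `ψ` whose `k`-th derivative, read in the charts `φ` and `ψ`, is `ε`-close to that of `f`
on `K`. -/
def basicNhd {r : ℕ∞} (f : Diff r M) (φ ψ : OpenPartialHomeomorph M E3) (K : Set M) (k : ℕ)
    (ε : ℝ) : Set (Diff r M) :=
  {g | MapsTo g K ψ.source ∧ ∀ x ∈ K,
    ‖iteratedFDeriv ℝ k (fun p => ψ (g (φ.symm p))) (φ x) -
      iteratedFDeriv ℝ k (fun p => ψ (f (φ.symm p))) (φ x)‖ < ε}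

/-- The `C^r` topology: uniform convergence on compact sets, in smooth charts, of all derivatives
of order at most `r`. -/
instance crTopology (r : ℕ∞) : TopologicalSpace (Diff r M) :=
  TopologicalSpace.generateFrom
    {N | ∃ (f : Diff r M) (φ ψ : OpenPartialHomeomorph M E3) (K : Set M) (k : ℕ) (ε : ℝ),
      φ ∈ IsManifold.maximalAtlas (𝓡 3) ∞ M ∧ ψ ∈ IsManifold.maximalAtlas (𝓡 3) ∞ M ∧
      IsCompact K ∧ K ⊆ φ.source ∧ MapsTo f K ψ.source ∧ (k : ℕ∞) ≤ r ∧ 0 < ε ∧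
      N = basicNhd f φ ψ K k ε}

end Topology

/-! ### Cones -/

/-- The stable cone of aperture `α`. -/
def stableCone (α : ℝ) : Set E3 := {v | √(v 1 ^ 2 + v 2 ^ 2) ≤ α * |v 0|}

/-- The unstable cone of aperture `α`. -/
def unstableCone (α : ℝ) : Set E3 := {v | |v 0| ≤ α * √(v 1 ^ 2 + v 2 ^ 2)}

/-- The strong unstable cone of aperture `α`. -/
def strongUnstableCone (α : ℝ) : Set E3 := {v | √(v 0 ^ 2 + v 1 ^ 2) ≤ α * |v 2|}

/-! ### Blender-horseshoes -/

/-- The data accompanying a blender-horseshoe: a local chart, a closed coordinate box in its image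
(the reference domain), the aperture of the cone fields, the two pieces of the box that return to
the strip above and below the box, and the two reference fixed points. -/
structure BlenderData (M : Type*) [TopologicalSpace M] where
  /-- The chart. -/
  chart : OpenPartialHomeomorph M E3
  /-- The box is the product of the intervals `[lo i, hi i]`. -/
  lo : Fin 3 → ℝ
  /-- The box is the product of the intervals `[lo i, hi i]`. -/
  hi : Fin 3 → ℝ
  /-- The aperture of the cones. -/
  α : ℝ
  /-- The piece of the box that contains `Pminus`, in coordinates. -/
  A : Set E3
  /-- The piece of the box that contains `Pplus`, in coordinates. -/
  B : Set E3
  /-- The left reference fixed point. -/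
  Pminus : M
  /-- The right reference fixed point. -/
  Pplus : M

/-- The local stable set of the maximal invariant set of `f` in `X`: the points whose whole forward
orbit stays in `X`. -/
def localStableSet {M : Type*} (f : M → M) (X : Set M) : Set M := {x | ∀ i : ℕ, f^[i] x ∈ X}

/-- `D` passes at the right of the curve `W`: over each common point of the projections along the
center direction, `D` has the larger center coordinate. For a curve `D` crossing the box in the
strong unstable direction and a curve `W` crossing it in the stable direction, both tangent to the
respective cones of aperture `< 1`, the two projections have exactly one common point. -/
def RightOf (D W : Set E3) : Prop := ∀ p ∈ D, ∀ q ∈ W, p 0 = q 0 → p 2 = q 2 → q 1 < p 1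

/-- `D` passes at the left of the curve `W`. -/
def LeftOf (D W : Set E3) : Prop := ∀ p ∈ D, ∀ q ∈ W, p 0 = q 0 → p 2 = q 2 → p 1 < q 1

namespace BlenderData

variable {M : Type*} [TopologicalSpace M] (𝔅 : BlenderData M)

/-- The closed box, in coordinates. -/
def box : Set E3 := {p | ∀ i, p i ∈ Icc (𝔅.lo i) (𝔅.hi i)}

/-- The closed reference domain in `M`. -/
def domain : Set M := 𝔅.chart.symm '' 𝔅.box

/-- The diffeomorphism in coordinates. -/
def local_ (f : M → M) (p : E3) : E3 := 𝔅.chart (f (𝔅.chart.symm p))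

/-- The local stable manifold of `P`, i.e. the component through `P` of the local stable set, in
coordinates. -/
def locStable (f : M → M) (P : M) : Set E3 :=
  𝔅.chart '' connectedComponentIn (localStableSet f 𝔅.domain) P

/-- `u` parametrizes, by the strong unstable coordinate, a `C^1` disc (an arc) in the box that is
tangent to the strong unstable cone field and joins the two strong unstable faces of the box. -/
structure IsUUParam (u : ℝ → E3) : Prop where
  contDiffOn : ContDiffOn ℝ 1 u (Icc (𝔅.lo 2) (𝔅.hi 2))
  coord : ∀ z ∈ Icc (𝔅.lo 2) (𝔅.hi 2), u z 2 = z
  mem_box : ∀ z ∈ Icc (𝔅.lo 2) (𝔅.hi 2), u z ∈ 𝔅.box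
  tangent : ∀ z ∈ Icc (𝔅.lo 2) (𝔅.hi 2),
    derivWithin u (Icc (𝔅.lo 2) (𝔅.hi 2)) z ∈ strongUnstableCone 𝔅.α

/-- The set parametrized by `u`. -/
def disc (u : ℝ → E3) : Set E3 := u '' Icc (𝔅.lo 2) (𝔅.hi 2)

/-- `uu`-discs. -/
def IsUUDisc (D : Set E3) : Prop := ∃ u : ℝ → E3, 𝔅.IsUUParam u ∧ D = 𝔅.disc u

/-- `uu`-discs in-between: at the right of the local stable manifold of the left reference fixed
point and at the left of that of the right reference fixed point. -/
def InBetween (f : M → M) (D : Set E3) : Prop :=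
  𝔅.IsUUDisc D ∧ RightOf D (𝔅.locStable f 𝔅.Pminus) ∧ LeftOf D (𝔅.locStable f 𝔅.Pplus)

end BlenderData

open BlenderData in
/-- `Γ` is a blender-horseshoe of `f` (of index two, in dimension three) with data `𝔅`. These
conditions imply that `Γ` lies in the interior of the domain, is hyperbolic and partially
hyperbolic with three one-dimensional bundles, and is conjugate to the full shift on two symbols. -/
structure IsBlenderHorseshoe {M : Type*} [TopologicalSpace M] [ChartedSpace E3 M]
    (f : Equiv.Perm M) (𝔅 : BlenderData M) (Γ : Set M) : Prop where
  /-- `Γ` is the maximal invariant set in the domain. -/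
  eq_maximal : Γ = ⋂ i : ℤ, (f ^ i : Equiv.Perm M) '' 𝔅.domain
  /-- The chart is a `C^1` chart of `M`. -/
  chart_mem : 𝔅.chart ∈ IsManifold.maximalAtlas (𝓡 3) 1 M
  lo_lt_hi : ∀ i, 𝔅.lo i < 𝔅.hi i
  box_subset : 𝔅.box ⊆ 𝔅.chart.target
  α_mem : 𝔅.α ∈ Ioo (0 : ℝ) 1
  /-- The part of the box that is mapped to the strip between the hyperplanes that contain the
  strong unstable faces has exactly two connected components, `A` and `B`. -/
  returns : 𝔅.A ∪ 𝔅.B = {p ∈ 𝔅.box | f (𝔅.chart.symm p) ∈ 𝔅.chart.source ∧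
    𝔅.local_ f p 2 ∈ Icc (𝔅.lo 2) (𝔅.hi 2)}
  isCompact_A : IsCompact 𝔅.A
  isCompact_B : IsCompact 𝔅.B
  isConnected_A : IsConnected 𝔅.A
  isConnected_B : IsConnected 𝔅.B
  disjoint_AB : Disjoint 𝔅.A 𝔅.B
  /-- The images of `A` and `B` avoid the stable faces, and `A` and `B` avoid the strong unstable
  faces. -/
  image_stable : ∀ p ∈ 𝔅.A ∪ 𝔅.B, 𝔅.local_ f p 0 ∈ Ioo (𝔅.lo 0) (𝔅.hi 0)
  source_uu : ∀ p ∈ 𝔅.A ∪ 𝔅.B, p 2 ∈ Ioo (𝔅.lo 2) (𝔅.hi 2)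
  /-- The cone fields are strictly invariant, uniformly expanding and contracting. -/
  cones : ∃ α' c : ℝ, 0 < α' ∧ α' < 𝔅.α ∧ 1 < c ∧ ∀ p ∈ 𝔅.A ∪ 𝔅.B, ∀ v : E3,
    (v ∈ unstableCone 𝔅.α →
      fderiv ℝ (𝔅.local_ f) p v ∈ unstableCone α' ∧ c * ‖v‖ ≤ ‖fderiv ℝ (𝔅.local_ f) p v‖) ∧
    (v ∈ strongUnstableCone 𝔅.α → fderiv ℝ (𝔅.local_ f) p v ∈ strongUnstableCone α') ∧
    (fderiv ℝ (𝔅.local_ f) p v ∈ stableCone 𝔅.α →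
      v ∈ stableCone α' ∧ c * ‖fderiv ℝ (𝔅.local_ f) p v‖ ≤ ‖v‖)
  /-- Markov property: the points of the box that return to the box avoid the center faces. -/
  source_center : ∀ p ∈ 𝔅.A ∪ 𝔅.B, 𝔅.local_ f p ∈ 𝔅.box → p 1 ∈ Ioo (𝔅.lo 1) (𝔅.hi 1)
  /-- The reference fixed points. -/
  Pminus_mem : 𝔅.Pminus ∈ 𝔅.chart.symm '' 𝔅.A
  Pplus_mem : 𝔅.Pplus ∈ 𝔅.chart.symm '' 𝔅.B
  fixed_Pminus : f 𝔅.Pminus = 𝔅.Pminus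
  fixed_Pplus : f 𝔅.Pplus = 𝔅.Pplus
  /-- Position of the `uu`-discs through the local stable manifolds of the reference fixed
  points. -/
  discs_through : ∀ D D' : Set E3, 𝔅.IsUUDisc D → 𝔅.IsUUDisc D' →
    (D ∩ 𝔅.locStable f 𝔅.Pminus).Nonempty → (D' ∩ 𝔅.locStable f 𝔅.Pplus).Nonempty →
    (∀ p ∈ D ∪ D', p 1 ∈ Ioo (𝔅.lo 1) (𝔅.hi 1)) ∧ Disjoint D D' ∧
    LeftOf D (𝔅.locStable f 𝔅.Pplus) ∧ RightOf D' (𝔅.locStable f 𝔅.Pminus)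
  /-- Position of the images of `uu`-discs. -/
  images_minus_A : ∀ D, 𝔅.IsUUDisc D →
    (RightOf D (𝔅.locStable f 𝔅.Pminus) →
      RightOf (𝔅.local_ f '' (D ∩ 𝔅.A)) (𝔅.locStable f 𝔅.Pminus)) ∧
    (LeftOf D (𝔅.locStable f 𝔅.Pminus) →
      LeftOf (𝔅.local_ f '' (D ∩ 𝔅.A)) (𝔅.locStable f 𝔅.Pminus))
  images_plus_B : ∀ D, 𝔅.IsUUDisc D →
    (RightOf D (𝔅.locStable f 𝔅.Pplus) →
      RightOf (𝔅.local_ f '' (D ∩ 𝔅.B)) (𝔅.locStable f 𝔅.Pplus)) ∧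
    (LeftOf D (𝔅.locStable f 𝔅.Pplus) →
      LeftOf (𝔅.local_ f '' (D ∩ 𝔅.B)) (𝔅.locStable f 𝔅.Pplus))
  images_minus_B : ∀ D, 𝔅.IsUUDisc D →
    (LeftOf D (𝔅.locStable f 𝔅.Pminus) ∨ (D ∩ 𝔅.locStable f 𝔅.Pminus).Nonempty) →
      LeftOf (𝔅.local_ f '' (D ∩ 𝔅.B)) (𝔅.locStable f 𝔅.Pminus)
  images_plus_A : ∀ D, 𝔅.IsUUDisc D →
    (RightOf D (𝔅.locStable f 𝔅.Pplus) ∨ (D ∩ 𝔅.locStable f 𝔅.Pplus).Nonempty) →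
      RightOf (𝔅.local_ f '' (D ∩ 𝔅.A)) (𝔅.locStable f 𝔅.Pplus)
  /-- The superposition property. -/
  superposition : ∀ D, 𝔅.InBetween f D →
    𝔅.InBetween f (𝔅.local_ f '' (D ∩ 𝔅.A)) ∨ 𝔅.InBetween f (𝔅.local_ f '' (D ∩ 𝔅.B))

/-! ### Tubes -/

/-- `S` is a `C^1` surface whose boundary lies in the strong unstable faces, to which it is
transverse wherever it contains `uu`-discs: locally a regular level set of a `C^1` function in the
strip between the two faces. -/
def IsC1Surface {M : Type*} [TopologicalSpace M] (𝔅 : BlenderData M) (S : Set E3) : Prop :=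
  ∀ p ∈ S, ∃ (O : Set E3) (h : E3 → ℝ), IsOpen O ∧ p ∈ O ∧ ContDiffOn ℝ 1 h O ∧
    (∀ q ∈ O, fderiv ℝ h q ≠ 0) ∧
    S ∩ O = {q ∈ O | q 2 ∈ Icc (𝔅.lo 2) (𝔅.hi 2) ∧ h q = 0}

/-- `T` is a `uu`-tube in-between: a surface `T = ⋃ D_t`, `t ∈ [0,1]`, where `D_t` is a continuous
family of `uu`-discs in-between, pairwise disjoint for `t ∈ [0,1)`, with `D_0 = D_1`. -/
def IsUUTubeInBetween {M : Type*} [TopologicalSpace M] (f : M → M) (𝔅 : BlenderData M)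
    (T : Set M) : Prop :=
  ∃ u : ℝ → ℝ → E3,
    ContinuousOn (Function.uncurry u) (Icc 0 1 ×ˢ Icc (𝔅.lo 2) (𝔅.hi 2)) ∧
    (∀ t ∈ Icc (0 : ℝ) 1, 𝔅.IsUUParam (u t) ∧ 𝔅.InBetween f (𝔅.disc (u t))) ∧
    (Ico (0 : ℝ) 1).PairwiseDisjoint (fun t => 𝔅.disc (u t)) ∧
    𝔅.disc (u 0) = 𝔅.disc (u 1) ∧
    IsC1Surface 𝔅 (⋃ t ∈ Icc (0 : ℝ) 1, 𝔅.disc (u t)) ∧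
    T = 𝔅.chart.symm '' ⋃ t ∈ Icc (0 : ℝ) 1, 𝔅.disc (u t)

/-! ### Saddles, unstable manifolds and tangencies -/

section Manifold

variable {M : Type*} [TopologicalSpace M] [ChartedSpace E3 M]

/-- The derivative at `R` of the `n`-th iterate of `f`; when `R` is fixed by this iterate, it is an
endomorphism of the tangent space at `R`. -/
def iterDeriv (f : M → M) (n : ℕ) (R : M) : E3 →L[ℝ] E3 := mfderiv (𝓡 3) (𝓡 3) f^[n] R

/-- `R` is a hyperbolic periodic point of `f` of minimal period `n` with unstable bundle of
dimension two. -/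
def IsSaddleOfIndexTwo (f : M → M) (n : ℕ) (R : M) : Prop :=
  0 < n ∧ Function.minimalPeriod f R = n ∧
  ∃ Es Eu : Submodule ℝ E3, IsCompl Es Eu ∧ Module.finrank ℝ Eu = 2 ∧
    (∀ v ∈ Es, iterDeriv f n R v ∈ Es) ∧ (∀ v ∈ Eu, iterDeriv f n R v ∈ Eu) ∧
    ∃ C κ : ℝ, 0 < C ∧ 0 < κ ∧ κ < 1 ∧ ∀ k : ℕ,
      (∀ v ∈ Es, ‖(iterDeriv f n R ^ k) v‖ ≤ C * κ ^ k * ‖v‖) ∧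
      (∀ v ∈ Eu, ‖v‖ ≤ C * κ ^ k * ‖(iterDeriv f n R ^ k) v‖)

/-- `X` is contained in the unstable manifold `W^u(R)` of the periodic point `R` of period `n`, as
a bounded piece of this immersed manifold: the backward iterates of `X` by the `n`-th iterate
converge uniformly to `R`. (For a compact `X`, this is inclusion and continuity of the inclusion
for the topology of `W^u(R)` as an immersed manifold; for `X = {x}` it says `x ∈ W^u(R)`.) -/
def InUnstableManifold (f : Equiv.Perm M) (n : ℕ) (R : M) (X : Set M) : Prop :=
  ∀ U ∈ 𝓝 R, ∀ᶠ k : ℕ in atTop, ∀ x ∈ X, f.symm^[n * k] x ∈ U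

/-- `v` is the velocity at `x` of a `C^1` curve through `x` a piece of which satisfies `IsPart`. -/
def IsVelocity (IsPart : Set M → Prop) (x : M) (v : E3) : Prop :=
  ∃ γ : ℝ → M, γ 0 = x ∧ ContMDiffAt 𝓘(ℝ, ℝ) (𝓡 3) 1 γ 0 ∧
    (mfderiv 𝓘(ℝ, ℝ) (𝓡 3) γ 0 (1 : ℝ) : E3) = v ∧ ∃ ε > 0, IsPart (γ '' Icc (-ε) ε)

/-- The one-dimensional lamination `W` and the (immersed) surface whose pieces are described by
`IsPart` have a tangency point: a common point at which they have a common nonzero tangent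
vector. -/
def HaveTangency (W : Set M) (IsPart : Set M → Prop) : Prop :=
  ∃ (x : M) (v : E3), v ≠ 0 ∧ IsVelocity (fun X => X ⊆ W) x v ∧ IsVelocity IsPart x v

/-- `ρ` is the continuation, on the set `V` of diffeomorphisms, of the saddle `R` of `f`. -/
def IsContinuation {r : ℕ∞} (f : Diff r M) (n : ℕ) (R : M) (V : Set (Diff r M))
    (ρ : Diff r M → M) : Prop :=
  ρ f = R ∧ ContinuousOn ρ V ∧ ∀ g ∈ V, IsSaddleOfIndexTwo g n (ρ g)

end Manifold

end BlenderTube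

end

open Set Filter Topology
open scoped Manifold ContDiff

noncomputable section

namespace BlenderTube

section

/-! ### Coordinate projections and cones -/

/-- The projection to the center-unstable plane. -/
def cuProj : E3 →L[ℝ] E3 := LinearMap.toContinuousLinearMap {
    toFun := fun v => !₂[0, v 1, v 2]
    map_add' := fun v w => by ext i; fin_cases i <;> simp
    map_smul' := fun a v => by ext i; fin_cases i <;> simp }

/-- The projection along the strong unstable direction. -/
def scProj : E3 →L[ℝ] E3 := LinearMap.toContinuousLinearMap {
    toFun := fun v => !₂[v 0, v 1, 0]
    map_add' := fun v w => by ext i; fin_cases i <;> simp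
    map_smul' := fun a v => by ext i; fin_cases i <;> simp }

lemma norm_eq_sqrt (v : E3) : ‖v‖ = √(v 0 ^ 2 + v 1 ^ 2 + v 2 ^ 2) := by
  rw [EuclideanSpace.norm_eq, Fin.sum_univ_three]; simp

lemma norm_cuProj (v : E3) : ‖cuProj v‖ = √(v 1 ^ 2 + v 2 ^ 2) := by
  rw [norm_eq_sqrt]; simp [cuProj]

lemma norm_scProj (v : E3) : ‖scProj v‖ = √(v 0 ^ 2 + v 1 ^ 2) := by
  rw [norm_eq_sqrt]; simp [scProj]

@[simp] theorem cuProj_zero (v : E3) : cuProj v 0 = 0 := by simp [cuProj]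
@[simp] theorem cuProj_one (v : E3) : cuProj v 1 = v 1 := by simp [cuProj]
@[simp] theorem cuProj_two (v : E3) : cuProj v 2 = v 2 := by simp [cuProj]
@[simp] theorem scProj_zero (v : E3) : scProj v 0 = v 0 := by simp [scProj]
@[simp] theorem scProj_one (v : E3) : scProj v 1 = v 1 := by simp [scProj]
@[simp] theorem scProj_two (v : E3) : scProj v 2 = 0 := by simp [scProj]

lemma mem_stableCone {a : ℝ} {v : E3} : v ∈ stableCone a ↔ ‖cuProj v‖ ≤ a * |v 0| := by
  rw [norm_cuProj]; rfl

lemma mem_unstableCone {a : ℝ} {v : E3} : v ∈ unstableCone a ↔ |v 0| ≤ a * ‖cuProj v‖ := by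
  rw [norm_cuProj]; rfl

lemma mem_strongUnstableCone {a : ℝ} {v : E3} :
    v ∈ strongUnstableCone a ↔ ‖scProj v‖ ≤ a * |v 2| := by
  rw [norm_scProj]; rfl

lemma abs_apply_le_norm (v : E3) (i : Fin 3) : |v i| ≤ ‖v‖ := by simpa using PiLp.norm_apply_le v i

lemma norm_cuProj_le (v : E3) : ‖cuProj v‖ ≤ ‖v‖ := by
  rw [norm_cuProj, norm_eq_sqrt]; exact Real.sqrt_le_sqrt (by nlinarith [sq_nonneg (v 0)])

lemma norm_scProj_le (v : E3) : ‖scProj v‖ ≤ ‖v‖ := by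
  rw [norm_scProj, norm_eq_sqrt]; exact Real.sqrt_le_sqrt (by nlinarith [sq_nonneg (v 2)])

lemma norm_le_abs_add_cuProj (v : E3) : ‖v‖ ≤ |v 0| + ‖cuProj v‖ := by
  have h : v = EuclideanSpace.single 0 (v 0) + cuProj v := by ext i; fin_cases i <;> simp
  calc ‖v‖ = ‖EuclideanSpace.single 0 (v 0) + cuProj v‖ := by rw [← h]
    _ ≤ _ := (norm_add_le _ _).trans (by simp)

lemma norm_le_abs_add_scProj (v : E3) : ‖v‖ ≤ |v 2| + ‖scProj v‖ := by
  have h : v = EuclideanSpace.single 2 (v 2) + scProj v := by ext i; fin_cases i <;> simp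
  calc ‖v‖ = ‖EuclideanSpace.single 2 (v 2) + scProj v‖ := by rw [← h]
    _ ≤ _ := (norm_add_le _ _).trans (by simp)

lemma continuous_coord (i : Fin 3) : Continuous fun v : E3 => v i := by fun_prop

lemma isClosed_stableCone (a : ℝ) : IsClosed (stableCone a) := by
  have : stableCone a = {v | ‖cuProj v‖ ≤ a * |v 0|} := by ext v; exact mem_stableCone
  rw [this]
  exact isClosed_le (by fun_prop) (by fun_prop)

lemma isClosed_strongUnstableCone (a : ℝ) : IsClosed (strongUnstableCone a) := by
  have : strongUnstableCone a = {v | ‖scProj v‖ ≤ a * |v 2|} := by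
    ext v; exact mem_strongUnstableCone
  rw [this]
  exact isClosed_le (by fun_prop) (by fun_prop)

lemma stableCone_mono {a b : ℝ} (h : a ≤ b) : stableCone a ⊆ stableCone b := fun v hv => by
  rw [mem_stableCone] at *; nlinarith [abs_nonneg (v 0)]

lemma strongUnstableCone_mono {a b : ℝ} (h : a ≤ b) :
    strongUnstableCone a ⊆ strongUnstableCone b := fun v hv => by
  rw [mem_strongUnstableCone] at *; nlinarith [abs_nonneg (v 2)]

lemma unstableCone_mono {a b : ℝ} (h : a ≤ b) : unstableCone a ⊆ unstableCone b := fun v hv => by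
  rw [mem_unstableCone] at *; nlinarith [norm_nonneg (cuProj v)]

lemma strongUnstableCone_subset_unstableCone {a : ℝ} (ha : 0 ≤ a) :
    strongUnstableCone a ⊆ unstableCone a := fun v hv => by
  rw [mem_strongUnstableCone] at hv
  rw [mem_unstableCone]
  have h1 : |v 0| ≤ ‖scProj v‖ := by simpa using abs_apply_le_norm (scProj v) 0
  have h2 : |v 2| ≤ ‖cuProj v‖ := by simpa using abs_apply_le_norm (cuProj v) 2
  exact h1.trans (hv.trans (by gcongr))

lemma mem_unstableCone_of_zero {a : ℝ} (ha : 0 ≤ a) {v : E3} (h : v 0 = 0) :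
    v ∈ unstableCone a := by
  rw [mem_unstableCone, h, abs_zero]; positivity

lemma mem_stableCone_of_eq {a : ℝ} (ha : 0 ≤ a) {v : E3} (h1 : v 1 = 0) (h2 : v 2 = 0) :
    v ∈ stableCone a := by
  rw [mem_stableCone, norm_cuProj, h1, h2]; simp; positivity

lemma smul_mem_stableCone {a r : ℝ} {v : E3} (h : v ∈ stableCone a) : r • v ∈ stableCone a := by
  rw [mem_stableCone] at *
  rw [map_smul, norm_smul, PiLp.smul_apply, smul_eq_mul, abs_mul, Real.norm_eq_abs]
  nlinarith [abs_nonneg r]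

set_option maxHeartbeats 1000000 in
/-- Linear maps close to one that respects the cone fields also respect them. -/
lemma cones_of_approx {L : E3 →L[ℝ] E3} {α α' c d c' κ : ℝ} (h0 : 0 < α') (h1 : α' < d)
    (h2 : d < α) (h3 : α < 1) (hc' : 1 < c') (hc : c' < c) (hκ : 0 < κ)
    (hL : ∀ v, κ * ‖v‖ ≤ ‖L v‖)
    (H : ∀ v : E3, (v ∈ unstableCone α → L v ∈ unstableCone α' ∧ c * ‖v‖ ≤ ‖L v‖) ∧
      (v ∈ strongUnstableCone α → L v ∈ strongUnstableCone α') ∧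
      (L v ∈ stableCone α → v ∈ stableCone α' ∧ c * ‖L v‖ ≤ ‖v‖)) :
    ∃ η > 0, ∀ v y : E3, ‖y - L v‖ ≤ η * ‖v‖ →
      (v ∈ unstableCone d → y ∈ unstableCone d ∧ c' * ‖v‖ ≤ ‖y‖) ∧
      (v ∈ strongUnstableCone α → y ∈ strongUnstableCone d ∧ c' * ‖v‖ ≤ ‖y‖) ∧
      (y ∈ stableCone d → v ∈ stableCone d ∧ c' * ‖y‖ ≤ ‖v‖) := by
  obtain ⟨t, ht, ht1, ht2, ht3, ht4⟩ : ∃ t > 0, 4 * t ≤ d - α' ∧ 4 * t ≤ α - d ∧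
      c' * (1 + t) ≤ c ∧ t ≤ c - c' := by
    refine ⟨min (min ((d - α') / 4) ((α - d) / 4)) ((c - c') / c'), ?_, ?_, ?_, ?_, ?_⟩
    · have : 0 < (c - c') / c' := by apply div_pos <;> linarith
      simp only [gt_iff_lt, lt_min_iff]
      refine ⟨⟨by linarith, by linarith⟩, this⟩
    · linarith [(min_le_left (min ((d - α') / 4) ((α - d) / 4)) ((c - c') / c')).trans
        (min_le_left _ _)]
    · linarith [(min_le_left (min ((d - α') / 4) ((α - d) / 4)) ((c - c') / c')).trans
        (min_le_right _ _)]
    · have := min_le_right (min ((d - α') / 4) ((α - d) / 4)) ((c - c') / c')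
      rw [le_div_iff₀ (by linarith)] at this
      linarith
    · refine (min_le_right _ _).trans ?_
      rw [div_le_iff₀ (by linarith)]; nlinarith
  refine ⟨min t (κ * t), lt_min ht (by positivity), fun v y hy => ?_⟩
  have hyt : ‖y - L v‖ ≤ t * ‖v‖ := hy.trans (by gcongr; exact min_le_left _ _)
  have hyk : ‖y - L v‖ ≤ t * ‖L v‖ := hy.trans (by
    calc min t (κ * t) * ‖v‖ ≤ κ * t * ‖v‖ := by gcongr; exact min_le_right _ _
      _ = t * (κ * ‖v‖) := by ring
      _ ≤ _ := by gcongr; exact hL v)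
  have e0 : ∀ i, |y i - L v i| ≤ ‖y - L v‖ := fun i => by simpa using abs_apply_le_norm (y - L v) i
  have ecu : ‖cuProj y - cuProj (L v)‖ ≤ ‖y - L v‖ := by rw [← map_sub]; exact norm_cuProj_le _
  have esc : ‖scProj y - scProj (L v)‖ ≤ ‖y - L v‖ := by rw [← map_sub]; exact norm_scProj_le _
  have ny : ‖L v‖ ≤ ‖y‖ + ‖y - L v‖ := by
    have := norm_sub_norm_le (L v) y
    rw [norm_sub_rev] at this; linarith
  have ny' : ‖y‖ ≤ ‖L v‖ + ‖y - L v‖ := by have := norm_sub_norm_le y (L v); linarith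
  refine ⟨fun hv => ?_, fun hv => ?_, fun hyc => ?_⟩
  · obtain ⟨g1, g2⟩ := (H v).1 (unstableCone_mono h2.le hv)
    rw [mem_unstableCone] at *
    have n1 := norm_le_abs_add_cuProj (L v)
    have n2 : ‖L v‖ ≤ 2 * ‖cuProj (L v)‖ := by nlinarith [norm_nonneg (cuProj (L v))]
    have n3 : ‖cuProj (L v)‖ ≤ ‖cuProj y‖ + ‖y - L v‖ := by
      have := norm_sub_norm_le (cuProj (L v)) (cuProj y)
      rw [norm_sub_rev] at this; linarith
    have n4 : |y 0| ≤ |L v 0| + ‖y - L v‖ := by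
      have := abs_sub_abs_le_abs_sub (y 0) (L v 0); linarith [e0 0]
    constructor
    · have q1 : |y 0| ≤ (α' + 2 * t) * ‖cuProj (L v)‖ := by nlinarith
      have q2 : (1 - 2 * t) * ‖cuProj (L v)‖ ≤ ‖cuProj y‖ := by nlinarith
      have q3 : α' + 2 * t ≤ d * (1 - 2 * t) := by nlinarith
      calc |y 0| ≤ d * (1 - 2 * t) * ‖cuProj (L v)‖ := q1.trans (by gcongr)
        _ ≤ d * ‖cuProj y‖ := by rw [mul_assoc]; gcongr; linarith
    · nlinarith [norm_nonneg v]
  · have g1 := (H v).2.1 hv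
    have g2 := ((H v).1 (strongUnstableCone_subset_unstableCone (by linarith) hv)).2
    rw [mem_strongUnstableCone] at *
    have n1 := norm_le_abs_add_scProj (L v)
    have n2 : ‖L v‖ ≤ 2 * |L v 2| := by nlinarith [abs_nonneg (L v 2)]
    have n3 : |L v 2| ≤ |y 2| + ‖y - L v‖ := by
      have := abs_sub_abs_le_abs_sub (L v 2) (y 2)
      rw [abs_sub_comm] at this; linarith [e0 2]
    have n4 : ‖scProj y‖ ≤ ‖scProj (L v)‖ + ‖y - L v‖ := by
      have := norm_sub_norm_le (scProj y) (scProj (L v)); linarith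
    have q1 : ‖scProj y‖ ≤ (α' + 2 * t) * |L v 2| := by nlinarith
    have q2 : (1 - 2 * t) * |L v 2| ≤ |y 2| := by nlinarith
    have q3 : α' + 2 * t ≤ d * (1 - 2 * t) := by nlinarith
    refine ⟨?_, by nlinarith [norm_nonneg v]⟩
    calc _ ≤ d * (1 - 2 * t) * |L v 2| := q1.trans (by gcongr)
      _ ≤ d * |y 2| := by rw [mul_assoc]; gcongr; linarith
  · have g : L v ∈ stableCone α := by
      rw [mem_stableCone] at *
      have n1 := norm_le_abs_add_cuProj (L v)
      have n3 : ‖cuProj (L v)‖ ≤ ‖cuProj y‖ + ‖y - L v‖ := by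
        have := norm_sub_norm_le (cuProj (L v)) (cuProj y)
        rw [norm_sub_rev] at this; linarith
      have n4 : |y 0| ≤ |L v 0| + ‖y - L v‖ := by
        have := abs_sub_abs_le_abs_sub (y 0) (L v 0); linarith [e0 0]
      have q1 : (1 - 2 * t) * ‖cuProj (L v)‖ ≤ (d + 2 * t) * |L v 0| := by
        have : ‖cuProj (L v)‖ ≤ d * |L v 0| + 2 * (t * ‖L v‖) := by
          have : d * |y 0| ≤ d * |L v 0| + d * ‖y - L v‖ := by nlinarith
          have : d * ‖y - L v‖ ≤ 1 * ‖y - L v‖ := by gcongr; linarith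
          linarith
        nlinarith
      have q3 : d + 2 * t ≤ α * (1 - 2 * t) := by nlinarith
      have q4 : (1 - 2 * t) * ‖cuProj (L v)‖ ≤ (1 - 2 * t) * (α * |L v 0|) := by
        calc _ ≤ α * (1 - 2 * t) * |L v 0| := q1.trans (by gcongr)
          _ = _ := by ring
      exact le_of_mul_le_mul_left q4 (by linarith)
    obtain ⟨g1, g2⟩ := (H v).2.2 g
    refine ⟨stableCone_mono h1.le g1, ?_⟩
    calc c' * ‖y‖ ≤ c' * ((1 + t) * ‖L v‖) := by gcongr; linarith
      _ = c' * (1 + t) * ‖L v‖ := by ring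
      _ ≤ c * ‖L v‖ := by gcongr
      _ ≤ _ := g2

/-! ### Calculus on intervals -/

lemma norm_sub_le_of_forall_right {F : Type*} [NormedAddCommGroup F] {f : ℝ → F}
    {a b C : ℝ} (hab : a ≤ b) (hf : ContinuousOn f (Icc a b))
    (h : ∀ x ∈ Ico a b, ∀ᶠ y in 𝓝[>] x, ‖f y - f x‖ ≤ C * (y - x)) :
    ‖f b - f a‖ ≤ C * (b - a) := by
  have key : Icc a b ⊆ {x | ‖f x - f a‖ ≤ C * (x - a)} := by
    refine IsClosed.Icc_subset_of_forall_exists_gt ?_ (by simp) ?_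
    · have : {x | ‖f x - f a‖ ≤ C * (x - a)} ∩ Icc a b =
          {x ∈ Icc a b | ‖f x - f a‖ ≤ C * (x - a)} := by ext; simp [and_comm]
      rw [this]
      exact isClosed_Icc.isClosed_le (by fun_prop) (by fun_prop)
    · rintro x ⟨hx, hxab⟩ y hy
      have h1 := h x hxab
      have h2 : ∀ᶠ z in 𝓝[>] x, z ∈ Ioc x y := Ioc_mem_nhdsGT hy
      obtain ⟨z, hz1, hz2⟩ := (h1.and h2).exists
      refine ⟨z, ?_, hz2⟩
      simp only [mem_ofPred_eq] at hx ⊢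
      calc ‖f z - f a‖ = ‖(f z - f x) + (f x - f a)‖ := by congr 1; abel
        _ ≤ ‖f z - f x‖ + ‖f x - f a‖ := norm_add_le _ _
        _ ≤ _ := by linarith
  exact key (right_mem_Icc.2 hab)

lemma norm_sub_le_of_local {F : Type*} [NormedAddCommGroup F] {f : ℝ → F} {a b C : ℝ}
    (hf : ContinuousOn f (Icc a b))
    (h : ∀ x ∈ Icc a b, ∀ᶠ y in 𝓝[Icc a b] x, ‖f y - f x‖ ≤ C * |y - x|) :
    ∀ x ∈ Icc a b, ∀ y ∈ Icc a b, ‖f y - f x‖ ≤ C * |y - x| := by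
  have key : ∀ x ∈ Icc a b, ∀ y ∈ Icc a b, x ≤ y → ‖f y - f x‖ ≤ C * (y - x) := by
    intro x hx y hy hxy
    refine norm_sub_le_of_forall_right hxy (hf.mono (Icc_subset_Icc hx.1 hy.2)) fun w hw => ?_
    have hw' : w ∈ Icc a b := ⟨hx.1.trans hw.1, hw.2.le.trans hy.2⟩
    have h1 : 𝓝[>] w ≤ 𝓝[Icc a b] w := by
      rw [nhdsWithin_le_iff]
      filter_upwards [Ioc_mem_nhdsGT (hw.2.trans_le hy.2)] with z hz
      exact ⟨hw'.1.trans hz.1.le, hz.2⟩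
    filter_upwards [h1 (h w hw'), self_mem_nhdsWithin] with z hz hzw
    rwa [abs_of_pos (sub_pos.2 hzw)] at hz
  intro x hx y hy
  rcases le_total x y with hxy | hxy
  · rw [abs_of_nonneg (sub_nonneg.2 hxy)]; exact key x hx y hy hxy
  · rw [abs_sub_comm, norm_sub_rev, abs_of_nonneg (sub_nonneg.2 hxy)]; exact key y hy x hx hxy

lemma exists_eq_near_of_isLocalMax {φ : ℝ → ℝ} {a b t : ℝ} (hφ : ContinuousOn φ (Icc a b))
    (ht : t ∈ Ioo a b) (hm : IsLocalMax φ t) (ε : ℝ) (hε : 0 < ε) :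
    ∃ x ∈ Ioo a b, ∃ y ∈ Ioo a b, x ≠ y ∧ |x - t| < ε ∧ |y - t| < ε ∧ φ x = φ y := by
  obtain ⟨r, hr, hrm⟩ := Metric.eventually_nhds_iff.1 hm
  obtain ⟨η, hη, h1, h2, h3, h4⟩ : ∃ η > 0, η < ε ∧ η < r ∧ a < t - η ∧ t + η < b := by
    have : 0 < min (min ε r) (min (t - a) (b - t)) := by
      simp only [lt_min_iff]; exact ⟨⟨hε, hr⟩, by linarith [ht.1], by linarith [ht.2]⟩
    obtain ⟨η, hη, hlt⟩ := exists_between this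
    simp only [lt_min_iff] at hlt
    exact ⟨η, hη, hlt.1.1, hlt.1.2, by linarith [hlt.2.1], by linarith [hlt.2.2]⟩
  have m1 : φ (t - η) ≤ φ t := hrm (by simp [abs_of_pos hη]; exact h2)
  have m2 : φ (t + η) ≤ φ t := hrm (by simp [abs_of_pos hη]; exact h2)
  rcases le_total (φ (t - η)) (φ (t + η)) with h | h
  · obtain ⟨x, hx, hxe⟩ := intermediate_value_Icc (by linarith : t - η ≤ t)
      (hφ.mono (Icc_subset_Icc h3.le ht.2.le)) ⟨h, m2⟩
    refine ⟨x, ⟨by linarith [hx.1], by linarith [hx.2, ht.2]⟩, t + η, ⟨by linarith, h4⟩,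
      by linarith [hx.2], ?_, ?_, hxe⟩
    · rw [abs_lt]; constructor <;> linarith [hx.1, hx.2]
    · rw [abs_lt]; constructor <;> linarith
  · obtain ⟨x, hx, hxe⟩ := intermediate_value_Icc' (by linarith : t ≤ t + η)
      (hφ.mono (Icc_subset_Icc ht.1.le h4.le)) ⟨h, m1⟩
    refine ⟨x, ⟨by linarith [hx.1, ht.1], by linarith [hx.2]⟩, t - η, ⟨h3, by linarith⟩,
      by linarith [hx.1], ?_, ?_, hxe⟩
    · rw [abs_lt]; constructor <;> linarith [hx.1, hx.2]
    · rw [abs_lt]; constructor <;> linarith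

/-- A continuous function with equal values at the end points of an interval is not locally
injective. -/
lemma exists_eq_near {φ : ℝ → ℝ} {a b : ℝ} (hab : a < b) (hφ : ContinuousOn φ (Icc a b))
    (h : φ a = φ b) : ∃ t ∈ Ioo a b, ∀ ε > 0, ∃ x ∈ Ioo a b, ∃ y ∈ Ioo a b,
      x ≠ y ∧ |x - t| < ε ∧ |y - t| < ε ∧ φ x = φ y := by
  obtain ⟨t, ht, hm | hm⟩ := exists_isLocalExtr_Ioo hab hφ h
  · refine ⟨t, ht, fun ε hε => ?_⟩
    obtain ⟨x, hx, y, hy, h1, h2, h3, h4⟩ :=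
      exists_eq_near_of_isLocalMax (φ := fun x => -φ x) hφ.neg ht hm.neg ε hε
    exact ⟨x, hx, y, hy, h1, h2, h3, neg_injective h4⟩
  · exact ⟨t, ht, exists_eq_near_of_isLocalMax hφ ht hm⟩

/-! ### Convergence in the `C^1` sense at a point -/

section C1At

variable {ι E F H : Type*} [NormedAddCommGroup E] [NormedSpace ℝ E]
  [NormedAddCommGroup F] [NormedSpace ℝ F] [NormedAddCommGroup H] [NormedSpace ℝ H]

/-- The maps `f i` converge to `g` along `l`, locally uniformly in the `C^1` sense at `x`. -/
structure C1At (l : Filter ι) (f : ι → E → F) (g : E → F) (x : E) : Prop where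
  diff : ∀ᶠ p in l ×ˢ 𝓝 x, DifferentiableAt ℝ (f p.1) p.2
  val : Tendsto (fun p : ι × E => f p.1 p.2) (l ×ˢ 𝓝 x) (𝓝 (g x))
  deriv : Tendsto (fun p : ι × E => fderiv ℝ (f p.1) p.2) (l ×ˢ 𝓝 x) (𝓝 (fderiv ℝ g x))

lemma C1At.const {l : Filter ι} {g : E → F} {x : E} (h : ContDiffAt ℝ 1 g x) :
    C1At l (fun _ => g) g x := by
  refine ⟨?_, h.continuousAt.tendsto.comp tendsto_snd, ?_⟩
  · have : ∀ᶠ y in 𝓝 x, ContDiffAt ℝ 1 g y := h.eventually (by simp)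
    exact (this.mono fun y hy => hy.differentiableAt (by simp)).prod_inr l
  · exact (h.continuousAt_fderiv (by simp)).tendsto.comp tendsto_snd

lemma C1At.comp {l : Filter ι} {f : ι → E → F} {g : E → F} {x : E} {f' : ι → F → H}
    {g' : F → H} (h' : C1At l f' g' (g x)) (h : C1At l f g x) (hg : DifferentiableAt ℝ g x)
    (hg' : DifferentiableAt ℝ g' (g x)) :
    C1At l (fun i => f' i ∘ f i) (g' ∘ g) x := by
  have T : Tendsto (fun p : ι × E => (p.1, f p.1 p.2)) (l ×ˢ 𝓝 x) (l ×ˢ 𝓝 (g x)) :=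
    tendsto_fst.prodMk h.val
  refine ⟨?_, h'.val.comp T, ?_⟩
  · filter_upwards [h.diff, T.eventually h'.diff] with p h1 h2
    exact h2.comp _ h1
  · rw [fderiv_comp x hg' hg]
    have h3 := ((continuous_fst.clm_comp continuous_snd).tendsto
      (fderiv ℝ g' (g x), fderiv ℝ g x)).comp ((h'.deriv.comp T).prodMk_nhds h.deriv)
    refine h3.congr' ?_
    filter_upwards [h.diff, T.eventually h'.diff] with p h1 h2
    exact (fderiv_comp _ h2 h1).symm

lemma C1At.congr {l : Filter ι} {f f' : ι → E → F} {g g' : E → F} {x : E} (h : C1At l f g x)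
    (hg : g =ᶠ[𝓝 x] g') (hf : ∀ᶠ p in l ×ˢ 𝓝 x, f p.1 p.2 = f' p.1 p.2) :
    C1At l f' g' x := by
  have hf' : ∀ᶠ p in l ×ˢ 𝓝 x, f p.1 =ᶠ[𝓝 p.2] f' p.1 := by
    obtain ⟨s, hs, t, ht, hst⟩ := Filter.mem_prod_iff.1 hf
    filter_upwards [Filter.prod_mem_prod hs (eventually_eventually_nhds.2 ht)] with p hp
    filter_upwards [hp.2] with y hy
    exact hst (mk_mem_prod hp.1 hy)
  refine ⟨?_, ?_, ?_⟩
  · filter_upwards [h.diff, hf'] with p h1 h2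
    exact h2.differentiableAt_iff.1 h1
  · rw [← hg.eq_of_nhds]
    exact h.val.congr' hf
  · rw [← hg.fderiv_eq]
    refine h.deriv.congr' ?_
    filter_upwards [hf'] with p h2
    exact h2.fderiv_eq

lemma C1At.mono {l l' : Filter ι} {f : ι → E → F} {g : E → F} {x : E} (h : C1At l f g x)
    (hl : l' ≤ l) : C1At l' f g x :=
  ⟨h.diff.filter_mono (prod_mono hl le_rfl), h.val.mono_left (prod_mono hl le_rfl),
    h.deriv.mono_left (prod_mono hl le_rfl)⟩

lemma C1At.chord {l : Filter ι} {f : ι → E → F} {g : E → F} {x : E} (h : C1At l f g x)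
    {η : ℝ} (hη : 0 < η) : ∀ᶠ p in l ×ˢ (𝓝 x ×ˢ 𝓝 x),
      ‖f p.1 p.2.1 - f p.1 p.2.2 - fderiv ℝ g x (p.2.1 - p.2.2)‖ ≤ η * ‖p.2.1 - p.2.2‖ := by
  have h1 : ∀ᶠ p in l ×ˢ 𝓝 x, ‖fderiv ℝ (f p.1) p.2 - fderiv ℝ g x‖ < η := by
    have := h.deriv.eventually (Metric.ball_mem_nhds _ hη)
    filter_upwards [this] with p hp
    rwa [dist_eq_norm] at hp
  obtain ⟨s, hs, t, ht, hst⟩ := Filter.mem_prod_iff.1 (h1.and h.diff)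
  obtain ⟨r, hr, hrt⟩ := Metric.mem_nhds_iff.1 ht
  filter_upwards [Filter.prod_mem_prod hs
    (Filter.prod_mem_prod (Metric.ball_mem_nhds x hr) (Metric.ball_mem_nhds x hr))] with p hp
  have hd : ∀ y ∈ Metric.ball x r, ‖fderiv ℝ (f p.1) y - fderiv ℝ g x‖ < η ∧
      DifferentiableAt ℝ (f p.1) y := fun y hy => @hst (p.1, y) (mk_mem_prod hp.1 (hrt hy))
  exact (convex_ball x r).norm_image_sub_le_of_norm_hasFDerivWithin_le'
    (f := f p.1) (f' := fderiv ℝ (f p.1)) (φ := fderiv ℝ g x)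
    (fun y hy => (hd y hy).2.hasFDerivAt.hasFDerivWithinAt)
    (fun y hy => (hd y hy).1.le) hp.2.2 hp.2.1

end C1At

lemma eventually_near_compact {ι X : Type*} [PseudoMetricSpace X] {l : Filter ι} {K : Set X}
    (hK : IsCompact K) {P : ι → X → X → Prop}
    (h : ∀ x ∈ K, ∀ᶠ p in l ×ˢ (𝓝 x ×ˢ 𝓝 x), P p.1 p.2.1 p.2.2) :
    ∃ δ > 0, ∀ᶠ i in l, ∀ x ∈ K, ∀ y z, dist y x < δ → dist z x < δ → P i y z := by
  refine hK.induction_on (p := fun K => ∃ δ > 0, ∀ᶠ i in l, ∀ x ∈ K, ∀ y z, dist y x < δ →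
    dist z x < δ → P i y z) ⟨1, one_pos, by simp⟩ ?_ ?_ fun x hx => ?_
  · rintro s t hst ⟨δ, hδ, H⟩
    exact ⟨δ, hδ, H.mono fun i hi x hx => hi x (hst hx)⟩
  · rintro s t ⟨δ, hδ, H⟩ ⟨δ', hδ', H'⟩
    refine ⟨min δ δ', lt_min hδ hδ', ?_⟩
    filter_upwards [H, H'] with i h1 h2 x hx y z hy hz
    rcases hx with hx | hx
    · exact h1 x hx y z (hy.trans_le (min_le_left _ _)) (hz.trans_le (min_le_left _ _))
    · exact h2 x hx y z (hy.trans_le (min_le_right _ _)) (hz.trans_le (min_le_right _ _))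
  · obtain ⟨s, hs, t, ht, hst⟩ := Filter.mem_prod_iff.1 (h x hx)
    obtain ⟨u, hu, v, hv, huv⟩ := Filter.mem_prod_iff.1 ht
    obtain ⟨r, hr, hrt⟩ := Metric.mem_nhds_iff.1 (inter_mem hu hv)
    refine ⟨Metric.ball x (r / 2), mem_nhdsWithin_of_mem_nhds (Metric.ball_mem_nhds x (by linarith)),
      ⟨r / 2, by linarith, ?_⟩⟩
    filter_upwards [hs] with i hi w hw y z hy hz
    rw [Metric.mem_ball] at hw
    have hy' : y ∈ Metric.ball x r := by rw [Metric.mem_ball]; linarith [dist_triangle y w x]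
    have hz' : z ∈ Metric.ball x r := by rw [Metric.mem_ball]; linarith [dist_triangle z w x]
    exact @hst (i, y, z) (mk_mem_prod hi (huv (mk_mem_prod (hrt hy').1 (hrt hz').2)))

lemma eventually_forall_compact {ι X : Type*} [TopologicalSpace X] {l : Filter ι} {K : Set X}
    (hK : IsCompact K) {P : ι → X → Prop} (h : ∀ x ∈ K, ∀ᶠ y in l ×ˢ 𝓝 x, P y.1 y.2) :
    ∀ᶠ i in l, ∀ x ∈ K, P i x := by
  have : ∀ᶠ y in l ×ˢ 𝓝ˢ K, P y.1 y.2 := by simpa only [hK.prod_nhdsSet_eq_biSup, eventually_iSup]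
  exact this.curry.mono fun i hi => hi.self_of_nhdsSet

/-- A property that is locally constant on a preconnected set is constant on it. -/
lemma forall_of_isPreconnected {X : Type*} [TopologicalSpace X] {K : Set X}
    (hK : IsPreconnected K) {P : X → Prop} (h1 : ∀ x ∈ K, P x → ∀ᶠ y in 𝓝[K] x, P y)
    (h2 : ∀ x ∈ K, ¬ P x → ∀ᶠ y in 𝓝[K] x, ¬ P y) {x0 : X} (h0 : x0 ∈ K) (hP : P x0) :
    ∀ x ∈ K, P x := by
  have : PreconnectedSpace K := Subtype.preconnectedSpace hK
  have hc : IsClopen {x : K | P x} := by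
    constructor
    · rw [← isOpen_compl_iff, isOpen_iff_mem_nhds]
      intro x hx
      rw [nhds_subtype_eq_comap_nhdsWithin]
      exact (h2 x x.2 hx).comap _
    · rw [isOpen_iff_mem_nhds]
      intro x hx
      rw [nhds_subtype_eq_comap_nhdsWithin]
      exact (h1 x x.2 hx).comap _
  have := hc.eq_univ ⟨⟨x0, h0⟩, hP⟩
  intro x hx
  have hx' : (⟨x, hx⟩ : K) ∈ {x : K | P x} := this ▸ mem_univ _
  exact hx'

end

section

/-! ### Lipschitz graphs in a box -/

/-- The product of the intervals `[lo i, hi i]`. -/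
def cbox (lo hi : Fin 3 → ℝ) : Set E3 := {p | ∀ i, p i ∈ Icc (lo i) (hi i)}

/-- A Lipschitz arc over the strong unstable coordinate, tangent to the strong unstable cone, in the
strip over the box that is unbounded in the center direction. -/
structure IsUGraph (lo hi : Fin 3 → ℝ) (a : ℝ) (D : ℝ → E3) : Prop where
  coord : ∀ z ∈ Icc (lo 2) (hi 2), D z 2 = z
  stable : ∀ z ∈ Icc (lo 2) (hi 2), D z 0 ∈ Icc (lo 0) (hi 0)
  chord : ∀ z ∈ Icc (lo 2) (hi 2), ∀ z' ∈ Icc (lo 2) (hi 2), D z - D z' ∈ strongUnstableCone a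

/-- The arc stays between the center faces of the box. -/
def CenterIn (lo hi : Fin 3 → ℝ) (D : ℝ → E3) : Prop :=
  ∀ z ∈ Icc (lo 2) (hi 2), D z 1 ∈ Icc (lo 1) (hi 1)

/-- A Lipschitz arc in the box over the stable coordinate, tangent to the stable cone. -/
structure IsSGraph (lo hi : Fin 3 → ℝ) (d : ℝ) (W : ℝ → E3) : Prop where
  coord : ∀ s ∈ Icc (lo 0) (hi 0), W s 0 = s
  mem : ∀ s ∈ Icc (lo 0) (hi 0), W s ∈ cbox lo hi
  chord : ∀ s ∈ Icc (lo 0) (hi 0), ∀ s' ∈ Icc (lo 0) (hi 0), W s - W s' ∈ stableCone d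

variable {lo hi : Fin 3 → ℝ} {a d c s : ℝ} {D W : ℝ → E3} {G H : E3 → E3} {X N : Bool → Set E3}
  {ι : Type*} {l : Filter ι} {Di : ι → ℝ → E3} {Hi : ι → E3 → E3}
local notation "I0" => Icc (lo 0) (hi 0)
local notation "I1" => Icc (lo 1) (hi 1)
local notation "I2" => Icc (lo 2) (hi 2)
local notation "UGraph" => IsUGraph lo hi
local notation "SGraph" => IsSGraph lo hi
local notation "Central" => CenterIn lo hi
local notation "Box" => cbox lo hi

section

lemma isCompact_cbox (lo hi : Fin 3 → ℝ) : IsCompact (cbox lo hi) := by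
  have h : cbox lo hi = WithLp.toLp 2 '' (univ.pi fun i => Icc (lo i) (hi i)) := by
    ext p
    constructor
    · intro hp
      exact ⟨fun i => p i, fun i _ => hp i, rfl⟩
    · rintro ⟨q, hq, rfl⟩ i
      exact hq i trivial
  rw [h]
  exact (isCompact_univ_pi fun i => isCompact_Icc).image (PiLp.continuous_toLp 2 _)

lemma IsUGraph.norm_sub_le (h : UGraph a D) {z z' : ℝ} (hz : z ∈ I2) (hz' : z' ∈ I2) :
    ‖D z - D z'‖ ≤ (1 + a) * |z - z'| := by
  have h1 := mem_strongUnstableCone.1 (h.chord z hz z' hz')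
  have h2 := norm_le_abs_add_scProj (D z - D z')
  rw [PiLp.sub_apply, h.coord z hz, h.coord z' hz'] at h1 h2
  linarith

lemma IsSGraph.norm_sub_le (h : SGraph d W) {z z' : ℝ} (hz : z ∈ I0) (hz' : z' ∈ I0) :
    ‖W z - W z'‖ ≤ (1 + d) * |z - z'| := by
  have h1 := mem_stableCone.1 (h.chord z hz z' hz')
  have h2 := norm_le_abs_add_cuProj (W z - W z')
  rw [PiLp.sub_apply, h.coord z hz, h.coord z' hz'] at h1 h2
  linarith

lemma IsUGraph.abs_zero_sub_le (h : UGraph a D) {z z' : ℝ} (hz : z ∈ I2) (hz' : z' ∈ I2) :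
    |D z 0 - D z' 0| ≤ a * |z - z'| := by
  have h1 := mem_strongUnstableCone.1 (h.chord z hz z' hz')
  have h2 := abs_apply_le_norm (scProj (D z - D z')) 0
  rw [PiLp.sub_apply, h.coord z hz, h.coord z' hz'] at h1
  simp only [scProj_zero, PiLp.sub_apply] at h2
  linarith

lemma IsSGraph.abs_two_sub_le (h : SGraph d W) {z z' : ℝ} (hz : z ∈ I0) (hz' : z' ∈ I0) :
    |W z 2 - W z' 2| ≤ d * |z - z'| := by
  have h1 := mem_stableCone.1 (h.chord z hz z' hz')
  have h2 := abs_apply_le_norm (cuProj (W z - W z')) 2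
  rw [PiLp.sub_apply, h.coord z hz, h.coord z' hz'] at h1
  simp only [cuProj_two, PiLp.sub_apply] at h2
  linarith

lemma continuousOn_of_norm_sub_le {F : Type*} [NormedAddCommGroup F] {f : ℝ → F} {s : Set ℝ}
    {C : ℝ} (h : ∀ z ∈ s, ∀ z' ∈ s, ‖f z - f z'‖ ≤ C * |z - z'|) : ContinuousOn f s := by
  have : LipschitzOnWith (Real.toNNReal C) f s := LipschitzOnWith.of_dist_le_mul fun x hx y hy => by
    rw [dist_eq_norm, Real.dist_eq]
    exact (h x hx y hy).trans (by gcongr; exact Real.le_coe_toNNReal C)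
  exact this.continuousOn

lemma IsUGraph.continuousOn (h : UGraph a D) : ContinuousOn D I2 :=
  continuousOn_of_norm_sub_le fun _ hz _ hz' => h.norm_sub_le hz hz'

lemma IsSGraph.continuousOn (h : SGraph d W) : ContinuousOn W I0 :=
  continuousOn_of_norm_sub_le fun _ hz _ hz' => h.norm_sub_le hz hz'

lemma IsUGraph.mono (h : UGraph d D) (hd : d ≤ a) : UGraph a D :=
  ⟨h.coord, h.stable, fun z hz z' hz' => strongUnstableCone_mono hd (h.chord z hz z' hz')⟩

lemma IsUGraph.mem_cbox (h : UGraph a D) (hc : Central D) {z : ℝ} (hz : z ∈ I2) : D z ∈ Box := by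
  intro i
  fin_cases i
  · exact h.stable z hz
  · exact hc z hz
  · have := h.coord z hz
    simp only [Fin.reduceFinMk]
    rwa [this]

section Limits

lemma IsUGraph.of_tendsto [l.NeBot] (hDi : ∀ᶠ i in l, UGraph a (Di i))
    (hD : ∀ z ∈ I2, Tendsto (fun i => Di i z) l (𝓝 (D z))) :
    UGraph a D := by
  refine ⟨fun z hz => ?_, fun z hz => ?_, fun z hz z' hz' => ?_⟩
  · have h1 := ((continuous_coord 2).tendsto _).comp (hD z hz)
    refine tendsto_nhds_unique h1 (tendsto_const_nhds.congr' ?_)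
    filter_upwards [hDi] with i hi using (hi.coord z hz).symm
  · exact isClosed_Icc.mem_of_tendsto (((continuous_coord 0).tendsto _).comp (hD z hz))
      (hDi.mono fun i hi => hi.stable z hz)
  · exact (isClosed_strongUnstableCone a).mem_of_tendsto ((hD z hz).sub (hD z' hz'))
      (hDi.mono fun i hi => hi.chord z hz z' hz')

lemma CenterIn.of_tendsto [l.NeBot] (hDi : ∀ᶠ i in l, Central (Di i))
    (hD : ∀ z ∈ I2, Tendsto (fun i => Di i z) l (𝓝 (D z))) :
    Central D := fun z hz =>
  isClosed_Icc.mem_of_tendsto (((continuous_coord 1).tendsto _).comp (hD z hz))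
    (hDi.mono fun i hi => hi z hz)

lemma tendsto_graph {f : ι → ℝ → E3} {g : ℝ → E3} {I : Set ℝ} {C : ℝ}
    (hf : ∀ᶠ i in l, ∀ z ∈ I, ∀ z' ∈ I, ‖f i z - f i z'‖ ≤ C * |z - z'|)
    (hfg : ∀ z ∈ I, Tendsto (fun i => f i z) l (𝓝 (g z))) {t : ι → ℝ} {t0 : ℝ}
    (ht : ∀ᶠ i in l, t i ∈ I) (ht0 : t0 ∈ I) (htt : Tendsto t l (𝓝 t0)) :
    Tendsto (fun i => f i (t i)) l (𝓝 (g t0)) := by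
  have h1 : Tendsto (fun i => C * |t i - t0|) l (𝓝 0) := by
    have : Tendsto (fun i => C * |t i - t0|) l (𝓝 (C * |t0 - t0|)) :=
      ((htt.sub_const t0).abs).const_mul C
    simpa using this
  have h2 : Tendsto (fun i => f i (t i) - f i t0) l (𝓝 0) := by
    refine squeeze_zero_norm' ?_ h1
    filter_upwards [hf, ht] with i hi hti using hi _ hti _ ht0
  simpa using h2.add (hfg t0 ht0)

end Limits

/-! ### Position of an unstable graph with respect to a stable graph -/

open Classical in
/-- The stable coordinate at which the projections of `D` and `W` along the center direction
meet. -/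
def overAt (lo hi : Fin 3 → ℝ) (D W : ℝ → E3) : ℝ :=
  if h : ∃ s, s ∈ Icc (lo 0) (hi 0) ∧ D (W s 2) 0 = s then h.choose else 0

/-- The difference of the center coordinates over the common point of the projections. -/
def gap (lo hi : Fin 3 → ℝ) (D W : ℝ → E3) : ℝ :=
  D (W (overAt lo hi D W) 2) 1 - W (overAt lo hi D W) 1

local notation "Over" => overAt lo hi
local notation "Gap" => gap lo hi

section

variable (hD : IsUGraph lo hi a D) (hW : IsSGraph lo hi d W) (had : a * d < 1) (ha : 0 ≤ a)
  (h0 : lo 0 ≤ hi 0)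

include hD hW had ha h0

lemma existsUnique_overAt :
    ∃! s, s ∈ I0 ∧ D (W s 2) 0 = s := by
  have hm : MapsTo (fun s => W s 2) I0 I2 := fun s hs => hW.mem s hs 2
  have hc : ContinuousOn (fun s => D (W s 2) 0 - s) I0 := by
    have h1 : ContinuousOn (fun s => W s 2) I0 :=
      (continuous_coord 2).comp_continuousOn hW.continuousOn
    have h2 := (continuous_coord 0).comp_continuousOn (hD.continuousOn.comp h1 hm)
    exact h2.sub continuousOn_id
  obtain ⟨s, hs, hse⟩ := intermediate_value_Icc' h0 hc (show (0 : ℝ) ∈ Icc _ _ from by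
    have h1 := hD.stable _ (hm (left_mem_Icc.2 h0))
    have h2 := hD.stable _ (hm (right_mem_Icc.2 h0))
    exact ⟨by linarith [h2.2], by linarith [h1.1]⟩)
  refine ⟨s, ⟨hs, by linarith⟩, ?_⟩
  rintro s' ⟨hs', hse'⟩
  have h1 := hD.abs_zero_sub_le (hm hs') (hm hs)
  have h2 := hW.abs_two_sub_le hs' hs
  simp only at h1 h2 hse
  rw [hse', show D (W s 2) 0 = s by linarith] at h1
  have h3 : |s' - s| ≤ a * d * |s' - s| := by rw [mul_assoc]; exact h1.trans (by gcongr)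
  have h4 : |s' - s| = 0 := by
    by_contra h
    have : 0 < |s' - s| := lt_of_le_of_ne (abs_nonneg _) (Ne.symm h)
    nlinarith
  linarith [abs_eq_zero.1 h4]

lemma overAt_spec :
    Over D W ∈ I0 ∧ D (W (Over D W) 2) 0 = Over D W := by
  have h := (existsUnique_overAt hD hW had ha h0).exists
  rw [overAt, dif_pos h]
  exact h.choose_spec

lemma overAt_eq (hs : s ∈ I0)
    (h : D (W s 2) 0 = s) : Over D W = s :=
  (existsUnique_overAt hD hW had ha h0).unique (overAt_spec hD hW had ha h0) ⟨hs, h⟩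

lemma overAt_eq_of_apply {z : ℝ} (hs : s ∈ I0)
    (hz : z ∈ I2) (e0 : D z 0 = W s 0) (e2 : D z 2 = W s 2) :
    Over D W = s ∧ Gap D W = D z 1 - W s 1 := by
  rw [hD.coord z hz] at e2
  rw [hW.coord s hs] at e0
  have := overAt_eq hD hW had ha h0 hs (by rw [← e2, e0])
  refine ⟨this, ?_⟩
  rw [gap, this, ← e2]

lemma gap_eq_zero_iff :
    Gap D W = 0 ↔ ∃ z ∈ I2, ∃ s ∈ I0, D z = W s := by
  constructor
  · intro h
    obtain ⟨h1, h2⟩ := overAt_spec hD hW had ha h0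
    have hz := hW.mem _ h1 2
    refine ⟨_, hz, _, h1, ?_⟩
    ext i
    fin_cases i
    · simp only [Fin.zero_eta]; rw [h2, hW.coord _ h1]
    · simp only [Fin.mk_one]; rw [gap] at h; linarith
    · simp only [Fin.reduceFinMk]; rw [hD.coord _ hz]
  · rintro ⟨z, hz, s, hs, h⟩
    rw [(overAt_eq_of_apply hD hW had ha h0 hs hz (by rw [h]) (by rw [h])).2, h, sub_self]

lemma side_iff : (RightOf (D '' I2) (W '' I0) ↔ 0 < Gap D W) ∧
    (LeftOf (D '' I2) (W '' I0) ↔ Gap D W < 0) := by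
  obtain ⟨h1, h2⟩ := overAt_spec hD hW had ha h0
  have hz := hW.mem _ h1 2
  have k := fun {P : E3 → E3 → Prop} (h : ∀ p ∈ D '' I2, ∀ q ∈ W '' I0, p 0 = q 0 → p 2 = q 2 →
      P p q) => h _ (mem_image_of_mem D hz) _ (mem_image_of_mem W h1) (by rw [h2, hW.coord _ h1])
    (by rw [hD.coord _ hz])
  refine ⟨⟨fun h => sub_pos.2 (k h), ?_⟩, ⟨fun h => sub_neg.2 (k h), ?_⟩⟩ <;>
  · rintro h _ ⟨z, hz, rfl⟩ _ ⟨s, hs, rfl⟩ e0 e2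
    rw [(overAt_eq_of_apply hD hW had ha h0 hs hz e0 e2).2] at h
    linarith

end

section Limits

lemma tendsto_overAt {Wi : ι → ℝ → E3}
    (hDi : ∀ᶠ i in l, UGraph a (Di i)) (hWi : ∀ᶠ i in l, SGraph d (Wi i))
    (hD : UGraph a D) (hW : SGraph d W) (had : a * d < 1) (ha : 0 ≤ a)
    (h0 : lo 0 ≤ hi 0)
    (tD : ∀ z ∈ I2, Tendsto (fun i => Di i z) l (𝓝 (D z)))
    (tW : ∀ s ∈ I0, Tendsto (fun i => Wi i s) l (𝓝 (W s))) :
    Tendsto (fun i => Over (Di i) (Wi i)) l (𝓝 (Over D W)) := by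
  obtain ⟨h1, h2⟩ := overAt_spec hD hW had ha h0
  set s := Over D W with hs
  have hz := hW.mem _ h1 2
  have e1 : Tendsto (fun i => |Di i (W s 2) 0 - D (W s 2) 0|) l (𝓝 0) := by
    have := ((((continuous_coord 0).tendsto _).comp (tD _ hz)).sub_const (D (W s 2) 0)).abs
    simpa using this
  have e2 : Tendsto (fun i => |Wi i s 2 - W s 2|) l (𝓝 0) := by
    have := ((((continuous_coord 2).tendsto _).comp (tW _ h1)).sub_const (W s 2)).abs
    simpa using this
  have e3 : Tendsto (fun i => (a * |Wi i s 2 - W s 2| + |Di i (W s 2) 0 - D (W s 2) 0|) /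
      (1 - a * d)) l (𝓝 0) := by
    have := ((e2.const_mul a).add e1).div_const (1 - a * d)
    simpa using this
  rw [tendsto_iff_norm_sub_tendsto_zero]
  refine squeeze_zero' (.of_forall fun _ => norm_nonneg _) ?_ e3
  filter_upwards [hDi, hWi] with i hDi hWi
  obtain ⟨g1, g2⟩ := overAt_spec hDi hWi had ha h0
  set t := Over (Di i) (Wi i) with ht
  have hzt := hWi.mem _ g1 2
  rw [Real.norm_eq_abs, le_div_iff₀ (by linarith)]
  have q1 := hDi.abs_zero_sub_le hzt hz
  have q2 := hWi.abs_two_sub_le g1 h1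
  have q3 : |Wi i t 2 - W s 2| ≤ |Wi i t 2 - Wi i s 2| + |Wi i s 2 - W s 2| := abs_sub_le _ _ _
  have q4 : |t - s| ≤ |Di i (Wi i t 2) 0 - Di i (W s 2) 0| + |Di i (W s 2) 0 - D (W s 2) 0| := by
    have := abs_sub_le (Di i (Wi i t 2) 0) (Di i (W s 2) 0) (D (W s 2) 0)
    rwa [g2, h2] at this ⊢
  have q5 : a * |Wi i t 2 - W s 2| ≤ a * (d * |t - s| + |Wi i s 2 - W s 2|) := by gcongr; linarith
  nlinarith

lemma tendsto_gap {Wi : ι → ℝ → E3}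
    (hDi : ∀ᶠ i in l, UGraph a (Di i)) (hWi : ∀ᶠ i in l, SGraph d (Wi i))
    (hD : UGraph a D) (hW : SGraph d W) (had : a * d < 1) (ha : 0 ≤ a)
    (h0 : lo 0 ≤ hi 0)
    (tD : ∀ z ∈ I2, Tendsto (fun i => Di i z) l (𝓝 (D z)))
    (tW : ∀ s ∈ I0, Tendsto (fun i => Wi i s) l (𝓝 (W s))) :
    Tendsto (fun i => Gap (Di i) (Wi i)) l (𝓝 (Gap D W)) ∧
    Tendsto (fun i => Di i (Wi i (Over (Di i) (Wi i)) 2)) l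
      (𝓝 (D (W (Over D W) 2))) := by
  have t1 := tendsto_overAt hDi hWi hD hW had ha h0 tD tW
  have m1 : ∀ᶠ i in l, Over (Di i) (Wi i) ∈ I0 := by
    filter_upwards [hDi, hWi] with i h1 h2 using (overAt_spec h1 h2 had ha h0).1
  have m0 := (overAt_spec hD hW had ha h0).1
  have t2 := tendsto_graph (hWi.mono fun i h z hz z' hz' => h.norm_sub_le hz hz') tW m1 m0 t1
  have m2 : ∀ᶠ i in l, Wi i (Over (Di i) (Wi i)) 2 ∈ I2 := by
    filter_upwards [m1, hWi] with i h1 h2 using h2.mem _ h1 2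
  have t3 := tendsto_graph (hDi.mono fun i h z hz z' hz' => h.norm_sub_le hz hz') tD m2
    (hW.mem _ m0 2) (((continuous_coord 2).tendsto _).comp t2)
  exact ⟨(((continuous_coord 1).tendsto _).comp t3).sub (((continuous_coord 1).tendsto _).comp t2),
    t3⟩

end Limits

/-! ### Images of unstable graphs -/

/-- The parameter `t` of a point of `D` in `X` whose image has strong unstable coordinate `z`. -/
def IsCrossing (lo hi : Fin 3 → ℝ) (H : E3 → E3) (X : Set E3) (D : ℝ → E3) (z t : ℝ) : Prop :=
  t ∈ Icc (lo 2) (hi 2) ∧ D t ∈ X ∧ H (D t) 2 = z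

/-- The image of `D ∩ X` is a complete graph over the strong unstable coordinate. -/
def UniqueCross (lo hi : Fin 3 → ℝ) (H : E3 → E3) (X : Set E3) (D : ℝ → E3) : Prop :=
  ∀ z ∈ Icc (lo 2) (hi 2), ∃! t, IsCrossing lo hi H X D z t

open Classical in
/-- The parameter of the point of `D ∩ X` whose image has strong unstable coordinate `z`. -/
def crossAt (lo hi : Fin 3 → ℝ) (H : E3 → E3) (X : Set E3) (D : ℝ → E3) (z : ℝ) : ℝ :=
  if h : ∃ t, IsCrossing lo hi H X D z t then h.choose else 0

/-- The image of `D ∩ X`, parametrized by the strong unstable coordinate. -/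
def imageGraph (lo hi : Fin 3 → ℝ) (H : E3 → E3) (X : Set E3) (D : ℝ → E3) (z : ℝ) : E3 :=
  H (D (crossAt lo hi H X D z))

lemma UniqueCross.spec {X : Set E3} (h : UniqueCross lo hi H X D) {z : ℝ} (hz : z ∈ I2) :
    IsCrossing lo hi H X D z (crossAt lo hi H X D z) := by
  have h' := (h z hz).exists
  rw [crossAt, dif_pos h']
  exact h'.choose_spec

lemma UniqueCross.eq {X : Set E3} (h : UniqueCross lo hi H X D)
    {z t : ℝ} (hz : z ∈ I2) (ht : IsCrossing lo hi H X D z t) :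
    crossAt lo hi H X D z = t := (h z hz).unique (h.spec hz) ht

lemma UniqueCross.image_eq {X : Set E3} (h : UniqueCross lo hi H X D) (hX : ∀ p ∈ X, H p 2 ∈ I2) :
    H '' (D '' I2 ∩ X) = imageGraph lo hi H X D '' I2 := by
  ext p
  constructor
  · rintro ⟨_, ⟨⟨t, ht, rfl⟩, htX⟩, rfl⟩
    refine ⟨H (D t) 2, hX _ htX, ?_⟩
    rw [imageGraph, h.eq (hX _ htX) ⟨ht, htX, rfl⟩]
  · rintro ⟨z, hz, rfl⟩
    obtain ⟨h1, h2, -⟩ := h.spec hz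
    exact ⟨_, ⟨mem_image_of_mem _ h1, h2⟩, rfl⟩

section Limits

/-- The maps `Hi i` on the sets `Xi i` converge to `H` on `X`: upper semicontinuity of the sets and
convergence of values. -/
def LimClosed (l : Filter ι) (Hi : ι → E3 → E3) (Xi : ι → Set E3) (H : E3 → E3) (X : Set E3) :
    Prop :=
  ∀ U : Ultrafilter ι, ↑U ≤ l → ∀ p : ι → E3, (∀ᶠ i in (U : Filter ι), p i ∈ Xi i) → ∀ q,
    Tendsto p U (𝓝 q) → q ∈ X ∧ Tendsto (fun i => Hi i (p i)) U (𝓝 (H q))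

lemma LimClosed.const {X : Set E3} (hX : IsClosed X) (hH : ContinuousOn H X) :
    LimClosed l (fun _ => H) (fun _ => X) H X := by
  intro U _ p hp q hq
  have hqX := hX.mem_of_tendsto hq hp
  exact ⟨hqX, (hH q hqX).tendsto.comp (tendsto_nhdsWithin_iff.2 ⟨hq, hp⟩)⟩

lemma exists_tendsto_of_compact {X : Type*} [TopologicalSpace X] {K : Set X} (hK : IsCompact K)
    (U : Ultrafilter ι) {p : ι → X} (hp : ∀ᶠ i in (U : Filter ι), p i ∈ K) :
    ∃ q ∈ K, Tendsto p U (𝓝 q) := by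
  obtain ⟨q, hq, h⟩ := hK.ultrafilter_le_nhds (U.map p) (le_principal_iff.2 (Filter.mem_map.2 hp))
  exact ⟨q, hq, h⟩

lemma tendsto_imageGraph {Xi : ι → Set E3} {X : Set E3} (hl : LimClosed l Hi Xi H X)
    (hDi : ∀ᶠ i in l, UGraph a (Di i))
    (tD : ∀ z ∈ I2, Tendsto (fun i => Di i z) l (𝓝 (D z)))
    (ui : ∀ᶠ i in l, UniqueCross lo hi (Hi i) (Xi i) (Di i)) (u : UniqueCross lo hi H X D)
    {z : ι → ℝ} {z0 : ℝ} (hz : ∀ᶠ i in l, z i ∈ I2) (hz0 : z0 ∈ I2)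
    (tz : Tendsto z l (𝓝 z0)) :
    Tendsto (fun i => imageGraph lo hi (Hi i) (Xi i) (Di i) (z i)) l
      (𝓝 (imageGraph lo hi H X D z0)) ∧
    Tendsto (fun i => Di i (crossAt lo hi (Hi i) (Xi i) (Di i) (z i))) l
      (𝓝 (D (crossAt lo hi H X D z0))) := by
  rw [tendsto_iff_ultrafilter, tendsto_iff_ultrafilter, ← forall_and]
  intro U
  rw [← forall_and]
  intro hU
  have hsp : ∀ᶠ i in (U : Filter ι), IsCrossing lo hi (Hi i) (Xi i) (Di i) (z i)
      (crossAt lo hi (Hi i) (Xi i) (Di i) (z i)) := by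
    filter_upwards [hU ui, hU hz] with i h1 h2 using h1.spec h2
  obtain ⟨t, ht, tt⟩ := exists_tendsto_of_compact isCompact_Icc U (hsp.mono fun i h => h.1)
  have t1 := tendsto_graph ((hDi.filter_mono hU).mono fun i h z hz z' hz' =>
    h.norm_sub_le hz hz') (fun z hz => (tD z hz).mono_left hU) (hsp.mono fun i h => h.1) ht tt
  obtain ⟨h1, h2⟩ := hl U hU _ (hsp.mono fun i h => h.2.1) _ t1
  have h3 : H (D t) 2 = z0 := by
    refine tendsto_nhds_unique (((continuous_coord 2).tendsto _).comp h2)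
      ((tz.mono_left hU).congr' ?_)
    filter_upwards [hsp] with i h using h.2.2.symm
  have h4 := u.eq hz0 ⟨ht, h1, h3⟩
  rw [imageGraph, h4]
  exact ⟨h2, t1⟩

end Limits

lemma continuousOn_imageGraph {X : Set E3} (hX : IsClosed X)
    (hH : ContinuousOn H X) (hD : UGraph a D) (u : UniqueCross lo hi H X D) :
    ContinuousOn (imageGraph lo hi H X D) I2 ∧
    ContinuousOn (fun z => D (crossAt lo hi H X D z)) I2 := by
  have h := fun z (hz : z ∈ I2) => tendsto_imageGraph (l := 𝓝[I2] z) (LimClosed.const hX hH)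
    (.of_forall fun _ => hD) (fun z hz => tendsto_const_nhds)
    (.of_forall fun _ => u) u (z := fun z => z) self_mem_nhdsWithin hz
    (tendsto_id.mono_left nhdsWithin_le_nhds)
  exact ⟨fun z hz => (h z hz).1, fun z hz => (h z hz).2⟩

lemma IsUGraph.image {X : Set E3} (hX : IsClosed X)
    (hH : ContinuousOn H X) (hD : UGraph a D) (u : UniqueCross lo hi H X D)
    (hs : ∀ p ∈ X, H p 0 ∈ I0) {δ : ℝ} (hδ : 0 < δ)
    (hch : ∀ p ∈ X, ∀ q ∈ X, dist p q < δ → p - q ∈ strongUnstableCone a →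
      H p - H q ∈ strongUnstableCone d) :
    UGraph d (imageGraph lo hi H X D) := by
  obtain ⟨c1, c2⟩ := continuousOn_imageGraph hX hH hD u
  refine ⟨fun z hz => (u.spec hz).2.2, fun z hz => hs _ (u.spec hz).2.1, ?_⟩
  have key := norm_sub_le_of_local (f := fun z => scProj (imageGraph lo hi H X D z)) (C := d)
    (scProj.continuous.comp_continuousOn c1) (fun x hx => by
      have h1 : ∀ᶠ y in 𝓝[I2] x, dist (D (crossAt lo hi H X D y))
          (D (crossAt lo hi H X D x)) < δ := (c2 x hx) (Metric.ball_mem_nhds _ hδ)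
      filter_upwards [h1, self_mem_nhdsWithin] with y hy hyI
      have sy := u.spec hyI
      have sx := u.spec hx
      have := mem_strongUnstableCone.1 (hch _ sy.2.1 _ sx.2.1 hy (hD.chord _ sy.1 _ sx.1))
      rw [map_sub, PiLp.sub_apply, sy.2.2, sx.2.2] at this
      exact this)
  intro z hz z' hz'
  rw [mem_strongUnstableCone, map_sub, PiLp.sub_apply]
  have := key z' hz' z hz
  rwa [show imageGraph lo hi H X D z 2 = z from (u.spec hz).2.2,
    show imageGraph lo hi H X D z' 2 = z' from (u.spec hz').2.2]

end

/-! ### Horseshoes in a box -/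

/-- A map of a subset of a box with two pieces, each of which is mapped across the strip over the
box in the strong unstable direction and into the box in the stable direction, with cone fields
that are invariant on short chords. -/
structure PreHorseshoe (lo hi : Fin 3 → ℝ) (a d : ℝ) (G : E3 → E3) (X : Bool → Set E3) : Prop where
  lo_lt_hi : ∀ i, lo i < hi i
  d_pos : 0 < d
  d_le : d ≤ a
  a_lt_one : a < 1
  compact : ∀ b, IsCompact (X b)
  subset : ∀ b, X b ⊆ cbox lo hi
  disjoint : Disjoint (X false) (X true)
  cont : ∀ b, ContinuousOn G (X b)
  inj : InjOn G (X false ∪ X true)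
  stable : ∀ b, ∀ p ∈ X b, G p 0 ∈ Ioo (lo 0) (hi 0)
  strip : ∀ b, ∀ p ∈ X b, G p 2 ∈ Icc (lo 2) (hi 2)
  cross : ∀ b D, IsUGraph lo hi a D → CenterIn lo hi D → UniqueCross lo hi G (X b) D
  chords : ∃ c δ, 1 < c ∧ 0 < δ ∧ ∀ b, ∀ p ∈ X b, ∀ q ∈ X b, dist p q < δ →
    (p - q ∈ unstableCone d → G p - G q ∈ unstableCone d ∧ c * ‖p - q‖ ≤ ‖G p - G q‖) ∧
    (p - q ∈ strongUnstableCone a → G p - G q ∈ strongUnstableCone d) ∧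
    (G p - G q ∈ stableCone d → p - q ∈ stableCone d)

/-- The two pieces are mapped completely across the box in the center-unstable directions. -/
structure Horseshoe (lo hi : Fin 3 → ℝ) (a d : ℝ) (G : E3 → E3) (X : Bool → Set E3) : Prop
    extends PreHorseshoe lo hi a d G X where
  full : ∀ b, ∀ s ∈ Icc (lo 0) (hi 0), ∀ y ∈ Icc (lo 1) (hi 1), ∀ z ∈ Icc (lo 2) (hi 2),
    ∃ p, p ∈ X b ∧ p 0 = s ∧ G p 1 = y ∧ G p 2 = z
  center : ∀ b, ∀ p ∈ X b, G p ∈ cbox lo hi → p 1 ∈ Ioo (lo 1) (hi 1)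

/-- The orientation of the center direction is preserved. -/
structure OrientedHorseshoe (lo hi : Fin 3 → ℝ) (a d : ℝ) (G : E3 → E3) (X : Bool → Set E3) : Prop
    extends Horseshoe lo hi a d G X where
  above : ∀ b, ∀ p ∈ X b, p 1 = hi 1 → hi 1 < G p 1
  below : ∀ b, ∀ p ∈ X b, p 1 = lo 1 → G p 1 < lo 1

/-- The line in the strong unstable direction. -/
def vline (s c : ℝ) (z : ℝ) : E3 := !₂[s, c, z]

/-- The line in the stable direction through `p`. -/
def hline (p : E3) (s : ℝ) : E3 := !₂[s, p 1, p 2]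

local notation "Crossing" => IsCrossing lo hi
local notation "ImageG" => imageGraph lo hi
local notation "Over" => overAt lo hi
local notation "Gap" => gap lo hi

section

lemma isUGraph_vline (ha : 0 ≤ a) (hs : s ∈ I0) (c : ℝ) : UGraph a (vline s c) := by
  refine ⟨fun z hz => by simp [vline], fun z hz => by simpa [vline] using hs, fun z hz z' hz' => ?_⟩
  rw [mem_strongUnstableCone, norm_scProj]
  simp [vline]
  positivity

lemma centerIn_vline (s : ℝ) (hc : c ∈ I1) :
    Central (vline s c) := fun z _ => by simpa [vline] using hc

lemma isSGraph_hline (hd : 0 ≤ d) {p : E3} (hp : p ∈ Box) : SGraph d (hline p) := by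
  refine ⟨fun s hs => by simp [hline], fun s hs i => ?_, fun s hs s' hs' => ?_⟩
  · fin_cases i
    · simpa [hline] using hs
    · simpa [hline] using hp 1
    · simpa [hline] using hp 2
  · exact mem_stableCone_of_eq hd (by simp [hline]) (by simp [hline])

lemma hline_self (p : E3) : hline p (p 0) = p := by ext i; fin_cases i <;> simp [hline]

lemma ext3 {p q : E3} (h0 : p 0 = q 0) (h1 : p 1 = q 1) (h2 : p 2 = q 2) : p = q := by
  ext i; fin_cases i
  · exact h0
  · exact h1
  · exact h2

namespace PreHorseshoe

variable (h : PreHorseshoe lo hi a d G X)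

include h

lemma a_pos : 0 < a := h.d_pos.trans_le h.d_le

lemma d_lt_one : d < 1 := h.d_le.trans_lt h.a_lt_one

lemma mul_lt_one : a * d < 1 := by nlinarith [h.a_pos, h.d_pos, h.d_lt_one, h.a_lt_one]

lemma dd_lt_one : d * d < 1 := by nlinarith [h.d_pos, h.d_lt_one]

lemma isUGraph_image (b : Bool) (hD : UGraph a D)
    (hc : Central D) : UGraph d (ImageG G (X b) D) := by
  obtain ⟨c, δ, -, hδ, H⟩ := h.chords
  exact hD.image (h.compact b).isClosed (h.cont b) (h.cross b D hD hc)
    (fun p hp => Ioo_subset_Icc_self (h.stable b p hp)) hδ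
    fun p hp q hq hpq => (H b p hp q hq hpq).2.1

lemma limClosed (l : Filter ι) (b : Bool) : LimClosed l (fun _ => G) (fun _ => X b) G (X b) :=
  LimClosed.const (h.compact b).isClosed (h.cont b)

/-! #### Slices -/

lemma exists_slice (b : Bool) {z : ℝ} (hs : s ∈ I0) (hz : z ∈ I2) : ∃ P : ℝ → E3,
      (∀ x ∈ I1, P x ∈ X b ∧ P x 0 = s ∧ P x 1 = x ∧ G (P x) 2 = z) ∧
      ContinuousOn (fun x => G (P x) 1) I1 ∧
      InjOn (fun x => G (P x) 1) I1 ∧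
      (∀ q ∈ X b, q 0 = s → G q 2 = z → P (q 1) = q) ∧
      ∀ x, G (P x) = ImageG G (X b) (vline s x) z := by
  obtain ⟨c, δ, hc, hδ, H⟩ := h.chords
  have hu : ∀ x ∈ I1, UniqueCross lo hi G (X b) (vline s x) := fun x hx =>
    h.cross b _ (isUGraph_vline h.a_pos.le hs x) (centerIn_vline s hx)
  have ht := fun x (hx : x ∈ I1) => tendsto_imageGraph
    (l := 𝓝[I1] x) (h.limClosed _ b) (Di := fun x => vline s x)
    (D := vline s x) (.of_forall fun x => isUGraph_vline h.a_pos.le hs x)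
    (fun t _ => by
      have : Continuous fun x => vline s x t := by unfold vline; fun_prop
      exact (this.tendsto x).mono_left nhdsWithin_le_nhds)
    (eventually_mem_nhdsWithin.mono fun x hx => hu x hx) (hu x hx) (z := fun _ => z)
    (.of_forall fun _ => hz) hz tendsto_const_nhds
  set F : ℝ → E3 := fun x => ImageG G (X b) (vline s x) z with hF
  set P : ℝ → E3 := fun x => vline s x (crossAt lo hi G (X b) (vline s x) z) with hP
  have cF : ContinuousOn F I1 := fun x hx => (ht x hx).1
  have cP : ContinuousOn P I1 := fun x hx => (ht x hx).2
  have hFP : ∀ x, F x = G (P x) := fun x => rfl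
  have hPX : ∀ x ∈ I1, P x ∈ X b := fun x hx => ((hu x hx).spec hz).2.1
  have hF2 : ∀ x ∈ I1, F x 2 = z := fun x hx => ((hu x hx).spec hz).2.2
  have hP0 : ∀ x, P x 0 = s := fun x => by simp [hP, vline]
  have hP1 : ∀ x, P x 1 = x := fun x => by simp [hP, vline]
  have hlt := h.lo_lt_hi 1
  have cF1 : ContinuousOn (fun x => F x 1) I1 := (continuous_coord 1).comp_continuousOn cF
  have inj : InjOn (fun x => F x 1) I1 := by
    have key : ∀ x ∈ I1, ∀ y ∈ I1, x < y → F x 1 ≠ F y 1 := by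
      intro x hx y hy hxy heq
      have hsub : Icc x y ⊆ I1 := Icc_subset_Icc hx.1 hy.2
      obtain ⟨t, ht, hnear⟩ := exists_eq_near hxy (cF1.mono hsub) heq
      have htI : t ∈ I1 := hsub (Ioo_subset_Icc_self ht)
      obtain ⟨ε, hε, hεP⟩ := Metric.continuousWithinAt_iff.1 (cP t htI) (δ / 2) (by linarith)
      obtain ⟨u, hu', v, hv', huv, hut, hvt, he⟩ := hnear ε hε
      have huI := hsub (Ioo_subset_Icc_self hu')
      have hvI := hsub (Ioo_subset_Icc_self hv')
      have d1 := hεP huI hut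
      have d2 := hεP hvI hvt
      have d3 : dist (P u) (P v) < δ := by have := dist_triangle_right (P u) (P v) (P t); linarith
      obtain ⟨g1, g2⟩ := (H b _ (hPX u huI) _ (hPX v hvI) d3).1
        (mem_unstableCone_of_zero h.d_pos.le (by rw [PiLp.sub_apply, hP0, hP0, sub_self]))
      rw [← hFP, ← hFP] at g1 g2
      have e1 : (F u - F v) 1 = 0 := by rw [PiLp.sub_apply]; simp only at he; rw [he, sub_self]
      have e2 : (F u - F v) 2 = 0 := by rw [PiLp.sub_apply, hF2 u huI, hF2 v hvI, sub_self]
      rw [mem_unstableCone, norm_cuProj, e1, e2] at g1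
      have e0 : (F u - F v) 0 = 0 := by simpa using g1
      have e3 : F u - F v = 0 := ext3 e0 e1 e2
      rw [e3, norm_zero] at g2
      have e4 : P u = P v := by
        rw [← sub_eq_zero, ← norm_eq_zero]
        nlinarith [norm_nonneg (P u - P v)]
      exact huv (by rw [← hP1 u, e4, hP1])
    intro x hx y hy hxy
    rcases lt_trichotomy x y with hlt | heq | hlt
    · exact absurd hxy (key x hx y hy hlt)
    · exact heq
    · exact absurd hxy.symm (key y hy x hx hlt)
  refine ⟨P, fun x hx => ⟨hPX x hx, hP0 x, hP1 x, hF2 x hx⟩, cF1, inj, fun q q1 q2 q4 => ?_,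
    fun x => rfl⟩
  have hqb := h.subset b q1
  have hq : vline s (q 1) (q 2) = q := by rw [← q2]; ext i; fin_cases i <;> simp [vline]
  have hcr : crossAt lo hi G (X b) (vline s (q 1)) z = q 2 :=
    (hu _ (hqb 1)).eq hz ⟨hqb 2, by rw [hq]; exact q1, by rw [hq]; exact q4⟩
  rw [hP]; simp only; rw [hcr, hq]

lemma eq_of_slice (b : Bool) {p q : E3} (hp : p ∈ X b) (hq : q ∈ X b) (h0 : p 0 = q 0)
    (h1 : G p 1 = G q 1) (h2 : G p 2 = G q 2) : p = q := by
  obtain ⟨P, -, -, inj, e, -⟩ := h.exists_slice b (h.subset b hq 0) (h.strip b q hq)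
  have ep := e p hp h0 h2
  have eq := e q hq rfl rfl
  have : p 1 = q 1 := inj (h.subset b hp 1) (h.subset b hq 1) (by simp only; rw [ep, eq, h1])
  rw [← ep, ← eq, this]

/-- If one of the center faces is mapped above the box and the other one below it, the box is
covered. -/
lemma full_of_faces (b : Bool) {m m' : ℝ} (hm : m = lo 1 ∧ m' = hi 1 ∨ m = hi 1 ∧ m' = lo 1)
    (h1 : ∀ p ∈ X b, p 1 = m → G p 1 < lo 1) (h2 : ∀ p ∈ X b, p 1 = m' → hi 1 < G p 1) :
    ∀ s ∈ I0, ∀ y ∈ I1, ∀ z ∈ I2, ∃ p, p ∈ X b ∧ p 0 = s ∧ G p 1 = y ∧ G p 2 = z := by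
  intro s hs y hy z hz
  obtain ⟨P, hP, cP, -, -, -⟩ := h.exists_slice b hs hz
  have hlt := (h.lo_lt_hi 1).le
  have hmm : m ∈ I1 ∧ m' ∈ I1 := by rcases hm with ⟨rfl, rfl⟩ | ⟨rfl, rfl⟩ <;> simp [hlt]
  have k1 := h1 _ (hP m hmm.1).1 (hP m hmm.1).2.2.1
  have k2 := h2 _ (hP m' hmm.2).1 (hP m' hmm.2).2.2.1
  obtain ⟨x, hx, hxe⟩ : ∃ x ∈ I1, G (P x) 1 = y := by
    rcases hm with ⟨rfl, rfl⟩ | ⟨rfl, rfl⟩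
    · exact intermediate_value_Icc hlt cP ⟨k1.le.trans hy.1, hy.2.trans k2.le⟩
    · exact intermediate_value_Icc' hlt cP ⟨k1.le.trans hy.1, hy.2.trans k2.le⟩
  exact ⟨P x, (hP x hx).1, (hP x hx).2.1, hxe, (hP x hx).2.2.2⟩

lemma center_of_faces (b : Bool) (h1 : ∀ p ∈ X b, p 1 = lo 1 → G p 1 ∉ I1)
    (h2 : ∀ p ∈ X b, p 1 = hi 1 → G p 1 ∉ I1) :
    ∀ p ∈ X b, G p ∈ Box → p 1 ∈ Ioo (lo 1) (hi 1) := by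
  intro p hp hG
  have hm := h.subset b hp 1
  refine ⟨lt_of_le_of_ne hm.1 fun e => ?_, lt_of_le_of_ne hm.2 fun e => ?_⟩
  · exact h1 p hp e.symm (hG 1)
  · exact h2 p hp e (hG 1)

/-- If the center faces are mapped outside the box and the image of the piece meets the box, then
the two center faces are mapped to different sides of the box. -/
lemma faces_dichotomy (b : Bool) (hc : ∀ p ∈ X b, G p ∈ Box → p 1 ∈ Ioo (lo 1) (hi 1))
    {p₀ : E3} (hp0 : p₀ ∈ X b) (hG0 : G p₀ ∈ Box) :
    ((∀ p ∈ X b, p 1 = lo 1 → G p 1 < lo 1) ∧ ∀ p ∈ X b, p 1 = hi 1 → hi 1 < G p 1) ∨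
    ((∀ p ∈ X b, p 1 = hi 1 → G p 1 < lo 1) ∧ ∀ p ∈ X b, p 1 = lo 1 → hi 1 < G p 1) := by
  have hlt := h.lo_lt_hi 1
  have hout : ∀ p ∈ X b, p 1 ∉ Ioo (lo 1) (hi 1) → G p 1 ∉ I1 := by
    intro p hp hn hm
    refine hn (hc p hp fun i => ?_)
    fin_cases i
    · exact Ioo_subset_Icc_self (h.stable b p hp)
    · exact hm
    · exact h.strip b p hp
  have key : ∀ m ∈ I1, m ∉ Ioo (lo 1) (hi 1) → ∀ q ∈ X b, q 1 = m → G q 1 < lo 1 →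
      ∀ p ∈ X b, p 1 = m → G p 1 < lo 1 := by
    intro m hm hmn q hq hq1 hqG p hp hp1
    set K : Set (ℝ × ℝ) := I0 ×ˢ I2
    set F : ℝ × ℝ → E3 := fun x => ImageG G (X b) (vline x.1 m) x.2 with hF
    have hu : ∀ x ∈ K, UniqueCross lo hi G (X b) (vline x.1 m) := fun x hx =>
      h.cross b _ (isUGraph_vline h.a_pos.le hx.1 m) (centerIn_vline _ hm)
    have cF : ∀ x ∈ K, Tendsto F (𝓝[K] x) (𝓝 (F x)) := fun x hx =>
      (tendsto_imageGraph (a := a) (h.limClosed _ b)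
        (eventually_mem_nhdsWithin.mono fun y hy => isUGraph_vline h.a_pos.le hy.1 m)
        (fun t _ => by
          have : Continuous fun x : ℝ × ℝ => vline x.1 m t := by unfold vline; fun_prop
          exact (this.tendsto x).mono_left nhdsWithin_le_nhds)
        (eventually_mem_nhdsWithin.mono fun x hx => hu x hx) (hu x hx) (z := fun x => x.2)
        (eventually_mem_nhdsWithin.mono fun x hx => hx.2) hx.2
        ((continuous_snd.tendsto x).mono_left nhdsWithin_le_nhds)).1
    have cF1 : ∀ x ∈ K, Tendsto (fun x => F x 1) (𝓝[K] x) (𝓝 (F x 1)) := fun x hx =>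
      ((continuous_coord 1).tendsto _).comp (cF x hx)
    have hFn : ∀ x ∈ K, F x 1 ∉ I1 := fun x hx => by
      obtain ⟨-, u2, -⟩ := (hu x hx).spec hx.2
      exact hout _ u2 (by simpa [vline] using hmn)
    have hFe : ∀ r ∈ X b, r 1 = m → (r 0, G r 2) ∈ K ∧ F (r 0, G r 2) = G r := by
      intro r hr hr1
      have hrb := h.subset b hr
      refine ⟨⟨hrb 0, h.strip b r hr⟩, ?_⟩
      have e : vline (r 0) m (r 2) = r := by rw [← hr1]; ext i; fin_cases i <;> simp [vline]
      have := (hu (r 0, G r 2) ⟨hrb 0, h.strip b r hr⟩).eq (h.strip b r hr)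
        ⟨hrb 2, by rw [e]; exact hr, by rw [e]⟩
      simp only [hF, imageGraph]
      rw [this, e]
    have := forall_of_isPreconnected (P := fun x => F x 1 < lo 1)
      (isPreconnected_Icc.prod isPreconnected_Icc)
      (fun x hx hx1 => (cF1 x hx).eventually (gt_mem_nhds hx1))
      (fun x hx hx1 => by
        have h2 : hi 1 < F x 1 := by
          by_contra hcon
          exact hFn x hx ⟨not_lt.1 hx1, not_lt.1 hcon⟩
        exact ((cF1 x hx).eventually (lt_mem_nhds h2)).mono fun y hy => by linarith)
      (hFe q hq hq1).1 (by rw [(hFe q hq hq1).2]; exact hqG) _ (hFe p hp hp1).1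
    simp only at this
    rwa [(hFe p hp hp1).2] at this
  have key2 : ∀ m ∈ I1, m ∉ Ioo (lo 1) (hi 1) → ∀ q ∈ X b, q 1 = m → hi 1 < G q 1 →
      ∀ p ∈ X b, p 1 = m → hi 1 < G p 1 := by
    intro m hm hmn q hq hq1 hqG p hp hp1
    by_contra hcon
    have hp2 : G p 1 < lo 1 := by
      by_contra hcon2
      exact hout p hp (by rwa [hp1]) ⟨not_lt.1 hcon2, not_lt.1 hcon⟩
    linarith [key m hm hmn p hp hp1 hp2 q hq hq1]
  obtain ⟨P, hP, cP, inj, e, -⟩ := h.exists_slice b (h.subset b hp0 0) (h.strip b p₀ hp0)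
  have ml := left_mem_Icc.2 hlt.le
  have mh := right_mem_Icc.2 hlt.le
  have nl : lo 1 ∉ Ioo (lo 1) (hi 1) := by simp
  have nh : hi 1 ∉ Ioo (lo 1) (hi 1) := by simp
  have e₀ := e p₀ hp0 rfl rfl
  have hx0 := hc p₀ hp0 hG0
  have hy0 := hG0 1
  have ol := hout _ (hP _ ml).1 (by rw [(hP _ ml).2.2.1]; exact nl)
  have oh := hout _ (hP _ mh).1 (by rw [(hP _ mh).2.2.1]; exact nh)
  rcases cP.strictMonoOn_of_injOn_Icc' hlt.le inj with hmono | hanti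
  · left
    have k1 := hmono ml (Ioo_subset_Icc_self hx0) hx0.1
    have k2 := hmono (Ioo_subset_Icc_self hx0) mh hx0.2
    simp only at k1 k2
    rw [e₀] at k1 k2
    refine ⟨key _ ml nl _ (hP _ ml).1 (hP _ ml).2.2.1 ?_, key2 _ mh nh _ (hP _ mh).1 (hP _ mh).2.2.1 ?_⟩
    · by_contra hcon; exact ol ⟨not_lt.1 hcon, k1.le.trans hy0.2⟩
    · by_contra hcon; exact oh ⟨hy0.1.trans k2.le, not_lt.1 hcon⟩
  · right
    have k1 := hanti ml (Ioo_subset_Icc_self hx0) hx0.1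
    have k2 := hanti (Ioo_subset_Icc_self hx0) mh hx0.2
    simp only at k1 k2
    rw [e₀] at k1 k2
    refine ⟨key _ mh nh _ (hP _ mh).1 (hP _ mh).2.2.1 ?_, key2 _ ml nl _ (hP _ ml).1 (hP _ ml).2.2.1 ?_⟩
    · by_contra hcon; exact oh ⟨not_lt.1 hcon, k2.le.trans hy0.2⟩
    · by_contra hcon; exact ol ⟨hy0.1.trans k1.le, not_lt.1 hcon⟩

end PreHorseshoe

namespace Horseshoe

variable (h : Horseshoe lo hi a d G X)

include h

lemma existsUnique_slice (b : Bool) {y z : ℝ} (hs : s ∈ I0) (hy : y ∈ I1) (hz : z ∈ I2) :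
    ∃! p, p ∈ X b ∧ p 0 = s ∧ G p 1 = y ∧ G p 2 = z :=
  existsUnique_of_exists_of_unique (h.full b s hs y hy z hz)
    fun _ _ ⟨p1, p2, p3, p4⟩ ⟨q1, q2, q3, q4⟩ =>
      h.eq_of_slice b p1 q1 (p2.trans q2.symm) (p3.trans q3.symm) (p4.trans q4.symm)

lemma slice_tendsto (b : Bool) {p : ι → E3} {q : E3}
    (hp : ∀ᶠ i in l, p i ∈ X b) (hq : q ∈ X b) (hqG : G q 1 ∈ I1)
    (t0 : Tendsto (fun i => p i 0) l (𝓝 (q 0)))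
    (t1 : Tendsto (fun i => G (p i) 1) l (𝓝 (G q 1)))
    (t2 : Tendsto (fun i => G (p i) 2) l (𝓝 (G q 2))) : Tendsto p l (𝓝 q) := by
  rw [tendsto_iff_ultrafilter]
  intro U hU
  obtain ⟨r, hr, hpr⟩ := exists_tendsto_of_compact (h.compact b) U (hp.filter_mono hU)
  have hG := (h.limClosed l b U hU p (hp.filter_mono hU) r hpr).2
  have e : ∀ j : Fin 3, Tendsto (fun i => G (p i) j) U (𝓝 (G r j)) := fun j =>
    ((continuous_coord j).tendsto _).comp hG
  have : r = q := (h.existsUnique_slice b (h.subset b hq 0) hqG (h.strip b q hq)).unique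
    ⟨hr, tendsto_nhds_unique (((continuous_coord 0).tendsto _).comp hpr) (t0.mono_left hU),
      tendsto_nhds_unique (e 1) (t1.mono_left hU), tendsto_nhds_unique (e 2) (t2.mono_left hU)⟩
    ⟨hq, rfl, rfl, rfl⟩
  rwa [this] at hpr

/-! #### Pulling back stable graphs -/

lemma existsUnique_pull (b : Bool) (hW : SGraph d W) (hs : s ∈ I0) :
    ∃! p, p ∈ X b ∧ p 0 = s ∧ ∃ s' ∈ I0, G p = W s' := by
  have h0 := (h.lo_lt_hi 0).le
  have hex : ∀ y ∈ I1, ∀ z ∈ I2, ∃ p, p ∈ X b ∧ p 0 = s ∧ G p 1 = y ∧ G p 2 = z := fun y hy z hz =>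
    (h.existsUnique_slice b hs hy hz).exists
  choose! P hPX hP0 hP1 hP2 using hex
  have cont : ∀ (f : ℝ → E3) (K : Set ℝ), ContinuousOn f K → (∀ t ∈ K, f t 1 ∈ I1) →
      (∀ t ∈ K, f t 2 ∈ I2) → ContinuousOn (fun t => P (f t 1) (f t 2)) K := by
    intro f K hf h1 h2 t ht
    refine h.slice_tendsto b (eventually_mem_nhdsWithin.mono fun t ht => hPX _ (h1 t ht) _ (h2 t ht))
      (hPX _ (h1 t ht) _ (h2 t ht)) (by rw [hP1 _ (h1 t ht) _ (h2 t ht)]; exact h1 t ht) ?_ ?_ ?_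
    · refine tendsto_const_nhds.congr' (f₁ := fun _ => s) ?_ |>.trans ?_
      · exact eventually_mem_nhdsWithin.mono fun t ht => (hP0 _ (h1 t ht) _ (h2 t ht)).symm
      · rw [hP0 _ (h1 t ht) _ (h2 t ht)]
    · rw [hP1 _ (h1 t ht) _ (h2 t ht)]
      refine (((continuous_coord 1).tendsto _).comp (hf t ht)).congr' ?_
      exact eventually_mem_nhdsWithin.mono fun t ht => (hP1 _ (h1 t ht) _ (h2 t ht)).symm
    · rw [hP2 _ (h1 t ht) _ (h2 t ht)]
      refine (((continuous_coord 2).tendsto _).comp (hf t ht)).congr' ?_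
      exact eventually_mem_nhdsWithin.mono fun t ht => (hP2 _ (h1 t ht) _ (h2 t ht)).symm
  have hW1 := fun t (ht : t ∈ I0) => hW.mem t ht 1
  have hW2 := fun t (ht : t ∈ I0) => hW.mem t ht 2
  have c1 := cont W _ hW.continuousOn hW1 hW2
  have m1 : MapsTo (fun t => P (W t 1) (W t 2)) I0 (X b) := fun t ht =>
    hPX _ (hW1 t ht) _ (hW2 t ht)
  have c2 : ContinuousOn (fun t => G (P (W t 1) (W t 2)) 0 - t) I0 :=
    ((continuous_coord 0).comp_continuousOn ((h.cont b).comp c1 m1)).sub continuousOn_id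
  obtain ⟨t, ht, hte⟩ := intermediate_value_Icc' h0 c2 (show (0 : ℝ) ∈ Icc _ _ from by
    have h1 := h.stable b _ (m1 (left_mem_Icc.2 h0))
    have h2 := h.stable b _ (m1 (right_mem_Icc.2 h0))
    simp only at h1 h2
    exact ⟨by linarith [h2.2], by linarith [h1.1]⟩)
  simp only at hte
  refine ⟨P (W t 1) (W t 2), ⟨m1 ht, hP0 _ (hW1 t ht) _ (hW2 t ht), t, ht, ?_⟩, ?_⟩
  · refine ext3 ?_ (hP1 _ (hW1 t ht) _ (hW2 t ht)) (hP2 _ (hW1 t ht) _ (hW2 t ht))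
    rw [hW.coord t ht]; linarith
  have uniq : ∀ p q, p ∈ X b → p 0 = s → (∃ s' ∈ I0, G p = W s') →
      q ∈ X b → q 0 = s → (∃ s' ∈ I0, G q = W s') → p = q := by
    rintro p q hp p0 ⟨s1, hs1, e1⟩ hq q0 ⟨s2, hs2, e2⟩
    obtain ⟨c, δ, hc, hδ, H⟩ := h.chords
    set ℓ : ℝ → E3 := fun τ => G p + τ • (G q - G p) with hℓ
    have mem : ∀ j : Fin 3, ∀ τ ∈ Icc (0 : ℝ) 1, ℓ τ j ∈ Icc (lo j) (hi j) := by
      intro j τ hτ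
      have b1 : G p j ∈ Icc (lo j) (hi j) := by rw [e1]; exact hW.mem s1 hs1 j
      have b2 : G q j ∈ Icc (lo j) (hi j) := by rw [e2]; exact hW.mem s2 hs2 j
      have : ℓ τ j = (1 - τ) * G p j + τ * G q j := by simp [hℓ]; ring
      rw [this]
      exact (convex_Icc _ _) b1 b2 (by linarith [hτ.2]) hτ.1 (by ring)
    have cℓ : Continuous ℓ := by fun_prop
    have c3 := cont ℓ (Icc 0 1) cℓ.continuousOn (mem 1) (mem 2)
    have m3 : MapsTo (fun τ => P (ℓ τ 1) (ℓ τ 2)) (Icc (0 : ℝ) 1) (X b) := fun τ hτ =>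
      hPX _ (mem 1 τ hτ) _ (mem 2 τ hτ)
    have c4 : ContinuousOn (fun τ => G (P (ℓ τ 1) (ℓ τ 2)) 0) (Icc (0 : ℝ) 1) :=
      (continuous_coord 0).comp_continuousOn ((h.cont b).comp c3 m3)
    have cu : ∀ τ ∈ Icc (0 : ℝ) 1, cuProj (G (P (ℓ τ 1) (ℓ τ 2))) = cuProj (ℓ τ) := by
      intro τ hτ
      refine ext3 (by simp) ?_ ?_
      · simpa using hP1 _ (mem 1 τ hτ) _ (mem 2 τ hτ)
      · simpa using hP2 _ (mem 1 τ hτ) _ (mem 2 τ hτ)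
    have key := norm_sub_le_of_local (C := d * ‖cuProj (G q - G p)‖) c4 (fun x hx => by
      have hd : ∀ᶠ y in 𝓝[Icc (0 : ℝ) 1] x, dist (P (ℓ y 1) (ℓ y 2)) (P (ℓ x 1) (ℓ x 2)) < δ :=
        (c3 x hx) (Metric.ball_mem_nhds _ hδ)
      filter_upwards [hd, self_mem_nhdsWithin] with y hy hyI
      have := (H b _ (m3 hyI) _ (m3 hx) hy).1 (mem_unstableCone_of_zero h.d_pos.le (by
        rw [PiLp.sub_apply]
        simp only
        rw [hP0 _ (mem 1 y hyI) _ (mem 2 y hyI), hP0 _ (mem 1 x hx) _ (mem 2 x hx), sub_self]))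
      have h1 := mem_unstableCone.1 this.1
      simp only at h1
      rw [map_sub, cu y hyI, cu x hx, ← map_sub, PiLp.sub_apply] at h1
      have h2 : ℓ y - ℓ x = (y - x) • (G q - G p) := by simp only [hℓ]; module
      rw [h2, map_smul, norm_smul, Real.norm_eq_abs] at h1
      rw [Real.norm_eq_abs]
      linarith)
    have k := key 0 (by simp) 1 (by simp)
    have ee : ∀ r, r ∈ X b → r 0 = s → (∀ j : Fin 3, G r j ∈ Icc (lo j) (hi j)) →
        P (G r 1) (G r 2) = r := fun r hr r0 hm =>
      (h.existsUnique_slice b hs (hm 1) (hm 2)).unique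
        ⟨hPX _ (hm 1) _ (hm 2), hP0 _ (hm 1) _ (hm 2), hP1 _ (hm 1) _ (hm 2),
          hP2 _ (hm 1) _ (hm 2)⟩ ⟨hr, r0, rfl, rfl⟩
    have l0 : ℓ 0 = G p := by simp [hℓ]
    have l1 : ℓ 1 = G q := by simp [hℓ]
    rw [l0, l1, ee p hp p0 (fun j => l0 ▸ mem j 0 (by simp)),
      ee q hq q0 (fun j => l1 ▸ mem j 1 (by simp)), sub_zero, abs_one, mul_one] at k
    have k2 := mem_stableCone.1 (hW.chord s2 hs2 s1 hs1)
    rw [← e1, ← e2, PiLp.sub_apply] at k2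
    rw [Real.norm_eq_abs] at k
    have k3 : |G q 0 - G p 0| ≤ d * d * |G q 0 - G p 0| := by
      rw [mul_assoc]; exact k.trans (by gcongr; exact h.d_pos.le)
    have k4 : |G q 0 - G p 0| = 0 := by nlinarith [abs_nonneg (G q 0 - G p 0), h.dd_lt_one]
    have k5 : cuProj (G q - G p) = 0 := by
      rw [← norm_eq_zero]; rw [k4, mul_zero] at k2; exact le_antisymm k2 (norm_nonneg _)
    have hb : X b ⊆ X false ∪ X true := by cases b; exacts [subset_union_left, subset_union_right]
    refine h.inj (hb hp) (hb hq) (ext3 ?_ ?_ ?_)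
    · linarith [abs_eq_zero.1 k4]
    · have := congrArg (fun v : E3 => v 1) k5
      simp at this; linarith
    · have := congrArg (fun v : E3 => v 2) k5
      simp at this; linarith
  rintro q ⟨q1, q2, q3⟩
  exact uniq q _ q1 q2 q3 (m1 ht) (hP0 _ (hW1 t ht) _ (hW2 t ht)) ⟨t, ht, by
    refine ext3 ?_ (hP1 _ (hW1 t ht) _ (hW2 t ht)) (hP2 _ (hW1 t ht) _ (hW2 t ht))
    rw [hW.coord t ht]; linarith⟩

end Horseshoe

end

section

open Classical in
/-- The point of `X` over the stable coordinate `s` which `G` maps into the graph `W`. -/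
def pull (lo hi : Fin 3 → ℝ) (G : E3 → E3) (X : Set E3) (W : ℝ → E3) (s : ℝ) : E3 :=
  if h : ∃ p, p ∈ X ∧ p 0 = s ∧ ∃ s' ∈ Icc (lo 0) (hi 0), G p = W s' then h.choose else 0

/-- Iterated pull-back along the first `n` symbols of `w`. -/
def pullN (lo hi : Fin 3 → ℝ) (G : E3 → E3) (X : Bool → Set E3) : ℕ → (ℕ → Bool) → (ℝ → E3) → ℝ → E3
  | 0, _, W => W
  | n + 1, w, W => pull lo hi G (X (w 0)) (pullN lo hi G X n (fun k => w (k + 1)) W)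

open Classical in
/-- The point over the stable coordinate `s` with itinerary `w`. -/
def itin (G : E3 → E3) (X : Bool → Set E3) (w : ℕ → Bool) (s : ℝ) : E3 :=
  if h : ∃ p : E3, p 0 = s ∧ ∀ k, G^[k] p ∈ X (w k) then h.choose else 0

/-- Prepending a symbol to a sequence. -/
def consSeq (b : Bool) (w : ℕ → Bool) : ℕ → Bool
  | 0 => b
  | n + 1 => w n

namespace Horseshoe

variable (h : Horseshoe lo hi a d G X)

include h

lemma pull_spec (b : Bool) (hW : SGraph d W) (hs : s ∈ I0) :
    pull lo hi G (X b) W s ∈ X b ∧ pull lo hi G (X b) W s 0 = s ∧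
      ∃ s' ∈ I0, G (pull lo hi G (X b) W s) = W s' := by
  have h' := (h.existsUnique_pull b hW hs).exists
  rw [pull, dif_pos h']
  exact h'.choose_spec

lemma pull_eq (b : Bool) (hW : SGraph d W) {p : E3} (hp : p ∈ X b) {s' : ℝ}
    (hs' : s' ∈ I0) (hG : G p = W s') : pull lo hi G (X b) W (p 0) = p :=
  (h.existsUnique_pull b hW (h.subset b hp 0)).unique (h.pull_spec b hW (h.subset b hp 0))
    ⟨hp, rfl, s', hs', hG⟩

lemma tendsto_pull (b : Bool) {Wi : ι → ℝ → E3} (hWi : ∀ᶠ i in l, SGraph d (Wi i)) (hW : SGraph d W)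
    (tW : ∀ s ∈ I0, Tendsto (fun i => Wi i s) l (𝓝 (W s))) {s : ι → ℝ} {s0 : ℝ}
    (hs : ∀ᶠ i in l, s i ∈ I0) (ts : Tendsto s l (𝓝 s0)) :
    Tendsto (fun i => pull lo hi G (X b) (Wi i) (s i)) l (𝓝 (pull lo hi G (X b) W s0)) := by
  rw [tendsto_iff_ultrafilter]
  intro U hU
  have hsp : ∀ᶠ i in (U : Filter ι), pull lo hi G (X b) (Wi i) (s i) ∈ X b ∧
      pull lo hi G (X b) (Wi i) (s i) 0 = s i ∧ ∃ s' ∈ I0,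
        G (pull lo hi G (X b) (Wi i) (s i)) = Wi i s' := by
    filter_upwards [hWi.filter_mono hU, hs.filter_mono hU] with i h1 h2 using h.pull_spec b h1 h2
  have hex : ∀ i, ∃ t, pull lo hi G (X b) (Wi i) (s i) ∈ X b ∧
      pull lo hi G (X b) (Wi i) (s i) 0 = s i ∧ (∃ s' ∈ I0,
        G (pull lo hi G (X b) (Wi i) (s i)) = Wi i s') → t ∈ I0 ∧
        G (pull lo hi G (X b) (Wi i) (s i)) = Wi i t := by
    intro i
    by_cases hi : ∃ s' ∈ I0, G (pull lo hi G (X b) (Wi i) (s i)) = Wi i s'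
    · obtain ⟨t, ht⟩ := hi; exact ⟨t, fun _ => ht⟩
    · exact ⟨0, fun h => absurd h.2.2 hi⟩
  choose t ht using hex
  have ht' : ∀ᶠ i in (U : Filter ι), t i ∈ I0 ∧
      G (pull lo hi G (X b) (Wi i) (s i)) = Wi i (t i) := hsp.mono fun i hi => ht i hi
  obtain ⟨r, hr, hpr⟩ := exists_tendsto_of_compact (h.compact b) U (hsp.mono fun i h => h.1)
  obtain ⟨t0, ht0, htt⟩ := exists_tendsto_of_compact isCompact_Icc U (ht'.mono fun i h => h.1)
  have hG := (h.limClosed l b U hU _ (hsp.mono fun i h => h.1) r hpr).2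
  have t1 := tendsto_graph ((hWi.filter_mono hU).mono fun i h z hz z' hz' => h.norm_sub_le hz hz')
    (fun s hs => (tW s hs).mono_left hU) (ht'.mono fun i h => h.1) ht0 htt
  have e1 : G r = W t0 := tendsto_nhds_unique hG (t1.congr' (ht'.mono fun i h => h.2.symm))
  have e0 : r 0 = s0 := tendsto_nhds_unique (((continuous_coord 0).tendsto _).comp hpr)
    ((ts.mono_left hU).congr' (hsp.mono fun i h => h.2.1.symm))
  have := h.pull_eq b hW hr ht0 e1
  rw [e0] at this
  rwa [← this] at hpr

lemma isSGraph_pull (b : Bool) (hW : SGraph d W) : SGraph d (pull lo hi G (X b) W) := by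
  obtain ⟨c, δ, hc, hδ, H⟩ := h.chords
  have sp := fun s hs => h.pull_spec b hW (s := s) hs
  refine ⟨fun s hs => (sp s hs).2.1, fun s hs => h.subset b (sp s hs).1, ?_⟩
  have cP : ContinuousOn (pull lo hi G (X b) W) I0 := fun s hs =>
    h.tendsto_pull b (.of_forall fun _ => hW) hW (fun s hs => tendsto_const_nhds)
      self_mem_nhdsWithin (tendsto_id.mono_left nhdsWithin_le_nhds)
  have key := norm_sub_le_of_local (f := fun s => cuProj (pull lo hi G (X b) W s)) (C := d)
    (cuProj.continuous.comp_continuousOn cP) (fun x hx => by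
      have h1 : ∀ᶠ y in 𝓝[I0] x, dist (pull lo hi G (X b) W y)
        (pull lo hi G (X b) W x) < δ := (cP x hx) (Metric.ball_mem_nhds _ hδ)
      filter_upwards [h1, self_mem_nhdsWithin] with y hy hyI
      obtain ⟨y1, y2, s1, hs1, e1⟩ := sp y hyI
      obtain ⟨x1, x2, s2, hs2, e2⟩ := sp x hx
      have := mem_stableCone.1 ((H b _ y1 _ x1 hy).2.2 (by rw [e1, e2]; exact hW.chord _ hs1 _ hs2))
      rwa [map_sub, PiLp.sub_apply, y2, x2] at this)
  intro z hz z' hz'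
  rw [mem_stableCone, map_sub, PiLp.sub_apply, (sp z hz).2.1, (sp z' hz').2.1]
  exact key z' hz' z hz

lemma isSGraph_pullN (n : ℕ) (w : ℕ → Bool) (hW : SGraph d W) :
    SGraph d (pullN lo hi G X n w W) := by
  induction n generalizing w with
  | zero => exact hW
  | succ n ih => exact h.isSGraph_pull _ (ih _)

lemma tendsto_pullN {Wi : ι → ℝ → E3} (hWi : ∀ᶠ i in l, SGraph d (Wi i)) (hW : SGraph d W)
    (tW : ∀ s ∈ I0, Tendsto (fun i => Wi i s) l (𝓝 (W s))) (n : ℕ)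
    (w : ℕ → Bool) (hs : s ∈ I0) :
    Tendsto (fun i => pullN lo hi G X n w (Wi i) s) l (𝓝 (pullN lo hi G X n w W s)) := by
  induction n generalizing w s with
  | zero => exact tW s hs
  | succ n ih =>
    exact h.tendsto_pull (w 0) (hWi.mono fun i hi => h.isSGraph_pullN n _ hi)
      (h.isSGraph_pullN n _ hW) (fun s hs => ih _ hs) (.of_forall fun _ => hs)
      tendsto_const_nhds

lemma pullN_spec (n : ℕ) (w : ℕ → Bool) (hW : SGraph d W) (hs : s ∈ I0) :
    (∀ k < n, G^[k] (pullN lo hi G X n w W s) ∈ X (w k)) ∧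
      ∃ s' ∈ I0, G^[n] (pullN lo hi G X n w W s) = W s' := by
  induction n generalizing w s with
  | zero => exact ⟨by simp, s, hs, rfl⟩
  | succ n ih =>
    obtain ⟨h1, h2, s', hs', h3⟩ := h.pull_spec (w 0) (h.isSGraph_pullN n (fun k => w (k + 1)) hW) hs
    obtain ⟨g1, s'', hs'', g2⟩ := ih (fun k => w (k + 1)) hs'
    refine ⟨fun k hk => ?_, s'', hs'', ?_⟩
    · cases k with
      | zero => exact h1
      | succ k =>
        rw [Function.iterate_succ_apply, pullN, h3]
        exact g1 k (by omega)
    · rw [Function.iterate_succ_apply, pullN, h3]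
      exact g2

lemma pullN_eq (n : ℕ) (w : ℕ → Bool) (hW : SGraph d W) {p : E3}
    (hp0 : p 0 ∈ I0) (hp : ∀ k < n, G^[k] p ∈ X (w k)) {s' : ℝ}
    (hs' : s' ∈ I0) (hG : G^[n] p = W s') : pullN lo hi G X n w W (p 0) = p := by
  induction n generalizing w p with
  | zero =>
    simp only [Function.iterate_zero, id_eq] at hG
    simp only [pullN]
    rw [hG, hW.coord s' hs']
  | succ n ih =>
    have h0 : p ∈ X (w 0) := hp 0 (by omega)
    have hG0 : G p 0 ∈ I0 := Ioo_subset_Icc_self (h.stable _ p h0)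
    exact h.pull_eq (w 0) (h.isSGraph_pullN n _ hW) h0 hG0
      (ih (fun k => w (k + 1)) hG0 (fun k hk => hp (k + 1) (by omega)) hG).symm

/-- The `n`-th pull-backs of two stable graphs are exponentially close. -/
lemma exists_contraction : ∃ c C : ℝ, 1 < c ∧ ∀ (n : ℕ) (w : ℕ → Bool) (W0 W1 : ℝ → E3),
    SGraph d W0 → SGraph d W1 → ∀ s ∈ I0,
      ‖pullN lo hi G X n w W1 s - pullN lo hi G X n w W0 s‖ ≤ C / c ^ n := by
  obtain ⟨c, δ, hc, hδ, H⟩ := h.chords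
  obtain ⟨R0, hR0⟩ := isBounded_iff_forall_norm_le.1 (isCompact_cbox lo hi).isBounded
  have hd := h.d_lt_one
  refine ⟨c, 2 * R0 / (1 - d), hc, fun n w W0 W1 hW0 hW1 s hs => ?_⟩
  set W : ℝ → ℝ → E3 := fun τ t => (1 - τ) • W0 t + τ • W1 t with hWdef
  have hW : ∀ τ ∈ Icc (0 : ℝ) 1, SGraph d (W τ) := by
    intro τ hτ
    refine ⟨fun t ht => ?_, fun t ht i => ?_, fun t ht t' ht' => ?_⟩
    · simp [hWdef, hW0.coord t ht, hW1.coord t ht]; ring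
    · have : W τ t i = (1 - τ) * W0 t i + τ * W1 t i := by simp [hWdef]
      rw [this]
      exact (convex_Icc _ _) (hW0.mem t ht i) (hW1.mem t ht i) (by linarith [hτ.2]) hτ.1 (by ring)
    · have e : W τ t - W τ t' = (1 - τ) • (W0 t - W0 t') + τ • (W1 t - W1 t') := by
        simp only [hWdef]; module
      have g0 := mem_stableCone.1 (hW0.chord t ht t' ht')
      have g1 := mem_stableCone.1 (hW1.chord t ht t' ht')
      rw [PiLp.sub_apply, hW0.coord t ht, hW0.coord t' ht'] at g0
      rw [PiLp.sub_apply, hW1.coord t ht, hW1.coord t' ht'] at g1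
      rw [mem_stableCone, e, map_add, map_smul, map_smul]
      have e0 : ((1 - τ) • (W0 t - W0 t') + τ • (W1 t - W1 t')) 0 = t - t' := by
        simp [hW0.coord t ht, hW1.coord t ht, hW0.coord t' ht', hW1.coord t' ht']; ring
      rw [e0]
      refine (norm_add_le _ _).trans ?_
      rw [norm_smul, norm_smul, Real.norm_of_nonneg hτ.1,
        Real.norm_of_nonneg (by linarith [hτ.2] : 0 ≤ 1 - τ)]
      nlinarith [hτ.1, hτ.2]
  have tW : ∀ τ0, ∀ t ∈ I0, Tendsto (fun τ => W τ t) (𝓝[Icc 0 1] τ0) (𝓝 (W τ0 t)) := by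
    intro τ0 t _
    have : Continuous fun τ => W τ t := by simp only [hWdef]; fun_prop
    exact (this.tendsto τ0).mono_left nhdsWithin_le_nhds
  set q : ℝ → E3 := fun τ => pullN lo hi G X n w (W τ) s with hq
  have tq : ∀ τ ∈ Icc (0 : ℝ) 1, Tendsto q (𝓝[Icc 0 1] τ) (𝓝 (q τ)) := fun τ hτ =>
    h.tendsto_pullN (eventually_mem_nhdsWithin.mono fun τ hτ => hW τ hτ) (hW τ hτ) (tW τ) n w hs
  have hqX : ∀ τ ∈ Icc (0 : ℝ) 1, ∀ k < n, G^[k] (q τ) ∈ X (w k) := fun τ hτ =>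
    (h.pullN_spec n w (hW τ hτ) hs).1
  have hq0 : ∀ τ ∈ Icc (0 : ℝ) 1, q τ 0 = s := fun τ hτ =>
    (h.isSGraph_pullN n w (hW τ hτ)).coord s hs
  have tk : ∀ τ ∈ Icc (0 : ℝ) 1, ∀ k < n, Tendsto (fun τ' => G^[k] (q τ')) (𝓝[Icc 0 1] τ)
      (𝓝 (G^[k] (q τ))) := by
    intro τ hτ k
    induction k with
    | zero => exact fun _ => tq τ hτ
    | succ k ih =>
      intro hk
      have h1 := ih (by omega)
      simp only [Function.iterate_succ_apply']
      exact (h.cont (w k) _ (hqX τ hτ k (by omega))).tendsto.comp (tendsto_nhdsWithin_iff.2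
        ⟨h1, eventually_mem_nhdsWithin.mono fun τ' hτ' => hqX τ' hτ' k (by omega)⟩)
  have key := norm_sub_le_of_local (f := q) (C := 2 * R0 / (1 - d) / c ^ n) tq (fun τ hτ => by
    have hnear : ∀ᶠ τ' in 𝓝[Icc 0 1] τ, ∀ k < n, dist (G^[k] (q τ')) (G^[k] (q τ)) < δ := by
      have : ∀ k ∈ Finset.range n, ∀ᶠ τ' in 𝓝[Icc 0 1] τ,
          dist (G^[k] (q τ')) (G^[k] (q τ)) < δ := fun k hk =>
        (tk τ hτ k (Finset.mem_range.1 hk)) (Metric.ball_mem_nhds _ hδ)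
      filter_upwards [(Finset.eventually_all (Finset.range n)).2 this] with τ' h' k hk
      exact h' k (Finset.mem_range.2 hk)
    filter_upwards [hnear, self_mem_nhdsWithin] with τ' hn hτ'
    have exp : ∀ k ≤ n, G^[k] (q τ') - G^[k] (q τ) ∈ unstableCone d ∧
        c ^ k * ‖q τ' - q τ‖ ≤ ‖G^[k] (q τ') - G^[k] (q τ)‖ := by
      intro k
      induction k with
      | zero =>
        intro _
        refine ⟨mem_unstableCone_of_zero h.d_pos.le ?_, by simp⟩
        simp only [Function.iterate_zero, id_eq, PiLp.sub_apply]
        rw [hq0 τ' hτ', hq0 τ hτ, sub_self]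
      | succ k ih =>
        intro hk
        obtain ⟨i1, i2⟩ := ih (by omega)
        obtain ⟨j1, j2⟩ := (H (w k) _ (hqX τ' hτ' k (by omega)) _ (hqX τ hτ k (by omega))
          (hn k (by omega))).1 i1
        simp only [Function.iterate_succ_apply']
        refine ⟨j1, le_trans ?_ j2⟩
        rw [pow_succ']
        nlinarith
    obtain ⟨e1, e2⟩ := exp n le_rfl
    obtain ⟨-, s1, hs1, g1⟩ := h.pullN_spec n w (hW τ' hτ') hs
    obtain ⟨-, s2, hs2, g2⟩ := h.pullN_spec n w (hW τ hτ) hs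
    change G^[n] (q τ') = W τ' s1 at g1
    change G^[n] (q τ) = W τ s2 at g2
    set Δ := G^[n] (q τ') - G^[n] (q τ) with hΔ
    set e := (τ' - τ) • (W1 s2 - W0 s2) with he
    have dec : Δ = (W τ' s1 - W τ' s2) + e := by rw [hΔ, g1, g2, he]; simp only [hWdef]; module
    have hf := mem_stableCone.1 ((hW τ' hτ').chord s1 hs1 s2 hs2)
    have f0 : (W τ' s1 - W τ' s2) 0 = Δ 0 := by
      rw [dec, PiLp.add_apply, he]; simp [hW1.coord s2 hs2, hW0.coord s2 hs2]
    have hen : ‖e‖ ≤ |τ' - τ| * (2 * R0) := by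
      rw [he, norm_smul, Real.norm_eq_abs]
      gcongr
      have := norm_sub_le (W1 s2) (W0 s2)
      linarith [hR0 _ (hW1.mem s2 hs2), hR0 _ (hW0.mem s2 hs2)]
    have c1 : ‖cuProj Δ‖ ≤ d * |Δ 0| + ‖e‖ := by
      rw [← f0, dec, map_add]
      have := norm_add_le (cuProj (W τ' s1 - W τ' s2)) (cuProj e)
      linarith [norm_cuProj_le e]
    have c2 := mem_unstableCone.1 e1
    have c3 := norm_le_abs_add_cuProj Δ
    have hd0 := h.d_pos
    have c4 : (1 - d) * ‖Δ‖ ≤ ‖e‖ := by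
      have : (1 - d * d) * ‖cuProj Δ‖ ≤ ‖e‖ := by nlinarith
      calc (1 - d) * ‖Δ‖ ≤ (1 - d) * ((1 + d) * ‖cuProj Δ‖) := by
            gcongr
            linarith
        _ = (1 - d * d) * ‖cuProj Δ‖ := by ring
        _ ≤ _ := this
    have hcn : 0 < c ^ n := pow_pos (by linarith) n
    rw [div_div, div_mul_eq_mul_div, le_div_iff₀ (by apply mul_pos <;> linarith)]
    calc ‖q τ' - q τ‖ * ((1 - d) * c ^ n) = (1 - d) * (c ^ n * ‖q τ' - q τ‖) := by ring
      _ ≤ (1 - d) * ‖Δ‖ := by gcongr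
      _ ≤ ‖e‖ := c4
      _ ≤ _ := by linarith)
  have k := key 0 (by simp) 1 (by simp)
  have q0 : q 0 = pullN lo hi G X n w W0 s := by simp [hq, hWdef]
  have q1 : q 1 = pullN lo hi G X n w W1 s := by simp [hq, hWdef]
  rwa [q0, q1, sub_zero, abs_one, mul_one] at k

lemma iterate_mem_cbox {w : ℕ → Bool} {p : E3} (hp : ∀ k, G^[k] p ∈ X (w k)) (k : ℕ) :
    G^[k] p ∈ Box := h.subset _ (hp k)

lemma eq_pullN {w : ℕ → Bool} {p : E3} (hp : ∀ k, G^[k] p ∈ X (w k)) (n : ℕ) :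
    pullN lo hi G X n w (hline (G^[n] p)) (p 0) = p :=
  h.pullN_eq n w (isSGraph_hline h.d_pos.le (h.iterate_mem_cbox hp n))
    (h.iterate_mem_cbox hp 0 0) (fun k _ => hp k) (h.iterate_mem_cbox hp n 0) (hline_self _).symm

lemma existsUnique_itin (w : ℕ → Bool) (hs : s ∈ I0) :
    ∃! p : E3, p 0 = s ∧ ∀ k, G^[k] p ∈ X (w k) := by
  obtain ⟨c, C, hc, H⟩ := h.exists_contraction
  have hlim : Tendsto (fun n : ℕ => C / c ^ n) atTop (𝓝 0) :=
    Tendsto.div_atTop tendsto_const_nhds (tendsto_pow_atTop_atTop_of_one_lt hc)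
  refine existsUnique_of_exists_of_unique ?_ ?_
  · have hm : (fun i => lo i : Fin 3 → ℝ) = lo := rfl
    have hp₀ : (WithLp.toLp 2 lo : E3) ∈ Box := fun i => ⟨le_rfl, (h.lo_lt_hi i).le⟩
    have hW := isSGraph_hline h.d_pos.le hp₀
    set W := hline (WithLp.toLp 2 lo : E3)
    set U : Ultrafilter ℕ := hyperfilter ℕ
    have hU : (U : Filter ℕ) ≤ atTop := Nat.hyperfilter_le_atTop
    set p : ℕ → E3 := fun n => pullN lo hi G X n w W s with hp
    obtain ⟨q, -, hq⟩ := exists_tendsto_of_compact (isCompact_cbox lo hi) U (p := p)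
      (.of_forall fun n => (h.isSGraph_pullN n w hW).mem s hs)
    have hpX : ∀ k, ∀ᶠ n in (U : Filter ℕ), G^[k] (p n) ∈ X (w k) := fun k => by
      filter_upwards [(eventually_gt_atTop k).filter_mono hU] with n hn
      exact (h.pullN_spec n w hW hs).1 k hn
    have tk : ∀ k, Tendsto (fun n => G^[k] (p n)) U (𝓝 (G^[k] q)) := by
      intro k
      induction k with
      | zero => exact hq
      | succ k ih =>
        simp only [Function.iterate_succ_apply']
        exact (h.limClosed atTop (w k) U hU _ (hpX k) _ ih).2
    refine ⟨q, ?_, fun k => (h.compact (w k)).isClosed.mem_of_tendsto (tk k) (hpX k)⟩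
    refine tendsto_nhds_unique (((continuous_coord 0).tendsto _).comp hq)
      (tendsto_const_nhds.congr fun n => ?_)
    exact ((h.isSGraph_pullN n w hW).coord s hs).symm
  · rintro p q ⟨p0, hp⟩ ⟨q0, hq⟩
    have hle : ∀ n : ℕ, ‖p - q‖ ≤ C / c ^ n := fun n => by
      have := H n w (hline (G^[n] q)) (hline (G^[n] p))
        (isSGraph_hline h.d_pos.le (h.iterate_mem_cbox hq n))
        (isSGraph_hline h.d_pos.le (h.iterate_mem_cbox hp n)) s hs
      rwa [← p0, h.eq_pullN hp n, p0, ← q0, h.eq_pullN hq n] at this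
    have := ge_of_tendsto' hlim hle
    rw [← sub_eq_zero, ← norm_eq_zero]
    exact le_antisymm this (norm_nonneg _)

lemma itin_spec (w : ℕ → Bool) (hs : s ∈ I0) :
    itin G X w s 0 = s ∧ ∀ k, G^[k] (itin G X w s) ∈ X (w k) := by
  have h' := (h.existsUnique_itin w hs).exists
  rw [itin, dif_pos h']
  exact h'.choose_spec

lemma itin_eq {w : ℕ → Bool} {p : E3} (hp : ∀ k, G^[k] p ∈ X (w k)) : itin G X w (p 0) = p :=
  (h.existsUnique_itin w (h.iterate_mem_cbox hp 0 0)).unique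
    (h.itin_spec w (h.iterate_mem_cbox hp 0 0)) ⟨rfl, hp⟩

lemma isSGraph_itin (w : ℕ → Bool) : SGraph d (itin G X w) := by
  refine ⟨fun s hs => (h.itin_spec w hs).1,
    fun s hs => h.iterate_mem_cbox (h.itin_spec w hs).2 0, fun s hs s' hs' => ?_⟩
  obtain ⟨c, C, hc, H⟩ := h.exists_contraction
  have hlim : Tendsto (fun n : ℕ => C / c ^ n) atTop (𝓝 0) :=
    Tendsto.div_atTop tendsto_const_nhds (tendsto_pow_atTop_atTop_of_one_lt hc)
  obtain ⟨p0, hp⟩ := h.itin_spec w hs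
  obtain ⟨q0, hq⟩ := h.itin_spec w hs'
  set p := itin G X w s
  set q := itin G X w s'
  have hWp := fun n => isSGraph_hline h.d_pos.le (h.iterate_mem_cbox hp n)
  have hWq := fun n => isSGraph_hline h.d_pos.le (h.iterate_mem_cbox hq n)
  set r : ℕ → E3 := fun n => pullN lo hi G X n w (hline (G^[n] p)) s'
  have hr : Tendsto r atTop (𝓝 q) := by
    rw [tendsto_iff_norm_sub_tendsto_zero]
    refine squeeze_zero (fun _ => norm_nonneg _) (fun n => ?_) hlim
    have := H n w _ _ (hWq n) (hWp n) s' hs'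
    rwa [show pullN lo hi G X n w (hline (G^[n] q)) s' = q by
      conv_lhs => rw [← q0]
      exact h.eq_pullN hq n] at this
  refine (isClosed_stableCone d).mem_of_tendsto (tendsto_const_nhds.sub hr) (.of_forall fun n => ?_)
  have := (h.isSGraph_pullN n w (hWp n)).chord s hs s' hs'
  rwa [show pullN lo hi G X n w (hline (G^[n] p)) s = p by
    conv_lhs => rw [← p0]
    exact h.eq_pullN hp n] at this

/-! #### Position of the image of an unstable graph -/

lemma itin_one_mem (w : ℕ → Bool) (hs : s ∈ I0) : itin G X w s 1 ∈ Ioo (lo 1) (hi 1) := by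
  have hp := (h.itin_spec w hs).2
  exact h.center _ _ (hp 0) (h.iterate_mem_cbox hp 1)

lemma gap_image_eq_zero_iff (b : Bool) (w : ℕ → Bool) (hD : UGraph a D)
    (hc : Central D) : Gap (ImageG G (X b) D) (itin G X w) = 0 ↔
      Gap D (itin G X (consSeq b w)) = 0 := by
  have u := h.cross b D hD hc
  have h0 := (h.lo_lt_hi 0).le
  rw [gap_eq_zero_iff (h.isUGraph_image b hD hc) (h.isSGraph_itin w) h.dd_lt_one h.d_pos.le h0,
    gap_eq_zero_iff hD (h.isSGraph_itin _) h.mul_lt_one h.a_pos.le h0]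
  constructor
  · rintro ⟨z, hz, s, hs, e⟩
    obtain ⟨u1, u2, u3⟩ := u.spec hz
    set p := D (crossAt lo hi G (X b) D z)
    have hp : ∀ k, G^[k] p ∈ X (consSeq b w k) := by
      intro k
      cases k with
      | zero => exact u2
      | succ k =>
        rw [Function.iterate_succ_apply, show G p = itin G X w s from e]
        exact (h.itin_spec w hs).2 k
    exact ⟨_, u1, p 0, h.subset b u2 0, (h.itin_eq hp).symm⟩
  · rintro ⟨t, ht, s, hs, e⟩
    have hp := (h.itin_spec (consSeq b w) hs).2
    rw [← e] at hp
    have hX : D t ∈ X b := hp 0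
    have hz := h.strip b _ hX
    have hG : ∀ k, G^[k] (G (D t)) ∈ X (w k) := fun k => hp (k + 1)
    refine ⟨G (D t) 2, hz, G (D t) 0, Ioo_subset_Icc_self (h.stable b _ hX), ?_⟩
    rw [h.itin_eq hG, imageGraph, u.eq hz ⟨ht, hX, rfl⟩]

/-- The arc `D` pushed towards the value `m` of the center coordinate. -/
def _root_.BlenderTube.shift (D : ℝ → E3) (m lam z : ℝ) : E3 :=
  !₂[D z 0, (1 - lam) * D z 1 + lam * m, D z 2]

omit h in
lemma _root_.BlenderTube.isUGraph_shift (hD : UGraph a D) (m : ℝ)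
    {lam : ℝ} (hl : lam ∈ Icc (0 : ℝ) 1) : UGraph a (shift D m lam) := by
  refine ⟨fun z hz => by simpa [shift] using hD.coord z hz,
    fun z hz => by simpa [shift] using hD.stable z hz, fun z hz z' hz' => ?_⟩
  have := mem_strongUnstableCone.1 (hD.chord z hz z' hz')
  rw [mem_strongUnstableCone]
  have e2 : (shift D m lam z - shift D m lam z') 2 = (D z - D z') 2 := by simp [shift]
  rw [e2]
  refine le_trans ?_ this
  rw [norm_scProj, norm_scProj]
  apply Real.sqrt_le_sqrt
  have e1 : (shift D m lam z - shift D m lam z') 1 = (1 - lam) * (D z - D z') 1 := by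
    simp [shift]; ring
  have e0 : (shift D m lam z - shift D m lam z') 0 = (D z - D z') 0 := by simp [shift]
  rw [e0, e1, mul_pow]
  have : (1 - lam) ^ 2 ≤ 1 := by nlinarith [hl.1, hl.2]
  nlinarith [sq_nonneg ((D z - D z') 1)]

omit h in
lemma _root_.BlenderTube.centerIn_shift (hD : Central D) {m : ℝ}
    (hm : m ∈ I1) {lam : ℝ} (hl : lam ∈ Icc (0 : ℝ) 1) :
    Central (shift D m lam) := fun z hz => by
  have : shift D m lam z 1 = (1 - lam) * D z 1 + lam * m := by simp [shift]
  rw [this]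
  exact (convex_Icc _ _) (hD z hz) hm (by linarith [hl.2]) hl.1 (by ring)

omit h in
lemma _root_.BlenderTube.gap_shift (hD : UGraph a D)
    (hW : SGraph d W) (had : a * d < 1) (ha : 0 ≤ a) (h0 : lo 0 ≤ hi 0) (m : ℝ) {lam : ℝ}
    (hl : lam ∈ Icc (0 : ℝ) 1) : Gap (shift D m lam) W =
      (1 - lam) * Gap D W + lam * (m - W (Over D W) 1) := by
  obtain ⟨h1, h2⟩ := overAt_spec hD hW had ha h0
  have hz := hW.mem _ h1 2
  rw [(overAt_eq_of_apply (isUGraph_shift hD m hl) hW had ha h0 h1 hz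
    (by simp [shift]; rw [h2, hW.coord _ h1]) (by simp [shift]; rw [hD.coord _ hz])).2, gap]
  simp [shift]; ring

lemma gap_image_pos_aux (b : Bool) (w : ℕ → Bool) (hD : UGraph a D)
    (hc : Central D) {σ m : ℝ} (hσ : σ ≠ 0) (hm : m ∈ I1)
    (h1 : ∀ y ∈ Ioo (lo 1) (hi 1), 0 < σ * (m - y))
    (h2 : ∀ p ∈ X b, p 1 = m → ∀ y ∈ Ioo (lo 1) (hi 1), 0 < σ * (G p 1 - y))
    (hg : 0 < σ * Gap D (itin G X (consSeq b w))) :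
    0 < σ * Gap (ImageG G (X b) D) (itin G X w) := by
  have h0 := (h.lo_lt_hi 0).le
  have hS := h.isSGraph_itin
  have hDl : ∀ l ∈ Icc (0 : ℝ) 1, UGraph a (shift D m l) := fun l hl => isUGraph_shift hD m hl
  have hcl : ∀ l ∈ Icc (0 : ℝ) 1, Central (shift D m l) := fun l hl => centerIn_shift hc hm hl
  set g : ℝ → ℝ := fun l => σ * Gap (ImageG G (X b) (shift D m l)) (itin G X w) with hgdef
  have hne : ∀ l ∈ Icc (0 : ℝ) 1, g l ≠ 0 := by
    intro l hl he
    rw [hgdef, mul_eq_zero, or_iff_right hσ, h.gap_image_eq_zero_iff b w (hDl l hl) (hcl l hl),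
      gap_shift hD (hS _) h.mul_lt_one h.a_pos.le h0 m hl] at he
    have k1 := h1 _ (h.itin_one_mem (consSeq b w) (overAt_spec hD (hS (consSeq b w)) h.mul_lt_one h.a_pos.le
      h0).1)
    set A := Gap D (itin G X (consSeq b w))
    set B := m - itin G X (consSeq b w) (Over D (itin G X (consSeq b w))) 1
    have : (1 - l) * (σ * A) + l * (σ * B) = 0 := by linear_combination σ * he
    rcases hl.1.eq_or_lt with hl0 | hl0
    · rw [← hl0] at this; linarith
    · nlinarith [mul_pos hl0 k1, mul_nonneg (by linarith [hl.2] : 0 ≤ 1 - l) hg.le]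
  have hcont : ∀ l ∈ Icc (0 : ℝ) 1, Tendsto g (𝓝[Icc 0 1] l) (𝓝 (g l)) := by
    intro l hl
    have tD : ∀ z ∈ I2, Tendsto (fun l => shift D m l z) (𝓝[Icc 0 1] l)
        (𝓝 (shift D m l z)) := fun z _ => by
      have : Continuous fun l => shift D m l z := by unfold shift; fun_prop
      exact (this.tendsto l).mono_left nhdsWithin_le_nhds
    have ev : ∀ᶠ l in 𝓝[Icc (0 : ℝ) 1] l, l ∈ Icc (0 : ℝ) 1 := self_mem_nhdsWithin
    refine Tendsto.const_mul σ (tendsto_gap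
      (ev.mono fun l hl => h.isUGraph_image b (hDl l hl) (hcl l hl))
      (.of_forall fun _ => hS w) (h.isUGraph_image b (hDl l hl) (hcl l hl)) (hS w)
      h.dd_lt_one h.d_pos.le h0 (fun z hz => ?_) fun s hs => tendsto_const_nhds).1
    exact (tendsto_imageGraph (h.limClosed _ b) (ev.mono fun l hl => hDl l hl) tD
      (ev.mono fun l hl => h.cross b _ (hDl l hl) (hcl l hl)) (h.cross b _ (hDl l hl) (hcl l hl))
      (z := fun _ => z) (.of_forall fun _ => hz) hz tendsto_const_nhds).1
  have m1 : (1 : ℝ) ∈ Icc (0 : ℝ) 1 := by simp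
  have m0 : (0 : ℝ) ∈ Icc (0 : ℝ) 1 := by simp
  have hpos1 : 0 < g 1 := by
    obtain ⟨k1, k2⟩ := overAt_spec (h.isUGraph_image b (hDl 1 m1) (hcl 1 m1)) (hS w) h.dd_lt_one
      h.d_pos.le h0
    obtain ⟨-, u2, -⟩ := (h.cross b _ (hDl 1 m1) (hcl 1 m1)).spec ((hS w).mem _ k1 2)
    exact h2 _ u2 (by simp [shift]) _ (h.itin_one_mem w k1)
  have := forall_of_isPreconnected (P := fun l => 0 < g l) isPreconnected_Icc
    (fun l hl hp => (hcont l hl).eventually (lt_mem_nhds hp))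
    (fun l hl hp => by
      have : g l < 0 := lt_of_le_of_ne (not_lt.1 hp) (hne l hl)
      exact ((hcont l hl).eventually (gt_mem_nhds this)).mono fun _ h => h.le.not_gt) m1 hpos1 0 m0
  have e0 : shift D m 0 = D := by funext z; ext i; fin_cases i <;> simp [shift]
  simpa only [hgdef, e0] using this

end Horseshoe

namespace OrientedHorseshoe

variable (h : OrientedHorseshoe lo hi a d G X)

include h

lemma gap_image_pos (b : Bool) (w : ℕ → Bool) (hD : UGraph a D)
    (hc : Central D) (hg : 0 < Gap D (itin G X (consSeq b w))) :
    0 < Gap (ImageG G (X b) D) (itin G X w) := by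
  have := h.gap_image_pos_aux b w hD hc one_ne_zero (right_mem_Icc.2 (h.lo_lt_hi 1).le)
    (fun y hy => by linarith [hy.2]) (fun p hp hp1 y hy => by linarith [h.above b p hp hp1, hy.2])
    (by rwa [one_mul])
  rwa [one_mul] at this

lemma gap_image_neg (b : Bool) (w : ℕ → Bool) (hD : UGraph a D)
    (hc : Central D) (hg : Gap D (itin G X (consSeq b w)) < 0) :
    Gap (ImageG G (X b) D) (itin G X w) < 0 := by
  have := h.gap_image_pos_aux b w hD hc (neg_ne_zero.2 one_ne_zero)
    (left_mem_Icc.2 (h.lo_lt_hi 1).le)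
    (fun y hy => by linarith [hy.1]) (fun p hp hp1 y hy => by linarith [h.below b p hp hp1, hy.1])
    (by linarith)
  linarith

end OrientedHorseshoe

end

local notation "Pull" => pull lo hi
local notation "PullN" => pullN lo hi

section

/-- The sign of a side: `true` is the right side, `false` the left side. -/
def sideSign (x : Bool) : ℝ := if x then 1 else -1

/-- How far `D` lies beyond the stable graph with itinerary `w`, on the side `x`. -/
def beyond (lo hi : Fin 3 → ℝ) (G : E3 → E3) (X : Bool → Set E3) (x : Bool) (w : ℕ → Bool)
    (D : ℝ → E3) : ℝ :=
  sideSign x * gap lo hi D (itin G X w)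

/-- A horseshoe with the superposition property, expressed by the position of unstable graphs with
respect to the four stable graphs with itineraries `xxx…` and `yxxx…`, `y ≠ x`. -/
structure Blender (lo hi : Fin 3 → ℝ) (a d : ℝ) (G : E3 → E3) (X : Bool → Set E3) : Prop
    extends OrientedHorseshoe lo hi a d G X where
  touch_hi : ∀ D, IsUGraph lo hi d D → CenterIn lo hi D → ∀ z ∈ Icc (lo 2) (hi 2),
    D z 1 = hi 1 → 0 < beyond lo hi G X true (fun _ => true) D
  touch_lo : ∀ D, IsUGraph lo hi d D → CenterIn lo hi D → ∀ z ∈ Icc (lo 2) (hi 2),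
    D z 1 = lo 1 → 0 < beyond lo hi G X false (fun _ => false) D
  leave : ∀ x D, IsUGraph lo hi d D → CenterIn lo hi D → 0 ≤ beyond lo hi G X x (fun _ => x) D →
    0 < beyond lo hi G X x (consSeq (!x) fun _ => x) D
  superpose : ∀ D, IsUGraph lo hi d D → CenterIn lo hi D →
    (∀ x, beyond lo hi G X x (fun _ => x) D ≤ 0) →
    ∃ x, beyond lo hi G X x (consSeq (!x) fun _ => x) D < 0

lemma consSeq_const (x : Bool) : consSeq x (fun _ => x) = fun _ => x := by funext n; cases n <;> rfl

namespace OrientedHorseshoe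

variable (h : OrientedHorseshoe lo hi a d G X)

include h

lemma sign_beyond_image (x b : Bool) (w : ℕ → Bool) (hD : UGraph a D)
    (hc : Central D) : SignType.sign (beyond lo hi G X x w (ImageG G (X b) D)) =
      SignType.sign (beyond lo hi G X x (consSeq b w) D) := by
  rw [beyond, beyond, sign_mul, sign_mul]
  congr 1
  rcases lt_trichotomy (Gap D (itin G X (consSeq b w))) 0 with hlt | heq | hgt
  · rw [sign_neg hlt, sign_neg (h.gap_image_neg b w hD hc hlt)]
  · rw [heq, (h.gap_image_eq_zero_iff b w hD hc).2 heq]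
  · rw [sign_pos hgt, sign_pos (h.gap_image_pos b w hD hc hgt)]

lemma beyond_image_nonpos (x b : Bool) (w : ℕ → Bool) (hD : UGraph a D)
    (hc : Central D) : beyond lo hi G X x w (ImageG G (X b) D) ≤ 0 ↔
      beyond lo hi G X x (consSeq b w) D ≤ 0 := by
  rw [← sign_nonpos_iff, h.sign_beyond_image x b w hD hc, sign_nonpos_iff]

lemma beyond_image_eq_zero (x b : Bool) (w : ℕ → Bool) (hD : UGraph a D)
    (hc : Central D) : beyond lo hi G X x w (ImageG G (X b) D) = 0 ↔
      beyond lo hi G X x (consSeq b w) D = 0 := by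
  rw [← sign_eq_zero_iff, h.sign_beyond_image x b w hD hc, sign_eq_zero_iff]

end OrientedHorseshoe

namespace Horseshoe

variable (h : Horseshoe lo hi a d G X)

include h

lemma tendsto_beyond (hDi : ∀ᶠ i in l, UGraph a (Di i)) (hD : UGraph a D)
    (tD : ∀ z ∈ I2, Tendsto (fun i => Di i z) l (𝓝 (D z))) (x : Bool)
    (w : ℕ → Bool) :
    Tendsto (fun i => beyond lo hi G X x w (Di i)) l (𝓝 (beyond lo hi G X x w D)) :=
  (tendsto_gap hDi (.of_forall fun _ => h.isSGraph_itin w) hD (h.isSGraph_itin w)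
    h.mul_lt_one h.a_pos.le (h.lo_lt_hi 0).le tD fun _ _ => tendsto_const_nhds).1.const_mul _

lemma weaken : Horseshoe lo hi d d G X where
  lo_lt_hi := h.lo_lt_hi
  d_pos := h.d_pos
  d_le := le_rfl
  a_lt_one := h.d_lt_one
  compact := h.compact
  subset := h.subset
  disjoint := h.disjoint
  cont := h.cont
  inj := h.inj
  stable := h.stable
  strip := h.strip
  cross := fun b D hD => h.cross b D (hD.mono h.d_le)
  full := h.full
  center := h.center
  chords := by
    obtain ⟨c, δ, hc, hδ, H⟩ := h.chords
    exact ⟨c, δ, hc, hδ, fun b p hp q hq hpq => ⟨(H b p hp q hq hpq).1,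
      fun hv => (H b p hp q hq hpq).2.1 (strongUnstableCone_mono h.d_le hv),
      (H b p hp q hq hpq).2.2⟩⟩

end Horseshoe

/-- The arc `D` with its center coordinate truncated to the box. -/
def clamp (lo hi : Fin 3 → ℝ) (D : ℝ → E3) (z : ℝ) : E3 :=
  !₂[D z 0, max (lo 1) (min (hi 1) (D z 1)), D z 2]

lemma isUGraph_clamp (hD : UGraph a D) : UGraph a (clamp lo hi D) := by
  refine ⟨fun z hz => by simpa [clamp] using hD.coord z hz,
    fun z hz => by simpa [clamp] using hD.stable z hz, fun z hz z' hz' => ?_⟩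
  have := mem_strongUnstableCone.1 (hD.chord z hz z' hz')
  rw [mem_strongUnstableCone]
  have e2 : (clamp lo hi D z - clamp lo hi D z') 2 = (D z - D z') 2 := by simp [clamp]
  rw [e2]
  refine le_trans ?_ this
  rw [norm_scProj, norm_scProj]
  apply Real.sqrt_le_sqrt
  have e0 : (clamp lo hi D z - clamp lo hi D z') 0 = (D z - D z') 0 := by simp [clamp]
  have e1 : |(clamp lo hi D z - clamp lo hi D z') 1| ≤ |(D z - D z') 1| := by
    simp only [clamp, PiLp.sub_apply]
    have h1 := abs_max_sub_max_le_max (lo 1) (min (hi 1) (D z 1)) (lo 1) (min (hi 1) (D z' 1))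
    have h2 := abs_min_sub_min_le_max (hi 1) (D z 1) (hi 1) (D z' 1)
    simp only [sub_self, abs_zero, abs_nonneg, sup_of_le_right] at h1 h2
    exact h1.trans h2
  rw [e0]
  have := sq_le_sq.2 e1
  linarith

lemma centerIn_clamp (h1 : lo 1 ≤ hi 1) (D : ℝ → E3) : Central (clamp lo hi D) :=
  fun z _ => by simp [clamp, h1]

lemma gap_clamp (hD : UGraph a D) (hW : SGraph d W)
    (had : a * d < 1) (ha : 0 ≤ a) (h0 : lo 0 ≤ hi 0) : Gap (clamp lo hi D) W =
      max (lo 1) (min (hi 1) (D (W (Over D W) 2) 1)) - W (Over D W) 1 := by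
  obtain ⟨h1, h2⟩ := overAt_spec hD hW had ha h0
  have hz := hW.mem _ h1 2
  rw [(overAt_eq_of_apply (isUGraph_clamp hD) hW had ha h0 h1 hz
    (by simp [clamp]; rw [h2, hW.coord _ h1]) (by simp [clamp]; rw [hD.coord _ hz])).2]
  simp [clamp]

namespace Blender

variable (h : Blender lo hi a d G X)

include h

lemma centerIn_of_beyond (hD : UGraph d D)
    (hp : ∀ x, beyond lo hi G X x (fun _ => x) D ≤ 0) : Central D := by
  have h0 := (h.lo_lt_hi 0).le
  have hS := h.isSGraph_itin
  have hlt := h.lo_lt_hi 1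
  intro z hz
  by_contra hcon
  rw [mem_Icc, not_and_or, not_le, not_le] at hcon
  rcases hcon with hcon | hcon
  · have h1 := h.touch_lo _ (isUGraph_clamp hD) (centerIn_clamp hlt.le D) z hz (by
      simp [clamp, hcon.le])
    have h2 := hp false
    have ho := h.itin_one_mem (fun _ => false)
      (overAt_spec hD (hS fun _ => false) h.dd_lt_one h.d_pos.le h0).1
    rw [beyond, gap_clamp hD (hS _) h.dd_lt_one h.d_pos.le h0] at h1
    rw [beyond, gap] at h2
    simp only [sideSign, Bool.false_eq_true, if_false, neg_mul, one_mul] at h1 h2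
    have h3 := le_max_right (lo 1) (min (hi 1)
      (D (itin G X (fun _ => false) (Over D (itin G X fun _ => false)) 2) 1))
    rcases min_cases (hi 1) (D (itin G X (fun _ => false) (Over D (itin G X fun _ => false)) 2) 1)
      with ⟨e, -⟩ | ⟨e, -⟩ <;> linarith [ho.1, ho.2]
  · have h1 := h.touch_hi _ (isUGraph_clamp hD) (centerIn_clamp hlt.le D) z hz (by
      simp [clamp, hcon.le, hlt.le])
    have h2 := hp true
    have ho := h.itin_one_mem (fun _ => true)
      (overAt_spec hD (hS fun _ => true) h.dd_lt_one h.d_pos.le h0).1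
    rw [beyond, gap_clamp hD (hS _) h.dd_lt_one h.d_pos.le h0] at h1
    rw [beyond, gap] at h2
    simp only [sideSign, if_true, one_mul] at h1 h2
    have h3 := min_le_right (hi 1)
      (D (itin G X (fun _ => true) (Over D (itin G X fun _ => true)) 2) 1)
    rcases max_cases (lo 1) (min (hi 1)
      (D (itin G X (fun _ => true) (Over D (itin G X fun _ => true)) 2) 1))
      with ⟨e, -⟩ | ⟨e, -⟩ <;> linarith [ho.1, ho.2]

end Blender

/-! ### Families of unstable graphs in-between -/

/-- A continuous family, over `K`, of unstable graphs in-between or touching the two extremal stable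
graphs. -/
structure IsFamily (lo hi : Fin 3 → ℝ) (d : ℝ) (G : E3 → E3) (X : Bool → Set E3) (K : Set ℝ)
    (v : ℝ → ℝ → E3) : Prop where
  graph : ∀ t ∈ K, IsUGraph lo hi d (v t)
  between : ∀ t ∈ K, ∀ x, beyond lo hi G X x (fun _ => x) (v t) ≤ 0
  cont : ∀ z ∈ Icc (lo 2) (hi 2), ContinuousOn (fun t => v t z) K

/-- A closed family whose members consist of points related to the parameter by `R`. -/
def IsTubeFamily (lo hi : Fin 3 → ℝ) (d : ℝ) (G : E3 → E3) (X : Bool → Set E3)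
    (R : ℝ → E3 → Prop) : Prop :=
  ∃ v : ℝ → ℝ → E3, IsFamily lo hi d G X univ v ∧ Function.Periodic v 1 ∧
    ∀ t, ∀ z ∈ Icc (lo 2) (hi 2), R t (v t z)

/-- A family, over an interval, the first and the last member of which meet the same extremal
stable graph. -/
def IsFoldFamily (lo hi : Fin 3 → ℝ) (d : ℝ) (G : E3 → E3) (X : Bool → Set E3)
    (R : ℝ → E3 → Prop) : Prop :=
  ∃ (v : ℝ → ℝ → E3) (t0 t1 : ℝ) (x : Bool), t0 < t1 ∧ t1 ≤ t0 + 1 ∧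
    IsFamily lo hi d G X (Icc t0 t1) v ∧
    (∀ t ∈ Icc t0 t1, ∀ z ∈ Icc (lo 2) (hi 2), R t (v t z)) ∧
    beyond lo hi G X x (fun _ => x) (v t0) = 0 ∧ beyond lo hi G X x (fun _ => x) (v t1) = 0

lemma IsFamily.mono {K K' : Set ℝ} {v : ℝ → ℝ → E3} (hv : IsFamily lo hi d G X K v)
    (hK : K' ⊆ K) : IsFamily lo hi d G X K' v :=
  ⟨fun t ht => hv.graph t (hK ht), fun t ht => hv.between t (hK ht),
    fun z hz => (hv.cont z hz).mono hK⟩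

lemma exists_zero_right {ψ : ℝ → ℝ} {t b : ℝ} (htb : t ≤ b) (hψ : ContinuousOn ψ (Icc t b))
    (ht : ψ t < 0) (hb : 0 < ψ b) : ∃ b' ∈ Ioc t b, ψ b' = 0 ∧ ∀ s ∈ Icc t b', ψ s ≤ 0 := by
  have hc : IsCompact {s ∈ Icc t b | 0 ≤ ψ s} := by
    refine isCompact_Icc.of_isClosed_subset ?_ fun s hs => hs.1
    exact isClosed_Icc.isClosed_le continuousOn_const hψ
  obtain ⟨b', ⟨hb', h0⟩, hleast⟩ := hc.exists_isLeast ⟨b, right_mem_Icc.2 htb, hb.le⟩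
  have hlt : t < b' := lt_of_le_of_ne hb'.1 fun e => by rw [← e] at h0; linarith
  have hneg : ∀ s ∈ Ico t b', ψ s < 0 := fun s hs => by
    by_contra hcon
    exact absurd (hleast ⟨⟨hs.1, hs.2.le.trans hb'.2⟩, not_lt.1 hcon⟩) (not_le.2 hs.2)
  have hz : ψ b' ≤ 0 := by
    obtain ⟨s, hs, hse⟩ := intermediate_value_Icc hlt.le
      (hψ.mono (Icc_subset_Icc le_rfl hb'.2)) ⟨ht.le, h0⟩
    rcases hs.2.eq_or_lt with e | e
    · rw [← e, hse]
    · exact absurd hse (hneg s ⟨hs.1, e⟩).ne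
  refine ⟨b', ⟨hlt, hb'.2⟩, le_antisymm hz h0, fun s hs => ?_⟩
  rcases hs.2.eq_or_lt with e | e
  · rw [e]; exact hz
  · exact (hneg s ⟨hs.1, e⟩).le

lemma exists_zero_both {ψ : ℝ → ℝ} {b t : ℝ} (ht : t ∈ Icc a b)
    (hψ : ContinuousOn ψ (Icc a b)) (hn : ψ t < 0) (ha : 0 < ψ a) (hb : 0 < ψ b) :
    ∃ a' b', a ≤ a' ∧ a' < b' ∧ b' ≤ b ∧ ψ a' = 0 ∧ ψ b' = 0 ∧ ∀ s ∈ Icc a' b', ψ s ≤ 0 := by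
  obtain ⟨b', h1, h2, h3⟩ := exists_zero_right ht.2 (hψ.mono (Icc_subset_Icc ht.1 le_rfl)) hn hb
  obtain ⟨c, g1, g2, g3⟩ := exists_zero_right (ψ := fun s => ψ (-s)) (neg_le_neg ht.1)
    (hψ.comp continuousOn_neg fun s hs => ⟨by linarith [hs.2], by linarith [hs.1, ht.2]⟩)
    (by simpa using hn) (by simpa using ha)
  refine ⟨-c, b', by linarith [g1.2], by linarith [g1.1, h1.1], h1.2, g2, h2, fun s hs => ?_⟩
  rcases le_total s t with hst | hst
  · have := g3 (-s) ⟨by linarith, by linarith [hs.1]⟩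
    simpa using this
  · exact h3 s ⟨hst, hs.2⟩

namespace Blender

variable (h : Blender lo hi a d G X)

include h

lemma centerIn {K : Set ℝ} {v : ℝ → ℝ → E3} (hv : IsFamily lo hi d G X K v) {t : ℝ}
    (ht : t ∈ K) : Central (v t) := h.centerIn_of_beyond (hv.graph t ht) (hv.between t ht)

lemma isFamily_image {K : Set ℝ} {v : ℝ → ℝ → E3} (hv : IsFamily lo hi d G X K v) (b : Bool)
    (hb : ∀ t ∈ K, ∀ x, beyond lo hi G X x (consSeq b fun _ => x) (v t) ≤ 0) :
    IsFamily lo hi d G X K (fun t => ImageG G (X b) (v t)) := by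
  have hg := fun t ht => (hv.graph t ht).mono h.d_le
  have hc := fun t ht => h.centerIn hv (t := t) ht
  refine ⟨fun t ht => h.isUGraph_image b (hg t ht) (hc t ht), fun t ht x =>
    (h.beyond_image_nonpos x b _ (hg t ht) (hc t ht)).2 (hb t ht x), fun z hz t ht => ?_⟩
  exact (tendsto_imageGraph (h.limClosed (𝓝[K] t) b)
    (eventually_mem_nhdsWithin.mono fun t ht => hg t ht) (fun z hz => hv.cont z hz t ht)
    (eventually_mem_nhdsWithin.mono fun t ht => h.cross b _ (hg t ht) (hc t ht))
    (h.cross b _ (hg t ht) (hc t ht)) (z := fun _ => z) (.of_forall fun _ => hz) hz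
    tendsto_const_nhds).1

lemma continuousOn_beyond {K : Set ℝ} {v : ℝ → ℝ → E3} (hv : IsFamily lo hi d G X K v)
    (x : Bool) (w : ℕ → Bool) : ContinuousOn (fun t => beyond lo hi G X x w (v t)) K :=
  fun t ht => h.weaken.tendsto_beyond (eventually_mem_nhdsWithin.mono fun t ht => hv.graph t ht)
    (hv.graph t ht) (fun z hz => hv.cont z hz t ht) x w

variable {R R' : ℝ → E3 → Prop} (hR : ∀ b t p, R t p → p ∈ X b → R' t (G p))

include hR

lemma reach_image {K : Set ℝ} {v : ℝ → ℝ → E3} (hv : IsFamily lo hi d G X K v)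
    (hvR : ∀ t ∈ K, ∀ z ∈ I2, R t (v t z)) (b : Bool) :
    ∀ t ∈ K, ∀ z ∈ I2, R' t (ImageG G (X b) (v t) z) := by
  intro t ht z hz
  obtain ⟨u1, u2, -⟩ := (h.cross b _ ((hv.graph t ht).mono h.d_le) (h.centerIn hv ht)).spec hz
  exact hR b t _ (hvR t ht _ u1) u2

/-- A family some member of which lies strictly on one side of the stable graph `yxxx…`, while the
first and the last member lie on the other side, has an image that contains a fold. -/
lemma isFoldFamily_of_neg {v : ℝ → ℝ → E3} {t0 t1 t : ℝ} {x : Bool} (hle : t1 ≤ t0 + 1)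
    (hv : IsFamily lo hi d G X (Icc t0 t1) v)
    (hvR : ∀ t ∈ Icc t0 t1, ∀ z ∈ I2, R t (v t z)) (ht : t ∈ Icc t0 t1)
    (hn : beyond lo hi G X x (consSeq (!x) fun _ => x) (v t) < 0)
    (h0 : 0 < beyond lo hi G X x (consSeq (!x) fun _ => x) (v t0))
    (h1 : 0 < beyond lo hi G X x (consSeq (!x) fun _ => x) (v t1)) :
    IsFoldFamily lo hi d G X R' := by
  obtain ⟨a', b', k1, k2, k3, k4, k5, k6⟩ :=
    exists_zero_both ht (h.continuousOn_beyond hv x _) hn h0 h1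
  have hsub : Icc a' b' ⊆ Icc t0 t1 := Icc_subset_Icc k1 k3
  have hv' := hv.mono hsub
  have hg := fun t ht => (hv'.graph t ht).mono h.d_le
  have hc := fun t ht => h.centerIn hv' (t := t) ht
  have ma := left_mem_Icc.2 k2.le
  have mb := right_mem_Icc.2 k2.le
  refine ⟨fun t => ImageG G (X (!x)) (v t), a', b', x, k2, by linarith,
    h.isFamily_image hv' (!x) fun t ht y => ?_, h.reach_image hR hv' (fun t ht => hvR t (hsub ht)) _,
    (h.beyond_image_eq_zero x _ _ (hg _ ma) (hc _ ma)).2 k4,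
    (h.beyond_image_eq_zero x _ _ (hg _ mb) (hc _ mb)).2 k5⟩
  by_cases hy : y = x
  · rw [hy]; exact k6 t ht
  · rw [show y = !x by cases x <;> cases y <;> simp_all, consSeq_const]
    exact hv'.between t ht _

lemma step_tube (hT : IsTubeFamily lo hi d G X R) :
    IsTubeFamily lo hi d G X R' ∨ IsFoldFamily lo hi d G X R' := by
  obtain ⟨v, hv, hper, hvR⟩ := hT
  by_cases hA : ∃ x, ∀ t, beyond lo hi G X x (consSeq (!x) fun _ => x) (v t) ≤ 0
  · obtain ⟨x, hx⟩ := hA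
    refine Or.inl ⟨fun t => ImageG G (X (!x)) (v t),
      h.isFamily_image hv (!x) fun t ht y => ?_, fun t => ?_, fun t => ?_⟩
    · by_cases hy : y = x
      · rw [hy]; exact hx t
      · rw [show y = !x by cases x <;> cases y <;> simp_all, consSeq_const]
        exact hv.between t ht _
    · simp only; rw [hper t]
    · exact h.reach_image hR hv (fun t _ => hvR t) _ t trivial
  · push Not at hA
    obtain ⟨t0, ht0⟩ := hA true
    obtain ⟨t, ht⟩ := hA false
    obtain ⟨x, hx⟩ := h.superpose _ (hv.graph t trivial) (h.centerIn hv trivial)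
      (hv.between t trivial)
    have hxt : x = true := by
      cases x
      · exact absurd hx ht.le.not_gt
      · rfl
    rw [hxt] at hx
    have e : v (t - ⌊t - t0⌋) = v t := by
      have := hper.sub_zsmul_eq ⌊t - t0⌋ (x := t)
      simpa using this
    right
    refine h.isFoldFamily_of_neg hR (t0 := t0) (t1 := t0 + 1) (t := t - ⌊t - t0⌋) (x := true) le_rfl
      (hv.mono (subset_univ _)) (fun t _ => hvR t) ?_ (by rwa [e]) ht0 (by rwa [hper t0])
    constructor
    · linarith [Int.floor_le (t - t0)]
    · linarith [Int.lt_floor_add_one (t - t0)]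

lemma step_fold (hT : IsFoldFamily lo hi d G X R) : IsFoldFamily lo hi d G X R' := by
  obtain ⟨v, t0, t1, x, hlt, hle, hv, hvR, h0, h1⟩ := hT
  have hg := fun t ht => (hv.graph t ht).mono h.d_le
  have hc := fun t ht => h.centerIn hv (t := t) ht
  have ma := left_mem_Icc.2 hlt.le
  have mb := right_mem_Icc.2 hlt.le
  by_cases hA : ∀ t ∈ Icc t0 t1, beyond lo hi G X (!x) (consSeq x fun _ => !x) (v t) ≤ 0
  · refine ⟨fun t => ImageG G (X x) (v t), t0, t1, x, hlt, hle,
      h.isFamily_image hv x fun t ht y => ?_, h.reach_image hR hv hvR _,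
      (h.beyond_image_eq_zero x _ _ (hg _ ma) (hc _ ma)).2 (by rwa [consSeq_const]),
      (h.beyond_image_eq_zero x _ _ (hg _ mb) (hc _ mb)).2 (by rwa [consSeq_const])⟩
    by_cases hy : y = x
    · rw [hy, consSeq_const]; exact hv.between t ht _
    · rw [show y = !x by cases x <;> cases y <;> simp_all]
      exact hA t ht
  · push Not at hA
    obtain ⟨t, ht, htp⟩ := hA
    obtain ⟨y, hy⟩ := h.superpose _ (hv.graph t ht) (h.centerIn hv ht) (hv.between t ht)
    have hyx : y = x := by
      by_contra hne
      rw [show y = !x by cases x <;> cases y <;> simp_all, Bool.not_not] at hy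
      linarith
    rw [hyx] at hy
    exact h.isFoldFamily_of_neg hR hle hv hvR ht hy
      (h.leave x _ (hv.graph _ ma) (hc _ ma) h0.ge) (h.leave x _ (hv.graph _ mb) (hc _ mb) h1.ge)

end Blender

namespace Blender

variable (h : Blender lo hi a d G X)

include h

lemma exists_family (R : ℕ → ℝ → E3 → Prop) (hR : ∀ n b t p, R n t p → p ∈ X b → R (n + 1) t (G p))
    (h0 : IsTubeFamily lo hi d G X (R 0) ∨ IsFoldFamily lo hi d G X (R 0)) (n : ℕ) :
    IsTubeFamily lo hi d G X (R n) ∨ IsFoldFamily lo hi d G X (R n) := by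
  induction n with
  | zero => exact h0
  | succ n ih =>
    rcases ih with ih | ih
    · exact h.step_tube (hR n) ih
    · exact Or.inr (h.step_fold (hR n) ih)

/-- The members of a tube or fold family are joined by arbitrarily short chords in the stable
cone. -/
lemma exists_stable_chords {R : ℝ → E3 → Prop}
    (hF : IsTubeFamily lo hi d G X R ∨ IsFoldFamily lo hi d G X R) :
    ∃ t0 : ℝ, ∀ ε > 0, ∃ t t', t ≠ t' ∧ |t - t'| < 1 ∧ |t - t0| < ε ∧ |t' - t0| < ε ∧
      ∃ y y', R t y ∧ R t' y' ∧ dist y y' < ε ∧ y - y' ∈ stableCone d := by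
  rcases hF with ⟨v, hv, hper, hvR⟩ | ⟨v, a', b', x, hlt, hle, hv, hvR, h0, h1⟩
  · have hz := left_mem_Icc.2 (h.lo_lt_hi 2).le
    have hcv : Continuous fun t => v t (lo 2) := continuousOn_univ.1 (hv.cont _ hz)
    obtain ⟨t0, ht0, hn⟩ := exists_eq_near (φ := fun t => v t (lo 2) 1) zero_lt_one
      ((continuous_coord 1).comp hcv).continuousOn (by
        have := hper 0
        rw [zero_add] at this
        simp only; rw [this])
    refine ⟨t0, fun ε hε => ?_⟩
    obtain ⟨η, hη, H⟩ := Metric.continuousAt_iff.1 (hcv.continuousAt (x := t0)) (ε / 2)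
      (by linarith)
    obtain ⟨t, ht, t', ht', hne, k1, k2, k3⟩ := hn (min ε η) (lt_min hε hη)
    refine ⟨t, t', hne, ?_, k1.trans_le (min_le_left _ _), k2.trans_le (min_le_left _ _),
      v t (lo 2), v t' (lo 2), hvR t _ hz, hvR t' _ hz, ?_, ?_⟩
    · rw [abs_lt]; constructor <;> linarith [ht.1, ht.2, ht'.1, ht'.2]
    · have d1 := H (k1.trans_le (min_le_right _ _))
      have d2 := H (k2.trans_le (min_le_right _ _))
      linarith [dist_triangle_right (v t (lo 2)) (v t' (lo 2)) (v t0 (lo 2))]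
    · refine mem_stableCone_of_eq h.d_pos.le ?_ ?_
      · rw [PiLp.sub_apply, k3, sub_self]
      · rw [PiLp.sub_apply, (hv.graph t trivial).coord _ hz, (hv.graph t' trivial).coord _ hz,
          sub_self]
  · obtain ⟨t0, ht0, hn⟩ := exists_eq_near hlt (h.continuousOn_beyond hv x fun _ => x)
      (h0.trans h1.symm)
    have hS := h.isSGraph_itin fun _ => x
    set W := itin G X fun _ => x
    have h00 := (h.lo_lt_hi 0).le
    set y : ℝ → E3 := fun t => v t (W (Over (v t) W) 2) with hy
    have hsp := fun t (ht : t ∈ Icc a' b') =>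
      overAt_spec (hv.graph t ht) hS h.dd_lt_one h.d_pos.le h00
    have ht0' := Ioo_subset_Icc_self ht0
    have cy : ContinuousWithinAt y (Icc a' b') t0 :=
      (tendsto_gap (eventually_mem_nhdsWithin.mono fun t ht => hv.graph t ht)
        (.of_forall fun _ => hS) (hv.graph t0 ht0') hS h.dd_lt_one h.d_pos.le h00
        (fun z hz => hv.cont z hz t0 ht0') fun _ _ => tendsto_const_nhds).2
    refine ⟨t0, fun ε hε => ?_⟩
    obtain ⟨η, hη, H⟩ := Metric.continuousWithinAt_iff.1 cy (ε / 2) (by linarith)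
    obtain ⟨t, ht, t', ht', hne, k1, k2, k3⟩ := hn (min ε η) (lt_min hε hη)
    have mt := Ioo_subset_Icc_self ht
    have mt' := Ioo_subset_Icc_self ht'
    refine ⟨t, t', hne, ?_, k1.trans_le (min_le_left _ _), k2.trans_le (min_le_left _ _),
      y t, y t', hvR t mt _ (hS.mem _ (hsp t mt).1 2), hvR t' mt' _ (hS.mem _ (hsp t' mt').1 2),
      ?_, ?_⟩
    · rw [abs_lt]; constructor <;> linarith [ht.1, ht.2, ht'.1, ht'.2]
    · have d1 := H mt (k1.trans_le (min_le_right _ _))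
      have d2 := H mt' (k2.trans_le (min_le_right _ _))
      linarith [dist_triangle_right (y t) (y t') (y t0)]
    · have e : y t - y t' = W (Over (v t) W) - W (Over (v t') W) := by
        refine ext3 ?_ ?_ ?_
        · rw [PiLp.sub_apply, PiLp.sub_apply, hS.coord _ (hsp t mt).1, hS.coord _ (hsp t' mt').1]
          simp only [hy]
          rw [(hsp t mt).2, (hsp t' mt').2]
        · have k4 : Gap (v t) W = Gap (v t') W := by
            simp only [beyond, W] at k3 ⊢
            cases x <;> simpa [sideSign] using k3
          rw [gap, gap] at k4
          rw [PiLp.sub_apply, PiLp.sub_apply]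
          simp only [hy]
          linarith
        · rw [PiLp.sub_apply, PiLp.sub_apply]
          simp only [hy]
          rw [(hv.graph t mt).coord _ (hS.mem _ (hsp t mt).1 2),
            (hv.graph t' mt').coord _ (hS.mem _ (hsp t' mt').1 2)]
      rw [e]
      exact hS.chord _ (hsp t mt).1 _ (hsp t' mt').1

end Blender

end

/-! ### Ultrafilter limits -/

lemma eventually_forall_of_ultrafilter {ι T : Type*} {l : Filter ι} {P : ι → T → Prop}
    (h : ∀ U : Ultrafilter ι, ↑U ≤ l → ∀ D : ι → T, ¬ ∀ᶠ i in (U : Filter ι), ¬ P i (D i)) :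
    ∀ᶠ i in l, ∀ t, P i t := by
  by_contra hcon
  rw [not_eventually] at hcon
  have hne : (l ⊓ 𝓟 {i | ¬ ∀ t, P i t}).NeBot := frequently_iff_neBot.1 hcon
  set U := Ultrafilter.of (l ⊓ 𝓟 {i | ¬ ∀ t, P i t})
  have hU : (U : Filter ι) ≤ l ⊓ 𝓟 {i | ¬ ∀ t, P i t} := Ultrafilter.of_le _
  have hev : ∀ᶠ i in (U : Filter ι), ¬ ∀ t, P i t := hU (mem_inf_of_right (mem_principal_self _))
  obtain ⟨i, hi⟩ := hev.exists
  push Not at hi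
  obtain ⟨t0, -⟩ := hi
  have : ∀ i, ∃ t, (¬ ∀ t, P i t) → ¬ P i t := fun i => by
    by_cases hi : ∀ t, P i t
    · exact ⟨t0, fun h => absurd hi h⟩
    · push Not at hi
      obtain ⟨t, ht⟩ := hi
      exact ⟨t, fun _ => ht⟩
  choose D hD using this
  exact h U (hU.trans inf_le_left) D (hev.mono fun i hi => hD i hi)

local notation "Beyond" => beyond lo hi

section

lemma exists_limit_graph (U : Ultrafilter ι) (hD : ∀ᶠ i in (U : Filter ι), UGraph a (Di i))
    (hc : ∀ᶠ i in (U : Filter ι), Central (Di i)) :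
    ∃ D, UGraph a D ∧ Central D ∧ ∀ z ∈ I2, Tendsto (fun i => Di i z) U (𝓝 (D z)) := by
  have : ∀ z, ∃ q, z ∈ I2 → Tendsto (fun i => Di i z) U (𝓝 q) := fun z => by
    by_cases hz : z ∈ I2
    · obtain ⟨q, -, hq⟩ := exists_tendsto_of_compact (isCompact_cbox lo hi) U
        (p := fun i => Di i z) (by filter_upwards [hD, hc] with i h1 h2 using h1.mem_cbox h2 hz)
      exact ⟨q, fun _ => hq⟩
    · exact ⟨0, fun h => absurd h hz⟩
  choose D hD' using this
  exact ⟨D, IsUGraph.of_tendsto hD hD', CenterIn.of_tendsto hc hD', hD'⟩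

lemma LimClosed.eventually_forall {Xi : ι → Set E3} {X : Set E3}
    (h : LimClosed l Hi Xi H X) {K : Set E3} (hK : IsCompact K) (hXK : ∀ i, Xi i ⊆ K)
    {O : Set (E3 × E3)} (hO : IsOpen O) (hXO : ∀ p ∈ X, (p, H p) ∈ O) :
    ∀ᶠ i in l, ∀ p ∈ Xi i, (p, Hi i p) ∈ O := by
  refine eventually_forall_of_ultrafilter fun U hU p hp => ?_
  simp only [Classical.not_imp] at hp
  obtain ⟨q, -, hq⟩ := exists_tendsto_of_compact hK U (hp.mono fun i h => hXK i h.1)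
  obtain ⟨h1, h2⟩ := h U hU p (hp.mono fun i h => h.1) q hq
  have := (hq.prodMk_nhds h2).eventually (hO.mem_nhds (hXO q h1))
  obtain ⟨i, h3, h4⟩ := (this.and hp).exists
  exact h4.2 h3

/-! ### Stability of horseshoes -/

/-- `y` is an image of `v` under a map that respects the cone fields. -/
structure ConeRel (a d c : ℝ) (v y : E3) : Prop where
  unstable : v ∈ unstableCone d → y ∈ unstableCone d ∧ c * ‖v‖ ≤ ‖y‖
  strong : v ∈ strongUnstableCone a → y ∈ strongUnstableCone d ∧ c * ‖v‖ ≤ ‖y‖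
  stable : y ∈ stableCone d → v ∈ stableCone d ∧ c * ‖y‖ ≤ ‖v‖

/-- The points of the box in `N ∩ Z` that return to the strip over the box. -/
def returnSet (lo hi : Fin 3 → ℝ) (N Z : Set E3) (H : E3 → E3) : Set E3 :=
  {p | p ∈ cbox lo hi ∧ p ∈ N ∧ p ∈ Z ∧ H p 2 ∈ Icc (lo 2) (hi 2)}

/-- The two pieces `X` of the domain of a horseshoe with isolating neighbourhoods `N`, and a `C^1`
map `G` that respects the cone fields on `X`. -/
structure ReturnData (lo hi : Fin 3 → ℝ) (a d c : ℝ) (G : E3 → E3) (X N : Bool → Set E3) :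
    Prop where
  lo_lt_hi : ∀ i, lo i < hi i
  d_pos : 0 < d
  d_le : d ≤ a
  a_lt_one : a < 1
  one_lt_c : 1 < c
  subset : ∀ b, X b ⊆ cbox lo hi
  compact_nbhd : ∀ b, IsCompact (N b)
  subset_interior : ∀ b, X b ⊆ interior (N b)
  disjoint_nbhd : Disjoint (N false) (N true)
  isolated : ∀ b, ∀ p ∈ N b, p ∈ cbox lo hi → G p 2 ∈ Icc (lo 2) (hi 2) → p ∈ X b
  smooth : ∀ b, ∀ p ∈ N b, ContDiffAt ℝ 1 G p
  inj : InjOn G (N false ∪ N true)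
  stable : ∀ b, ∀ p ∈ X b, G p 0 ∈ Ioo (lo 0) (hi 0)
  strip : ∀ b, ∀ p ∈ X b, G p 2 ∈ Icc (lo 2) (hi 2)
  source : ∀ b, ∀ p ∈ X b, p 2 ∈ Ioo (lo 2) (hi 2)
  cone : ∀ b, ∀ p ∈ X b, ∃ η > 0, ∀ v y, ‖y - fderiv ℝ G p v‖ ≤ η * ‖v‖ → ConeRel a d c v y

lemma isClosed_returnSet {N Z : Set E3} (hN : IsClosed N) (hZ : IsClosed Z)
    (hH : ContinuousOn H (N ∩ Z)) : IsClosed (returnSet lo hi N Z H) := by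
  have h1 : returnSet lo hi N Z H = Box ∩ ((N ∩ Z) ∩ H ⁻¹' {q | q 2 ∈ I2}) := by
    ext p; simp only [returnSet, mem_ofPred_eq, mem_inter_iff, mem_preimage]; tauto
  rw [h1]
  exact (isCompact_cbox lo hi).isClosed.inter
    (hH.preimage_isClosed_of_isClosed (hN.inter hZ) (isClosed_Icc.preimage (continuous_coord 2)))

lemma isCompact_returnSet {N Z : Set E3} (hN : IsClosed N) (hZ : IsClosed Z)
    (hH : ContinuousOn H (N ∩ Z)) : IsCompact (returnSet lo hi N Z H) :=
  (isCompact_cbox lo hi).of_isClosed_subset (isClosed_returnSet hN hZ hH) fun _ hp => hp.1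

namespace ReturnData

variable (h : ReturnData lo hi a d c G X N)

include h

lemma a_pos : 0 < a := h.d_pos.trans_le h.d_le

lemma subset_nbhd (b : Bool) : X b ⊆ N b := (h.subset_interior b).trans interior_subset

lemma eq_returnSet (b : Bool) : X b = returnSet lo hi (N b) univ G := by
  ext p
  exact ⟨fun hp => ⟨h.subset b hp, h.subset_nbhd b hp, trivial, h.strip b p hp⟩,
    fun hp => h.isolated b p hp.2.1 hp.1 hp.2.2.2⟩

lemma compact (b : Bool) : IsCompact (X b) := by
  rw [h.eq_returnSet]
  exact isCompact_returnSet (h.compact_nbhd b).isClosed isClosed_univ fun p hp =>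
    (h.smooth b p hp.1).continuousAt.continuousWithinAt

variable {Z : Set E3} (hZ : IsClosed Z) (hH : ∀ b, ∀ p ∈ N b, p ∈ Z → C1At l Hi G p)

include hZ hH

lemma limClosed_returnSet (b : Bool) :
    LimClosed l Hi (fun i => returnSet lo hi (N b) Z (Hi i)) G (X b ∩ Z) := by
  intro U hU p hp q hq
  have h1 : q ∈ N b := (h.compact_nbhd b).isClosed.mem_of_tendsto hq (hp.mono fun i h => h.2.1)
  have h2 : q ∈ Z := hZ.mem_of_tendsto hq (hp.mono fun i h => h.2.2.1)
  have h3 : q ∈ Box := (isCompact_cbox lo hi).isClosed.mem_of_tendsto hq (hp.mono fun i h => h.1)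
  have h4 : Tendsto (fun i => Hi i (p i)) U (𝓝 (G q)) :=
    (hH b q h1 h2).val.comp ((tendsto_id'.2 hU).prodMk hq)
  have h5 : G q 2 ∈ I2 := isClosed_Icc.mem_of_tendsto (((continuous_coord 2).tendsto _).comp h4)
      (hp.mono fun i h => h.2.2.2)
  exact ⟨⟨h.isolated b q h1 h3 h5, h2⟩, h4⟩

lemma eventually_returnSet (b : Bool) {O : Set (E3 × E3)} (hO : IsOpen O)
    (hXO : ∀ p ∈ X b, p ∈ Z → (p, G p) ∈ O) :
    ∀ᶠ i in l, ∀ p ∈ returnSet lo hi (N b) Z (Hi i), (p, Hi i p) ∈ O :=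
  (h.limClosed_returnSet hZ hH b).eventually_forall (isCompact_cbox lo hi) (fun _ _ hp => hp.1) hO
    fun p hp => hXO p hp.1 hp.2

omit hZ in
lemma eventually_coneRel (b : Bool) {x : E3} (hx : x ∈ X b) (hxZ : x ∈ Z) :
    ∀ᶠ p in l ×ˢ (𝓝 x ×ˢ 𝓝 x), ConeRel a d c (p.2.1 - p.2.2) (Hi p.1 p.2.1 - Hi p.1 p.2.2) := by
  obtain ⟨η, hη, H⟩ := h.cone b x hx
  filter_upwards [(hH b x (h.subset_nbhd b hx) hxZ).chord hη] with p hp using H _ _ hp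

lemma exists_coneRel : ∃ δ > 0, ∀ᶠ i in l, ∀ b, ∀ p ∈ returnSet lo hi (N b) Z (Hi i), ∀ q,
    dist q p < δ → ConeRel a d c (p - q) (Hi i p - Hi i q) := by
  have key : ∀ b, ∃ δ > 0, ∀ᶠ i in l, ∀ p ∈ returnSet lo hi (N b) Z (Hi i), ∀ q,
      dist q p < δ → ConeRel a d c (p - q) (Hi i p - Hi i q) := fun b => by
    obtain ⟨δ, hδ, H⟩ := eventually_near_compact ((h.compact b).inter_right hZ) (l := l)
      (P := fun i y z => ConeRel a d c (y - z) (Hi i y - Hi i z))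
      fun x hx => h.eventually_coneRel hH b hx.1 hx.2
    refine ⟨δ / 2, by linarith, ?_⟩
    have hO : IsOpen (Metric.thickening (δ / 2) (X b ∩ Z) ×ˢ (univ : Set E3)) :=
      Metric.isOpen_thickening.prod isOpen_univ
    filter_upwards [H, h.eventually_returnSet hZ hH b hO fun p hp hpZ =>
      ⟨Metric.self_subset_thickening (by linarith) _ ⟨hp, hpZ⟩, trivial⟩] with i h1 h2 p hp q hq
    obtain ⟨x, hx, hpx⟩ := Metric.mem_thickening_iff.1 (h2 p hp).1
    exact h1 x hx p q (by linarith) (by linarith [dist_triangle q p x])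
  obtain ⟨δ, hδ, H⟩ := key false
  obtain ⟨δ', hδ', H'⟩ := key true
  refine ⟨min δ δ', lt_min hδ hδ', ?_⟩
  filter_upwards [H, H'] with i h1 h2 b p hp q hq
  cases b
  · exact h1 p hp q (hq.trans_le (min_le_left _ _))
  · exact h2 p hp q (hq.trans_le (min_le_right _ _))

omit h hZ in
lemma eventually_continuousOn (hN : ∀ b, IsCompact (N b)) (hZ : IsClosed Z) :
    ∀ᶠ i in l, ∀ b, ContinuousOn (Hi i) (N b ∩ Z) :=
  eventually_all.2 fun b => (eventually_forall_compact ((hN b).inter_right hZ)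
    (P := fun i x => DifferentiableAt ℝ (Hi i) x) fun x hx => (hH b x hx.1 hx.2).diff).mono
    fun _ hi x hx => (hi x hx).continuousAt.continuousWithinAt

/-! #### Crossings -/

omit hZ in
lemma exists_window (b : Bool) (hDi : ∀ᶠ i in l, UGraph a (Di i))
    (tD : ∀ z ∈ I2, Tendsto (fun i => Di i z) l (𝓝 (D z)))
    {t0 : ℝ} (ht0 : t0 ∈ I2) (hX : D t0 ∈ X b) (hDZ : D t0 ∈ Z) {ε0 : ℝ}
    (hε0 : 0 < ε0) : ∃ ε > 0, ε < ε0 ∧ ∀ᶠ i in l, ContinuousOn (fun t => Hi i (Di i t) 2)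
          (Icc (t0 - ε) (t0 + ε) ∩ I2) ∧
        ∀ t ∈ Icc (t0 - ε) (t0 + ε), t ∈ I2 → Di i t ∈ N b ∧ ∀ t' ∈ Icc (t0 - ε) (t0 + ε), t' ∈ I2 →
            c / (1 + d) * |t - t'| ≤ |Hi i (Di i t) 2 - Hi i (Di i t') 2| := by
  set I := I2 with hI
  have hL : ∀ᶠ i in l, ∀ z ∈ I, ∀ z' ∈ I, ‖Di i z - Di i z'‖ ≤ (1 + a) * |z - z'| :=
    hDi.mono fun i h z hz z' hz' => h.norm_sub_le hz hz'
  have T : Tendsto (fun p : ι × ℝ => Di p.1 p.2) (l ×ˢ 𝓝[I] t0) (𝓝 (D t0)) :=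
    tendsto_graph (f := fun p : ι × ℝ => Di p.1) (C := 1 + a) (tendsto_fst.eventually hL)
      (fun z hz => (tD z hz).comp tendsto_fst)
      (tendsto_snd.eventually eventually_mem_nhdsWithin) ht0
      ((tendsto_id.mono_left nhdsWithin_le_nhds).comp tendsto_snd)
  have hx := hH b _ (h.subset_nbhd b hX) hDZ
  have hN : ∀ᶠ p in l ×ˢ 𝓝[I] t0, Di p.1 p.2 ∈ N b :=
    T.eventually (mem_interior_iff_mem_nhds.1 (h.subset_interior b hX))
  have hdf : ∀ᶠ p in l ×ˢ 𝓝[I] t0, DifferentiableAt ℝ (Hi p.1) (Di p.1 p.2) :=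
    (tendsto_fst.prodMk T).eventually hx.diff
  have T2 : Tendsto (fun p : ι × ℝ × ℝ => (p.1, Di p.1 p.2.1, Di p.1 p.2.2))
      (l ×ˢ (𝓝[I] t0 ×ˢ 𝓝[I] t0)) (l ×ˢ (𝓝 (D t0) ×ˢ 𝓝 (D t0))) := by
    have e1 : Tendsto (fun p : ι × ℝ × ℝ => (p.1, p.2.1)) (l ×ˢ (𝓝[I] t0 ×ˢ 𝓝[I] t0))
        (l ×ˢ 𝓝[I] t0) := tendsto_fst.prodMk (tendsto_fst.comp tendsto_snd)
    have e2 : Tendsto (fun p : ι × ℝ × ℝ => (p.1, p.2.2)) (l ×ˢ (𝓝[I] t0 ×ˢ 𝓝[I] t0))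
        (l ×ˢ 𝓝[I] t0) := tendsto_fst.prodMk (tendsto_snd.comp tendsto_snd)
    exact tendsto_fst.prodMk ((T.comp e1).prodMk (T.comp e2))
  have hcr := T2.eventually (h.eventually_coneRel hH b hX hDZ)
  obtain ⟨s, hs, u, hu, hsu⟩ := Filter.mem_prod_iff.1 (hN.and hdf)
  obtain ⟨s', hs', u', hu', hsu'⟩ := Filter.mem_prod_iff.1 hcr
  obtain ⟨u1, hu1, u2, hu2, hu12⟩ := Filter.mem_prod_iff.1 hu'
  obtain ⟨r, hr, hru⟩ := Metric.mem_nhdsWithin_iff.1 (inter_mem hu (inter_mem hu1 hu2))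
  have hlt : min (r / 2) (ε0 / 2) < r := (min_le_left _ _).trans_lt (by linarith)
  have hmem : ∀ t ∈ Icc (t0 - min (r / 2) (ε0 / 2)) (t0 + min (r / 2) (ε0 / 2)), t ∈ I →
      t ∈ u ∩ (u1 ∩ u2) := fun t ht htI => hru ⟨by
    rw [Metric.mem_ball, Real.dist_eq, abs_lt]; constructor <;> linarith [ht.1, ht.2], htI⟩
  refine ⟨min (r / 2) (ε0 / 2), lt_min (by linarith) (by linarith),
    (min_le_right _ _).trans_lt (by linarith), ?_⟩
  · filter_upwards [hs, hs', hDi] with i hi hi' hDi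
    refine ⟨fun t ht => ?_, fun t ht htI => ⟨(@hsu (i, t) ⟨hi, (hmem t ht htI).1⟩).1,
      fun t' ht' htI' => ?_⟩⟩
    · have h1 := (@hsu (i, t) ⟨hi, (hmem t ht.1 ht.2).1⟩).2.continuousAt
      exact (continuous_coord 2).continuousAt.comp_continuousWithinAt
        (h1.comp_continuousWithinAt ((hDi.continuousOn t ht.2).mono inter_subset_right))
    · have h1 := @hsu' (i, t, t') ⟨hi', @hu12 (t, t') ⟨(hmem t ht htI).2.1, (hmem t' ht' htI').2.2⟩⟩
      obtain ⟨h2, h3⟩ := ConeRel.strong h1 (hDi.chord t htI t' htI')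
      rw [mem_strongUnstableCone] at h2
      have h4 := norm_le_abs_add_scProj (Hi i (Di i t) - Hi i (Di i t'))
      have h5 := abs_apply_le_norm (Di i t - Di i t') 2
      rw [PiLp.sub_apply, hDi.coord t htI, hDi.coord t' htI'] at h5
      simp only [PiLp.sub_apply] at h2 h3 h4
      have hd := h.d_pos
      have hc := h.one_lt_c
      rw [div_mul_eq_mul_div, div_le_iff₀ (by linarith)]
      nlinarith

omit h hH hZ in
lemma exists_eq_of_expanding {φ : ℝ → ℝ} {t0 ε κ z : ℝ} (hε : 0 < ε) (hκ : 0 < κ)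
    (hc : ContinuousOn φ (Icc (t0 - ε) (t0 + ε)))
    (he : ∀ t ∈ Icc (t0 - ε) (t0 + ε), ∀ t' ∈ Icc (t0 - ε) (t0 + ε), κ * |t - t'| ≤ |φ t - φ t'|)
    (hz : |z - φ t0| ≤ κ * ε) : ∃ t ∈ Icc (t0 - ε) (t0 + ε), φ t = z := by
  have hle : t0 - ε ≤ t0 + ε := by linarith
  have m1 := left_mem_Icc.2 hle
  have m2 := right_mem_Icc.2 hle
  have m0 : t0 ∈ Icc (t0 - ε) (t0 + ε) := ⟨by linarith, by linarith⟩
  have e1 := he _ m1 _ m0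
  have e2 := he _ m2 _ m0
  rw [show t0 - ε - t0 = -ε by ring, abs_neg, abs_of_pos hε] at e1
  rw [show t0 + ε - t0 = ε by ring, abs_of_pos hε] at e2
  have hinj : InjOn φ (Icc (t0 - ε) (t0 + ε)) := fun t ht t' ht' e => by
    have := he t ht t' ht'
    rw [e, sub_self, abs_zero] at this
    by_contra hne
    have := abs_pos.2 (sub_ne_zero.2 hne)
    nlinarith
  have hz' := abs_le.1 hz
  rcases hc.strictMonoOn_of_injOn_Icc' hle hinj with hm | hm
  · have g1 := hm m1 m0 (by linarith)
    have g2 := hm m0 m2 (by linarith)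
    rw [abs_of_neg (by linarith)] at e1
    rw [abs_of_pos (by linarith)] at e2
    exact intermediate_value_Icc hle hc ⟨by linarith, by linarith⟩
  · have g1 := hm m1 m0 (by linarith)
    have g2 := hm m0 m2 (by linarith)
    rw [abs_of_pos (by linarith)] at e1
    rw [abs_of_neg (by linarith)] at e2
    exact intermediate_value_Icc' hle hc ⟨by linarith, by linarith⟩

omit hZ in
/-- A crossing persists. -/
lemma eventually_exists_crossing (b : Bool)
    (hDi : ∀ᶠ i in l, UGraph a (Di i)) (hci : ∀ᶠ i in l, Central (Di i))
    (hDZ : ∀ᶠ i in l, ∀ z ∈ I2, Di i z ∈ Z)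
    (tD : ∀ z ∈ I2, Tendsto (fun i => Di i z) l (𝓝 (D z)))
    {z : ι → ℝ} {z0 t0 : ℝ} (hz : ∀ᶠ i in l, z i ∈ I2) (tz : Tendsto z l (𝓝 z0))
    (ht0 : Crossing G (X b ∩ Z) D z0 t0) (hD : UGraph a D) {ε0 : ℝ}
    (hε0 : 0 < ε0) :
    ∀ᶠ i in l, ∃ t, |t - t0| < ε0 ∧
      Crossing (Hi i) (returnSet lo hi (N b) Z (Hi i)) (Di i) (z i) t := by
  obtain ⟨tI, ⟨tX, tZ⟩, rfl⟩ := ht0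
  have hsrc := h.source b _ tX
  rw [hD.coord _ tI] at hsrc
  obtain ⟨ε, hε, hlt, H⟩ := h.exists_window hH b hDi tD tI tX tZ
    (ε0 := min ε0 (min (t0 - lo 2) (hi 2 - t0)))
    (lt_min hε0 (lt_min (by linarith [hsrc.1]) (by linarith [hsrc.2])))
  obtain ⟨k1, k2, k3⟩ : ε < ε0 ∧ ε < t0 - lo 2 ∧ ε < hi 2 - t0 := by
    simpa only [lt_min_iff] using hlt
  have hsub : Icc (t0 - ε) (t0 + ε) ⊆ I2 := Icc_subset_Icc (by linarith) (by linarith)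
  have hκ : 0 < c / (1 + d) := div_pos (by linarith [h.one_lt_c]) (by linarith [h.d_pos])
  have h4 : Tendsto (fun i => |z i - Hi i (Di i t0) 2|) l (𝓝 0) := by
    have h5 : Tendsto (fun i => Hi i (Di i t0)) l (𝓝 (G (D t0))) :=
      (hH b _ (h.subset_nbhd b tX) tZ).val.comp (tendsto_id.prodMk (tD _ tI))
    have h6 := (tz.sub (((continuous_coord 2).tendsto _).comp h5)).abs
    simpa using h6
  filter_upwards [H, hz, hDi, hci, hDZ, h4.eventually (gt_mem_nhds (mul_pos hκ hε))] with
    i hi hzi hDi hci hDZ hzz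
  obtain ⟨t, ht, hte⟩ := exists_eq_of_expanding hε hκ (hi.1.mono fun t ht => ⟨ht, hsub ht⟩)
    (fun t ht t' ht' => (hi.2 t ht (hsub ht)).2 t' ht' (hsub ht')) hzz.le
  refine ⟨t, ?_, hsub ht, ⟨hDi.mem_cbox hci (hsub ht), (hi.2 t ht (hsub ht)).1, hDZ t (hsub ht), ?_⟩,
    hte⟩
  · rw [abs_lt]; constructor <;> linarith [ht.1, ht.2]
  · rw [hte]; exact hzi

omit hZ in
/-- Crossings do not merge. -/
lemma eventually_crossing_eq (b : Bool) (hDi : ∀ᶠ i in l, UGraph a (Di i))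
    (tD : ∀ z ∈ I2, Tendsto (fun i => Di i z) l (𝓝 (D z)))
    {t0 : ℝ} (ht0 : t0 ∈ I2) (hX : D t0 ∈ X b) (hDZ : D t0 ∈ Z) :
    ∃ ε > 0, ∀ᶠ i in l, ∀ t ∈ I2, ∀ t' ∈ I2, |t - t0| < ε →
      |t' - t0| < ε → Hi i (Di i t) 2 = Hi i (Di i t') 2 → t = t' := by
  obtain ⟨ε, hε, -, H⟩ := h.exists_window hH b hDi tD ht0 hX hDZ one_pos
  refine ⟨ε, hε, ?_⟩
  filter_upwards [H] with i hi t ht t' ht' h1 h2 he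
  rw [abs_lt] at h1 h2
  have h3 := (hi.2 t ⟨by linarith, by linarith⟩ ht).2 t' ⟨by linarith, by linarith⟩ ht'
  rw [he, sub_self, abs_zero] at h3
  have hκ : 0 < c / (1 + d) := div_pos (by linarith [h.one_lt_c]) (by linarith [h.d_pos])
  by_contra hne
  have := abs_pos.2 (sub_ne_zero.2 hne)
  nlinarith

lemma eventually_uniqueCross (hG : ∀ b D, UGraph a D → Central D →
    UniqueCross lo hi G (X b) D) : ∀ᶠ i in l, ∀ D : ℝ → E3, UGraph a D → Central D →
      (∀ z ∈ I2, D z ∈ Z) → ∀ b,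
      UniqueCross lo hi (Hi i) (returnSet lo hi (N b) Z (Hi i)) D := by
  refine eventually_forall_of_ultrafilter fun U hU Di hcon => ?_
  simp only [Classical.not_imp, not_forall, exists_prop] at hcon
  have hDi := hcon.mono fun i h => h.1
  have hci := hcon.mono fun i h => h.2.1
  have hZi := hcon.mono fun i h => h.2.2.1
  obtain ⟨D, hD, hc, tD⟩ := exists_limit_graph U hDi hci
  have hDZ : ∀ z ∈ I2, D z ∈ Z := fun z hz =>
    hZ.mem_of_tendsto (tD z hz) (hZi.mono fun i h => h z hz)
  have hHU : ∀ b, ∀ p ∈ N b, p ∈ Z → C1At (U : Filter ι) Hi G p :=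
    fun b p hp hpZ => (hH b p hp hpZ).mono hU
  have : ∀ i, ∃ (b : Bool) (z : ℝ), (∃ x, ¬ UniqueCross lo hi (Hi i)
      (returnSet lo hi (N x) Z (Hi i)) (Di i)) → z ∈ I2 ∧
      ¬ ∃! t, Crossing (Hi i) (returnSet lo hi (N b) Z (Hi i)) (Di i) z t := fun i => by
    by_cases hx : ∃ x, ¬ UniqueCross lo hi (Hi i) (returnSet lo hi (N x) Z (Hi i)) (Di i)
    · obtain ⟨b, hb⟩ := hx
      simp only [UniqueCross, not_forall] at hb
      obtain ⟨z, hz, hb⟩ := hb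
      exact ⟨b, z, fun _ => ⟨hz, hb⟩⟩
    · exact ⟨true, 0, fun h => absurd h hx⟩
  choose b z hbz using this
  have hbz' := hcon.mono fun i h => hbz i h.2.2.2
  obtain ⟨b0, hb0⟩ : ∃ b0, ∀ᶠ i in (U : Filter ι), b i = b0 := by
    rcases U.em (fun i => b i = true) with hb | hb
    · exact ⟨true, hb⟩
    · exact ⟨false, hb.mono fun i hi => by simpa using hi⟩
  obtain ⟨z0, hz0, tz⟩ := exists_tendsto_of_compact isCompact_Icc U (hbz'.mono fun i h => h.1)
  have hu := hG b0 D hD hc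
  obtain ⟨t0, ht0, huniq⟩ := hu z0 hz0
  have hlim := h.limClosed_returnSet hZ hHU b0
  obtain ⟨ε, hε, hmer⟩ := h.eventually_crossing_eq hHU b0 hDi tD ht0.1 ht0.2.1 (hDZ _ ht0.1)
  have hex := h.eventually_exists_crossing hHU b0 hDi hci hZi tD (hbz'.mono fun i h => h.1) tz
    ⟨ht0.1, ⟨ht0.2.1, hDZ _ ht0.1⟩, ht0.2.2⟩ hD one_pos
  have hnear : ∀ᶠ i in (U : Filter ι), ∀ t, Crossing (Hi i)
      (returnSet lo hi (N b0) Z (Hi i)) (Di i) (z i) t → |t - t0| < ε := by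
    refine eventually_forall_of_ultrafilter fun V hV t ht => ?_
    simp only [Classical.not_imp, not_lt] at ht
    obtain ⟨t1, ht1, tt⟩ := exists_tendsto_of_compact isCompact_Icc V (ht.mono fun i h => h.1.1)
    have k1 := tendsto_graph ((hDi.filter_mono hV).mono fun i h z hz z' hz' =>
      h.norm_sub_le hz hz') (fun z hz => (tD z hz).mono_left hV) (ht.mono fun i h => h.1.1) ht1 tt
    obtain ⟨k2, k3⟩ := hlim V hV _ (ht.mono fun i h => h.1.2.1) _ k1
    have k4 : G (D t1) 2 = z0 := tendsto_nhds_unique (((continuous_coord 2).tendsto _).comp k3)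
      ((tz.mono_left hV).congr' (ht.mono fun i h => h.1.2.2.symm))
    have k5 := huniq t1 ⟨ht1, k2.1, k4⟩
    have k6 : Tendsto (fun i => |t i - t0|) V (𝓝 0) := by
      rw [k5] at tt
      have := (tt.sub_const t0).abs
      simpa using this
    obtain ⟨i, h1, h2⟩ := ((k6.eventually (gt_mem_nhds hε)).and ht).exists
    exact absurd h1 (not_lt.2 h2.2)
  obtain ⟨i, h1, h2, h3, h4, h5⟩ := (hbz'.and (hb0.and (hex.and (hmer.and hnear)))).exists
  refine h1.2 ?_
  rw [h2]
  obtain ⟨t, -, ht⟩ := h3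
  exact ⟨t, ht, fun t' ht' => h4 t' ht'.1 t ht.1 (h5 t' ht') (h5 t ht) (ht'.2.2.trans ht.2.2.symm)⟩

end ReturnData

/-- The pieces of the domain of a horseshoe for a map close to `G`. -/
def pieces (lo hi : Fin 3 → ℝ) (N : Bool → Set E3) (G : E3 → E3) (b : Bool) : Set E3 :=
  returnSet lo hi (N b) univ G

end

local notation "Ret" => returnSet lo hi
local notation "Pieces" => pieces lo hi

section

namespace ReturnData

variable (h : ReturnData lo hi a d c G X N)

section

variable {Z : Set E3} (hZ : IsClosed Z) (hH : ∀ b, ∀ p ∈ N b, p ∈ Z → C1At l Hi G p)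

include h hZ hH

lemma eventually_coneRel_fderiv : ∀ᶠ i in l, ∀ b, ∀ p ∈ Ret (N b) Z (Hi i),
    DifferentiableAt ℝ (Hi i) p ∧ ∀ v, ConeRel a d c v (fderiv ℝ (Hi i) p v) := by
  refine eventually_all.2 fun b => ?_
  obtain ⟨δ, hδ, H⟩ := eventually_near_compact ((h.compact b).inter_right hZ) (l := l)
    (P := fun i y _ => DifferentiableAt ℝ (Hi i) y ∧
      ∀ v, ConeRel a d c v (fderiv ℝ (Hi i) y v)) fun x hx => by
      have T : Tendsto (fun p : ι × E3 × E3 => (p.1, p.2.1)) (l ×ˢ (𝓝 x ×ˢ 𝓝 x)) (l ×ˢ 𝓝 x) :=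
        tendsto_fst.prodMk (tendsto_fst.comp tendsto_snd)
      obtain ⟨η, hη, hc⟩ := h.cone b x hx.1
      have hx' := hH b x (h.subset_nbhd b hx.1) hx.2
      refine T.eventually (p := fun p => DifferentiableAt ℝ (Hi p.1) p.2 ∧
        ∀ v, ConeRel a d c v (fderiv ℝ (Hi p.1) p.2 v)) ?_
      filter_upwards [hx'.diff, hx'.deriv.eventually (Metric.ball_mem_nhds _ hη)] with p h1 h2
      refine ⟨h1, fun v => hc v _ ?_⟩
      rw [← ContinuousLinearMap.sub_apply]
      refine (ContinuousLinearMap.le_opNorm _ _).trans ?_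
      rw [dist_eq_norm] at h2
      gcongr
  have hO : IsOpen (Metric.thickening δ (X b ∩ Z) ×ˢ (univ : Set E3)) :=
    Metric.isOpen_thickening.prod isOpen_univ
  filter_upwards [H, h.eventually_returnSet hZ hH b hO fun p hp hpZ =>
    ⟨Metric.self_subset_thickening hδ _ ⟨hp, hpZ⟩, trivial⟩] with i h1 h2 p hp
  obtain ⟨x, hx, hpx⟩ := Metric.mem_thickening_iff.1 (h2 p hp).1
  exact h1 x hx p p hpx hpx

end

variable {Gi : ι → E3 → E3} (hH : ∀ b, ∀ p ∈ N b, C1At l Gi G p)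
  (hinj : ∀ᶠ i in l, InjOn (Gi i) (N false ∪ N true))

include h

include hH

lemma limClosed_pieces (b : Bool) : LimClosed l Gi (fun i => Pieces N (Gi i) b) G (X b) := by
  have := h.limClosed_returnSet isClosed_univ (fun b p hp _ => hH b p hp) b
  rwa [inter_univ] at this

lemma eventually_pieces (b : Bool) {O : Set (E3 × E3)} (hO : IsOpen O)
    (hXO : ∀ p ∈ X b, (p, G p) ∈ O) :
    ∀ᶠ i in l, ∀ p ∈ Pieces N (Gi i) b, (p, Gi i p) ∈ O :=
  h.eventually_returnSet isClosed_univ (fun b p hp _ => hH b p hp) b hO fun p hp _ => hXO p hp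

include hinj

lemma eventually_preHorseshoe (hG : PreHorseshoe lo hi a d G X) :
    ∀ᶠ i in l, PreHorseshoe lo hi a d (Gi i) (Pieces N (Gi i)) := by
  have hH' : ∀ b, ∀ p ∈ N b, p ∈ univ → C1At l Gi G p := fun b p hp _ => hH b p hp
  have hO : IsOpen {p : E3 × E3 | p.2 0 ∈ Ioo (lo 0) (hi 0)} :=
    isOpen_Ioo.preimage ((continuous_coord 0).comp continuous_snd)
  obtain ⟨δ, hδ, hch⟩ := h.exists_coneRel isClosed_univ hH'
  filter_upwards [hinj, eventually_continuousOn hH' h.compact_nbhd isClosed_univ, hch,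
    h.eventually_uniqueCross isClosed_univ hH' hG.cross,
    h.eventually_pieces hH false hO (h.stable false),
    h.eventually_pieces hH true hO (h.stable true)] with i hinj hcont hch hcr hs hs'
  have hN : ∀ b, Pieces N (Gi i) b ⊆ N b := fun b p hp => hp.2.1
  exact {
    lo_lt_hi := h.lo_lt_hi
    d_pos := h.d_pos
    d_le := h.d_le
    a_lt_one := h.a_lt_one
    compact := fun b => isCompact_returnSet (h.compact_nbhd b).isClosed isClosed_univ (hcont b)
    subset := fun b p hp => hp.1
    disjoint := h.disjoint_nbhd.mono (hN false) (hN true)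
    cont := fun b => (hcont b).mono fun p hp => ⟨hN b hp, trivial⟩
    inj := hinj.mono (union_subset_union (hN false) (hN true))
    stable := fun b => by cases b; exacts [hs, hs']
    strip := fun b p hp => hp.2.2.2
    cross := fun b D hD hc => hcr D hD hc (fun _ _ => trivial) b
    chords := ⟨c, δ, h.one_lt_c, hδ, fun b p hp q hq hpq => by
      have := hch b p hp q (by rwa [dist_comm])
      exact ⟨this.unstable, fun hv => (this.strong hv).1, fun hv => (this.stable hv).1⟩⟩ }

lemma eventually_orientedHorseshoe (hG : OrientedHorseshoe lo hi a d G X) :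
    ∀ᶠ i in l, OrientedHorseshoe lo hi a d (Gi i) (Pieces N (Gi i)) := by
  have c1 : Continuous fun p : E3 × E3 => p.1 1 := (continuous_coord 1).comp continuous_fst
  have c2 : Continuous fun p : E3 × E3 => p.2 1 := (continuous_coord 1).comp continuous_snd
  have hO : IsOpen ({p : E3 × E3 | p.1 1 < hi 1} ∪ {p | hi 1 < p.2 1}) :=
    (isOpen_lt c1 continuous_const).union (isOpen_lt continuous_const c2)
  have hO' : IsOpen ({p : E3 × E3 | lo 1 < p.1 1} ∪ {p | p.2 1 < lo 1}) :=
    (isOpen_lt continuous_const c1).union (isOpen_lt c2 continuous_const)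
  have k1 : ∀ b, ∀ p ∈ X b, (p, G p) ∈ {p : E3 × E3 | p.1 1 < hi 1} ∪ {p | hi 1 < p.2 1} := by
    intro b p hp
    rcases (h.subset b hp 1).2.eq_or_lt with e | e
    · exact Or.inr (hG.above b p hp e)
    · exact Or.inl e
  have k2 : ∀ b, ∀ p ∈ X b, (p, G p) ∈ {p : E3 × E3 | lo 1 < p.1 1} ∪ {p | p.2 1 < lo 1} := by
    intro b p hp
    rcases (h.subset b hp 1).1.eq_or_lt with e | e
    · exact Or.inr (hG.below b p hp e.symm)
    · exact Or.inl e
  filter_upwards [h.eventually_preHorseshoe hH hinj hG.toPreHorseshoe,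
    eventually_all.2 fun b => h.eventually_pieces hH b hO (k1 b),
    eventually_all.2 fun b => h.eventually_pieces hH b hO' (k2 b)] with i hP a1 a2
  have ha : ∀ b, ∀ p ∈ Pieces N (Gi i) b, p 1 = hi 1 → hi 1 < Gi i p 1 := fun b p hp e =>
    (a1 b p hp).resolve_left (by simp [e])
  have hb : ∀ b, ∀ p ∈ Pieces N (Gi i) b, p 1 = lo 1 → Gi i p 1 < lo 1 := fun b p hp e =>
    (a2 b p hp).resolve_left (by simp [e])
  exact {
    toPreHorseshoe := hP, full := fun b => hP.full_of_faces b (Or.inl ⟨rfl, rfl⟩) (hb b) (ha b)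
    center := fun b => hP.center_of_faces b (fun p hp e hm => absurd hm.1 (hb b p hp e).not_ge)
      fun p hp e hm => absurd hm.2 (ha b p hp e).not_ge
    above := ha
    below := hb }

omit hinj in
lemma tendsto_itin (hG : Horseshoe lo hi a d G X)
    (hGi : ∀ᶠ i in l, Horseshoe lo hi a d (Gi i) (Pieces N (Gi i))) (w : ℕ → Bool)
    (hs : s ∈ I0) :
    Tendsto (fun i => itin (Gi i) (Pieces N (Gi i)) w s) l (𝓝 (itin G X w s)) := by
  rw [tendsto_iff_ultrafilter]
  intro U hU
  have hU' := hGi.filter_mono hU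
  set p : ι → E3 := fun i => itin (Gi i) (Pieces N (Gi i)) w s with hp
  have hsp : ∀ᶠ i in (U : Filter ι), p i 0 = s ∧ ∀ k, (Gi i)^[k] (p i) ∈ Pieces N (Gi i) (w k) :=
    hU'.mono fun i h => h.itin_spec w hs
  obtain ⟨q, -, hq⟩ := exists_tendsto_of_compact (isCompact_cbox lo hi) U (p := p)
    (hsp.mono fun i h => (h.2 0).1)
  have hlim := fun b => h.limClosed_pieces hH b
  have tk : ∀ k, Tendsto (fun i => (Gi i)^[k] (p i)) U (𝓝 (G^[k] q)) := by
    intro k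
    induction k with
    | zero => exact hq
    | succ k ih =>
      simp only [Function.iterate_succ_apply']
      exact (hlim (w k) U hU _ (hsp.mono fun i h => h.2 k) _ ih).2
  have hqX : ∀ k, G^[k] q ∈ X (w k) := fun k =>
    (hlim (w k) U hU _ (hsp.mono fun i h => h.2 k) _ (tk k)).1
  have q0 : q 0 = s := tendsto_nhds_unique (((continuous_coord 0).tendsto _).comp hq)
    (tendsto_const_nhds.congr' (hsp.mono fun i h => h.1.symm))
  rw [← q0, hG.itin_eq hqX]
  exact hq

omit hinj in
lemma tendsto_beyond_pieces (hG : Horseshoe lo hi a d G X)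
    (hGi : ∀ᶠ i in l, Horseshoe lo hi a d (Gi i) (Pieces N (Gi i)))
    (hDi : ∀ᶠ i in l, UGraph a (Di i)) (hD : UGraph a D)
    (tD : ∀ z ∈ I2, Tendsto (fun i => Di i z) l (𝓝 (D z))) (x : Bool)
    (w : ℕ → Bool) :
    Tendsto (fun i => Beyond (Gi i) (Pieces N (Gi i)) x w (Di i)) l (𝓝 (Beyond G X x w D)) :=
  (tendsto_gap hDi (hGi.mono fun _ h => h.isSGraph_itin w) hD (hG.isSGraph_itin w)
    hG.mul_lt_one hG.a_pos.le (hG.lo_lt_hi 0).le tD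
    fun _ hs => h.tendsto_itin hH hG hGi w hs).1.const_mul _

lemma eventually_blender (hG : Blender lo hi a d G X) :
    ∀ᶠ i in l, Blender lo hi a d (Gi i) (Pieces N (Gi i)) := by
  have ho := h.eventually_orientedHorseshoe hH hinj hG.toOrientedHorseshoe
  have hh := ho.mono fun i h => h.toHorseshoe
  have lim : ∀ (U : Ultrafilter ι) (D : ι → ℝ → E3), ↑U ≤ l →
      (∀ᶠ i in (U : Filter ι), UGraph d (D i) ∧ Central (D i)) →
      ∃ D', UGraph d D' ∧ Central D' ∧ (∀ z : ι → ℝ, (∀ᶠ i in (U : Filter ι), z i ∈ I2) → ∀ m,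
          (∀ᶠ i in (U : Filter ι), D i (z i) 1 = m) → ∃ z' ∈ I2, D' z' 1 = m) ∧
        ∀ x w, Tendsto (fun i => Beyond (Gi i) (Pieces N (Gi i)) x w (D i)) U
          (𝓝 (Beyond G X x w D')) := by
    intro U D hU hD
    obtain ⟨D', h1, h2, h3⟩ := exists_limit_graph U (hD.mono fun i h => h.1)
      (hD.mono fun i h => h.2)
    refine ⟨D', h1, h2, fun z hz m hm => ?_, fun x w =>
      h.tendsto_beyond_pieces (fun b p hp => (hH b p hp).mono hU) hG.toHorseshoe
        (hh.filter_mono hU) (hD.mono fun i h' => h'.1.mono h.d_le) (h1.mono h.d_le) h3 x w⟩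
    obtain ⟨z', hz', tz⟩ := exists_tendsto_of_compact isCompact_Icc U hz
    have := tendsto_graph (hD.mono fun i h z hz z' hz' => h.1.norm_sub_le hz hz') h3 hz hz' tz
    exact ⟨z', hz', tendsto_nhds_unique (((continuous_coord 1).tendsto _).comp this)
      (tendsto_const_nhds.congr' (hm.mono fun i h => h.symm))⟩
  have t1 : ∀ᶠ i in l, ∀ D : ℝ → E3, UGraph d D → Central D → ∀ z ∈ I2, D z 1 = hi 1 →
      0 < Beyond (Gi i) (Pieces N (Gi i)) true (fun _ => true) D := by
    refine eventually_forall_of_ultrafilter fun U hU D hcon => ?_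
    simp only [Classical.not_imp, not_forall, exists_prop, not_lt] at hcon
    obtain ⟨D', h1, h2, h3, h4⟩ := lim U D hU (hcon.mono fun i h => ⟨h.1, h.2.1⟩)
    have : ∀ i, ∃ z, (∃ z, z ∈ I2 ∧ D i z 1 = hi 1) → z ∈ I2 ∧ D i z 1 = hi 1 := fun i => by
      by_cases hx : ∃ z, z ∈ I2 ∧ D i z 1 = hi 1
      · exact ⟨hx.choose, fun _ => hx.choose_spec⟩
      · exact ⟨0, fun h => absurd h hx⟩
    choose z hz using this
    have hz' : ∀ᶠ i in (U : Filter ι), z i ∈ I2 ∧ D i (z i) 1 = hi 1 :=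
      hcon.mono fun i h => hz i (h.2.2.imp fun z hz => ⟨hz.1, hz.2.1⟩)
    obtain ⟨z', k1, k2⟩ := h3 z (hz'.mono fun i h => h.1) _ (hz'.mono fun i h => h.2)
    have k3 := le_of_tendsto (h4 true fun _ => true) (hcon.mono fun i h => h.2.2.choose_spec.2.2)
    exact absurd (hG.touch_hi D' h1 h2 z' k1 k2) (not_lt.2 k3)
  have t2 : ∀ᶠ i in l, ∀ D : ℝ → E3, UGraph d D → Central D → ∀ z ∈ I2, D z 1 = lo 1 →
      0 < Beyond (Gi i) (Pieces N (Gi i)) false (fun _ => false) D := by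
    refine eventually_forall_of_ultrafilter fun U hU D hcon => ?_
    simp only [Classical.not_imp, not_forall, exists_prop, not_lt] at hcon
    obtain ⟨D', h1, h2, h3, h4⟩ := lim U D hU (hcon.mono fun i h => ⟨h.1, h.2.1⟩)
    have : ∀ i, ∃ z, (∃ z, z ∈ I2 ∧ D i z 1 = lo 1) → z ∈ I2 ∧ D i z 1 = lo 1 := fun i => by
      by_cases hx : ∃ z, z ∈ I2 ∧ D i z 1 = lo 1
      · exact ⟨hx.choose, fun _ => hx.choose_spec⟩
      · exact ⟨0, fun h => absurd h hx⟩
    choose z hz using this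
    have hz' : ∀ᶠ i in (U : Filter ι), z i ∈ I2 ∧ D i (z i) 1 = lo 1 :=
      hcon.mono fun i h => hz i (h.2.2.imp fun z hz => ⟨hz.1, hz.2.1⟩)
    obtain ⟨z', k1, k2⟩ := h3 z (hz'.mono fun i h => h.1) _ (hz'.mono fun i h => h.2)
    have k3 := le_of_tendsto (h4 false fun _ => false) (hcon.mono fun i h => h.2.2.choose_spec.2.2)
    exact absurd (hG.touch_lo D' h1 h2 z' k1 k2) (not_lt.2 k3)
  have t3 : ∀ x, ∀ᶠ i in l, ∀ D : ℝ → E3, UGraph d D → Central D →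
      0 ≤ Beyond (Gi i) (Pieces N (Gi i)) x (fun _ => x) D →
      0 < Beyond (Gi i) (Pieces N (Gi i)) x (consSeq (!x) fun _ => x) D := by
    intro x
    refine eventually_forall_of_ultrafilter fun U hU D hcon => ?_
    simp only [Classical.not_imp, not_lt] at hcon
    obtain ⟨D', h1, h2, h3, h4⟩ := lim U D hU (hcon.mono fun i h => ⟨h.1, h.2.1⟩)
    exact absurd (hG.leave x D' h1 h2 (ge_of_tendsto (h4 x fun _ => x)
      (hcon.mono fun i h => h.2.2.1))) (not_lt.2 (le_of_tendsto (h4 x _)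
      (hcon.mono fun i h => h.2.2.2)))
  have t4 : ∀ᶠ i in l, ∀ D : ℝ → E3, UGraph d D → Central D →
      (∀ x, Beyond (Gi i) (Pieces N (Gi i)) x (fun _ => x) D ≤ 0) →
      ∃ x, Beyond (Gi i) (Pieces N (Gi i)) x (consSeq (!x) fun _ => x) D < 0 := by
    refine eventually_forall_of_ultrafilter fun U hU D hcon => ?_
    simp only [Classical.not_imp, not_exists, not_lt] at hcon
    obtain ⟨D', h1, h2, h3, h4⟩ := lim U D hU (hcon.mono fun i h => ⟨h.1, h.2.1⟩)
    obtain ⟨x, hx⟩ := hG.superpose D' h1 h2 fun x =>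
      le_of_tendsto (h4 x fun _ => x) (hcon.mono fun i h => h.2.2.1 x)
    exact absurd hx (not_lt.2 (ge_of_tendsto (h4 x _) (hcon.mono fun i h => h.2.2.2 x)))
  filter_upwards [ho, t1, t2, t3 true, t3 false, t4] with i ho t1 t2 t3 t3' t4
  exact {
    toOrientedHorseshoe := ho
    touch_hi := t1
    touch_lo := t2
    leave := fun x => by cases x; exacts [t3', t3]
    superpose := t4 }

end ReturnData

/-! ### The first image of a tube -/

/-- Two families of images of a periodic family of graphs give a tube or a fold. -/
lemma isTubeFamily_or_isFoldFamily (h : Horseshoe lo hi a d G X) {v : Bool → ℝ → ℝ → E3}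
    {R : ℝ → E3 → Prop} (hg : ∀ b t, UGraph d (v b t))
    (hcont : ∀ b, ∀ z ∈ I2, Continuous fun t => v b t z)
    (hper : ∀ b, Function.Periodic (v b) 1)
    (hR : ∀ b t, ∀ z ∈ I2, R t (v b t z))
    (h1 : ∀ x t, Beyond G X x (fun _ => x) (v x t) ≤ 0)
    (h2 : ∀ t, ∃ x, Beyond G X x (fun _ => x) (v (!x) t) < 0) :
    IsTubeFamily lo hi d G X R ∨ IsFoldFamily lo hi d G X R := by
  by_cases hA : ∃ x, ∀ t, Beyond G X x (fun _ => x) (v (!x) t) ≤ 0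
  · obtain ⟨x, hx⟩ := hA
    refine Or.inl ⟨v (!x), ⟨fun t _ => hg _ t, fun t _ y => ?_,
      fun z hz => (hcont _ z hz).continuousOn⟩, hper _, hR _⟩
    by_cases hy : y = x
    · rw [hy]; exact hx t
    · rw [show y = !x by cases x <;> cases y <;> simp_all]
      exact h1 _ t
  · push Not at hA
    obtain ⟨t0, ht0⟩ := hA true
    obtain ⟨t, ht⟩ := hA false
    obtain ⟨x, hx⟩ := h2 t
    have hxt : x = true := by
      cases x
      · exact absurd hx ht.le.not_gt
      · rfl
    rw [hxt] at hx
    have e : v false (t - ⌊t - t0⌋) = v false t := by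
      have := (hper false).sub_zsmul_eq ⌊t - t0⌋ (x := t)
      simpa using this
    have hc : ContinuousOn (fun t => Beyond G X true (fun _ => true) (v false t))
        (Icc t0 (t0 + 1)) := fun t _ =>
      (h.weaken.tendsto_beyond (.of_forall fun t => hg false t) (hg false t)
        (fun z hz => (hcont false z hz).tendsto t) true _).mono_left nhdsWithin_le_nhds
    obtain ⟨a', b', k1, k2, k3, k4, k5, k6⟩ := exists_zero_both (t := t - ⌊t - t0⌋)
      ⟨by linarith [Int.floor_le (t - t0)], by linarith [Int.lt_floor_add_one (t - t0)]⟩ hc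
      (by rw [e]; exact hx) ht0 (by rw [hper false t0]; exact ht0)
    refine Or.inr ⟨v false, a', b', true, k2, by linarith, ⟨fun t _ => hg _ t, fun t ht y => ?_,
      fun z hz => (hcont _ z hz).continuousOn⟩, fun t _ => hR _ t, k4, k5⟩
    cases y
    · exact h1 _ t
    · exact k6 t ht

/-- For the maps `Hi i` and `Gi i` close to `G`, the images under `Hi i` of a tube of unstable
graphs in-between contain a tube or a fold for `Gi i`. -/
lemma ReturnData.eventually_family (h : ReturnData lo hi a d c G X N) {Gi : ι → E3 → E3}
    {Z : Set E3} (hZ : IsClosed Z) (hGi : ∀ b, ∀ p ∈ N b, C1At l Gi G p)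
    (hHi : ∀ b, ∀ p ∈ N b, p ∈ Z → C1At l Hi G p) (hG : OrientedHorseshoe lo hi a d G X)
    (hb : ∀ᶠ i in l, Horseshoe lo hi a d (Gi i) (Pieces N (Gi i)))
    {u : ℝ → ℝ → E3} (hu : ∀ t, UGraph a (u t)) (hc : ∀ t, Central (u t))
    (huZ : ∀ t, ∀ z ∈ I2, u t z ∈ Z) (hper : Function.Periodic u 1)
    (hcont : ∀ z ∈ I2, Continuous fun t => u t z)
    (h1 : ∀ x t, Beyond G X x (fun _ => x) (u t) < 0)
    (h2 : ∀ t, ∃ x, Beyond G X x (consSeq (!x) fun _ => x) (u t) < 0) :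
    ∀ᶠ i in l, IsTubeFamily lo hi d (Gi i) (Pieces N (Gi i)) (fun t y => ∃ b,
        ∃ z ∈ I2, u t z ∈ Ret (N b) Z (Hi i) ∧ y = Hi i (u t z)) ∨
      IsFoldFamily lo hi d (Gi i) (Pieces N (Gi i)) (fun t y => ∃ b,
        ∃ z ∈ I2, u t z ∈ Ret (N b) Z (Hi i) ∧ y = Hi i (u t z)) := by
  set v : ι → Bool → ℝ → ℝ → E3 := fun i b t => ImageG (Hi i) (Ret (N b) Z (Hi i)) (u t) with hv
  have hO : IsOpen {p : E3 × E3 | p.2 0 ∈ Ioo (lo 0) (hi 0)} :=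
    isOpen_Ioo.preimage ((continuous_coord 0).comp continuous_snd)
  obtain ⟨δ, hδ, hch⟩ := h.exists_coneRel hZ hHi
  have hcn := eventually_continuousOn hHi h.compact_nbhd hZ
  have hcr := h.eventually_uniqueCross hZ hHi hG.cross
  have hXcl : ∀ b i, ContinuousOn (Hi i) (N b ∩ Z) → IsClosed (Ret (N b) Z (Hi i)) ∧
      ContinuousOn (Hi i) (Ret (N b) Z (Hi i)) := fun b i hi =>
    ⟨isClosed_returnSet (h.compact_nbhd b).isClosed hZ hi, hi.mono fun p hp => ⟨hp.2.1, hp.2.2.1⟩⟩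
  have hgr : ∀ᶠ i in l, ∀ b t, UGraph d (v i b t) := by
    filter_upwards [hcn, hch, hcr, h.eventually_returnSet hZ hHi false hO
      (fun p hp _ => h.stable false p hp), h.eventually_returnSet hZ hHi true hO
      (fun p hp _ => h.stable true p hp)] with i h1 h2 h3 h4 h5 b t
    refine (hu t).image (hXcl b i (h1 b)).1 (hXcl b i (h1 b)).2 (h3 _ (hu t) (hc t) (huZ t) b)
      (fun p hp => Ioo_subset_Icc_self (by cases b; exacts [h4 p hp, h5 p hp])) hδ
      fun p hp q hq hpq hv => ((h2 b p hp q (by rwa [dist_comm])).strong hv).1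
  have hfr : ∀ (t : ℝ) i b, v i b (Int.fract t) = v i b t := fun t i b => by
    have : u (Int.fract t) = u t := by
      have := hper.sub_zsmul_eq ⌊t⌋ (x := t)
      rw [zsmul_eq_mul, mul_one] at this
      exact this
    rw [hv]
    simp only
    rw [this]
  have lim : ∀ (U : Ultrafilter ι) (t : ι → ℝ), ↑U ≤ l → ∃ t0, ∀ x b,
      Tendsto (fun i => Beyond (Gi i) (Pieces N (Gi i)) x (fun _ => x) (v i b (t i))) U
        (𝓝 (Beyond G X x (fun _ => x) (ImageG G (X b) (u t0)))) := by
    intro U t hU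
    obtain ⟨t0, -, ht0⟩ := exists_tendsto_of_compact (isCompact_Icc (a := (0 : ℝ)) (b := 1)) U
      (p := fun i => Int.fract (t i))
      (.of_forall fun i => ⟨Int.fract_nonneg _, (Int.fract_lt_one _).le⟩)
    refine ⟨t0, fun x b => ?_⟩
    have hcr0 : UniqueCross lo hi G (X b ∩ Z) (u t0) := fun z hz => by
      obtain ⟨t, ⟨m1, m2, m3⟩, m4⟩ := hG.cross b _ (hu t0) (hc t0) z hz
      exact ⟨t, ⟨m1, ⟨m2, huZ _ _ m1⟩, m3⟩, fun s hs => m4 s ⟨hs.1, hs.2.1.1, hs.2.2⟩⟩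
    have himg : ∀ z ∈ I2, ImageG G (X b ∩ Z) (u t0) z = ImageG G (X b) (u t0) z := fun z hz => by
      have k1 := hcr0.spec hz
      rw [imageGraph, imageGraph, (hG.cross b _ (hu t0) (hc t0)).eq hz ⟨k1.1, k1.2.1.1, k1.2.2⟩]
    have tv : ∀ z ∈ I2, Tendsto (fun i => v i b (Int.fract (t i)) z) U
        (𝓝 (ImageG G (X b) (u t0) z)) := fun z hz => by
      rw [← himg z hz]
      exact (tendsto_imageGraph
        (h.limClosed_returnSet hZ (fun b p hp hpZ => (hHi b p hp hpZ).mono hU) b)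
        (.of_forall fun i => hu _) (fun z hz => ((hcont z hz).tendsto t0).comp ht0)
        ((hcr.filter_mono hU).mono fun i hi => hi _ (hu _) (hc _) (huZ _) b) hcr0
        (z := fun _ => z) (.of_forall fun _ => hz) hz tendsto_const_nhds).1
    have := h.tendsto_beyond_pieces (fun b p hp => (hGi b p hp).mono hU) hG.toHorseshoe
      (hb.filter_mono hU) ((hgr.filter_mono hU).mono fun i hi => (hi b (Int.fract (t i))).mono h.d_le)
      ((hG.isUGraph_image b (hu t0) (hc t0)).mono h.d_le) tv x (fun _ => x)
    simpa only [hfr] using this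
  have hneg : ∀ x b t, Beyond G X x (consSeq b fun _ => x) (u t) < 0 ↔
      Beyond G X x (fun _ => x) (ImageG G (X b) (u t)) < 0 := fun x b t => by
    rw [← sign_eq_neg_one_iff, ← sign_eq_neg_one_iff, hG.sign_beyond_image x b _ (hu t) (hc t)]
  have e1 : ∀ x, ∀ᶠ i in l, ∀ t, Beyond (Gi i) (Pieces N (Gi i)) x (fun _ => x)
      (v i x t) < 0 := fun x => by
    refine eventually_forall_of_ultrafilter fun U hU t hcon => ?_
    obtain ⟨t0, ht0⟩ := lim U t hU
    have k1 := ge_of_tendsto (ht0 x x) (hcon.mono fun i h => not_lt.1 h)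
    have k2 := h1 x t0
    rw [← consSeq_const x, hneg] at k2
    linarith
  have e2 : ∀ᶠ i in l, ∀ t, ∃ x, Beyond (Gi i) (Pieces N (Gi i)) x (fun _ => x)
      (v i (!x) t) < 0 := by
    refine eventually_forall_of_ultrafilter fun U hU t hcon => ?_
    simp only [not_exists, not_lt] at hcon
    obtain ⟨t0, ht0⟩ := lim U t hU
    obtain ⟨x, hx⟩ := h2 t0
    rw [hneg] at hx
    have k1 := ge_of_tendsto (ht0 x (!x)) (hcon.mono fun i h => h x)
    linarith
  filter_upwards [hb, hgr, hcn, hcr, e1 false, e1 true, e2] with i hb hgr hcn hcr e1 e1' e2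
  refine isTubeFamily_or_isFoldFamily hb (v := v i) hgr (fun b z hz => ?_) (fun b t => ?_)
    (fun b t z hz => ?_) (fun x t => by cases x; exacts [(e1 t).le, (e1' t).le]) e2
  · rw [continuous_iff_continuousAt]
    intro t
    exact (tendsto_imageGraph (LimClosed.const (hXcl b i (hcn b)).1 (hXcl b i (hcn b)).2)
      (.of_forall fun t => hu t) (fun z hz => (hcont z hz).tendsto t)
      (.of_forall fun t => hcr _ (hu t) (hc t) (huZ t) b)
      (hcr _ (hu t) (hc t) (huZ t) b) (z := fun _ => z) (.of_forall fun _ => hz) hz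
      tendsto_const_nhds).1
  · simp only [hv]; rw [hper t]
  · obtain ⟨k1, k2, -⟩ := (hcr _ (hu t) (hc t) (huZ t) b).spec hz
    exact ⟨b, _, k1, k2, rfl⟩

end

section

namespace ReturnData

variable (h : ReturnData lo hi a d c G X N)

include h

/-! ### Crossings of the pieces of a connected domain -/

lemma exists_crossing_limit (b : Bool) (hDi : ∀ᶠ i in l, UGraph a (Di i))
    (tD : ∀ z ∈ I2, Tendsto (fun i => Di i z) l (𝓝 (D z)))
    {z : ι → ℝ} {z0 : ℝ} (tz : Tendsto z l (𝓝 z0)) (U : Ultrafilter ι) (hU : ↑U ≤ l)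
    {t : ι → ℝ} (ht : ∀ᶠ i in (U : Filter ι), Crossing G (X b) (Di i) (z i) (t i)) :
    ∃ t0, Crossing G (X b) D z0 t0 ∧ Tendsto t U (𝓝 t0) := by
  obtain ⟨t0, ht0, tt⟩ := exists_tendsto_of_compact isCompact_Icc U (ht.mono fun i h => h.1)
  have k1 := tendsto_graph ((hDi.filter_mono hU).mono fun i h z hz z' hz' =>
    h.norm_sub_le hz hz') (fun z hz => (tD z hz).mono_left hU) (ht.mono fun i h => h.1) ht0 tt
  have hlim : LimClosed l (fun _ => G) (fun _ => X b) G (X b) := LimClosed.const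
    (h.compact b).isClosed fun p hp => (h.smooth b p (h.subset_nbhd b hp)).continuousAt.continuousWithinAt
  obtain ⟨k2, k3⟩ := hlim U hU _ (ht.mono fun i h => h.2.1) _ k1
  exact ⟨t0, ⟨ht0, k2, tendsto_nhds_unique (((continuous_coord 2).tendsto _).comp k3)
    ((tz.mono_left hU).congr' (ht.mono fun i h => h.2.2.symm))⟩, tt⟩

/-- A family of unstable graphs, with a height for each of them. -/
structure _root_.BlenderTube.IsHeightFamily (lo hi : Fin 3 → ℝ) (a : ℝ) {T : Type*}
    [TopologicalSpace T] (K : Set T) (D : T → ℝ → E3) (z : T → ℝ) : Prop where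
  graph : ∀ i ∈ K, IsUGraph lo hi a (D i)
  center : ∀ i ∈ K, CenterIn lo hi (D i)
  cont : ∀ t ∈ Icc (lo 2) (hi 2), ContinuousOn (fun i => D i t) K
  mem : ∀ i ∈ K, z i ∈ Icc (lo 2) (hi 2)
  cont_height : ContinuousOn z K

variable {T : Type*} [TopologicalSpace T] {K : Set T} {D : T → ℝ → E3} {z : T → ℝ}

lemma eventually_exists_near (b : Bool) (hD : IsHeightFamily lo hi a K D z) {i0 : T}
    (hi0 : i0 ∈ K) {t0 : ℝ} (ht0 : Crossing G (X b) (D i0) (z i0) t0) {ε : ℝ}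
    (hε : 0 < ε) :
    ∀ᶠ i in 𝓝[K] i0, ∃ t, |t - t0| < ε ∧ Crossing G (X b) (D i) (z i) t := by
  have := h.eventually_exists_crossing (l := 𝓝[K] i0) (Hi := fun _ => G) (Z := univ)
    (fun b p hp _ => C1At.const (h.smooth b p hp)) b
    (eventually_mem_nhdsWithin.mono hD.graph) (eventually_mem_nhdsWithin.mono hD.center)
    (.of_forall fun _ _ _ => trivial) (fun t ht => hD.cont t ht i0 hi0)
    (eventually_mem_nhdsWithin.mono hD.mem) (hD.cont_height i0 hi0)
    ⟨ht0.1, ⟨ht0.2.1, trivial⟩, ht0.2.2⟩ (hD.graph i0 hi0) hε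
  rwa [← h.eq_returnSet b] at this

lemma eventually_crossing_unique (b : Bool) (hD : IsHeightFamily lo hi a K D z) {i0 : T}
    (hi0 : i0 ∈ K) {t0 : ℝ} (ht0 : Crossing G (X b) (D i0) (z i0) t0) :
    ∃ ε > 0, ∀ᶠ i in 𝓝[K] i0, ∀ t t', |t - t0| < ε → |t' - t0| < ε →
      Crossing G (X b) (D i) (z i) t → Crossing G (X b) (D i) (z i) t' →
      t = t' := by
  obtain ⟨ε, hε, H⟩ := h.eventually_crossing_eq (l := 𝓝[K] i0) (Hi := fun _ => G) (Z := univ)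
    (fun b p hp _ => C1At.const (h.smooth b p hp)) b
    (eventually_mem_nhdsWithin.mono hD.graph) (fun t ht => hD.cont t ht i0 hi0) ht0.1 ht0.2.1
    trivial
  exact ⟨ε, hε, H.mono fun i hi t t' h1 h2 h3 h4 =>
    hi t h3.1 t' h4.1 h1 h2 (h3.2.2.trans h4.2.2.symm)⟩

/-- Pairs of crossings, subject to a closed condition `C` on the lower one that is open among
crossings, exist for all members of a connected family if they exist for one of them. -/
lemma exists_pair (b : Bool) (hD : IsHeightFamily lo hi a K D z) (hK : IsPreconnected K)
    {C : T → ℝ → Prop}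
    (hCl : ∀ i0 ∈ K, ∀ U : Ultrafilter T, ↑U ≤ 𝓝[K] i0 → ∀ t : T → ℝ, ∀ t0, Tendsto t U (𝓝 t0) →
      (∀ᶠ i in (U : Filter T), C i (t i)) → C i0 t0)
    (hCo : ∀ i0 ∈ K, ∀ t0, Crossing G (X b) (D i0) (z i0) t0 → C i0 t0 → ∃ ε > 0,
      ∀ᶠ i in 𝓝[K] i0, ∀ t, |t - t0| < ε → Crossing G (X b) (D i) (z i) t → C i t)
    {i0 : T} (hi0 : i0 ∈ K)
    (h0 : ∃ t t', t < t' ∧ C i0 t ∧ Crossing G (X b) (D i0) (z i0) t ∧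
      Crossing G (X b) (D i0) (z i0) t') :
    ∀ i ∈ K, ∃ t t', t < t' ∧ C i t ∧ Crossing G (X b) (D i) (z i) t ∧
      Crossing G (X b) (D i) (z i) t' := by
  refine forall_of_isPreconnected hK (fun i hiK => ?_) (fun i hiK hn => ?_) hi0 h0
  · rintro ⟨t, t', hlt, hC, ht, ht'⟩
    obtain ⟨ε, hε, hev⟩ := hCo i hiK t ht hC
    filter_upwards [hev,
      h.eventually_exists_near b hD hiK ht (lt_min hε (show 0 < (t' - t) / 2 by linarith)),
      h.eventually_exists_near b hD hiK ht' (show 0 < (t' - t) / 2 by linarith)] with j h1 h2 h3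
    obtain ⟨s, hs, hsc⟩ := h2
    obtain ⟨s', hs', hsc'⟩ := h3
    refine ⟨s, s', ?_, h1 s (hs.trans_le (min_le_left _ _)) hsc, hsc, hsc'⟩
    have k1 := (abs_lt.1 (hs.trans_le (min_le_right _ _))).2
    have k2 := (abs_lt.1 hs').1
    linarith
  · have := eventually_forall_of_ultrafilter (l := 𝓝[K] i) (P := fun i (t : ℝ × ℝ) =>
      ¬ (t.1 < t.2 ∧ C i t.1 ∧ Crossing G (X b) (D i) (z i) t.1 ∧
        Crossing G (X b) (D i) (z i) t.2)) fun U hU t ht => by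
      simp only [not_not] at ht
      have hDi : ∀ᶠ j in 𝓝[K] i, UGraph a (D j) := eventually_mem_nhdsWithin.mono hD.graph
      have tD := fun t ht => hD.cont t ht i hiK
      have tz := hD.cont_height i hiK
      obtain ⟨t1, c1, l1⟩ := h.exists_crossing_limit b hDi tD tz U hU (ht.mono fun i h => h.2.2.1)
      obtain ⟨t2, c2, l2⟩ := h.exists_crossing_limit b hDi tD tz U hU (ht.mono fun i h => h.2.2.2)
      have hle : t1 ≤ t2 := le_of_tendsto_of_tendsto l1 l2 (ht.mono fun i h => h.1.le)
      rcases hle.eq_or_lt with e | e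
      · obtain ⟨ε, hε, H⟩ := h.eventually_crossing_unique b hD hiK c1
        have d1 := l1.eventually (Metric.ball_mem_nhds _ hε)
        rw [← e] at l2
        have d2 := l2.eventually (Metric.ball_mem_nhds _ hε)
        obtain ⟨j, e1, e2, e3, e4⟩ := (ht.and ((H.filter_mono hU).and (d1.and d2))).exists
        exact e1.1.ne (e2 _ _ e3 e4 e1.2.2.1 e1.2.2.2)
      · exact hn ⟨t1, t2, e, hCl i hiK U hU _ _ l1 (ht.mono fun i h => h.2.1), c1, c2⟩
    exact this.mono fun j hj ⟨t, t', hh⟩ => hj (t, t') hh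

lemma exists_crossing (b : Bool) (hD : IsHeightFamily lo hi a K D z) (hK : IsPreconnected K)
    {i0 : T} (hi0 : i0 ∈ K) (h0 : ∃ t, Crossing G (X b) (D i0) (z i0) t) :
    ∀ i ∈ K, ∃ t, Crossing G (X b) (D i) (z i) t := by
  refine forall_of_isPreconnected hK (fun i hiK => ?_) (fun i hiK hn => ?_) hi0 h0
  · rintro ⟨t, ht⟩
    exact (h.eventually_exists_near b hD hiK ht one_pos).mono fun j ⟨t, _, ht⟩ => ⟨t, ht⟩
  · have := eventually_forall_of_ultrafilter (l := 𝓝[K] i) (P := fun i t =>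
      ¬ Crossing G (X b) (D i) (z i) t) fun U hU t ht => by
      simp only [not_not] at ht
      obtain ⟨t1, c1, -⟩ := h.exists_crossing_limit b (show ∀ᶠ j in 𝓝[K] i, UGraph a (D j) from
          eventually_mem_nhdsWithin.mono hD.graph) (fun t ht => hD.cont t ht i hiK)
        (hD.cont_height i hiK) U hU ht
      exact hn ⟨t1, c1⟩
    exact this.mono fun j hj ⟨t, hh⟩ => hj t hh

omit h in
/-- The homotopy from `D0` to `D1` by convex combinations. -/
lemma isHeightFamily_homotopy (ha : 0 ≤ a) {D0 D1 : ℝ → E3} (h0 : UGraph a D0)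
    (h₁ : UGraph a D1) (c0 : Central D0) (c₁ : Central D1) :
    IsHeightFamily lo hi a (Icc (0 : ℝ) 1 ×ˢ I2)
      (fun p t => (1 - p.1) • D0 t + p.1 • D1 t) Prod.snd where
  graph := by
    rintro ⟨m, z⟩ ⟨⟨m0, m1⟩, -⟩
    simp only at m0 m1
    refine ⟨fun t ht => ?_, fun t ht => ?_, fun t ht t' ht' => ?_⟩
    · simp [h0.coord t ht, h₁.coord t ht]
      ring
    · have := convex_Icc (lo 0) (hi 0) (h0.stable t ht) (h₁.stable t ht)
        (show 0 ≤ 1 - m by linarith) m0 (by ring)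
      simpa using this
    · have e : (1 - m) • D0 t + m • D1 t - ((1 - m) • D0 t' + m • D1 t') =
          (1 - m) • (D0 t - D0 t') + m • (D1 t - D1 t') := by module
      have k0 := mem_strongUnstableCone.1 (h0.chord t ht t' ht')
      have k1 := mem_strongUnstableCone.1 (h₁.chord t ht t' ht')
      simp only
      rw [e, mem_strongUnstableCone, map_add, map_smul, map_smul]
      have e2 : ((1 - m) • (D0 t - D0 t') + m • (D1 t - D1 t')) 2 = t - t' := by
        simp [h0.coord t ht, h₁.coord t ht, h0.coord t' ht', h₁.coord t' ht']
        ring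
      rw [PiLp.sub_apply, h0.coord t ht, h0.coord t' ht'] at k0
      rw [PiLp.sub_apply, h₁.coord t ht, h₁.coord t' ht'] at k1
      rw [e2]
      refine (norm_add_le _ _).trans ?_
      rw [norm_smul, norm_smul, Real.norm_of_nonneg m0, Real.norm_of_nonneg (sub_nonneg.2 m1)]
      nlinarith
  center := by
    rintro ⟨m, z⟩ ⟨⟨m0, m1⟩, -⟩ t ht
    have := convex_Icc (lo 1) (hi 1) (c0 t ht) (c₁ t ht)
      (show 0 ≤ 1 - m by simpa using m1) m0 (by ring)
    simpa using this
  cont := fun t _ => by fun_prop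
  mem := fun p hp => hp.2
  cont_height := continuous_snd.continuousOn

/-- If the pieces are connected, each of them is crossed exactly once by every unstable graph at
each height. -/
lemma uniqueCross (hconn : ∀ b, IsConnected (X b)) {D : ℝ → E3} (b : Bool)
    (hD : UGraph a D) (hc : Central D) : UniqueCross lo hi G (X b) D := by
  intro z hz
  have vl : ∀ p ∈ X b, vline (p 0) (p 1) (p 2) = p := fun p _ =>
    ext3 (by simp [vline]) (by simp [vline]) (by simp [vline])
  have hpre : IsPreconnected (Icc (0 : ℝ) 1 ×ˢ I2) := isPreconnected_Icc.prod isPreconnected_Icc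
  obtain ⟨p, hp⟩ := (hconn b).nonempty
  have hpb := h.subset b hp
  have hV := isUGraph_vline (lo := lo) (hi := hi) h.a_pos.le (hpb 0) (p 1)
  have hVc := centerIn_vline (lo := lo) (hi := hi) (p 0) (hpb 1)
  have hself : ∀ p ∈ X b, Crossing G (X b) (vline (p 0) (p 1)) (G p 2) (p 2) :=
    fun p hp => ⟨h.subset b hp 2, by rw [vl p hp]; exact hp, by rw [vl p hp]⟩
  have hfam := isHeightFamily_homotopy h.a_pos.le hV hD hVc hc
  have hex : ∀ m ∈ Icc (0 : ℝ) 1, ∀ z ∈ I2, ∃ t, Crossing G (X b)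
      (fun t => (1 - m) • vline (p 0) (p 1) t + m • D t) z t := fun m hm z hz =>
    h.exists_crossing b hfam hpre (i0 := (0, G p 2)) ⟨by simp, h.strip b p hp⟩
      ⟨p 2, by simpa using hself p hp⟩ (m, z) ⟨hm, hz⟩
  obtain ⟨t, ht⟩ := hex 1 (by simp) z hz
  have ht' : Crossing G (X b) D z t := by simpa using ht
  -- there is no second crossing
  have nopair : ∀ q ∈ X b, ∀ t t', t < t' → t = q 2 →
      ¬ Crossing G (X b) (vline (q 0) (q 1)) (G q 2) t' := by
    by_contra hcon
    push Not at hcon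
    obtain ⟨q, hq, t, t', hlt, hte, hcr⟩ := hcon
    have hF : IsHeightFamily lo hi a (X b) (fun q => vline (q 0) (q 1)) (fun q => G q 2) :=
      ⟨fun q hq => isUGraph_vline h.a_pos.le (h.subset b hq 0) _,
        fun q hq => centerIn_vline _ (h.subset b hq 1),
        fun t _ => by
          have : Continuous fun q : E3 => vline (q 0) (q 1) t := by unfold vline; fun_prop
          exact this.continuousOn,
        h.strip b, (continuous_coord 2).comp_continuousOn fun p hp =>
          (h.smooth b p (h.subset_nbhd b hp)).continuousAt.continuousWithinAt⟩
    have all := h.exists_pair b hF (hconn b).isPreconnected (C := fun q t => t = q 2)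
      (fun i0 _ U hU t t0 tt ht => tendsto_nhds_unique tt
        ((((continuous_coord 2).tendsto i0).mono_left (hU.trans nhdsWithin_le_nhds)).congr'
          (ht.mono fun i h => h.symm)))
      (fun i0 hi0 t0 ht0 he => by
        obtain ⟨ε, hε, H⟩ := h.eventually_crossing_unique b hF hi0 ht0
        have hn : ∀ᶠ i : E3 in 𝓝[X b] i0, |i 2 - t0| < ε := by
          rw [he]
          exact (((continuous_coord 2).tendsto i0).mono_left nhdsWithin_le_nhds).eventually
            (Metric.ball_mem_nhds _ hε)
        refine ⟨ε, hε, ?_⟩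
        filter_upwards [H, hn, self_mem_nhdsWithin] with i h1 h2 h3 t ht htc
        exact h1 t _ ht h2 htc (hself i h3))
      hq ⟨t, t', hlt, hte, by rw [hte]; exact hself q hq, hcr⟩
    obtain ⟨q, hq, hmax⟩ := (h.compact b).exists_isMaxOn (hconn b).nonempty
      (continuous_coord 2).continuousOn
    obtain ⟨t, t', hlt, hte, -, hcr⟩ := all q hq
    have := hmax hcr.2.1
    simp only [vline, mem_ofPred_eq] at this
    simp at this
    linarith
  refine ⟨t, ht', fun t' hcr' => ?_⟩
  by_contra hne
  have hpair : ∀ m ∈ Icc (0 : ℝ) 1, ∃ t t', t < t' ∧ True ∧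
      Crossing G (X b) (fun t => (1 - m) • vline (p 0) (p 1) t + m • D t) z t ∧
      Crossing G (X b) (fun t => (1 - m) • vline (p 0) (p 1) t + m • D t) z t' := by
    intro m hm
    refine h.exists_pair b hfam hpre (C := fun _ _ => True) (fun _ _ _ _ _ _ _ _ => trivial)
      (fun _ _ _ _ _ => ⟨1, one_pos, .of_forall fun _ _ _ _ => trivial⟩)
      (i0 := (1, z)) ⟨by simp, hz⟩ ?_ (m, z) ⟨hm, hz⟩
    rcases lt_or_gt_of_ne hne with hlt | hlt
    · exact ⟨t', t, hlt, trivial, by simpa using hcr', by simpa using ht'⟩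
    · exact ⟨t, t', hlt, trivial, by simpa using ht', by simpa using hcr'⟩
  obtain ⟨s, s', hlt, -, hs, hs'⟩ := hpair 0 (by simp)
  simp only [sub_zero, one_smul, zero_smul, add_zero] at hs hs'
  have hsX := hs.2.1
  refine nopair _ hsX s s' hlt (by simp [vline]) ?_
  have e : vline (vline (p 0) (p 1) s 0) (vline (p 0) (p 1) s 1) = vline (p 0) (p 1) := by
    funext t; simp [vline]
  rw [e, hs.2.2]
  exact hs'

lemma preHorseshoe (hconn : ∀ b, IsConnected (X b)) : PreHorseshoe lo hi a d G X where
  lo_lt_hi := h.lo_lt_hi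
  d_pos := h.d_pos
  d_le := h.d_le
  a_lt_one := h.a_lt_one
  compact := h.compact
  subset := h.subset
  disjoint := h.disjoint_nbhd.mono (h.subset_nbhd _) (h.subset_nbhd _)
  cont := fun b p hp => (h.smooth b p (h.subset_nbhd b hp)).continuousAt.continuousWithinAt
  inj := h.inj.mono (union_subset_union (h.subset_nbhd _) (h.subset_nbhd _))
  stable := h.stable
  strip := h.strip
  cross := fun b _ hD hc => h.uniqueCross hconn b hD hc
  chords := by
    obtain ⟨δ, hδ, H⟩ := h.exists_coneRel (l := (⊤ : Filter Unit)) (Hi := fun _ => G)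
      isClosed_univ fun b p hp _ => C1At.const (h.smooth b p hp)
    obtain ⟨-, H⟩ := H.exists
    simp only [← h.eq_returnSet] at H
    refine ⟨c, δ, h.one_lt_c, hδ, fun b p hp q _ hpq => ?_⟩
    have := H b p hp q (by rwa [dist_comm])
    exact ⟨this.unstable, fun hv => (this.strong hv).1, fun hv => (this.stable hv).1⟩

end ReturnData

end

section

/-! ### Interpolation of Lipschitz graphs by `C^1` discs -/

/-- Smooth ramps of slope slightly larger than `1`. -/
lemma exists_ramp {K : ℝ} (hK : 1 < K) : ∃ χ χ' : ℝ → ℝ, (∀ x, HasDerivAt χ (χ' x) x) ∧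
    Continuous χ' ∧ (∀ x, 0 ≤ χ' x ∧ χ' x ≤ K) ∧ (∀ x ≤ 0, χ x = 0 ∧ χ' x = 0) ∧
    (∀ x ≥ 1, χ x = 1 ∧ χ' x = 0) ∧ ∀ x, χ x ∈ Icc (0 : ℝ) 1 := by
  have hK0 : 0 < K := by linarith
  set ε : ℝ := 1 - 1 / K with hε
  have hε0 : 0 < ε := by rw [hε, sub_pos, div_lt_one hK0]; exact hK
  set r : ℝ → ℝ := fun x => max 0 (min 1 (K * x)) with hr
  have cr : Continuous r := by fun_prop
  have r01 : ∀ x, 0 ≤ r x ∧ r x ≤ 1 := fun x => ⟨le_max_left _ _, by simp [hr]⟩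
  have r0 : ∀ x ≤ 0, r x = 0 := fun x hx => by
    simp only [hr]
    exact max_eq_left ((min_le_right _ _).trans (by nlinarith))
  have hKε : K * ε = K - 1 := by rw [hε]; field_simp
  have r1 : ∀ x ≥ 1 - ε, r x = 1 := fun x hx => by
    simp only [hr]
    rw [min_eq_left, max_eq_right zero_le_one]
    have : 1 - ε ≤ x := hx
    nlinarith
  have rmono : Monotone r := fun x y hxy => by
    simp only [hr]
    gcongr
  have rlip : ∀ x, r x - r (x - ε) ≤ K * ε := fun x => by
    simp only [hr]
    have e : K * (x - ε) = K * x - K * ε := by ring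
    have hp : 0 < K * ε := by positivity
    rw [sub_le_iff_le_add]
    refine max_le (by linarith [le_max_left 0 (min 1 (K * (x - ε)))]) ?_
    have k := le_max_right 0 (min 1 (K * (x - ε)))
    rcases min_cases 1 (K * (x - ε)) with ⟨e', _⟩ | ⟨e', _⟩
    · linarith [min_le_left 1 (K * x)]
    · linarith [min_le_right 1 (K * x)]
  have hR : ∀ x, HasDerivAt (fun x => ∫ s in (0 : ℝ)..x, r s) (r x) x := fun x =>
    intervalIntegral.integral_hasDerivAt_right (cr.intervalIntegrable _ _)
      (cr.stronglyMeasurableAtFilter _ _) cr.continuousAt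
  have hi : ∀ x y, IntervalIntegrable r MeasureTheory.volume x y :=
    fun x y => cr.intervalIntegrable _ _
  set χ : ℝ → ℝ := fun x => ((∫ s in (0 : ℝ)..x, r s) - ∫ s in (0 : ℝ)..(x - ε), r s) / ε with hχ
  have hχe : ∀ x, χ x = (∫ s in (x - ε)..x, r s) / ε := fun x => by
    simp only [hχ]
    rw [intervalIntegral.integral_interval_sub_left (hi _ _) (hi _ _)]
  refine ⟨χ, fun x => (r x - r (x - ε)) / ε, fun x => ?_, by fun_prop, fun x => ⟨?_, ?_⟩,
    fun x hx => ⟨?_, ?_⟩, fun x hx => ⟨?_, ?_⟩, fun x => ⟨?_, ?_⟩⟩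
  · exact ((hR x).sub ((hR (x - ε)).comp_sub_const x ε)).div_const ε
  · exact div_nonneg (sub_nonneg.2 (rmono (by linarith))) hε0.le
  · rw [div_le_iff₀ hε0]; exact rlip x
  · rw [hχe, intervalIntegral.integral_congr (g := fun _ => (0 : ℝ)) fun s hs => ?_]
    · simp
    · rw [uIcc_of_le (by linarith)] at hs
      exact r0 s (hs.2.trans hx)
  · simp only
    rw [r0 x hx, r0 (x - ε) (by linarith)]; simp
  · rw [hχe, intervalIntegral.integral_congr (g := fun _ => (1 : ℝ)) fun s hs => ?_]
    · simp [hε0.ne']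
    · rw [uIcc_of_le (by linarith)] at hs
      exact r1 s (by linarith [hs.1])
  · have : 1 ≤ x := hx
    simp only
    rw [r1 x (by linarith), r1 (x - ε) (by linarith)]; simp
  · rw [hχe]
    exact div_nonneg (intervalIntegral.integral_nonneg (by linarith) fun s _ => (r01 s).1) hε0.le
  · rw [hχe, div_le_one hε0]
    have := intervalIntegral.integral_mono_on (show x - ε ≤ x by linarith) (hi _ _)
      (intervalIntegrable_const (c := (1 : ℝ))) fun s _ => (r01 s).2
    simpa using this

variable {lo hi : Fin 3 → ℝ} {a d : ℝ}

/-- The projection along the strong unstable direction of a `C^1` disc that passes through given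
points of the graph `D`. -/
lemma exists_interpolation (hd : 0 < d) (hda : d < a) {D : ℝ → E3} (hD : IsUGraph lo hi d D)
    (hc : CenterIn lo hi D) (F : Finset ℝ) (hF : (F : Set ℝ) ⊆ Icc (lo 2) (hi 2))
    (hne : F.Nonempty) : ∃ p p' : ℝ → E3, (∀ z, HasDerivAt p (p' z) z) ∧ Continuous p' ∧
      (∀ z, p z 2 = 0 ∧ p z 0 ∈ Icc (lo 0) (hi 0) ∧ p z 1 ∈ Icc (lo 1) (hi 1)) ∧
      (∀ z, p' z 2 = 0 ∧ ‖p' z‖ ≤ a) ∧ (∀ z ∈ F, p z = scProj (D z)) ∧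
      ∃ m ∈ F, (∀ z ∈ F, z ≤ m) ∧ ∀ z ≥ m, p z = scProj (D m) ∧ p' z = 0 := by
  induction F using Finset.induction_on_max with
  | empty => exact absurd hne Finset.not_nonempty_empty
  | @insert m s hm ih =>
    have hmI : m ∈ Icc (lo 2) (hi 2) := hF (by simp)
    rcases s.eq_empty_or_nonempty with rfl | hs
    · refine ⟨fun _ => scProj (D m), fun _ => 0, fun z => hasDerivAt_const _ _, continuous_const,
        fun z => ⟨by simp, by simpa using hD.stable m hmI, by simpa using hc m hmI⟩,
        fun z => by simp [(hd.trans hda).le], fun z hz => by simp_all, m, by simp, by simp, by simp⟩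
    · obtain ⟨p, p', h1, h2, h3, h4, h5, n, hn, h6, h7⟩ := ih (fun x hx => hF (by simp_all)) hs
      have hnm : n < m := hm n hn
      have hnI : n ∈ Icc (lo 2) (hi 2) := hF (by simp [hn])
      obtain ⟨χ, χ', k1, k2, k3, k4, k5, k6⟩ := exists_ramp ((one_lt_div hd).2 hda)
      set e : ℝ → ℝ := fun z => (z - n) / (m - n) with he
      set w := scProj (D m) - scProj (D n) with hw
      have hw2 : w 2 = 0 := by simp [hw]
      have hwn : ‖w‖ ≤ d * (m - n) := by
        have := mem_strongUnstableCone.1 (hD.chord m hmI n hnI)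
        rwa [map_sub, PiLp.sub_apply, hD.coord m hmI, hD.coord n hnI,
          abs_of_pos (by linarith)] at this
      have ed : ∀ z, HasDerivAt e (1 / (m - n)) z := fun z =>
        ((hasDerivAt_id z).sub_const n).div_const _
      have hmn : 0 < m - n := by linarith
      have e0 : ∀ z ≤ n, e z ≤ 0 := fun z hz => div_nonpos_of_nonpos_of_nonneg (by linarith) hmn.le
      have e1 : ∀ z ≥ m, e z ≥ 1 := fun z hz => by
        have : m ≤ z := hz
        simp only [he, ge_iff_le]; rw [le_div_iff₀ hmn]; linarith
      refine ⟨fun z => p z + χ (e z) • w, fun z => p' z + (χ' (e z) * (1 / (m - n))) • w, fun z => ?_,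
        ?_, fun z => ?_, fun z => ?_, fun z hz => ?_, m, by simp, fun z hz => ?_, fun z hz => ?_⟩
      · exact (h1 z).add (((k1 (e z)).comp z (ed z)).smul_const w)
      · have : Continuous e := by simp only [he]; fun_prop
        exact h2.add (((k2.comp this).mul continuous_const).smul continuous_const)
      · refine ⟨by simp [h3 z, hw2], ?_⟩
        rcases le_total z n with hz | hz
        · simpa [(k4 _ (e0 z hz)).1] using (h3 z).2
        · have hk := k6 (e z)
          have q0 := convex_Icc (lo 0) (hi 0) (hD.stable n hnI) (hD.stable m hmI)
            (show 0 ≤ 1 - χ (e z) by linarith [hk.2]) hk.1 (by ring)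
          have q1 := convex_Icc (lo 1) (hi 1) (hc n hnI) (hc m hmI)
            (show 0 ≤ 1 - χ (e z) by linarith [hk.2]) hk.1 (by ring)
          simp only [smul_eq_mul] at q0 q1
          simp only [(h7 z hz).1, PiLp.add_apply, PiLp.smul_apply, hw, PiLp.sub_apply,
            scProj_zero, scProj_one, smul_eq_mul]
          constructor
          · convert q0 using 1; ring
          · convert q1 using 1; ring
      · refine ⟨by simp [h4 z, hw2], ?_⟩
        rcases le_total z n with hz | hz
        · simpa [(k4 _ (e0 z hz)).2] using (h4 z).2
        · simp only
          rw [(h7 z hz).2, zero_add, norm_smul, Real.norm_of_nonneg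
            (mul_nonneg (k3 _).1 (by positivity))]
          have ha0 : 0 < a := hd.trans hda
          calc χ' (e z) * (1 / (m - n)) * ‖w‖ ≤ a / d * (1 / (m - n)) * (d * (m - n)) := by
                gcongr
                exact (k3 _).2
            _ = a := by field_simp
      · rcases Finset.mem_insert.1 hz with rfl | hz
        · simp only
          rw [(k5 _ (e1 z le_rfl)).1, (h7 z hnm.le).1, hw]; simp
        · simp only
          rw [h5 z hz, (k4 _ (e0 z (h6 z hz))).1]; simp
      · rcases Finset.mem_insert.1 hz with rfl | hz
        · exact le_rfl
        · exact (hm z hz).le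
      · have : m ≤ z := hz
        simp only
        rw [(k5 _ (e1 z hz)).1, (h7 z (by linarith)).1, (k5 _ (e1 z hz)).2,
          (h7 z (by linarith)).2, hw]
        simp

variable {M : Type*} [TopologicalSpace M] {B : BlenderData M}

lemma exists_isUUParam_eq (hd : 0 < d) (hda : d < B.α) (hlt : B.lo 2 < B.hi 2) {D : ℝ → E3}
    (hD : IsUGraph B.lo B.hi d D) (hc : CenterIn B.lo B.hi D) (F : Finset ℝ)
    (hF : (F : Set ℝ) ⊆ Icc (B.lo 2) (B.hi 2)) : ∃ u, B.IsUUParam u ∧ ∀ z ∈ F, u z = D z := by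
  obtain ⟨p, p', h1, h2, h3, h4, h5, -⟩ := exists_interpolation hd hda hD hc (insert (B.lo 2) F)
    (by rw [Finset.coe_insert]; exact insert_subset (left_mem_Icc.2 hlt.le) hF) (by simp)
  set e₂ : E3 := !₂[0, 0, 1] with he2
  set u : ℝ → E3 := fun z => p z + z • e₂ with hu
  have hder : ∀ z, HasDerivAt u (p' z + e₂) z := fun z => by
    have := (h1 z).add ((hasDerivAt_id z).smul_const e₂)
    rwa [one_smul] at this
  have hcd : ContDiff ℝ 1 u := by
    rw [contDiff_one_iff_deriv]
    refine ⟨fun z => (hder z).differentiableAt, ?_⟩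
    rw [show deriv u = fun z => p' z + e₂ from funext fun z => (hder z).deriv]
    exact h2.add continuous_const
  refine ⟨u, ⟨hcd.contDiffOn, fun z hz => ?_, fun z hz i => ?_, fun z hz => ?_⟩, fun z hz => ?_⟩
  · simp [hu, he2, h3 z]
  · fin_cases i
    · simpa [hu, he2] using (h3 z).2.1
    · simpa [hu, he2] using (h3 z).2.2
    · simpa [hu, he2, h3 z] using hz
  · rw [(hder z).hasDerivWithinAt.derivWithin (uniqueDiffOn_Icc hlt z hz), mem_strongUnstableCone]
    have e : scProj (p' z + e₂) = p' z := ext3 (by simp [he2]) (by simp [he2]) (by simp [h4 z])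
    rw [e]
    simpa [h4 z, he2] using (h4 z).2
  · have := h5 z (Finset.mem_insert_of_mem hz)
    have hz2 := hD.coord z (hF hz)
    refine ext3 ?_ ?_ ?_
    · simp [hu, he2, this]
    · simp [hu, he2, this]
    · simp [hu, he2, h3 z, hz2]

lemma IsUUParam_isUGraph (hlt : B.lo 2 < B.hi 2) {u : ℝ → E3} (hu : B.IsUUParam u) :
    IsUGraph B.lo B.hi B.α u ∧ CenterIn B.lo B.hi u := by
  refine ⟨⟨hu.coord, fun z hz => hu.mem_box z hz 0, fun z hz z' hz' => ?_⟩,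
    fun z hz => hu.mem_box z hz 1⟩
  set I := Icc (B.lo 2) (B.hi 2) with hI
  have hdu : ∀ z ∈ I, HasDerivWithinAt u (derivWithin u I z) I z := fun z hz =>
    ((hu.contDiffOn.differentiableOn (by simp)) z hz).hasDerivWithinAt
  have h2 : ∀ z ∈ I, derivWithin u I z 2 = 1 := fun z hz => by
    have e1 : HasDerivWithinAt (fun z => u z 2) (derivWithin u I z 2) I z := by
      have := (EuclideanSpace.proj (𝕜 := ℝ) (2 : Fin 3)).hasFDerivAt.comp_hasDerivWithinAt z (hdu z hz)
      exact this
    have e2 : HasDerivWithinAt (fun z => u z 2) 1 I z :=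
      (hasDerivWithinAt_id z I).congr (fun y hy => hu.coord y hy) (hu.coord z hz)
    exact (uniqueDiffOn_Icc hlt z hz).eq_deriv _ e1 e2
  have h3 := (convex_Icc (B.lo 2) (B.hi 2)).norm_image_sub_le_of_norm_hasDerivWithin_le
    (f := fun z => scProj (u z)) (f' := fun z => scProj (derivWithin u I z)) (C := B.α)
    (fun z hz => scProj.hasFDerivAt.comp_hasDerivWithinAt z (hdu z hz)) (fun z hz => by
      have := mem_strongUnstableCone.1 (hu.tangent z hz)
      rwa [h2 z hz, abs_one, mul_one] at this) hz' hz
  rw [mem_strongUnstableCone, map_sub, PiLp.sub_apply, hu.coord z hz, hu.coord z' hz']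
  exact h3

end

section

variable {M : Type*} [TopologicalSpace M] {B : BlenderData M}

namespace BlenderData

/-- The two pieces `A` and `B`. -/
def sides (B : BlenderData M) (b : Bool) : Set E3 := cond b B.B B.A

/-- The two reference fixed points. -/
def ref (B : BlenderData M) (b : Bool) : M := cond b B.Pplus B.Pminus

lemma symm_iterate {g : M → M} {X : Bool → Set E3}
    (hX : ∀ b, ∀ p ∈ X b, g (B.chart.symm p) ∈ B.chart.source) {w : ℕ → Bool} {p : E3}
    (hp : ∀ k, (B.local_ g)^[k] p ∈ X (w k)) (k : ℕ) :
    g^[k] (B.chart.symm p) = B.chart.symm ((B.local_ g)^[k] p) := by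
  induction k with
  | zero => rfl
  | succ k ih =>
    rw [Function.iterate_succ_apply', Function.iterate_succ_apply', ih, local_,
      B.chart.left_inv (hX _ _ (hp k))]

lemma symm_mem_localStableSet {g : M → M} {X : Bool → Set E3}
    (hX : ∀ b, ∀ p ∈ X b, p ∈ B.box ∧ g (B.chart.symm p) ∈ B.chart.source) {w : ℕ → Bool}
    {p : E3} (hp : ∀ k, (B.local_ g)^[k] p ∈ X (w k)) :
    B.chart.symm p ∈ localStableSet g B.domain := fun k => by
  rw [symm_iterate (fun b p hp => (hX b p hp).2) hp k]
  exact mem_image_of_mem _ (hX _ _ (hp k)).1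

end BlenderData

open BlenderData

namespace IsBlenderHorseshoe

section

variable {B : BlenderData M}

/-- The diffeomorphism is of class `C^1` in the chart, with invertible derivative. -/
def _root_.BlenderTube.IsRegularIn (B : BlenderData M) (f : M → M) : Prop :=
  ∀ p ∈ B.chart.target, f (B.chart.symm p) ∈ B.chart.source →
    ContDiffAt ℝ 1 (B.local_ f) p ∧ ∃ κ > 0, ∀ v, κ * ‖v‖ ≤ ‖fderiv ℝ (B.local_ f) p v‖

end

variable [ChartedSpace E3 M] {f : Equiv.Perm M} {Γ : Set M} (hΓ : IsBlenderHorseshoe f B Γ)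

local notation "fB" => B.local_ f
local notation "Itin" => itin (B.local_ f) B.sides

include hΓ

lemma mem_sides_iff {p : E3} : (∃ b, p ∈ B.sides b) ↔ p ∈ B.box ∧
    f (B.chart.symm p) ∈ B.chart.source ∧ fB p 2 ∈ Icc (B.lo 2) (B.hi 2) := by
  have h1 : (∃ b, p ∈ B.sides b) ↔ p ∈ B.A ∪ B.B := Bool.exists_bool
  rw [h1, hΓ.returns]
  rfl

lemma mem_of_mem_sides {b : Bool} {p : E3} (hp : p ∈ B.sides b) : p ∈ B.box ∧
    f (B.chart.symm p) ∈ B.chart.source ∧ fB p 2 ∈ Icc (B.lo 2) (B.hi 2) :=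
  hΓ.mem_sides_iff.1 ⟨b, hp⟩

lemma mem_union {b : Bool} {p : E3} (hp : p ∈ B.sides b) : p ∈ B.A ∪ B.B :=
  Bool.exists_bool (p := (p ∈ B.sides ·)).1 ⟨b, hp⟩

lemma exists_returnData (hf : Continuous f) (hreg : IsRegularIn B f) :
    ∃ (N : Bool → Set E3) (d c : ℝ), 0 < d ∧ d < B.α ∧ ReturnData B.lo B.hi B.α d c fB B.sides N ∧
      ∀ b, ∀ p ∈ N b, p ∈ B.chart.target ∧ f (B.chart.symm p) ∈ B.chart.source := by
  set U : Set E3 := B.chart.target ∩ B.chart.symm ⁻¹' (f ⁻¹' B.chart.source) with hU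
  have hUo : IsOpen U := B.chart.continuousOn_symm.isOpen_inter_preimage B.chart.open_target
    (B.chart.open_source.preimage hf)
  have hXU : ∀ b, B.sides b ⊆ U := fun b p hp =>
    ⟨hΓ.box_subset (hΓ.mem_of_mem_sides hp).1, (hΓ.mem_of_mem_sides hp).2.1⟩
  have hXc : ∀ b, IsCompact (B.sides b) := fun b => by
    cases b; exacts [hΓ.isCompact_A, hΓ.isCompact_B]
  have hdis : Disjoint (B.sides false) (B.sides true) := hΓ.disjoint_AB
  obtain ⟨δ1, hδ1, H1⟩ := hdis.exists_cthickenings (hXc false) (hXc true).isClosed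
  obtain ⟨δ2, hδ2, H2⟩ := (hXc false).exists_cthickening_subset_open hUo (hXU false)
  obtain ⟨δ3, hδ3, H3⟩ := (hXc true).exists_cthickening_subset_open hUo (hXU true)
  set δ := min δ1 (min δ2 δ3) with hδ
  have hδ0 : 0 < δ := lt_min hδ1 (lt_min hδ2 hδ3)
  set N : Bool → Set E3 := fun b => Metric.cthickening δ (B.sides b) with hN
  have hNU : ∀ b, N b ⊆ U := fun b => by
    cases b
    · exact (Metric.cthickening_mono ((min_le_right _ _).trans (min_le_left _ _)) _).trans H2
    · exact (Metric.cthickening_mono ((min_le_right _ _).trans (min_le_right _ _)) _).trans H3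
  have hNd : Disjoint (N false) (N true) := H1.mono (Metric.cthickening_mono (min_le_left _ _) _)
      (Metric.cthickening_mono (min_le_left _ _) _)
  have hXN : ∀ b, B.sides b ⊆ interior (N b) := fun b =>
    (Metric.self_subset_thickening hδ0 _).trans
      (interior_maximal (Metric.thickening_subset_cthickening _ _) Metric.isOpen_thickening)
  obtain ⟨α', c, h1, h2, h3, h4⟩ := hΓ.cones
  obtain ⟨hα0, hα1⟩ := hΓ.α_mem
  refine ⟨N, (α' + B.α) / 2, (1 + c) / 2, by linarith, by linarith, ?_, fun b p hp => hNU b hp⟩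
  exact {
    lo_lt_hi := hΓ.lo_lt_hi
    d_pos := by linarith
    d_le := by linarith
    a_lt_one := hα1
    one_lt_c := by linarith
    subset := fun b p hp => (hΓ.mem_of_mem_sides hp).1
    compact_nbhd := fun b => (hXc b).cthickening
    subset_interior := hXN
    disjoint_nbhd := hNd
    isolated := fun b p hp hpb hz => by
      obtain ⟨b', hb'⟩ := hΓ.mem_sides_iff.2 ⟨hpb, (hNU b hp).2, hz⟩
      have hb'' := interior_subset (hXN b' hb')
      by_cases e : b' = b
      · rwa [← e]
      · exfalso
        cases b <;> cases b'
        exacts [e rfl, disjoint_left.1 hNd hp hb'', disjoint_left.1 hNd hb'' hp, e rfl]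
    smooth := fun b p hp => (hreg p (hNU b hp).1 (hNU b hp).2).1
    inj := fun p hp q hq e => by
      have hpU : p ∈ U := hp.elim (fun h => hNU _ h) fun h => hNU _ h
      have hqU : q ∈ U := hq.elim (fun h => hNU _ h) fun h => hNU _ h
      exact B.chart.symm.injOn hpU.1 hqU.1 (f.injective (B.chart.injOn hpU.2 hqU.2 e))
    stable := fun b p hp => hΓ.image_stable p (hΓ.mem_union hp)
    strip := fun b p hp => (hΓ.mem_of_mem_sides hp).2.2
    source := fun b p hp => hΓ.source_uu p (hΓ.mem_union hp)
    cone := fun b p hp => by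
      obtain ⟨κ, hκ, hL⟩ := (hreg p (hXU b hp).1 (hXU b hp).2).2
      obtain ⟨η, hη, H⟩ := cones_of_approx (d := (α' + B.α) / 2) (c' := (1 + c) / 2) h1
        (by linarith) (by linarith) hα1 (by linarith) (by linarith) hκ hL
        (h4 p (hΓ.mem_union hp))
      exact ⟨η, hη, fun v y hv => ⟨(H v y hv).1, (H v y hv).2.1, (H v y hv).2.2⟩⟩ }

lemma isConnected_sides (b : Bool) : IsConnected (B.sides b) := by
  cases b; exacts [hΓ.isConnected_A, hΓ.isConnected_B]

lemma exists_ref (b : Bool) : ∃ p ∈ B.sides b, B.chart.symm p = B.ref b ∧ fB p = p := by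
  have h1 : B.ref b ∈ B.chart.symm '' B.sides b := by cases b; exacts [hΓ.Pminus_mem, hΓ.Pplus_mem]
  have h2 : f (B.ref b) = B.ref b := by cases b; exacts [hΓ.fixed_Pminus, hΓ.fixed_Pplus]
  obtain ⟨p, hp, e⟩ := h1
  refine ⟨p, hp, e, ?_⟩
  rw [local_, e, h2, ← e, B.chart.right_inv (hΓ.box_subset (hΓ.mem_of_mem_sides hp).1)]

variable {N : Bool → Set E3} {d c : ℝ} (hR : ReturnData B.lo B.hi B.α d c (B.local_ f) B.sides N)

include hR

lemma center : ∀ b, ∀ p ∈ B.sides b, fB p ∈ cbox B.lo B.hi → p 1 ∈ Ioo (B.lo 1) (B.hi 1) :=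
  fun _ p hp hG => hΓ.source_center p (hΓ.mem_union hp) hG

lemma faces (b : Bool) : ((∀ p ∈ B.sides b, p 1 = B.lo 1 → fB p 1 < B.lo 1) ∧
      ∀ p ∈ B.sides b, p 1 = B.hi 1 → B.hi 1 < fB p 1) ∨
    ((∀ p ∈ B.sides b, p 1 = B.hi 1 → fB p 1 < B.lo 1) ∧
      ∀ p ∈ B.sides b, p 1 = B.lo 1 → B.hi 1 < fB p 1) := by
  obtain ⟨p, hp, -, e⟩ := hΓ.exists_ref b
  exact (hR.preHorseshoe hΓ.isConnected_sides).faces_dichotomy b (hΓ.center hR b) hp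
    (by rw [e]; exact (hΓ.mem_of_mem_sides hp).1)

lemma horseshoe : Horseshoe B.lo B.hi B.α d fB B.sides where
  toPreHorseshoe := hR.preHorseshoe hΓ.isConnected_sides
  center := hΓ.center hR
  full := fun b => by
    rcases hΓ.faces hR b with ⟨h1, h2⟩ | ⟨h1, h2⟩
    · exact (hR.preHorseshoe hΓ.isConnected_sides).full_of_faces b (Or.inl ⟨rfl, rfl⟩) h1 h2
    · exact (hR.preHorseshoe hΓ.isConnected_sides).full_of_faces b (Or.inr ⟨rfl, rfl⟩) h1 h2

lemma locStable_eq (hf : Continuous f) (x : Bool) : B.locStable f (B.ref x) =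
    Itin (fun _ => x) '' Icc (B.lo 0) (B.hi 0) := by
  have hH := hΓ.horseshoe hR
  obtain ⟨p, hp, hps, hpf⟩ := hΓ.exists_ref x
  have hpit : ∀ k, fB^[k] p ∈ B.sides x := fun k => by rw [Function.iterate_fixed hpf k]; exact hp
  have hX : ∀ b, ∀ p ∈ B.sides b, p ∈ B.box ∧ f (B.chart.symm p) ∈ B.chart.source :=
    fun b p hp => ⟨(hΓ.mem_of_mem_sides hp).1, (hΓ.mem_of_mem_sides hp).2.1⟩
  set F := localStableSet f B.domain with hF
  have hPF : B.ref x ∈ F := by rw [← hps]; exact symm_mem_localStableSet (w := fun _ => x) hX hpit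
  have hdom : ∀ y ∈ B.domain, y ∈ B.chart.source ∧ B.chart y ∈ B.box := by
    rintro _ ⟨q, hq, rfl⟩
    have := hΓ.box_subset hq
    exact ⟨B.chart.map_target this, by rwa [B.chart.right_inv this]⟩
  have hside : ∀ y ∈ F, ∀ k : ℕ, ∃ b, B.chart (f^[k] y) ∈ B.sides b := fun y hy k => by
    obtain ⟨s1, s2⟩ := hdom _ (hy k)
    obtain ⟨s3, s4⟩ := hdom _ (hy (k + 1))
    rw [Function.iterate_succ_apply'] at s3 s4
    refine hΓ.mem_sides_iff.2 ⟨s2, by rwa [B.chart.left_inv s1], ?_⟩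
    rw [local_, B.chart.left_inv s1]
    exact s4 2
  have hiter : ∀ y ∈ F, ∀ k : ℕ, fB^[k] (B.chart y) = B.chart (f^[k] y) := by
    intro y hy k
    induction k with
    | zero => rfl
    | succ k ih =>
      rw [Function.iterate_succ_apply', ih, Function.iterate_succ_apply', local_,
        B.chart.left_inv (hdom _ (hy k)).1]
  have hdisj : Disjoint (B.sides false) (B.sides true) := hΓ.disjoint_AB
  apply Subset.antisymm
  · rintro _ ⟨y, hy, rfl⟩
    have hsub := connectedComponentIn_subset F (B.ref x)
    have hall : ∀ k : ℕ, ∀ y ∈ connectedComponentIn F (B.ref x),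
        B.chart (f^[k] y) ∈ B.sides x := fun k => by
      have hcont : ∀ y ∈ F, ContinuousAt (fun y => B.chart (f^[k] y)) y := fun y hy =>
        ContinuousAt.comp (f := f^[k]) (B.chart.continuousAt (hdom _ (hy k)).1)
          (hf.iterate k).continuousAt
      have hopen : ∀ b, ∀ y ∈ connectedComponentIn F (B.ref x), B.chart (f^[k] y) ∈ B.sides b →
          ∀ᶠ y' in 𝓝[connectedComponentIn F (B.ref x)] y,
            B.chart (f^[k] y') ∈ B.sides b := fun b y hy hb => by
        have hnot : B.chart (f^[k] y) ∉ B.sides (!b) := fun hn => by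
          cases b
          · exact disjoint_left.1 hdisj hb hn
          · exact disjoint_left.1 hdisj hn hb
        have := (hcont y (hsub hy)).eventually
          ((hH.compact (!b)).isClosed.isOpen_compl.mem_nhds hnot)
        filter_upwards [nhdsWithin_le_nhds this, self_mem_nhdsWithin] with y' h1 h2
        obtain ⟨b', hb'⟩ := hside y' (hsub h2) k
        by_cases e : b' = b
        · rwa [← e]
        · rw [show b' = !b by cases b <;> cases b' <;> simp_all] at hb'
          exact absurd hb' h1
      refine forall_of_isPreconnected isPreconnected_connectedComponentIn (hopen x)
        (fun y hy hn => ?_) (mem_connectedComponentIn hPF) ?_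
      · obtain ⟨b, hb⟩ := hside y (hsub hy) k
        have hbx : b = !x := by
          by_contra hne
          exact hn (by rwa [show b = x by cases b <;> cases x <;> simp_all] at hb)
        refine (hopen b y hy hb).mono fun y' hy' hx' => ?_
        rw [hbx] at hy'
        cases x
        · exact disjoint_left.1 hdisj hx' hy'
        · exact disjoint_left.1 hdisj hy' hx'
      · rw [← hiter _ hPF k, ← hps, B.chart.right_inv (hΓ.box_subset (hX _ _ hp).1)]
        exact hpit k
    have hw : ∀ k, fB^[k] (B.chart y) ∈ B.sides x := fun k => by
      rw [hiter y (hsub hy)]; exact hall k y hy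
    exact ⟨B.chart y 0, (hdom y (hsub hy 0)).2 0, hH.itin_eq (w := fun _ => x) hw⟩
  · have hpc : IsPreconnected (B.chart.symm '' (Itin (fun _ => x) '' Icc (B.lo 0) (B.hi 0))) := by
      refine IsPreconnected.image (isPreconnected_Icc.image _ (hH.isSGraph_itin _).continuousOn) _
        (B.chart.continuousOn_symm.mono ?_)
      rintro _ ⟨s, hs, rfl⟩
      exact hΓ.box_subset ((hH.isSGraph_itin _).mem s hs)
    have hsubF : B.chart.symm '' (Itin (fun _ => x) '' Icc (B.lo 0) (B.hi 0)) ⊆ F := by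
      rintro _ ⟨_, ⟨s, hs, rfl⟩, rfl⟩
      exact symm_mem_localStableSet hX (hH.itin_spec _ hs).2
    have hPm : B.ref x ∈ B.chart.symm '' (Itin (fun _ => x) '' Icc (B.lo 0) (B.hi 0)) :=
      ⟨p, ⟨p 0, (hX _ _ hp).1 0, hH.itin_eq (w := fun _ => x) hpit⟩, hps⟩
    have := hpc.subset_connectedComponentIn hPm hsubF
    rintro q hq
    obtain ⟨s, hs, rfl⟩ := hq
    refine ⟨_, this (mem_image_of_mem _ (mem_image_of_mem _ hs)), ?_⟩
    exact B.chart.right_inv (hΓ.box_subset ((hH.isSGraph_itin _).mem s hs))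

end IsBlenderHorseshoe

end

section

open BlenderData

variable {M : Type*} [TopologicalSpace M] {B : BlenderData M}

lemma isUUParam_vline (hα : 0 ≤ B.α) (hlt : B.lo 2 < B.hi 2) {s y : ℝ}
    (hs : s ∈ Icc (B.lo 0) (B.hi 0)) (hy : y ∈ Icc (B.lo 1) (B.hi 1)) :
    B.IsUUParam (vline s y) := by
  have e : vline s y = fun z => !₂[s, y, 0] + z • !₂[0, 0, 1] := by
    funext z; exact ext3 (by simp [vline]) (by simp [vline]) (by simp [vline])
  have hd : ∀ z, HasDerivAt (vline s y) !₂[0, 0, 1] z := fun z => by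
    rw [e]
    simpa using ((hasDerivAt_id z).smul_const (!₂[0, 0, 1] : E3)).const_add (!₂[s, y, 0] : E3)
  refine ⟨?_, fun z hz => by simp [vline], fun z hz i => ?_, fun z hz => ?_⟩
  · rw [e]; fun_prop
  · fin_cases i
    · simpa [vline] using hs
    · simpa [vline] using hy
    · simpa [vline] using hz
  · rw [(hd z).hasDerivWithinAt.derivWithin (uniqueDiffOn_Icc hlt z hz), mem_strongUnstableCone,
      norm_scProj]
    simpa using hα

namespace IsBlenderHorseshoe

variable [ChartedSpace E3 M] {f : Equiv.Perm M} {Γ : Set M} (hΓ : IsBlenderHorseshoe f B Γ)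
  {N : Bool → Set E3} {d c : ℝ} (hf : Continuous f)
  (hR : ReturnData B.lo B.hi B.α d c (B.local_ f) B.sides N)

local notation "fB" => B.local_ f
local notation "Itin" => itin (B.local_ f) B.sides

include hΓ hf hR

lemma side_disc_iff {u : ℝ → E3} (hu : B.IsUUParam u) (x : Bool) :
    (RightOf (B.disc u) (B.locStable f (B.ref x)) ↔ 0 < gap B.lo B.hi u (Itin fun _ => x)) ∧
      (LeftOf (B.disc u) (B.locStable f (B.ref x)) ↔ gap B.lo B.hi u (Itin fun _ => x) < 0) := by
  have hH := hΓ.horseshoe hR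
  rw [hΓ.locStable_eq hR hf, disc]
  exact side_iff (IsUUParam_isUGraph (hΓ.lo_lt_hi 2) hu).1 (hH.isSGraph_itin _) hH.mul_lt_one
    hH.a_pos.le (hΓ.lo_lt_hi 0).le

lemma meets_disc_iff {u : ℝ → E3} (hu : B.IsUUParam u) (x : Bool) :
    (B.disc u ∩ B.locStable f (B.ref x)).Nonempty ↔ gap B.lo B.hi u (Itin fun _ => x) = 0 := by
  have hH := hΓ.horseshoe hR
  rw [hΓ.locStable_eq hR hf, disc, gap_eq_zero_iff (IsUUParam_isUGraph (hΓ.lo_lt_hi 2) hu).1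
    (hH.isSGraph_itin _) hH.mul_lt_one hH.a_pos.le (hΓ.lo_lt_hi 0).le]
  constructor
  · rintro ⟨_, ⟨z, hz, rfl⟩, s, hs, e⟩
    exact ⟨z, hz, s, hs, e.symm⟩
  · rintro ⟨z, hz, s, hs, e⟩
    exact ⟨u z, mem_image_of_mem u hz, s, hs, e.symm⟩

lemma side_image_iff {u : ℝ → E3} (hu : B.IsUUParam u) (b x : Bool) :
    (RightOf (fB '' (B.disc u ∩ B.sides b)) (B.locStable f (B.ref x)) ↔
      0 < gap B.lo B.hi (imageGraph B.lo B.hi fB (B.sides b) u) (Itin fun _ => x)) ∧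
    (LeftOf (fB '' (B.disc u ∩ B.sides b)) (B.locStable f (B.ref x)) ↔
      gap B.lo B.hi (imageGraph B.lo B.hi fB (B.sides b) u) (Itin fun _ => x) < 0) := by
  have hH := hΓ.horseshoe hR
  obtain ⟨h1, h2⟩ := IsUUParam_isUGraph (hΓ.lo_lt_hi 2) hu
  rw [hΓ.locStable_eq hR hf, disc, (hH.cross b u h1 h2).image_eq (hH.strip b)]
  exact side_iff (hH.isUGraph_image b h1 h2) (hH.isSGraph_itin _) hH.dd_lt_one hH.d_pos.le
    (hΓ.lo_lt_hi 0).le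

lemma orientedHorseshoe : OrientedHorseshoe B.lo B.hi B.α d fB B.sides := by
  have hH := hΓ.horseshoe hR
  have key : ∀ b, (∀ p ∈ B.sides b, p 1 = B.lo 1 → fB p 1 < B.lo 1) ∧
      ∀ p ∈ B.sides b, p 1 = B.hi 1 → B.hi 1 < fB p 1 := fun b => by
    refine (hΓ.faces hR b).resolve_right fun hcon => ?_
    have hs := left_mem_Icc.2 (hΓ.lo_lt_hi 0).le
    have hy := right_mem_Icc.2 (hΓ.lo_lt_hi 1).le
    have hu := isUUParam_vline hΓ.α_mem.1.le (hΓ.lo_lt_hi 2) hs hy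
    obtain ⟨h1, h2⟩ := IsUUParam_isUGraph (hΓ.lo_lt_hi 2) hu
    have hgap : 0 < gap B.lo B.hi (vline (B.lo 0) (B.hi 1)) (Itin fun _ => b) := by
      have := hH.itin_one_mem (fun _ => b) (overAt_spec h1 (hH.isSGraph_itin fun _ => b)
        hH.mul_lt_one hH.a_pos.le (hΓ.lo_lt_hi 0).le).1
      rw [gap]
      simp only [vline]
      simpa using this.2
    have himg : 0 < gap B.lo B.hi (imageGraph B.lo B.hi fB (B.sides b)
        (vline (B.lo 0) (B.hi 1))) (Itin fun _ => b) := by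
      rw [← (hΓ.side_image_iff hf hR hu b b).1]
      have hr := (hΓ.side_disc_iff hf hR hu b).1.2 hgap
      cases b
      · exact (hΓ.images_minus_A _ ⟨_, hu, rfl⟩).1 hr
      · exact (hΓ.images_plus_B _ ⟨_, hu, rfl⟩).1 hr
    have hI := hH.isUGraph_image b h1 h2
    have hov := (overAt_spec hI (hH.isSGraph_itin fun _ => b) hH.dd_lt_one hH.d_pos.le
      (hΓ.lo_lt_hi 0).le).1
    have hmem := hH.itin_one_mem (fun _ => b) hov
    obtain ⟨-, k2, -⟩ := (hH.cross b _ h1 h2).spec ((hH.isSGraph_itin fun _ => b).mem _ hov 2)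
    have := hcon.1 _ k2 (by simp [vline])
    rw [gap, imageGraph] at himg
    linarith [hmem.1]
  exact { toHorseshoe := hH, above := fun b => (key b).2, below := fun b => (key b).1 }

lemma sign_gap_image (b : Bool) (w : ℕ → Bool) {D : ℝ → E3} (hD : IsUGraph B.lo B.hi B.α D)
    (hc : CenterIn B.lo B.hi D) :
    SignType.sign (gap B.lo B.hi (imageGraph B.lo B.hi fB (B.sides b) D) (Itin w)) =
      SignType.sign (gap B.lo B.hi D (Itin (consSeq b w))) := by
  simpa [beyond, sideSign] using (hΓ.orientedHorseshoe hf hR).sign_beyond_image true b w hD hc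

lemma gap_disc {u : ℝ → E3} (hu : B.IsUUParam u) (x : Bool)
    (hx : gap B.lo B.hi u (Itin fun _ => x) = 0) :
    (∀ z ∈ Icc (B.lo 2) (B.hi 2), u z 1 ∈ Ioo (B.lo 1) (B.hi 1)) ∧
      sideSign (!x) * gap B.lo B.hi u (Itin fun _ => !x) < 0 := by
  have hH := hΓ.horseshoe hR
  obtain ⟨p, hp, -, hpf⟩ := hΓ.exists_ref (!x)
  have hpb := hR.subset _ hp
  have hv := isUUParam_vline hΓ.α_mem.1.le (hΓ.lo_lt_hi 2) (hpb 0) (hpb 1)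
  have hvm : (B.disc (vline (p 0) (p 1)) ∩ B.locStable f (B.ref (!x))).Nonempty := by
    refine ⟨p, ⟨p 2, hpb 2, ext3 (by simp [vline]) (by simp [vline]) (by simp [vline])⟩, ?_⟩
    rw [hΓ.locStable_eq hR hf]
    exact ⟨p 0, hpb 0, hH.itin_eq (w := fun _ => !x) fun k => by
      rw [Function.iterate_fixed hpf k]; exact hp⟩
  have hum := (hΓ.meets_disc_iff hf hR hu x).2 hx
  cases x
  · obtain ⟨h1, -, h2, -⟩ := hΓ.discs_through _ _ ⟨u, hu, rfl⟩ ⟨_, hv, rfl⟩ hum hvm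
    refine ⟨fun z hz => h1 _ (Or.inl (mem_image_of_mem u hz)), ?_⟩
    simpa [sideSign] using (hΓ.side_disc_iff hf hR hu true).2.1 h2
  · obtain ⟨h1, -, -, h2⟩ := hΓ.discs_through _ _ ⟨_, hv, rfl⟩ ⟨u, hu, rfl⟩ hvm hum
    refine ⟨fun z hz => h1 _ (Or.inr (mem_image_of_mem u hz)), ?_⟩
    simpa [sideSign] using (hΓ.side_disc_iff hf hR hu false).1.1 h2

lemma exists_disc (hd : d < B.α) {D : ℝ → E3} (hD : IsUGraph B.lo B.hi d D)
    (hc : CenterIn B.lo B.hi D) (S : List (ℕ → Bool)) {z0 : ℝ}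
    (hz0 : z0 ∈ Icc (B.lo 2) (B.hi 2)) : ∃ u, B.IsUUParam u ∧ u z0 = D z0 ∧ ∀ w ∈ S,
      gap B.lo B.hi u (Itin w) = gap B.lo B.hi D (Itin w) := by
  classical
  have hH := hΓ.horseshoe hR
  have hov := fun w => overAt_spec hD (hH.isSGraph_itin w) hH.dd_lt_one hH.d_pos.le
    (hΓ.lo_lt_hi 0).le
  have hz := fun w => (hH.isSGraph_itin w).mem _ (hov w).1 2
  obtain ⟨u, hu, H⟩ := exists_isUUParam_eq hH.d_pos hd (hΓ.lo_lt_hi 2) hD hc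
    (insert z0 (S.map fun w => Itin w (overAt B.lo B.hi D (Itin w)) 2).toFinset) (by
        intro z hz'
        rw [Finset.mem_coe, Finset.mem_insert, List.mem_toFinset, List.mem_map] at hz'
        rcases hz' with rfl | ⟨w, -, rfl⟩
        · exact hz0
        · exact hz w)
  refine ⟨u, hu, H _ (Finset.mem_insert_self _ _), fun w hw => ?_⟩
  have e := H _ (Finset.mem_insert_of_mem (List.mem_toFinset.2 (List.mem_map_of_mem hw)))
  rw [(overAt_eq_of_apply (IsUUParam_isUGraph (hΓ.lo_lt_hi 2) hu).1 (hH.isSGraph_itin w)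
    hH.mul_lt_one hH.a_pos.le (hΓ.lo_lt_hi 0).le (hov w).1 (hz w)
    (by rw [e, (hov w).2, (hH.isSGraph_itin w).coord _ (hov w).1])
    (by rw [e, hD.coord _ (hz w)])).2, e, gap]

lemma gap_graph (hd : d < B.α) {D : ℝ → E3} (hD : IsUGraph B.lo B.hi d D) (x : Bool)
    (hx : gap B.lo B.hi D (Itin fun _ => x) = 0) :
    sideSign (!x) * gap B.lo B.hi D (Itin fun _ => !x) < 0 := by
  have hH := hΓ.horseshoe hR
  have hov := fun w => (overAt_spec hD (hH.isSGraph_itin w) hH.dd_lt_one hH.d_pos.le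
    (hΓ.lo_lt_hi 0).le).1
  have hcl := fun w => gap_clamp hD (hH.isSGraph_itin w) hH.dd_lt_one hH.d_pos.le (hΓ.lo_lt_hi 0).le
  obtain ⟨u, hu, -, hg⟩ := hΓ.exists_disc hf hR hd (isUGraph_clamp hD)
    (centerIn_clamp (hΓ.lo_lt_hi 1).le D) [fun _ => x, fun _ => !x]
    (left_mem_Icc.2 (hΓ.lo_lt_hi 2).le)
  have m1 := hH.itin_one_mem (fun _ => x) (hov fun _ => x)
  have m2 := hH.itin_one_mem (fun _ => !x) (hov fun _ => !x)
  have g1 := hg (fun _ => x) (by simp)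
  have g2 := hg (fun _ => !x) (by simp)
  rw [hcl] at g1 g2
  rw [gap, sub_eq_zero] at hx
  rw [hx, min_eq_right m1.2.le, max_eq_right m1.1.le, sub_self] at g1
  have h2 := (hΓ.gap_disc hf hR hu x g1).2
  rw [g2] at h2
  rw [gap]
  set e := D (Itin (fun _ => !x) (overAt B.lo B.hi D (Itin fun _ => !x)) 2) 1
  have hlt := hΓ.lo_lt_hi 1
  cases x
  · simp only [sideSign, Bool.not_false, if_true, one_mul] at h2 ⊢ m2
    rcases max_cases (B.lo 1) (min (B.hi 1) e) with ⟨k, k'⟩ | ⟨k, k'⟩ <;>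
    rcases min_cases (B.hi 1) e with ⟨l, l'⟩ | ⟨l, l'⟩ <;> linarith [m2.1, m2.2]
  · simp only [sideSign, Bool.not_true, Bool.false_eq_true, if_false, neg_mul, one_mul] at h2 ⊢ m2
    rcases max_cases (B.lo 1) (min (B.hi 1) e) with ⟨k, k'⟩ | ⟨k, k'⟩ <;>
    rcases min_cases (B.hi 1) e with ⟨l, l'⟩ | ⟨l, l'⟩ <;> linarith [m2.1, m2.2]

lemma gap_superpose {u : ℝ → E3} (hu : B.IsUUParam u)
    (hg : ∀ x, beyond B.lo B.hi fB B.sides x (fun _ => x) u < 0) :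
    ∃ x, beyond B.lo B.hi fB B.sides x (consSeq (!x) fun _ => x) u < 0 := by
  obtain ⟨h1, h2⟩ := IsUUParam_isUGraph (hΓ.lo_lt_hi 2) hu
  have hb : B.InBetween f (B.disc u) := ⟨⟨u, hu, rfl⟩,
    (hΓ.side_disc_iff hf hR hu false).1.2 (by simpa [beyond, sideSign] using hg false),
    (hΓ.side_disc_iff hf hR hu true).2.2 (by simpa [beyond, sideSign] using hg true)⟩
  rcases hΓ.superposition _ hb with h | h
  · refine ⟨true, ?_⟩
    have := (hΓ.side_image_iff hf hR hu false true).2.1 h.2.2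
    rw [← sign_eq_neg_one_iff, hΓ.sign_gap_image hf hR _ _ h1 h2, sign_eq_neg_one_iff] at this
    simpa [beyond, sideSign] using this
  · refine ⟨false, ?_⟩
    have := (hΓ.side_image_iff hf hR hu true false).1.1 h.2.1
    rw [← sign_eq_one_iff, hΓ.sign_gap_image hf hR _ _ h1 h2, sign_eq_one_iff] at this
    simpa [beyond, sideSign] using this

lemma touch (hd : d < B.α) (x : Bool) {D : ℝ → E3} (hD : IsUGraph B.lo B.hi d D)
    (hc : CenterIn B.lo B.hi D) {z : ℝ} (hz : z ∈ Icc (B.lo 2) (B.hi 2))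
    (hm : D z 1 = cond x (B.hi 1) (B.lo 1)) :
    0 < beyond B.lo B.hi fB B.sides x (fun _ => x) D := by
  have hH := hΓ.horseshoe hR
  have hS := hH.isSGraph_itin fun _ => x
  set m := cond x (B.hi 1) (B.lo 1) with hmdef
  have hlt := hΓ.lo_lt_hi 1
  have hmI : m ∈ Icc (B.lo 1) (B.hi 1) := by cases x <;> simp [m, hlt.le]
  have hov := (overAt_spec hD hS hH.dd_lt_one hH.d_pos.le (hΓ.lo_lt_hi 0).le).1
  have hmem := hH.itin_one_mem (fun _ => x) hov
  set g := beyond B.lo B.hi fB B.sides x (fun _ => x) D with hg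
  set y := Itin (fun _ => x) (overAt B.lo B.hi D (Itin fun _ => x)) 1 with hy
  by_contra hcon
  rw [not_lt] at hcon
  have hpos : 0 < sideSign x * (m - y) := by
    cases x
    · simp only [sideSign, m, cond_false, Bool.false_eq_true, if_false]; linarith [hmem.1]
    · simp only [sideSign, m, cond_true, if_true]; linarith [hmem.2]
  set lam := -g / (sideSign x * (m - y) - g) with hlam
  have hden : 0 < sideSign x * (m - y) - g := by linarith
  have hl : lam ∈ Icc (0 : ℝ) 1 := by
    refine ⟨div_nonneg (by linarith) hden.le, ?_⟩
    rw [hlam, div_le_one hden]; linarith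
  have hzero : gap B.lo B.hi (shift D m lam) (Itin fun _ => x) = 0 := by
    have e := gap_shift hD hS hH.dd_lt_one hH.d_pos.le (hΓ.lo_lt_hi 0).le m hl
    have hs : sideSign x ≠ 0 := by cases x <;> simp [sideSign]
    refine mul_left_cancel₀ hs ?_
    rw [e, mul_zero]
    have : sideSign x * ((1 - lam) * gap B.lo B.hi D (Itin fun _ => x) +
        lam * (m - y)) = g + lam * (sideSign x * (m - y) - g) := by
      rw [hg, beyond]; ring
    rw [this, hlam, div_mul_cancel₀ _ hden.ne']; ring
  obtain ⟨u, hu, huz, hgu⟩ := hΓ.exists_disc hf hR hd (isUGraph_shift hD m hl)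
    (centerIn_shift hc hmI hl) [fun _ => x] hz
  have k1 := (hΓ.gap_disc hf hR hu x (by rw [hgu _ (by simp), hzero])).1 z hz
  have k2 : u z 1 = m := by rw [huz]; simp only [shift]; simp [hm]; ring
  rw [k2] at k1
  cases x
  · exact k1.1.ne rfl
  · exact k1.2.ne rfl

lemma blender (hd : d < B.α) : Blender B.lo B.hi B.α d fB B.sides where
  toOrientedHorseshoe := hΓ.orientedHorseshoe hf hR
  touch_hi := fun _ hD hc _ hz hm => hΓ.touch hf hR hd true hD hc hz hm
  touch_lo := fun _ hD hc _ hz hm => hΓ.touch hf hR hd false hD hc hz hm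
  leave := fun x D hD hc hx => by
    obtain ⟨u, hu, -, hg⟩ := hΓ.exists_disc hf hR hd hD hc [fun _ => x, consSeq (!x) fun _ => x]
      (left_mem_Icc.2 (hΓ.lo_lt_hi 2).le)
    obtain ⟨h1, h2⟩ := IsUUParam_isUGraph (hΓ.lo_lt_hi 2) hu
    have g1 := hg (fun _ => x) (by simp)
    have g2 := hg (consSeq (!x) fun _ => x) (by simp)
    rw [beyond, ← g1] at hx
    rw [beyond, ← g2]
    cases x
    · have hx' : gap B.lo B.hi u (Itin fun _ => false) ≤ 0 := by simpa [sideSign] using hx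
      have := hΓ.images_minus_B _ ⟨u, hu, rfl⟩ (hx'.lt_or_eq.imp
        (hΓ.side_disc_iff hf hR hu false).2.2 (hΓ.meets_disc_iff hf hR hu false).2)
      have := (hΓ.side_image_iff hf hR hu true false).2.1 this
      rw [← sign_eq_neg_one_iff, hΓ.sign_gap_image hf hR _ _ h1 h2, sign_eq_neg_one_iff] at this
      simpa [sideSign] using this
    · have hx' : 0 ≤ gap B.lo B.hi u (Itin fun _ => true) := by simpa [sideSign] using hx
      have := hΓ.images_plus_A _ ⟨u, hu, rfl⟩ (hx'.lt_or_eq.imp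
        (hΓ.side_disc_iff hf hR hu true).1.2
        fun e => (hΓ.meets_disc_iff hf hR hu true).2 e.symm)
      have := (hΓ.side_image_iff hf hR hu false true).1.1 this
      rw [← sign_eq_one_iff, hΓ.sign_gap_image hf hR _ _ h1 h2, sign_eq_one_iff] at this
      simpa [sideSign] using this
  superpose := fun D hD hc hx => by
    have hH := hΓ.horseshoe hR
    by_cases hz : ∃ x, beyond B.lo B.hi fB B.sides x (fun _ => x) D = 0
    · obtain ⟨x, hx0⟩ := hz
      have hDα := hD.mono hH.d_le
      have e1 := ((hΓ.orientedHorseshoe hf hR).beyond_image_eq_zero x x (fun _ => x) hDα hc).2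
        (by rwa [consSeq_const])
      have hs : sideSign x ≠ 0 := by cases x <;> simp [sideSign]
      have e2 := hΓ.gap_graph hf hR hd (hH.isUGraph_image x hDα hc) x
        ((mul_eq_zero.1 e1).resolve_left hs)
      refine ⟨!x, ?_⟩
      have e3 := (hΓ.orientedHorseshoe hf hR).sign_beyond_image (!x) x (fun _ => !x) hDα hc
      rw [beyond, sign_neg e2] at e3
      rw [Bool.not_not, ← sign_eq_neg_one_iff, ← e3]
    · push Not at hz
      obtain ⟨u, hu, -, hg⟩ := hΓ.exists_disc hf hR hd hD hc [fun _ => true, fun _ => false,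
        consSeq true fun _ => false, consSeq false fun _ => true]
        (left_mem_Icc.2 (hΓ.lo_lt_hi 2).le)
      obtain ⟨x, hx'⟩ := hΓ.gap_superpose hf hR hu fun x => by
        rw [beyond, hg _ (by cases x <;> simp)]
        exact lt_of_le_of_ne (hx x) (hz x)
      refine ⟨x, ?_⟩
      rw [beyond, hg _ (by cases x <;> simp)] at hx'
      exact hx'

end IsBlenderHorseshoe

end

section

/-! ### Differentiability of invariant graphs -/

section Chords

variable {ι κ E F A : Type*} [NormedAddCommGroup E] [NormedSpace ℝ E] [NormedAddCommGroup F]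
  [NormedSpace ℝ F] [NormedAddCommGroup A] [NormedSpace ℝ A]

lemma tendsto_smul_of_approx {k : Filter κ} {P : κ → E} {Q : κ → F} {L : E →L[ℝ] F} {ρ : κ → ℝ}
    {w : E} (h : ∀ η > 0, ∀ᶠ j in k, ‖Q j - L (P j)‖ ≤ η * ‖P j‖)
    (hw : Tendsto (fun j => ρ j • P j) k (𝓝 w)) : Tendsto (fun j => ρ j • Q j) k (𝓝 (L w)) := by
  have h1 : Tendsto (fun j => ρ j • Q j - L (ρ j • P j)) k (𝓝 0) := by
    refine Metric.tendsto_nhds.2 fun ε hε => ?_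
    have h2 : ∀ᶠ j in k, ‖ρ j • P j‖ < ‖w‖ + 1 := hw.norm.eventually (gt_mem_nhds (by linarith))
    have h3 : 0 < ‖w‖ + 1 := by positivity
    filter_upwards [h (ε / (‖w‖ + 1)) (by positivity), h2] with j h4 h5
    rw [dist_zero_right, map_smul, ← smul_sub, norm_smul]
    calc ‖ρ j‖ * ‖Q j - L (P j)‖ ≤ ‖ρ j‖ * (ε / (‖w‖ + 1) * ‖P j‖) := by gcongr
      _ = ε / (‖w‖ + 1) * ‖ρ j • P j‖ := by rw [norm_smul]; ring
      _ < ε / (‖w‖ + 1) * (‖w‖ + 1) := by gcongr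
      _ = ε := by field_simp
  have h2 := h1.add ((L.continuous.tendsto w).comp hw)
  simpa using h2

lemma C1At.tendsto_smul {l : Filter ι} {f : ι → E → F} {g : E → F} {x : E} (h : C1At l f g x)
    {k : Filter κ} {i : κ → ι} {p q : κ → E} (hi : Tendsto i k l) (hp : Tendsto p k (𝓝 x))
    (hq : Tendsto q k (𝓝 x)) {ρ : κ → ℝ} {w : E}
    (hw : Tendsto (fun j => ρ j • (p j - q j)) k (𝓝 w)) :
    Tendsto (fun j => ρ j • (f (i j) (p j) - f (i j) (q j))) k (𝓝 (fderiv ℝ g x w)) :=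
  tendsto_smul_of_approx (fun _ hη => (hi.prodMk (hp.prodMk hq)).eventually (h.chord hη)) hw

lemma C1At.of_chord {l : Filter ι} {f : ι → E → F} {g : E → F} {x : E} {L : E →L[ℝ] F}
    (hd : ∀ᶠ p in l ×ˢ 𝓝 x, DifferentiableAt ℝ (f p.1) p.2) (hv : Tendsto (fun p : ι × E =>
      f p.1 p.2) (l ×ˢ 𝓝 x) (𝓝 (g x))) (hg : HasFDerivAt g L x)
    (h : ∀ η > 0, ∀ᶠ p in l ×ˢ (𝓝 x ×ˢ 𝓝 x),
      ‖f p.1 p.2.1 - f p.1 p.2.2 - L (p.2.1 - p.2.2)‖ ≤ η * ‖p.2.1 - p.2.2‖) : C1At l f g x := by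
  refine ⟨hd, hv, hg.fderiv ▸ Metric.tendsto_nhds.2 fun ε hε => ?_⟩
  obtain ⟨s, hs, t, ht, hst⟩ := Filter.mem_prod_iff.1 (h (ε / 2) (by positivity))
  obtain ⟨t1, h1, t2, h2, ht'⟩ := Filter.mem_prod_iff.1 ht
  filter_upwards [prod_mem_prod hs (eventually_eventually_nhds.2 (inter_mem h1 h2)), hd] with p hp hdp
  obtain ⟨hps, hpt⟩ := hp
  have h3 := hdp.hasFDerivAt.sub L.hasFDerivAt
  have h4 := h3.le_of_lip' (C := ε / 2) (by positivity) (by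
    filter_upwards [hpt] with y hy
    have := @hst (p.1, y, p.2) ⟨hps, ht' ⟨hy.1, (mem_of_mem_nhds hpt).2⟩⟩
    simp only [mem_ofPred_eq, map_sub] at this
    simp only [Pi.sub_apply]
    rwa [show f p.1 y - L y - (f p.1 p.2 - L p.2) = f p.1 y - f p.1 p.2 - (L y - L p.2) by abel])
  rw [dist_eq_norm]
  linarith

lemma C1At.contDiffAt {g : E → F} {x : E} (h : ∀ᶠ y in 𝓝 x, DifferentiableAt ℝ g y)
    (h' : ∀ᶠ y in 𝓝 x, C1At (pure ()) (fun _ : Unit => g) g y) : ContDiffAt ℝ 1 g x := by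
  rw [contDiffAt_one_iff]
  refine ⟨fderiv ℝ g, _, h.and h', fun y hy => ContinuousAt.continuousWithinAt ?_,
    fun y hy => hy.1.hasFDerivAt⟩
  have := hy.2.deriv.comp ((tendsto_pure_pure (fun _ : Unit => ()) ()).comp
    (tendsto_const_pure (a := 𝓝 y)) |>.prodMk tendsto_id)
  exact this

/-- A family of Lipschitz sections `w` of a linear projection `π` is strictly differentiable if the
limits of its chords lie in a linear complement of the kernel of `π`. -/
lemma exists_strict_of_chords [FiniteDimensional ℝ E] {l : Filter ι} [l.NeBot]
    {w : ι → A → E} {π : E →L[ℝ] A} {O : Set A} {a0 : A} (hO : O ∈ 𝓝 a0) {C : ℝ}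
    (hπ : ∀ᶠ i in l, ∀ a ∈ O, π (w i a) = a)
    (hC : ∀ᶠ i in l, ∀ a ∈ O, ∀ a' ∈ O, ‖w i a - w i a'‖ ≤ C * ‖a - a'‖) (V : Submodule ℝ E)
    (hV : ∀ v ∈ V, π v = 0 → v = 0)
    (hlim : ∀ U : Ultrafilter (ι × A × A), (U : Filter (ι × A × A)) ≤ l ×ˢ (𝓝 a0 ×ˢ 𝓝 a0) →
      ∀ (ρ : ι × A × A → ℝ) v, (∀ᶠ p in (U : Filter (ι × A × A)), p.2.1 ≠ p.2.2 ∧ ρ p = ‖p.2.1 - p.2.2‖⁻¹) →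
      Tendsto (fun p => ρ p • (w p.1 p.2.1 - w p.1 p.2.2)) U (𝓝 v) → v ∈ V) :
    ∃ L : A →L[ℝ] E, (∀ e, L e ∈ V ∧ π (L e) = e) ∧ ∀ η > 0, ∀ᶠ p in l ×ˢ (𝓝 a0 ×ˢ 𝓝 a0),
      ‖w p.1 p.2.1 - w p.1 p.2.2 - L (p.2.1 - p.2.2)‖ ≤ η * ‖p.2.1 - p.2.2‖ := by
  have key : ∀ U : Ultrafilter (ι × A × A), (U : Filter (ι × A × A)) ≤ l ×ˢ (𝓝 a0 ×ˢ 𝓝 a0) →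
      (∀ᶠ p in (U : Filter (ι × A × A)), p.2.1 ≠ p.2.2) →
      ∃ v ∈ V, Tendsto (fun p : ι × A × A => ‖p.2.1 - p.2.2‖⁻¹ • (w p.1 p.2.1 - w p.1 p.2.2)) U (𝓝 v) ∧
        Tendsto (fun p : ι × A × A => ‖p.2.1 - p.2.2‖⁻¹ • (p.2.1 - p.2.2)) U (𝓝 (π v)) := by
    intro U hj hne
    have hev : ∀ᶠ p in l ×ˢ (𝓝 a0 ×ˢ 𝓝 a0), (∀ a ∈ O, π (w p.1 a) = a) ∧ (∀ a ∈ O, ∀ a' ∈ O,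
        ‖w p.1 a - w p.1 a'‖ ≤ C * ‖a - a'‖) ∧ p.2.1 ∈ O ∧ p.2.2 ∈ O :=
      (tendsto_fst.eventually hπ).and ((tendsto_fst.eventually hC).and
        ((tendsto_fst.comp tendsto_snd |>.eventually hO).and
          (tendsto_snd.comp tendsto_snd |>.eventually hO)))
    have hev' := hev.filter_mono hj
    obtain ⟨v, -, hv⟩ := exists_tendsto_of_compact (isCompact_closedBall (0 : E) C) U
      (p := fun p => ‖p.2.1 - p.2.2‖⁻¹ • (w p.1 p.2.1 - w p.1 p.2.2)) (by
        filter_upwards [hev', hne] with k h1 h2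
        rw [mem_closedBall_zero_iff, norm_smul, norm_inv, norm_norm,
          inv_mul_le_iff₀ (norm_sub_pos_iff.2 h2), mul_comm]
        exact h1.2.1 _ h1.2.2.1 _ h1.2.2.2)
    refine ⟨v, hlim U hj _ v (hne.mono fun p hp => ⟨hp, rfl⟩) hv, hv, ?_⟩
    refine ((π.continuous.tendsto v).comp hv).congr' ?_
    filter_upwards [hev'] with k h1
    simp [h1.1 _ h1.2.2.1, h1.1 _ h1.2.2.2]
  have hsurj : Function.Surjective (π.toLinearMap.domRestrict V) := by
    intro e
    by_cases he : e = 0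
    · exact ⟨0, by simp [he]⟩
    have hpos := norm_pos_iff.2 he
    set U := Ultrafilter.of (l ×ˢ 𝓝[>] (0 : ℝ))
    have hU : (U : Filter (ι × ℝ)) ≤ l ×ˢ 𝓝[>] (0 : ℝ) := Ultrafilter.of_le _
    have h0 : Tendsto (fun k : ι × ℝ => k.2) U (𝓝[>] 0) := tendsto_snd.mono_left hU
    have ht : ∀ᶠ k in (U : Filter (ι × ℝ)), 0 < k.2 := h0.eventually self_mem_nhdsWithin
    obtain ⟨v, hv, -, h2⟩ := key (U.map fun k => (k.1, a0 + k.2 • e, a0)) (by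
      change Tendsto _ _ _
      refine (tendsto_fst.mono_left hU).prodMk (Tendsto.prodMk ?_ tendsto_const_nhds)
      have : Tendsto (fun t : ℝ => a0 + t • e) (𝓝 0) (𝓝 (a0 + (0 : ℝ) • e)) :=
        Continuous.tendsto (by fun_prop) 0
      rw [zero_smul, add_zero] at this
      exact this.comp (h0.mono_right nhdsWithin_le_nhds)) (by
      rw [Ultrafilter.coe_map, eventually_map]
      filter_upwards [ht] with k hk
      simp [hk.ne', he])
    rw [Ultrafilter.coe_map, tendsto_map'_iff] at h2
    have h3 : π v = ‖e‖⁻¹ • e := by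
      refine tendsto_nhds_unique h2 (tendsto_const_nhds.congr' ?_)
      filter_upwards [ht] with k hk
      simp only [Function.comp_apply, add_sub_cancel_left, norm_smul, Real.norm_eq_abs, abs_of_pos hk, smul_smul]
      congr 1
      field_simp
    refine ⟨‖e‖ • ⟨v, hv⟩, ?_⟩
    simp [LinearMap.domRestrict_apply, h3, smul_smul, hpos.ne']
  have hinj : Function.Injective (π.toLinearMap.domRestrict V) := by
    rw [← LinearMap.ker_eq_bot, LinearMap.ker_eq_bot']
    exact fun v hv => Subtype.ext (hV v v.2 hv)
  let T := LinearEquiv.ofBijective _ ⟨hinj, hsurj⟩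
  haveI : FiniteDimensional ℝ A := T.finiteDimensional
  let L : A →L[ℝ] E := LinearMap.toContinuousLinearMap (V.subtype ∘ₗ T.symm.toLinearMap)
  have hL : ∀ e, L e ∈ V ∧ π (L e) = e := fun e => ⟨(T.symm e).2, T.apply_symm_apply e⟩
  refine ⟨L, hL, fun η hη => ?_⟩
  by_contra hcon
  rw [not_eventually] at hcon
  have := frequently_iff_neBot.1 hcon
  set U := Ultrafilter.of ((l ×ˢ (𝓝 a0 ×ˢ 𝓝 a0)) ⊓ 𝓟 {p : ι × A × A |
    ¬ ‖w p.1 p.2.1 - w p.1 p.2.2 - L (p.2.1 - p.2.2)‖ ≤ η * ‖p.2.1 - p.2.2‖})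
  have hU := Ultrafilter.of_le ((l ×ˢ (𝓝 a0 ×ˢ 𝓝 a0)) ⊓ 𝓟 {p : ι × A × A |
    ¬ ‖w p.1 p.2.1 - w p.1 p.2.2 - L (p.2.1 - p.2.2)‖ ≤ η * ‖p.2.1 - p.2.2‖})
  have hev : ∀ᶠ p in (U : Filter (ι × A × A)),
    ¬ ‖w p.1 p.2.1 - w p.1 p.2.2 - L (p.2.1 - p.2.2)‖ ≤ η * ‖p.2.1 - p.2.2‖ :=
      hU (mem_inf_of_right (mem_principal_self _))
  have hne : ∀ᶠ p in (U : Filter (ι × A × A)), p.2.1 ≠ p.2.2 := by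
    filter_upwards [hev] with p hp heq
    simp [heq] at hp
  obtain ⟨v, hv, h1, h2⟩ := key U (hU.trans inf_le_left) hne
  have hv' : L (π v) = v :=
    sub_eq_zero.1 (hV _ (V.sub_mem (hL _).1 hv) (by rw [map_sub, (hL _).2, sub_self]))
  have h3 := h1.sub ((L.continuous.tendsto _).comp h2)
  rw [hv', sub_self] at h3
  have h4 := h3.norm.eventually (gt_mem_nhds (show ‖(0 : E)‖ < η by simpa using hη))
  obtain ⟨p, hp, hp', hp''⟩ := (h4.and (hev.and hne)).exists
  apply hp'
  simp only [Function.comp_apply, map_smul, ← smul_sub, norm_smul, norm_inv, norm_norm] at hp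
  rw [inv_mul_lt_iff₀ (norm_sub_pos_iff.2 hp''), mul_comm] at hp
  exact hp.le

end Chords

end

/-! ### Stable directions -/

section

/-- `w` is annihilated by the derivatives at `q` of the local `C^1` equations of `S`. -/
def IsTangentTo (S : Set E3) (q w : E3) : Prop :=
  ∀ (O : Set E3) (h : E3 → ℝ), IsOpen O → q ∈ O → ContDiffOn ℝ 1 h O → (∀ x ∈ S ∩ O, h x = 0) →
    fderiv ℝ h q w = 0

lemma IsTangentTo.of_chords {κ : Type*} {k : Filter κ} [k.NeBot] {S : Set E3} {p p' : κ → E3}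
    {q w : E3} {ρ : κ → ℝ} (hp : Tendsto p k (𝓝 q)) (hp' : Tendsto p' k (𝓝 q))
    (hS : ∀ᶠ j in k, p j ∈ S ∧ p' j ∈ S)
    (hw : Tendsto (fun j => ρ j • (p j - p' j)) k (𝓝 w)) : IsTangentTo S q w := by
  intro O h hO hq hh h0
  have h1 := (C1At.const (l := pure ()) (hh.contDiffAt (hO.mem_nhds hq))).tendsto_smul
    (i := fun _ : κ => ()) tendsto_const_pure hp hp' hw
  refine tendsto_nhds_unique h1 (tendsto_const_nhds.congr' ?_)
  filter_upwards [hS, hp.eventually (hO.mem_nhds hq), hp'.eventually (hO.mem_nhds hq)] with j h2 h3 h4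
  simp [h0 _ ⟨h2.1, h3⟩, h0 _ ⟨h2.2, h4⟩]

lemma tendsto_clm_apply {κ E F : Type*} [NormedAddCommGroup E] [NormedSpace ℝ E]
    [NormedAddCommGroup F] [NormedSpace ℝ F] {k : Filter κ} {T : κ → E →L[ℝ] F} {T0 : E →L[ℝ] F}
    {v : κ → E} {v0 : E} (hT : Tendsto T k (𝓝 T0)) (hv : Tendsto v k (𝓝 v0)) :
    Tendsto (fun j => T j (v j)) k (𝓝 (T0 v0)) :=
  (isBoundedBilinearMap_apply.continuous.tendsto (T0, v0)).comp (hT.prodMk_nhds hv)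

lemma IsTangentTo.of_tendsto {κ : Type*} {k : Filter κ} [k.NeBot] {S : Set E3} {q w : κ → E3}
    {q0 w0 : E3} (hq : Tendsto q k (𝓝 q0)) (hw : Tendsto w k (𝓝 w0))
    (h : ∀ᶠ j in k, IsTangentTo S (q j) (w j)) : IsTangentTo S q0 w0 := by
  intro O f hO hqO hf h0
  have h1 := ((hf.contDiffAt (hO.mem_nhds hqO)).continuousAt_fderiv (by simp)).tendsto.comp hq
  have h2 := tendsto_clm_apply h1 hw
  refine tendsto_nhds_unique h2 (tendsto_const_nhds.congr' ?_)
  filter_upwards [h, hq.eventually (hO.mem_nhds hqO)] with j h3 h4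
  exact (h3 O f hO h4 hf h0).symm

/-- The maps and their derivatives respect the cone fields. -/
def ConeSmooth (a d c : ℝ) (H : E3 → E3) (K : Set E3) : Prop :=
  ∀ p ∈ K, ContDiffAt ℝ 1 H p ∧ ∀ v, ConeRel a d c v (fderiv ℝ H p v)

lemma contDiffAt_iterate_comp (hG : ConeSmooth a d c G (X false ∪ X true)) {p : E3}
    (hH : ContDiffAt ℝ 1 H p) {n : ℕ} (hp : ∀ k < n, G^[k] (H p) ∈ X false ∪ X true) :
    ContDiffAt ℝ 1 (fun x => G^[n] (H x)) p := by
  induction n with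
  | zero => exact hH
  | succ n ih =>
    have h1 := ih fun k hk => hp k (hk.trans n.lt_succ_self)
    simp only [Function.iterate_succ_apply']
    exact (hG _ (hp n n.lt_succ_self)).1.comp p h1

lemma fderiv_iterate_comp (hG : ConeSmooth a d c G (X false ∪ X true)) {p : E3}
    (hH : ContDiffAt ℝ 1 H p) {n : ℕ} (hp : ∀ k < n + 1, G^[k] (H p) ∈ X false ∪ X true) (v : E3) :
    fderiv ℝ (fun x => G^[n + 1] (H x)) p v =
      fderiv ℝ G (G^[n] (H p)) (fderiv ℝ (fun x => G^[n] (H x)) p v) := by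
  have h1 := contDiffAt_iterate_comp hG hH (n := n) fun k hk => hp k (hk.trans n.lt_succ_self)
  have h2 := (hG _ (hp n n.lt_succ_self)).1
  have := fderiv_comp p (h2.differentiableAt (by simp)) (h1.differentiableAt (by simp))
  simp only [Function.iterate_succ_apply']
  exact congrArg (fun T => T v) this

lemma fderiv_iterate_mem_stableCone (hG : ConeSmooth a d c G (X false ∪ X true)) {p v : E3}
    (hH : ContDiffAt ℝ 1 H p) {n : ℕ} (hp : ∀ k < n, G^[k] (H p) ∈ X false ∪ X true)
    (hv : fderiv ℝ (fun x => G^[n] (H x)) p v ∈ stableCone d) {k : ℕ} (hk : k ≤ n) :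
    fderiv ℝ (fun x => G^[k] (H x)) p v ∈ stableCone d := by
  induction n with
  | zero => rwa [Nat.le_zero.1 hk]
  | succ n ih =>
    rcases hk.eq_or_lt with rfl | hk'
    · exact hv
    rw [fderiv_iterate_comp hG hH hp] at hv
    exact ih (fun k hk => hp k (hk.trans n.lt_succ_self))
      (((hG _ (hp n n.lt_succ_self)).2 _).stable hv).1 (Nat.le_of_lt_succ hk')

lemma injOn_iterate_comp {K : Set E3} (hH : InjOn H K) (hG : InjOn G (X false ∪ X true)) (n : ℕ) :
    InjOn (fun p => G^[n] (H p)) {p | p ∈ K ∧ ∀ k < n, G^[k] (H p) ∈ X false ∪ X true} := by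
  induction n with
  | zero => exact hH.mono fun p hp => hp.1
  | succ n ih =>
    intro p hp q hq h
    simp only [Function.iterate_succ_apply'] at h
    exact ih ⟨hp.1, fun k hk => hp.2 k (hk.trans n.lt_succ_self)⟩
      ⟨hq.1, fun k hk => hq.2 k (hk.trans n.lt_succ_self)⟩
      (hG (hp.2 n n.lt_succ_self) (hq.2 n n.lt_succ_self) h)

lemma tendsto_iterate_mem {κ : Type*} {k : Filter κ} [k.NeBot] (hX : ∀ b, IsClosed (X b))
    (hG : ConeSmooth a d c G (X false ∪ X true)) {p : κ → E3} {q : E3} (hp : Tendsto p k (𝓝 q))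
    (hH : ContDiffAt ℝ 1 H q) {n : ℕ}
    (h : ∀ m < n, ∀ᶠ j in k, G^[m] (H (p j)) ∈ X false ∪ X true) :
    ∀ m < n, G^[m] (H q) ∈ X false ∪ X true := by
  intro m
  induction m using Nat.strong_induction_on with
  | _ m ih =>
    intro hm
    have h1 := contDiffAt_iterate_comp hG hH fun j hj => ih j hj (hj.trans hm)
    exact ((hX false).union (hX true)).mem_of_tendsto (h1.continuousAt.tendsto.comp hp) (h m hm)

/-- A surface covered by a tube of discs is tangent to a direction whose forward images remain in
the stable cone field. -/
lemma exists_stable_direction (hB : Blender lo hi a d G X)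
    (hG : ConeSmooth a d c G (X false ∪ X true)) {K S : Set E3} (hK : IsCompact K)
    (hH : ConeSmooth a d c H K) (hHinj : InjOn H K) {u : ℝ → ℝ → E3}
    (hdisj : ∀ t t', t ≠ t' → |t - t'| < 1 → ∀ z ∈ I2, ∀ z' ∈ I2,
      u t z ≠ u t' z') (hS : ∀ t, ∀ z ∈ I2, u t z ∈ S) {R : ℝ → E3 → Prop}
    (hRdef : ∀ t y, R t y ↔ ∃ z ∈ I2, u t z ∈ K ∧ y = H (u t z))
    (hR : IsTubeFamily lo hi d G X R ∨ IsFoldFamily lo hi d G X R) :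
    ∃ q ∈ K, ∃ (w : E3) (σ : ℕ → Bool), w ≠ 0 ∧ IsTangentTo S q w ∧
      ∀ k, G^[k] (H q) ∈ X (σ k) ∧ fderiv ℝ (fun x => G^[k] (H x)) q w ∈ stableCone d := by
  have hXc : ∀ b, IsClosed (X b) := fun b => (hB.compact b).isClosed
  have hstep : ∀ n : ℕ, ∃ q ∈ K, ∃ w : E3, ‖w‖ = 1 ∧ IsTangentTo S q w ∧
      (∀ k < n, G^[k] (H q) ∈ X false ∪ X true) ∧
      ∀ k ≤ n, fderiv ℝ (fun x => G^[k] (H x)) q w ∈ stableCone d := by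
    intro n
    let Q : ℕ → ℝ → E3 → Prop := fun n t y => ∃ z ∈ I2,
      (u t z ∈ K ∧ ∀ k < n, G^[k] (H (u t z)) ∈ X false ∪ X true) ∧ y = G^[n] (H (u t z))
    have hQ0 : Q 0 = R := by
      funext t y
      simp [Q, hRdef]
    obtain ⟨t0, ht0⟩ := Blender.exists_stable_chords hB (Blender.exists_family hB Q (by
      rintro m b t p ⟨z, hz, ⟨h1, h2⟩, rfl⟩ hp
      refine ⟨z, hz, ⟨h1, fun k hk => ?_⟩, (Function.iterate_succ_apply' _ _ _).symm⟩
      rcases (Nat.lt_succ_iff.1 hk).eq_or_lt with rfl | hk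
      · cases b
        · exact Or.inl hp
        · exact Or.inr hp
      · exact h2 k hk) (hQ0 ▸ hR) n)
    have hex : ∀ j : ℕ, ∃ p p', p ≠ p' ∧ (p ∈ S ∧ p' ∈ S) ∧
        (p ∈ K ∧ ∀ k < n, G^[k] (H p) ∈ X false ∪ X true) ∧
        (p' ∈ K ∧ ∀ k < n, G^[k] (H p') ∈ X false ∪ X true) ∧
        dist (G^[n] (H p)) (G^[n] (H p')) < 1 / ((j : ℝ) + 1) ∧
        G^[n] (H p) - G^[n] (H p') ∈ stableCone d := by
      intro j
      obtain ⟨t, t', h1, h2, -, -, y, y', ⟨z, hz, h3, rfl⟩, ⟨z', hz', h4, rfl⟩, h5, h6⟩ :=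
        ht0 (1 / ((j : ℝ) + 1)) (by positivity)
      exact ⟨_, _, hdisj t t' h1 h2 z hz z' hz', ⟨hS t z hz, hS t' z' hz'⟩, h3, h4, h5, h6⟩
    choose p p' hne hpS hpK hpK' hdist hcone using hex
    set U := Filter.hyperfilter ℕ
    have hU : (U : Filter ℕ) ≤ atTop := Nat.hyperfilter_le_atTop
    obtain ⟨q, hqK, hq⟩ := exists_tendsto_of_compact hK U (.of_forall fun j => (hpK j).1)
    obtain ⟨q', hqK', hq'⟩ := exists_tendsto_of_compact hK U (.of_forall fun j => (hpK' j).1)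
    have hm := tendsto_iterate_mem hXc hG hq (hH q hqK).1 (n := n)
      fun k hk => .of_forall fun j => (hpK j).2 k hk
    have hm' := tendsto_iterate_mem hXc hG hq' (hH q' hqK').1 (n := n)
      fun k hk => .of_forall fun j => (hpK' j).2 k hk
    have hF := contDiffAt_iterate_comp hG (hH q hqK).1 hm
    have hF' := contDiffAt_iterate_comp hG (hH q' hqK').1 hm'
    have heq : G^[n] (H q) = G^[n] (H q') := by
      refine dist_le_zero.1 (le_of_tendsto_of_tendsto ((hF.continuousAt.tendsto.comp hq).dist
        (hF'.continuousAt.tendsto.comp hq')) (tendsto_one_div_add_atTop_nhds_zero_nat.mono_left hU)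
        (.of_forall fun j => (hdist j).le))
    obtain rfl : q = q' := injOn_iterate_comp hHinj hB.inj n ⟨hqK, hm⟩ ⟨hqK', hm'⟩ heq
    obtain ⟨w, hw, hlim⟩ := exists_tendsto_of_compact (isCompact_sphere (0 : E3) 1) U
      (p := fun j => ‖p j - p' j‖⁻¹ • (p j - p' j)) (.of_forall fun j => by
        rw [mem_sphere_zero_iff_norm]
        exact norm_smul_inv_norm (𝕜 := ℝ) (sub_ne_zero.2 (hne j)))
    refine ⟨q, hqK, w, mem_sphere_zero_iff_norm.1 hw,
      IsTangentTo.of_chords hq hq' (.of_forall hpS) hlim, hm, fun k hk => ?_⟩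
    refine fderiv_iterate_mem_stableCone hG (hH q hqK).1 hm ?_ hk
    refine (isClosed_stableCone d).mem_of_tendsto ((C1At.const (l := pure ()) hF).tendsto_smul
      (i := fun _ : ℕ => ()) tendsto_const_pure hq hq' hlim) (.of_forall fun j => ?_)
    exact smul_mem_stableCone (hcone j)
  choose q hqK w hw hqS hqX hqd using hstep
  set U := Filter.hyperfilter ℕ
  have hU : (U : Filter ℕ) ≤ atTop := Nat.hyperfilter_le_atTop
  obtain ⟨q0, hq0, hq⟩ := exists_tendsto_of_compact hK U (.of_forall hqK)
  obtain ⟨w0, hw0, hwl⟩ := exists_tendsto_of_compact (isCompact_sphere (0 : E3) 1) U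
    (.of_forall fun n => mem_sphere_zero_iff_norm.2 (hw n))
  have hm : ∀ k, G^[k] (H q0) ∈ X false ∪ X true := fun k =>
    tendsto_iterate_mem hXc hG hq (hH q0 hq0).1 (n := k + 1)
      (fun m _ => ((eventually_gt_atTop m).filter_mono hU).mono fun n hn => hqX n m hn) k
        k.lt_succ_self
  have hσ : ∀ k, ∃ b, G^[k] (H q0) ∈ X b := fun k => (hm k).elim (fun h => ⟨_, h⟩) fun h => ⟨_, h⟩
  choose σ hσ using hσ
  refine ⟨q0, hq0, w0, σ, norm_ne_zero_iff.1 (by simp [mem_sphere_zero_iff_norm.1 hw0]),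
    IsTangentTo.of_tendsto hq hwl (.of_forall hqS), fun k => ⟨hσ k, ?_⟩⟩
  have h1 := contDiffAt_iterate_comp hG (hH q0 hq0).1 (n := k) fun j _ => hm j
  exact (isClosed_stableCone d).mem_of_tendsto
    (tendsto_clm_apply ((h1.continuousAt_fderiv (by simp)).tendsto.comp hq) hwl)
    (((eventually_ge_atTop k).filter_mono hU).mono fun n hn => hqd n k hn)

end

/-! ### Tangent curves -/

section

lemma fderiv_iterate_succ (hG : ConeSmooth a d c G (X false ∪ X true)) {p : E3}
    (hp : ∀ k, G^[k] p ∈ X false ∪ X true) (k : ℕ) (v : E3) : fderiv ℝ (fun x => G^[k + 1] x) p v =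
      fderiv ℝ G (G^[k] p) (fderiv ℝ (fun x => G^[k] x) p v) :=
  fderiv_iterate_comp (H := id) hG contDiffAt_id (fun j _ => hp j) v

lemma iterate_unstable (hG : ConeSmooth a d c G (X false ∪ X true)) (hc : 1 < c) {p v : E3}
    (hp : ∀ k, G^[k] p ∈ X false ∪ X true) (hv : v ∈ unstableCone d) (k : ℕ) :
    fderiv ℝ (fun x => G^[k] x) p v ∈ unstableCone d ∧
      c ^ k * ‖v‖ ≤ ‖fderiv ℝ (fun x => G^[k] x) p v‖ := by
  induction k with
  | zero => simpa using hv
  | succ k ih =>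
    rw [fderiv_iterate_succ hG hp]
    have := ((hG _ (hp k)).2 _).unstable ih.1
    refine ⟨this.1, le_trans ?_ this.2⟩
    rw [pow_succ', mul_assoc]
    exact mul_le_mul_of_nonneg_left ih.2 (by linarith)

lemma iterate_stable (hG : ConeSmooth a d c G (X false ∪ X true)) (hc : 1 < c) {p v : E3}
    (hp : ∀ k, G^[k] p ∈ X false ∪ X true)
    (hv : ∀ k, fderiv ℝ (fun x => G^[k] x) p v ∈ stableCone d) (k : ℕ) :
    ‖fderiv ℝ (fun x => G^[k] x) p v‖ ≤ ‖v‖ := by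
  induction k with
  | zero => simp
  | succ k ih =>
    have h1 := hv (k + 1)
    rw [fderiv_iterate_succ hG hp] at h1 ⊢
    have := (((hG _ (hp k)).2 _).stable h1).2
    nlinarith [norm_nonneg (fderiv ℝ G (G^[k] p) (fderiv ℝ (fun x => G^[k] x) p v))]

lemma Horseshoe.itin_shift (hB : Horseshoe lo hi a d G X) (σ : ℕ → Bool) (hs : s ∈ I0) (k : ℕ) :
    ∃ t ∈ I0, G^[k] (itin G X σ s) = itin G X (fun j => σ (k + j)) t := by
  have h1 := (hB.itin_spec σ hs).2
  refine ⟨_, hB.iterate_mem_cbox h1 k 0, (hB.itin_eq fun j => ?_).symm⟩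
  rw [← Function.iterate_add_apply, add_comm]
  exact h1 _

lemma Horseshoe.contDiffAt_itin (hB : Horseshoe lo hi a d G X)
    (hG : ConeSmooth a d c G (X false ∪ X true)) (hc : 1 < c) (σ : ℕ → Bool)
    (hs : s ∈ Ioo (lo 0) (hi 0)) : ContDiffAt ℝ 1 (itin G X σ) s ∧
      ∀ v, (∀ k, fderiv ℝ (fun x => G^[k] x) (itin G X σ s) v ∈ stableCone d) →
        fderiv ℝ (itin G X σ) s (v 0) = v := by
  have hX : ∀ {s}, s ∈ Ioo (lo 0) (hi 0) → ∀ k, G^[k] (itin G X σ s) ∈ X false ∪ X true := by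
    intro s hs k
    have := (hB.itin_spec σ (Ioo_subset_Icc_self hs)).2 k
    cases h : σ k <;> rw [h] at this
    exacts [Or.inl this, Or.inr this]
  let V : ℝ → Submodule ℝ E3 := fun s =>
    { carrier := {v | ∃ C, ∀ k, ‖fderiv ℝ (fun x => G^[k] x) (itin G X σ s) v‖ ≤ C}
      zero_mem' := ⟨0, by simp⟩
      add_mem' := by
        rintro v w ⟨C, hC⟩ ⟨C', hC'⟩
        refine ⟨C + C', fun k => ?_⟩
        rw [map_add]
        exact (norm_add_le _ _).trans (add_le_add (hC k) (hC' k))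
      smul_mem' := by
        rintro r v ⟨C, hC⟩
        refine ⟨‖r‖ * C, fun k => ?_⟩
        rw [map_smul, norm_smul]
        exact mul_le_mul_of_nonneg_left (hC k) (norm_nonneg r) }
  have hV : ∀ {s}, s ∈ Ioo (lo 0) (hi 0) → ∀ v ∈ V s, v 0 = 0 → v = 0 := by
    rintro s hs v ⟨C, hC⟩ h0
    by_contra hv
    have h1 := iterate_unstable hG hc (hX hs) (mem_unstableCone_of_zero hB.d_pos.le h0)
    obtain ⟨k, hk⟩ := pow_unbounded_of_one_lt (C / ‖v‖) hc
    rw [div_lt_iff₀ (norm_pos_iff.2 hv)] at hk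
    exact (hk.trans_le ((h1 k).2.trans (hC k))).false
  have hW : ∀ {s}, s ∈ Ioo (lo 0) (hi 0) → I0 ∈ 𝓝 s := fun hs => Icc_mem_nhds hs.1 hs.2
  have key : ∀ {s}, s ∈ Ioo (lo 0) (hi 0) → ∃ L : ℝ →L[ℝ] E3,
      (∀ e, L e ∈ V s ∧ (L e) 0 = e) ∧ ∀ η > 0, ∀ᶠ p in pure () ×ˢ (𝓝 s ×ˢ 𝓝 s),
      ‖itin G X σ p.2.1 - itin G X σ p.2.2 - L (p.2.1 - p.2.2)‖ ≤ η * ‖p.2.1 - p.2.2‖ := by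
    intro s hs
    refine exists_strict_of_chords (l := pure ()) (w := fun _ : Unit => itin G X σ)
      (π := EuclideanSpace.proj 0) (hW hs) (C := 1 + d)
      (.of_forall fun _ a ha => (hB.itin_spec σ ha).1)
      (.of_forall fun _ a ha a' ha' => (hB.isSGraph_itin σ).norm_sub_le ha ha')
      (V s) (hV hs) fun U hU ρ v _ hv => ?_
    have h2 : Tendsto (fun p : Unit × ℝ × ℝ => p.2) U (𝓝 s ×ˢ 𝓝 s) := tendsto_snd.mono_left hU
    have hc : ContinuousAt (itin G X σ) s := (hB.isSGraph_itin σ).continuousOn.continuousAt (hW hs)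
    have hst : ∀ k, fderiv ℝ (fun x => G^[k] x) (itin G X σ s) v ∈ stableCone d := by
      intro k
      have hk := contDiffAt_iterate_comp (H := id) hG contDiffAt_id (n := k) fun j _ => hX hs j
      refine (isClosed_stableCone d).mem_of_tendsto ((C1At.const (l := pure ()) hk).tendsto_smul
        (i := fun _ => ()) tendsto_const_pure (hc.tendsto.comp (tendsto_fst.comp h2))
        (hc.tendsto.comp (tendsto_snd.comp h2)) hv) ?_
      filter_upwards [(tendsto_fst.comp h2).eventually (hW hs),
        (tendsto_snd.comp h2).eventually (hW hs)] with p h3 h4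
      refine smul_mem_stableCone ?_
      obtain ⟨t, ht, e⟩ := hB.itin_shift σ h3 k
      obtain ⟨t', ht', e'⟩ := hB.itin_shift σ h4 k
      simp only [Function.comp_apply, id] at e e' ⊢
      rw [e, e']
      exact (hB.isSGraph_itin _).chord t ht t' ht'
    exact ⟨‖v‖, iterate_stable hG ‹1 < c› (hX hs) hst⟩
  have hder : ∀ {s}, s ∈ Ioo (lo 0) (hi 0) → ∀ {L : ℝ →L[ℝ] E3}, (∀ η > 0,
      ∀ᶠ p in pure () ×ˢ (𝓝 s ×ˢ 𝓝 s),
      ‖itin G X σ p.2.1 - itin G X σ p.2.2 - L (p.2.1 - p.2.2)‖ ≤ η * ‖p.2.1 - p.2.2‖) →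
      HasFDerivAt (itin G X σ) L s := by
    intro s hs L hL
    refine HasStrictFDerivAt.hasFDerivAt (hasStrictFDerivAt_iff_isLittleO.2
      (Asymptotics.isLittleO_iff.2 fun η hη => ?_))
    have := ((tendsto_const_pure (a := 𝓝 (s, s)) (b := ())).prodMk
      (show Tendsto id (𝓝 (s, s)) (𝓝 s ×ˢ 𝓝 s) from nhds_prod_eq.le)).eventually (hL η hη)
    exact this
  have hev := fun {s : ℝ} (hs : s ∈ Ioo (lo 0) (hi 0)) => isOpen_Ioo.eventually_mem hs
  have hdiff : ∀ {s}, s ∈ Ioo (lo 0) (hi 0) → ∀ᶠ t in 𝓝 s, DifferentiableAt ℝ (itin G X σ) t :=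
    fun hs => (hev hs).mono fun t ht => (hder ht (key ht).choose_spec.2).differentiableAt
  refine ⟨C1At.contDiffAt (hdiff hs) ((hev hs).mono fun t ht => ?_), fun v hv => ?_⟩
  · exact C1At.of_chord (tendsto_snd.eventually (hdiff ht))
      (((hdiff ht).self_of_nhds.continuousAt.tendsto).comp tendsto_snd)
      (hder ht (key ht).choose_spec.2) (key ht).choose_spec.2
  · obtain ⟨L, hL, h2⟩ := key hs
    rw [(hder hs h2).fderiv]
    refine sub_eq_zero.1 (hV hs _ ((V s).sub_mem (hL _).1 ⟨‖v‖, iterate_stable hG hc (hX hs) hv⟩) ?_)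
    simp [(hL _).2]

lemma exists_curve_of_equation {E : Type*} [NormedAddCommGroup E] [NormedSpace ℝ E]
    [CompleteSpace E] {O : Set E} {h : E → ℝ} {q w : E} (hO : IsOpen O) (hq : q ∈ O)
    (hh : ContDiffOn ℝ 1 h O) (h0 : h q = 0) (hd : fderiv ℝ h q ≠ 0) (hw : fderiv ℝ h q w = 0) :
    ∃ γ : ℝ → E, γ 0 = q ∧ ContDiffAt ℝ 1 γ 0 ∧ HasDerivAt γ w 0 ∧ ∀ᶠ τ in 𝓝 0, h (γ τ) = 0 := by
  obtain ⟨e, he⟩ : ∃ e, fderiv ℝ h q e = 1 := by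
    obtain ⟨e, he⟩ : ∃ e, fderiv ℝ h q e ≠ 0 := by
      by_contra! hcon
      exact hd (ContinuousLinearMap.ext hcon)
    exact ⟨(fderiv ℝ h q e)⁻¹ • e, by simp [he]⟩
  set T := fderiv ℝ h q
  have hha := hh.contDiffAt (hO.mem_nhds hq)
  set Φ : E → E := fun p => p + (h p - T (p - q)) • e
  have hΦ : ContDiffAt ℝ 1 Φ q := contDiffAt_id.add ((hha.sub
    (T.contDiff.contDiffAt.comp q (contDiffAt_id.sub contDiffAt_const))).smul contDiffAt_const)
  have hd' : HasFDerivAt Φ ((ContinuousLinearEquiv.refl ℝ E : E ≃L[ℝ] E) : E →L[ℝ] E) q := by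
    have h1 := (hha.differentiableAt (by simp)).hasFDerivAt
    have h2 := (hasFDerivAt_id (𝕜 := ℝ) q).add ((h1.sub (T.hasFDerivAt.comp q
      ((hasFDerivAt_id (𝕜 := ℝ) q).sub_const q))).smul_const e)
    refine h2.congr_fderiv ?_
    ext v : 1
    simp [T]
  have hΦq : Φ q = q := by simp [Φ, h0]
  set Ψ := hΦ.localInverse hd' one_ne_zero
  have hs := hΦ.hasStrictFDerivAt' hd' one_ne_zero
  have hΨ : ContDiffAt ℝ 1 Ψ q := hΦq ▸ hΦ.to_localInverse hd' one_ne_zero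
  have hΨq : Ψ q = q := by
    have := hs.localInverse_apply_image
    rwa [hΦq] at this
  have hΨd : HasFDerivAt Ψ (ContinuousLinearMap.id ℝ E) q := by
    have := hs.to_localInverse.hasFDerivAt
    rwa [hΦq] at this
  have hΨr : ∀ᶠ y in 𝓝 q, Φ (Ψ y) = y := hΦq ▸ hs.eventually_right_inverse
  have hc : ContDiff ℝ 1 fun τ : ℝ => q + τ • w := by fun_prop
  have hcd : HasDerivAt (fun τ : ℝ => q + τ • w) w 0 := by
    simpa using ((hasDerivAt_id (0 : ℝ)).smul_const w).const_add q
  have hc0 : q + (0 : ℝ) • w = q := by simp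
  have hct : Tendsto (fun τ : ℝ => q + τ • w) (𝓝 0) (𝓝 q) := by simpa using hc.continuous.tendsto 0
  refine ⟨fun τ => Ψ (q + τ • w), by simp [hΨq], ContDiffAt.comp (0 : ℝ) (by rwa [hc0])
    hc.contDiffAt, ?_, ?_⟩
  · have h1 : HasFDerivAt Ψ (ContinuousLinearMap.id ℝ E) (q + (0 : ℝ) • w) := by rwa [hc0]
    exact h1.comp_hasDerivAt 0 hcd
  · filter_upwards [hct.eventually hΨr] with τ hτ
    have h1 := congrArg (fun x => T (x - q)) hτ
    simp only [Φ, add_sub_right_comm _ _ q, sub_self, map_zero, map_add, map_smul, add_sub_cancel_left, hw, he,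
      smul_eq_mul, mul_one, mul_zero] at h1
    linarith

/-- A surface that is locally the part of a regular level set in the strip over the box. -/
def IsStripSurface (lo hi : Fin 3 → ℝ) (S : Set E3) : Prop :=
  ∀ p ∈ S, ∃ (O : Set E3) (h : E3 → ℝ), IsOpen O ∧ p ∈ O ∧ ContDiffOn ℝ 1 h O ∧
    (∀ q ∈ O, fderiv ℝ h q ≠ 0) ∧ S ∩ O = {q ∈ O | q 2 ∈ Icc (lo 2) (hi 2) ∧ h q = 0}

lemma IsStripSurface.exists_curve {S : Set E3} (hS : IsStripSurface lo hi S) {q w : E3}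
    (hq : q ∈ S) (h2 : q 2 ∈ Ioo (lo 2) (hi 2)) (hw : IsTangentTo S q w) :
    ∃ γ : ℝ → E3, γ 0 = q ∧ ContDiffAt ℝ 1 γ 0 ∧ HasDerivAt γ w 0 ∧ ∀ᶠ τ in 𝓝 0, γ τ ∈ S := by
  obtain ⟨O, h, hO, hqO, hh, hd, hSO⟩ := hS q hq
  have hz : ∀ x ∈ S ∩ O, h x = 0 := fun x hx => by
    rw [hSO] at hx
    exact hx.2.2
  obtain ⟨γ, h0, h1, h3, h4⟩ := exists_curve_of_equation hO hqO hh (hz q ⟨hq, hqO⟩) (hd q hqO)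
    (hw O h hO hqO hh hz)
  refine ⟨γ, h0, h1, h3, ?_⟩
  have hc : Tendsto γ (𝓝 0) (𝓝 q) := h0 ▸ h1.continuousAt.tendsto
  filter_upwards [h4, hc.eventually (hO.mem_nhds hqO),
    (((continuous_coord 2).tendsto q).comp hc).eventually (isOpen_Ioo.mem_nhds h2)] with τ h5 h6 h7
  have : γ τ ∈ S ∩ O := hSO ▸ ⟨h6, Ioo_subset_Icc_self h7, h5⟩
  exact this.1

lemma IsStripSurface.mem_Ioo {S : Set E3} (hS : IsStripSurface lo hi S) (hSb : S ⊆ Box)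
    {q w : E3} (hq : q ∈ S) (h2 : q 2 ∈ Ioo (lo 2) (hi 2)) (hw : IsTangentTo S q w)
    (hw0 : w 0 ≠ 0) : q 0 ∈ Ioo (lo 0) (hi 0) := by
  obtain ⟨γ, h0, -, h1, h3⟩ := hS.exists_curve hq h2 hw
  have h4 : HasDerivAt (fun τ => γ τ 0) (w 0) 0 :=
    (EuclideanSpace.proj (𝕜 := ℝ) (0 : Fin 3)).hasFDerivAt.comp_hasDerivAt 0 h1
  have h5 := hSb hq 0
  refine ⟨lt_of_le_of_ne h5.1 fun e => hw0 ?_, lt_of_le_of_ne h5.2 fun e => hw0 ?_⟩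
  · refine IsLocalMin.hasDerivAt_eq_zero (f := fun τ => γ τ 0) ?_ h4
    filter_upwards [h3] with τ hτ
    rw [h0, ← e]
    exact (hSb hτ 0).1
  · refine IsLocalMax.hasDerivAt_eq_zero (f := fun τ => γ τ 0) ?_ h4
    filter_upwards [h3] with τ hτ
    rw [h0, e]
    exact (hSb hτ 0).2

end

section

lemma mem_union_bool {α : Type*} (X : Bool → Set α) {p : α} :
    p ∈ X false ∪ X true ↔ ∃ b, p ∈ X b := by simp

/-- Surfaces close to a tube in-between are tangent to stable directions of the nearby maps. -/
lemma ReturnData.eventually_tangency [l.NeBot] (h : ReturnData lo hi a d c G X N)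
    (hB : Blender lo hi a d G X) {Gi θi : ι → E3 → E3} {Z : Set E3} (hZ : IsClosed Z)
    (hGi : ∀ b, ∀ p ∈ N b, C1At l Gi G p) (hθ : ∀ p ∈ Z, C1At l θi id p)
    (hinj : ∀ᶠ i in l, InjOn (Gi i) (N false ∪ N true))
    (hinj' : ∀ᶠ i in l, InjOn (Gi i ∘ θi i) (Z ∩ (N false ∪ N true)))
    (hGs : ∀ b, ∀ p ∈ N b, ∀ᶠ y in l ×ˢ 𝓝 p, ContDiffAt ℝ 1 (Gi y.1) y.2)
    (hθs : ∀ᶠ i in l, ∀ p ∈ Z, ContDiffAt ℝ 1 (θi i) p) (hZb : Z ⊆ Box)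
    (hZs : IsStripSurface lo hi Z) {u : ℝ → ℝ → E3} (hu : ∀ t, UGraph a (u t))
    (hc : ∀ t, Central (u t)) (huZ : ∀ t, ∀ z ∈ I2, u t z ∈ Z)
    (hper : Function.Periodic u 1) (hcont : ∀ z ∈ I2, Continuous fun t => u t z)
    (hdisj : ∀ t t', t ≠ t' → |t - t'| < 1 → ∀ z ∈ I2, ∀ z' ∈ I2, u t z ≠ u t' z')
    (h1 : ∀ x t, Beyond G X x (fun _ => x) (u t) < 0)
    (h2 : ∀ t, ∃ x, Beyond G X x (consSeq (!x) fun _ => x) (u t) < 0) :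
    ∀ᶠ i in l, Blender lo hi a d (Gi i) (Pieces N (Gi i)) ∧
      ConeSmooth a d c (Gi i) (Pieces N (Gi i) false ∪ Pieces N (Gi i) true) ∧
      ∃ q ∈ Z, ∃ (w : E3) (σ : ℕ → Bool), q 2 ∈ Ioo (lo 2) (hi 2) ∧ IsTangentTo Z q w ∧
        fderiv ℝ (θi i) q w ≠ 0 ∧ θi i q 0 ∈ Ioo (lo 0) (hi 0) ∧
        (∀ k, (Gi i)^[k] (θi i q) ∈ Pieces N (Gi i) (σ k)) ∧
        ∀ k, fderiv ℝ (fun x => (Gi i)^[k] x) (θi i q) (fderiv ℝ (θi i) q w) ∈ stableCone d := by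
  have hN : ∀ b, IsClosed (N b) := fun b => (h.compact_nbhd b).isClosed
  have hZc : IsCompact Z := (isCompact_cbox lo hi).of_isClosed_subset hZ hZb
  have hHi : ∀ b, ∀ p ∈ N b, p ∈ Z → C1At l (fun i => Gi i ∘ θi i) G p := fun b p hp hpZ =>
    (hGi b p hp).comp (g := id) (hθ p hpZ) differentiableAt_id
      ((h.smooth b p hp).differentiableAt (by simp))
  have hGu : ∀ b, ∀ p ∈ N b, p ∈ univ → C1At l Gi G p := fun b p hp _ => hGi b p hp
  have hBi := h.eventually_blender hGi hinj hB
  have hGc : ∀ᶠ i in l, ∀ b, ∀ p ∈ N b, ContDiffAt ℝ 1 (Gi i) p :=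
    eventually_all.2 fun b => eventually_forall_compact (h.compact_nbhd b) (hGs b)
  have hHc : ∀ᶠ i in l, ∀ b, ∀ p ∈ N b ∩ Z, ContDiffAt ℝ 1 (Gi i) (θi i p) :=
    eventually_all.2 fun b => eventually_forall_compact ((h.compact_nbhd b).inter_right hZ)
      fun p hp => (tendsto_fst.prodMk (hθ p hp.2).val).eventually (hGs b p hp.1)
  have hfam := h.eventually_family hZ hGi hHi hB.toOrientedHorseshoe
    (hBi.mono fun i h => h.toHorseshoe) hu hc huZ hper hcont h1 h2
  have hdom : ∀ᶠ i in l, ∀ b, ∀ p : E3 × E3,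
      (p.1 ∈ Ret (N b) Z (Gi i ∘ θi i) ∧ p.2 ≠ 0 ∧ IsTangentTo Z p.1 p.2 ∧
        p.2 ∈ stableCone d ∧ Gi i (θi i p.1) ∈ Box) →
      p.1 2 ∈ Ioo (lo 2) (hi 2) ∧ fderiv ℝ (θi i) p.1 p.2 ≠ 0 ∧
        θi i p.1 0 ∈ Ioo (lo 0) (hi 0) ∧ θi i p.1 ∈ Pieces N (Gi i) b := by
    refine eventually_all.2 fun b => eventually_forall_of_ultrafilter fun U hU D hD => ?_
    simp only [Classical.not_imp] at hD
    obtain ⟨q, hqZ, hq⟩ := exists_tendsto_of_compact hZc U (hD.mono fun i h => h.1.1.2.2.1)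
    have hqb := hZb hqZ
    have hqN : q ∈ N b := (hN b).mem_of_tendsto hq (hD.mono fun i h => h.1.1.2.1)
    have hne : ∀ᶠ i in (U : Filter ι), ‖(D i).2‖ ≠ 0 := hD.mono fun i h => norm_ne_zero_iff.2 h.1.2.1
    obtain ⟨w, hw, hwl⟩ := exists_tendsto_of_compact (isCompact_sphere (0 : E3) 1) U
      (p := fun i => ‖(D i).2‖⁻¹ • (D i).2) (hD.mono fun i h => by
        rw [mem_sphere_zero_iff_norm]
        exact norm_smul_inv_norm (𝕜 := ℝ) h.1.2.1)
    have hpair : Tendsto (fun i => (i, (D i).1)) U (l ×ˢ 𝓝 q) := Tendsto.prodMk hU hq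
    have hwT : IsTangentTo Z q w := IsTangentTo.of_tendsto hq hwl (hD.mono fun i h => by
      intro O f hO hqO hf h0
      rw [map_smul, h.1.2.2.1 O f hO hqO hf h0, smul_zero])
    have hws : w ∈ stableCone d := (isClosed_stableCone d).mem_of_tendsto hwl
      (hD.mono fun i h => smul_mem_stableCone h.1.2.2.2.1)
    have hGq : G q ∈ Box := (isCompact_cbox lo hi).isClosed.mem_of_tendsto
      ((hHi b q hqN hqZ).val.comp hpair) (hD.mono fun i h => h.1.2.2.2.2)
    have hqX : q ∈ X b := h.isolated b q hqN hqb (hGq 2)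
    have hw0 : w 0 ≠ 0 := fun e => by
      have h3 := mem_stableCone.1 hws
      have h4 := norm_le_abs_add_cuProj w
      rw [e] at h3 h4
      simp only [abs_zero, mul_zero] at h3 h4
      rw [mem_sphere_zero_iff_norm.1 hw] at h4
      linarith
    have hq2 := h.source b q hqX
    have hq1 := hB.center b q hqX hGq
    have hq0 := hZs.mem_Ioo hZb hqZ hq2 hwT hw0
    have hθq : Tendsto (fun i => θi i (D i).1) U (𝓝 q) := (hθ q hqZ).val.comp hpair
    have hco : ∀ j, Tendsto (fun i => θi i (D i).1 j) U (𝓝 (q j)) := fun j =>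
      ((continuous_coord j).tendsto q).comp hθq
    have hdw := tendsto_clm_apply ((hθ q hqZ).deriv.comp hpair) hwl
    rw [fderiv_id] at hdw
    have hev := ((((continuous_coord 2).tendsto q).comp hq).eventually
      (isOpen_Ioo.mem_nhds hq2)).and ((hdw.eventually (isOpen_ne.mem_nhds (show
        ContinuousLinearMap.id ℝ E3 w ≠ 0 from fun e => hw0 (congrArg (fun v : E3 => v 0) e)))).and
      (((hco 0).eventually (isOpen_Ioo.mem_nhds hq0)).and
      (((hco 1).eventually (isOpen_Ioo.mem_nhds hq1)).and
      (((hco 2).eventually (isOpen_Ioo.mem_nhds hq2)).and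
      (hθq.eventually (isOpen_interior.mem_nhds (h.subset_interior b hqX)))))))
    obtain ⟨i, ⟨e1, e2, e3, e4, e5, e6⟩, e7, e8⟩ := (hev.and hD).exists
    refine e8 ⟨e1, fun e => e2 ?_, e3, ?_, interior_subset e6, trivial, e7.1.2.2.2⟩
    · simp [e]
    · intro j
      fin_cases j
      exacts [Ioo_subset_Icc_self e3, Ioo_subset_Icc_self e4, Ioo_subset_Icc_self e5]
  filter_upwards [hBi, hfam, hdom, h.eventually_coneRel_fderiv hZ hHi,
    h.eventually_coneRel_fderiv isClosed_univ hGu, hGc, hHc, hθs, hinj'] with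
    i kB kfam kdom kH kG kGc kHc kθ kinj
  have hGcone : ConeSmooth a d c (Gi i) (Pieces N (Gi i) false ∪ Pieces N (Gi i) true) := by
    intro p hp
    obtain ⟨b, hp⟩ := (mem_union_bool (Pieces N (Gi i))).1 hp
    exact ⟨kGc b p hp.2.1, (kG b p hp).2⟩
  refine ⟨kB, hGcone, ?_⟩
  set H := Gi i ∘ θi i
  set K := Ret (N false) Z H ∪ Ret (N true) Z H
  have hHs : ∀ b, ∀ p ∈ N b ∩ Z, ContDiffAt ℝ 1 H p := fun b p hp => (kHc b p hp).comp p (kθ p hp.2)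
  have hKc : IsCompact K := by
    have : ∀ b, IsCompact (Ret (N b) Z H) := fun b =>
      isCompact_returnSet (hN b) hZ fun p hp => (hHs b p hp).continuousAt.continuousWithinAt
    exact (this false).union (this true)
  have hKcone : ConeSmooth a d c H K := by
    intro p hp
    obtain ⟨b, hp⟩ := (mem_union_bool fun b => Ret (N b) Z H).1 hp
    exact ⟨hHs b p ⟨hp.2.1, hp.2.2.1⟩, (kH b p hp).2⟩
  have hKinj : InjOn H K := kinj.mono (by
    rintro p (hp | hp)
    exacts [⟨hp.2.2.1, Or.inl hp.2.1⟩, ⟨hp.2.2.1, Or.inr hp.2.1⟩])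
  obtain ⟨q, hqK, w, σ, hw, hwT, hσ⟩ := exists_stable_direction kB hGcone hKc hKcone hKinj hdisj huZ
    (fun t y => by
      constructor
      · rintro ⟨b, z, hz, hzr, rfl⟩
        exact ⟨z, hz, (mem_union_bool fun b => Ret (N b) Z H).2 ⟨b, hzr⟩, rfl⟩
      · rintro ⟨z, hz, hzr | hzr, rfl⟩
        exacts [⟨_, z, hz, hzr, rfl⟩, ⟨_, z, hz, hzr, rfl⟩]) kfam
  obtain ⟨b, hb⟩ : ∃ b, q ∈ Ret (N b) Z H := (mem_union_bool fun b => Ret (N b) Z H).1 hqK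
  have hw0 : w ∈ stableCone d := (((kH b q hb).2 w).stable (hσ 0).2).1
  have hcb : Gi i (θi i q) ∈ Box := (hσ 0).1.1
  obtain ⟨f1, f2, f3, f4⟩ := kdom b (q, w) ⟨hb, hw, hwT, hw0, hcb⟩
  have hθd := (kθ q hb.2.2.1).differentiableAt one_ne_zero
  have hX : θi i q ∈ Pieces N (Gi i) false ∪ Pieces N (Gi i) true :=
    (mem_union_bool _).2 ⟨b, f4⟩
  have hσX : ∀ k, (Gi i)^[k] (Gi i (θi i q)) ∈
      Pieces N (Gi i) false ∪ Pieces N (Gi i) true := fun k =>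
    (mem_union_bool _).2 ⟨_, (hσ k).1⟩
  have hk : ∀ k, fderiv ℝ (fun x => (Gi i)^[k + 1] x) (θi i q) (fderiv ℝ (θi i) q w) ∈
      stableCone d := fun k => by
    have h3 := contDiffAt_iterate_comp hGcone (hGcone _ hX).1 (n := k) fun j _ => hσX j
    have h4 := fderiv_comp q (h3.differentiableAt one_ne_zero) hθd
    have h5 := (hσ k).2
    rw [show (fun x => (Gi i)^[k] (H x)) = (fun x => (Gi i)^[k] (Gi i x)) ∘ θi i from rfl, h4] at h5
    exact h5
  refine ⟨q, hb.2.2.1, w, fun k => Nat.casesOn k b σ, f1, hwT, f2, f3, ?_, ?_⟩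
  · rintro (_ | k)
    exacts [f4, (hσ k).1]
  · rintro (_ | k)
    · have h3 := hk 0
      simp only [zero_add, Function.iterate_one] at h3
      have h4 := (((hGcone _ hX).2 _).stable h3).1
      simpa using h4
    · exact hk k

end

end

section

open BlenderData

variable {M : Type*} [TopologicalSpace M] [ChartedSpace E3 M] {ι : Type*} {l : Filter ι} {x R : M}
  {f : M → M} {g : ι → M → M} {φ : OpenPartialHomeomorph M E3} {n m : ℕ}
local notation "Atlas" => IsManifold.maximalAtlas (𝓡 3) 1

section

/-! ### Tangencies in the manifold -/

variable {B : BlenderData M}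

lemma HaveTangency.mono {W : Set M} {P Q : Set M → Prop} (h : HaveTangency W P)
    (hPQ : ∀ X, P X → Q X) : HaveTangency W Q := by
  obtain ⟨x, v, hv, h1, γ, h2, h3, h4, ε, hε, h5⟩ := h
  exact ⟨x, v, hv, h1, γ, h2, h3, h4, ε, hε, hPQ _ h5⟩

lemma isVelocity_chart_symm [IsManifold (𝓡 3) 1 M]
    (hφ : φ ∈ Atlas M) {γ : ℝ → E3} {p v : E3} {Y : Set M}
    (hp : p ∈ φ.target) (h0 : γ 0 = p) (hc : ContDiffAt ℝ 1 γ 0) (hd : HasDerivAt γ v 0)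
    (hY : ∀ᶠ τ in 𝓝 0, φ.symm (γ τ) ∈ Y) :
    IsVelocity (fun X => X ⊆ Y) (φ.symm p) (mfderiv (𝓡 3) (𝓡 3) φ.symm p v : E3) := by
  have hs : ContMDiffAt (𝓡 3) (𝓡 3) 1 φ.symm p :=
    (contMDiffOn_symm_of_mem_maximalAtlas hφ).contMDiffAt (φ.open_target.mem_nhds hp)
  have hγ : ContMDiffAt 𝓘(ℝ, ℝ) (𝓡 3) 1 γ 0 := contMDiffAt_iff_contDiffAt.2 hc
  subst h0
  refine ⟨φ.symm ∘ γ, rfl, hs.comp (0 : ℝ) hγ, ?_, ?_⟩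
  · have h1 := mfderiv_comp (0 : ℝ) (hs.mdifferentiableAt one_ne_zero)
      (hγ.mdifferentiableAt one_ne_zero)
    have h2 : mfderiv 𝓘(ℝ, ℝ) (𝓡 3) γ 0 (1 : ℝ) = v := by
      rw [mfderiv_eq_fderiv]
      have h3 : fderiv ℝ γ 0 1 = v := fderiv_apply_one_eq_deriv.trans hd.deriv
      exact h3
    have h3 := congrArg (fun T => T (1 : ℝ)) h1
    exact h3.trans (congrArg (mfderiv (𝓡 3) (𝓡 3) φ.symm (γ 0)) h2)
  · obtain ⟨ε, hε, h1⟩ := Metric.eventually_nhds_iff.1 hY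
    refine ⟨ε / 2, by positivity, ?_⟩
    rintro _ ⟨τ, hτ, rfl⟩
    refine h1 ?_
    rw [Real.dist_eq, sub_zero]
    exact (abs_le.2 hτ).trans_lt (by linarith)

lemma mfderiv_chart_symm_ne_zero [IsManifold (𝓡 3) 1 M]
    (hφ : φ ∈ Atlas M) {p v : E3} (hp : p ∈ φ.target) (hv : v ≠ 0) :
    (mfderiv (𝓡 3) (𝓡 3) φ.symm p v : E3) ≠ 0 := by
  intro h0
  have hs : ContMDiffAt (𝓡 3) (𝓡 3) 1 φ.symm p :=
    (contMDiffOn_symm_of_mem_maximalAtlas hφ).contMDiffAt (φ.open_target.mem_nhds hp)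
  have hf : ContMDiffAt (𝓡 3) (𝓡 3) 1 φ (φ.symm p) :=
    (contMDiffOn_of_mem_maximalAtlas hφ).contMDiffAt (φ.open_source.mem_nhds (φ.map_target hp))
  have h1 := mfderiv_comp p (hf.mdifferentiableAt one_ne_zero) (hs.mdifferentiableAt one_ne_zero)
  have h2 : φ ∘ φ.symm =ᶠ[𝓝 p] id := by
    filter_upwards [φ.open_target.mem_nhds hp] with q hq using φ.right_inv hq
  rw [h2.mfderiv_eq, mfderiv_id] at h1
  have h3 := congrArg (fun T => T v) h1
  have h4 : (mfderiv (𝓡 3) (𝓡 3) φ (φ.symm p)) (mfderiv (𝓡 3) (𝓡 3) φ.symm p v) = 0 := by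
    rw [show mfderiv (𝓡 3) (𝓡 3) φ.symm p v = 0 from h0, map_zero]
  exact hv (h3.trans h4)

/-- The maps `g i` converge to `f` in the `C^1` sense in the chart of `B`. -/
structure C1Near (B : BlenderData M) (l : Filter ι) (g : ι → Equiv.Perm M) (f : Equiv.Perm M) :
    Prop where
  cont : Continuous f
  regular : IsRegularIn B f
  regular_near : ∀ i, IsRegularIn B (g i)
  near : ∀ p ∈ B.chart.target, f (B.chart.symm p) ∈ B.chart.source →
    C1At l (fun i => B.local_ (g i)) (B.local_ f) p ∧
      ∀ᶠ y in l ×ˢ 𝓝 p, g y.1 (B.chart.symm y.2) ∈ B.chart.source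

/-- The tube with the periodic parametrization. -/
lemma exists_periodic_tube {T : Set M} (hT : IsUUTubeInBetween f B T)
    (hlt : B.lo 2 < B.hi 2) : ∃ (u : ℝ → ℝ → E3) (Z : Set E3), T = B.chart.symm '' Z ∧
      IsClosed Z ∧ Z ⊆ B.box ∧ IsC1Surface B Z ∧
      (∀ t, B.IsUUParam (u t) ∧ B.InBetween f (B.disc (u t))) ∧
      (∀ t, ∀ z ∈ Icc (B.lo 2) (B.hi 2), u t z ∈ Z) ∧ Function.Periodic u 1 ∧
      (∀ z ∈ Icc (B.lo 2) (B.hi 2), Continuous fun t => u t z) ∧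
      ∀ t t', t ≠ t' → |t - t'| < 1 → ∀ z ∈ Icc (B.lo 2) (B.hi 2),
        ∀ z' ∈ Icc (B.lo 2) (B.hi 2), u t z ≠ u t' z' := by
  obtain ⟨u, hcu, hu, hdisj, h01, hs, rfl⟩ := hT
  have hZ : (⋃ t ∈ Icc (0 : ℝ) 1, B.disc (u t)) =
      Function.uncurry u '' (Icc 0 1 ×ˢ Icc (B.lo 2) (B.hi 2)) := by
    ext p
    simp only [mem_iUnion, disc, mem_image, Prod.exists, mem_prod, Function.uncurry]
    constructor
    · rintro ⟨t, ht, z, hz, rfl⟩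
      exact ⟨t, z, ⟨ht, hz⟩, rfl⟩
    · rintro ⟨t, z, ⟨ht, hz⟩, rfl⟩
      exact ⟨t, ht, z, hz, rfl⟩
  have hfr : ∀ t : ℝ, Int.fract t ∈ Icc (0 : ℝ) 1 := fun t =>
    ⟨Int.fract_nonneg t, (Int.fract_lt_one t).le⟩
  refine ⟨fun t => u (Int.fract t), _, rfl, ?_, ?_, hs, fun t => hu _ (hfr t), fun t z hz => ?_,
    fun t => by simp, fun z hz => ?_, fun t t' hne hlt z hz z' hz' e => ?_⟩
  · rw [hZ]
    exact ((isCompact_Icc.prod isCompact_Icc).image_of_continuousOn hcu).isClosed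
  · rw [hZ]
    rintro _ ⟨⟨t, z⟩, ⟨ht, hz⟩, rfl⟩
    exact (hu t ht).1.mem_box z hz
  · exact mem_biUnion (hfr t) (mem_image_of_mem _ hz)
  · have h1 : ContinuousOn (fun t => u t z) (Icc 0 1) :=
      hcu.comp (f := fun t => (t, z)) (by fun_prop) fun t ht => ⟨ht, hz⟩
    refine h1.comp_fract'' ?_
    have h2 : u 0 z ∈ B.disc (u 1) := h01 ▸ mem_image_of_mem _ hz
    obtain ⟨z', hz', e⟩ := h2
    have h3 := congrArg (fun p : E3 => p 2) e
    simp only at h3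
    rw [(hu 0 (by simp)).1.coord z hz, (hu 1 (by simp)).1.coord z' hz'] at h3
    rw [← e, h3]
  · have hfe : Int.fract t = Int.fract t' := by
      by_contra hfe
      exact disjoint_left.1 (hdisj ⟨Int.fract_nonneg t, Int.fract_lt_one t⟩
        ⟨Int.fract_nonneg t', Int.fract_lt_one t'⟩ hfe) (mem_image_of_mem _ hz) ⟨z', hz', e.symm⟩
    obtain ⟨n, hn⟩ := Int.fract_eq_fract.1 hfe
    rw [hn] at hlt
    have : |n| < 1 := by exact_mod_cast hlt
    rw [Int.abs_lt_one_iff.1 this, Int.cast_zero, sub_eq_zero] at hn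
    exact hne hn

lemma IsBlenderHorseshoe.eventually_haveTangency [IsManifold (𝓡 3) 1 M] [l.NeBot]
    {f : Equiv.Perm M} {Γ : Set M} (hΓ : IsBlenderHorseshoe f B Γ) {g : ι → Equiv.Perm M}
    (hg : C1Near B l g f) {Z : Set E3} (hZT : IsUUTubeInBetween f B (B.chart.symm '' Z))
    (hZb : Z ⊆ B.chart.target) {θi : ι → E3 → E3} (hθ : ∀ p ∈ Z, C1At l θi id p)
    (hθs : ∀ᶠ i in l, ∀ p ∈ Z, ContDiffAt ℝ 1 (θi i) p)
    (hθi : ∀ᶠ i in l, InjOn (θi i) Z) :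
    ∀ᶠ i in l, HaveTangency (localStableSet (g i) B.domain)
      fun X => X ⊆ B.chart.symm '' (θi i '' Z) := by
  obtain ⟨u, Z', hTZ, hZ, hZ'b, hZs, hu, huZ, hper, hcont, hdisj⟩ :=
    exists_periodic_tube hZT (hΓ.lo_lt_hi 2)
  obtain rfl : Z = Z' := by
    have := congrArg (B.chart '' ·) hTZ
    have h1 : ∀ {Z : Set E3}, Z ⊆ B.chart.target → B.chart '' (B.chart.symm '' Z) = Z := by
      intro Z hZ
      rw [image_image]
      exact (image_congr fun p hp => B.chart.right_inv (hZ hp)).trans (image_id' Z)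
    simpa only [h1 hZb, h1 (hZ'b.trans hΓ.box_subset)] using this
  obtain ⟨N, d, c, hd, hdα, hR, hN⟩ := hΓ.exists_returnData hg.cont hg.regular
  have hB := hΓ.blender hg.cont hR hdα
  have hneg : ∀ x t, beyond B.lo B.hi (B.local_ f) B.sides x (fun _ => x) (u t) < 0 := by
    intro x t
    obtain ⟨h1, -, h2, h3⟩ := hu t
    cases x
    · simpa [beyond, sideSign] using (hΓ.side_disc_iff hg.cont hR h1 false).1.1 h2
    · simpa [beyond, sideSign] using (hΓ.side_disc_iff hg.cont hR h1 true).2.1 h3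
  have hnear : ∀ b, ∀ p ∈ N b, ∀ᶠ y in l ×ˢ 𝓝 p, y.2 ∈ B.chart.target ∧
      g y.1 (B.chart.symm y.2) ∈ B.chart.source := fun b p hp =>
    (tendsto_snd.eventually (B.chart.open_target.mem_nhds (hN b p hp).1)).and
      (hg.near p (hN b p hp).1 (hN b p hp).2).2
  have hNi : ∀ᶠ i in l, ∀ b, ∀ p ∈ N b, p ∈ B.chart.target ∧
      g i (B.chart.symm p) ∈ B.chart.source :=
    eventually_all.2 fun b => eventually_forall_compact (hR.compact_nbhd b) (hnear b)
  have hNZ : ∀ᶠ i in l, ∀ b, ∀ p ∈ N b ∩ Z, θi i p ∈ B.chart.target ∧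
      g i (B.chart.symm (θi i p)) ∈ B.chart.source :=
    eventually_all.2 fun b => eventually_forall_compact ((hR.compact_nbhd b).inter_right hZ)
      fun p hp => (tendsto_fst.prodMk (hθ p hp.2).val).eventually (hnear b p hp.1)
  have hginj : ∀ (i : ι) {p q : E3}, (p ∈ B.chart.target ∧ g i (B.chart.symm p) ∈ B.chart.source) →
      (q ∈ B.chart.target ∧ g i (B.chart.symm q) ∈ B.chart.source) →
      B.local_ (g i) p = B.local_ (g i) q → p = q := fun i p q hp hq e =>
    B.chart.symm.injOn hp.1 hq.1 ((g i).injective (B.chart.injOn hp.2 hq.2 e))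
  have main := hR.eventually_tangency hB hZ (fun b p hp => (hg.near p (hN b p hp).1 (hN b p hp).2).1)
    hθ (hNi.mono fun i h p hp q hq e => hginj i (hp.elim (fun hp => h _ p hp) fun hp => h _ p hp)
      (hq.elim (fun hp => h _ q hp) fun hp => h _ q hp) e)
    ((hNZ.and hθi).mono fun i h p hp q hq e => h.2 hp.1 hq.1 (hginj i
      (hp.2.elim (fun hp' => h.1 _ p ⟨hp', hp.1⟩) fun hp' => h.1 _ p ⟨hp', hp.1⟩)
      (hq.2.elim (fun hp' => h.1 _ q ⟨hp', hq.1⟩) fun hp' => h.1 _ q ⟨hp', hq.1⟩) e))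
    (fun b p hp => (hnear b p hp).mono fun y hy => (hg.regular_near y.1 y.2 hy.1 hy.2).1)
    hθs hZ'b hZs (fun t => (IsUUParam_isUGraph (hΓ.lo_lt_hi 2) (hu t).1).1)
    (fun t => (IsUUParam_isUGraph (hΓ.lo_lt_hi 2) (hu t).1).2) huZ hper hcont hdisj hneg
    fun t => hΓ.gap_superpose hg.cont hR (hu t).1 fun x => hneg x t
  filter_upwards [main, hNi, hθs] with i hi hNi' hθi'
  obtain ⟨hBi, hGi, q, hqZ, w, σ, h2, hwT, hv0, hp0, hpX, hst⟩ := hi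
  set p := θi i q
  set v := fderiv ℝ (θi i) q w
  have hpt : p ∈ B.chart.target := hΓ.box_subset (hpX 0).1
  refine ⟨B.chart.symm p, mfderiv (𝓡 3) (𝓡 3) B.chart.symm p v,
    mfderiv_chart_symm_ne_zero hΓ.chart_mem hpt hv0, ?_, ?_⟩
  · set W := itin (B.local_ (g i)) (pieces B.lo B.hi N (B.local_ (g i))) σ
    have hWp : W (p 0) = p := hBi.itin_eq hpX
    obtain ⟨hW, hWd⟩ := hBi.toHorseshoe.contDiffAt_itin hGi hR.one_lt_c σ hp0
    have hline : ContDiffAt ℝ 1 (fun τ : ℝ => p 0 + τ * v 0) 0 := by fun_prop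
    have hlined : HasDerivAt (fun τ : ℝ => p 0 + τ * v 0) (v 0) 0 := by
      simpa using ((hasDerivAt_id (0 : ℝ)).mul_const (v 0)).const_add (p 0)
    have e0 : p 0 + 0 * v 0 = p 0 := by ring
    refine isVelocity_chart_symm (γ := fun τ => W (p 0 + τ * v 0)) hΓ.chart_mem hpt
      (by simp only [e0, hWp]) (ContDiffAt.comp (g := W) (0 : ℝ) (by rwa [e0]) hline) ?_ ?_
    · have h3 : HasFDerivAt W (fderiv ℝ W (p 0)) (p 0 + 0 * v 0) := by
        rw [e0]
        exact (hW.differentiableAt one_ne_zero).hasFDerivAt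
      have h4 := h3.comp_hasDerivAt 0 hlined
      rw [hWd v (by
        change ∀ k, fderiv ℝ _ (W (p 0)) v ∈ _
        rw [hWp]
        exact hst)] at h4
      exact h4
    · filter_upwards [hlined.continuousAt.eventually
        (isOpen_Ioo.mem_nhds (e0.symm ▸ hp0 : p 0 + 0 * v 0 ∈ Ioo (B.lo 0) (B.hi 0)))] with τ hτ
      exact symm_mem_localStableSet (X := pieces B.lo B.hi N (B.local_ (g i)))
        (fun b x hx => ⟨hx.1, (hNi' b x hx.2.1).2⟩)
        (hBi.itin_spec σ (Ioo_subset_Icc_self hτ)).2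
  · obtain ⟨γ, h0, h1, h3, h4⟩ := IsStripSurface.exists_curve hZs hqZ h2 hwT
    have hθq := hθi' q hqZ
    refine isVelocity_chart_symm (γ := fun τ => θi i (γ τ)) hΓ.chart_mem hpt (by simp only [h0, p])
      (ContDiffAt.comp (0 : ℝ) (by rwa [h0]) h1) ?_ ?_
    · have h5 : HasFDerivAt (θi i) (fderiv ℝ (θi i) q) (γ 0) := by
        rw [h0]
        exact (hθq.differentiableAt one_ne_zero).hasFDerivAt
      exact h5.comp_hasDerivAt 0 h3
    · exact h4.mono fun τ hτ => mem_image_of_mem _ (mem_image_of_mem _ hτ)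

end

open BlenderData

section

/-! ### Convergence of maps of manifolds -/

variable [IsManifold (𝓡 3) 1 M]

lemma contDiffAt_chart {ψ : OpenPartialHomeomorph M E3}
    (hφ : φ ∈ Atlas M) (hψ : ψ ∈ Atlas M) (hx : x ∈ φ.source) (hfx : f x ∈ ψ.source)
    (hf : ContMDiffAt (𝓡 3) (𝓡 3) 1 f x) : ContDiffAt ℝ 1 (ψ ∘ f ∘ φ.symm) (φ x) := by
  have hs : ContMDiffAt (𝓡 3) (𝓡 3) 1 φ.symm (φ x) :=
    (contMDiffOn_symm_of_mem_maximalAtlas hφ).contMDiffAt (φ.open_target.mem_nhds (φ.map_source hx))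
  have h1 : ContMDiffAt (𝓡 3) (𝓡 3) 1 ψ (f x) :=
    (contMDiffOn_of_mem_maximalAtlas hψ).contMDiffAt (ψ.open_source.mem_nhds hfx)
  have e : φ.symm (φ x) = x := φ.left_inv hx
  exact contMDiffAt_iff_contDiffAt.1 (ContMDiffAt.comp (φ x) (by rwa [Function.comp_apply, e])
    (ContMDiffAt.comp (φ x) (by rwa [e]) hs))

/-- The maps `g i` converge to `f` in the `C^1` sense at `x`. -/
structure C1AtM (l : Filter ι) (g : ι → M → M) (f : M → M) (x : M) : Prop where
  smooth : ContMDiffAt (𝓡 3) (𝓡 3) 1 f x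
  val : Tendsto (fun y : ι × M => g y.1 y.2) (l ×ˢ 𝓝 x) (𝓝 (f x))
  chart : ∀ φ ∈ Atlas M, ∀ ψ ∈ Atlas M,
    x ∈ φ.source → f x ∈ ψ.source → C1At l (fun i => ψ ∘ g i ∘ φ.symm) (ψ ∘ f ∘ φ.symm) (φ x)

lemma tendsto_chart_symm {W : Type*} [TopologicalSpace W] {φ : OpenPartialHomeomorph M W}
    (hx : x ∈ φ.source) : Tendsto (fun y : ι × W => (y.1, φ.symm y.2)) (l ×ˢ 𝓝 (φ x)) (l ×ˢ 𝓝 x) := by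
  have h1 := (φ.continuousAt_symm (φ.map_source hx)).tendsto
  rw [φ.left_inv hx] at h1
  exact tendsto_fst.prodMk (h1.comp tendsto_snd)

lemma C1AtM.comp {g' : ι → M → M} {f' : M → M} (h' : C1AtM l g' f' (f x))
    (h : C1AtM l g f x) : C1AtM l (fun i => g' i ∘ g i) (f' ∘ f) x := by
  refine ⟨h'.smooth.comp x h.smooth, h'.val.comp (tendsto_fst.prodMk h.val),
    fun φ hφ ψ hψ hx hfx => ?_⟩
  let χ := chartAt E3 (f x)
  have hχ := IsManifold.chart_mem_maximalAtlas (I := 𝓡 3) (n := 1) (f x)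
  have hχx : f x ∈ χ.source := mem_chart_source E3 (f x)
  have e1 : (χ ∘ f ∘ φ.symm) (φ x) = χ (f x) := by simp [φ.left_inv hx]
  have h1 := C1At.comp (x := φ x) (e1 ▸ h'.chart χ hχ ψ hψ hχx hfx) (h.chart φ hφ χ hχ hx hχx)
    ((contDiffAt_chart hφ hχ hx hχx h.smooth).differentiableAt one_ne_zero)
    (e1 ▸ (contDiffAt_chart hχ hψ hχx hfx h'.smooth).differentiableAt one_ne_zero)
  refine h1.congr ?_ ?_
  · have h2 : ContinuousAt (f ∘ φ.symm) (φ x) :=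
      ContinuousAt.comp (by rw [φ.left_inv hx]; exact h.smooth.continuousAt)
        (φ.continuousAt_symm (φ.map_source hx))
    have h3 : ∀ᶠ y in 𝓝 (φ x), (f ∘ φ.symm) y ∈ χ.source :=
      h2.eventually (χ.open_source.mem_nhds (by simpa [φ.left_inv hx] using hχx))
    filter_upwards [h3] with y hy
    simp only [Function.comp_apply] at hy ⊢
    rw [χ.left_inv hy]
  · filter_upwards [(h.val.comp (tendsto_chart_symm hx)).eventually
      (χ.open_source.mem_nhds hχx)] with y hy
    simp only [Function.comp_apply] at hy ⊢
    rw [χ.left_inv hy]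

lemma C1AtM.const (hf : ContMDiffAt (𝓡 3) (𝓡 3) 1 f x) : C1AtM l (fun _ => f) f x :=
  ⟨hf, hf.continuousAt.tendsto.comp tendsto_snd, fun _ hφ _ hψ hx hfx =>
    C1At.const (contDiffAt_chart hφ hψ hx hfx hf)⟩

lemma C1AtM.id (x : M) : C1AtM l (fun _ => _root_.id) _root_.id x := C1AtM.const contMDiffAt_id

lemma C1AtM.iterate (h : ∀ x, C1AtM l g f x) (n : ℕ) (x : M) :
    C1AtM l (fun i => (g i)^[n]) f^[n] x := by
  induction n generalizing x with
  | zero => exact C1AtM.id x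
  | succ n ih => exact (ih (f x)).comp (h x)

lemma C1AtM.of_chart {α β : OpenPartialHomeomorph M E3} (hα : α ∈ Atlas M) (hβ : β ∈ Atlas M)
    (hαx : x ∈ α.source) (hβx : f x ∈ β.source) (hf : ContMDiffAt (𝓡 3) (𝓡 3) 1 f x)
    (hv : Tendsto (fun y : ι × M => g y.1 y.2) (l ×ˢ 𝓝 x) (𝓝 (f x)))
    (h : C1At l (fun i => β ∘ g i ∘ α.symm) (β ∘ f ∘ α.symm) (α x)) : C1AtM l g f x := by
  refine ⟨hf, hv, fun φ hφ ψ hψ hx hfx => ?_⟩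
  have d1 : ContDiffAt ℝ 1 (α ∘ _root_.id ∘ φ.symm) (φ x) :=
    contDiffAt_chart hφ hα hx hαx contMDiffAt_id
  have d2 : ContDiffAt ℝ 1 (ψ ∘ _root_.id ∘ β.symm) (β (f x)) :=
    contDiffAt_chart hβ hψ hβx hfx contMDiffAt_id
  have d3 := contDiffAt_chart hα hβ hαx hβx hf
  have e1 : (α ∘ _root_.id ∘ φ.symm) (φ x) = α x := by simp [φ.left_inv hx]
  have e2 : (β ∘ f ∘ α.symm) (α x) = β (f x) := by simp [α.left_inv hαx]
  have h1 := C1At.comp (x := φ x) (e1.symm ▸ h) (C1At.const (l := l) d1)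
    (d1.differentiableAt one_ne_zero) (e1.symm ▸ d3.differentiableAt one_ne_zero)
  have e3 : ((β ∘ f ∘ α.symm) ∘ α ∘ _root_.id ∘ φ.symm) (φ x) = β (f x) := by
    rw [Function.comp_apply, e1, e2]
  have h2 := C1At.comp (x := φ x) (e3.symm ▸ C1At.const (l := l) d2) h1
    ((e1.symm ▸ d3.differentiableAt one_ne_zero : DifferentiableAt ℝ (β ∘ f ∘ α.symm)
      ((α ∘ _root_.id ∘ φ.symm) (φ x))).comp _ (d1.differentiableAt one_ne_zero))
    (e3.symm ▸ d2.differentiableAt one_ne_zero)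
  have hs : ∀ᶠ y in 𝓝 (φ x), φ.symm y ∈ α.source :=
    (φ.continuousAt_symm (φ.map_source hx)).eventually
      (α.open_source.mem_nhds (by rwa [φ.left_inv hx]))
  refine h2.congr ?_ ?_
  · have hc : ContinuousAt (f ∘ φ.symm) (φ x) :=
      ContinuousAt.comp (by rw [φ.left_inv hx]; exact hf.continuousAt)
        (φ.continuousAt_symm (φ.map_source hx))
    filter_upwards [hs, hc.eventually (β.open_source.mem_nhds
      (by simpa [φ.left_inv hx] using hβx))] with y h3 h4
    simp only [Function.comp_apply, _root_.id] at h4 ⊢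
    rw [α.left_inv h3, β.left_inv h4]
  · filter_upwards [tendsto_snd.eventually hs, (hv.comp (tendsto_chart_symm hx)).eventually
      (β.open_source.mem_nhds hβx)] with y h3 h4
    simp only [Function.comp_apply, _root_.id] at h4 ⊢
    rw [α.left_inv h3, β.left_inv h4]

end

section

open BlenderData

variable {E F : Type*} [NormedAddCommGroup E] [NormedSpace ℝ E] [NormedAddCommGroup F]
  [NormedSpace ℝ F] {Lu : E ≃L[ℝ] E} {Ls : F →L[ℝ] F} {p q : E × F} {a : E} {T : E × F → E × F}
  {Ti : ι → E × F → E × F}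

section

/-! ### The `C^r` topology -/

variable {r : ℕ∞}

lemma Diff.contMDiffAt (hr : 1 ≤ r) (f : Diff r M) (x : M) : ContMDiffAt (𝓡 3) (𝓡 3) 1 f x :=
  (f.contMDiff.of_le (by exact_mod_cast hr)).contMDiffAt

lemma basicNhd_mem_nhds {f : Diff r M} {ψ : OpenPartialHomeomorph M E3} {K : Set M}
    (hφ : φ ∈ IsManifold.maximalAtlas (𝓡 3) ∞ M) (hψ : ψ ∈ IsManifold.maximalAtlas (𝓡 3) ∞ M)
    (hK : IsCompact K) (hKφ : K ⊆ φ.source) (hKψ : MapsTo f K ψ.source) {k : ℕ} (hk : (k : ℕ∞) ≤ r)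
    {ε : ℝ} (hε : 0 < ε) : basicNhd f φ ψ K k ε ∈ 𝓝 f := by
  have : IsOpen (basicNhd f φ ψ K k ε) := TopologicalSpace.isOpen_generateFrom_of_mem
    ⟨f, φ, ψ, K, k, ε, hφ, hψ, hK, hKφ, hKψ, hk, hε, rfl⟩
  exact this.mem_nhds ⟨hKψ, by simp [hε]⟩

lemma norm_sub_eq_iteratedFDeriv_zero (f g : E → F) (x : E) :
    ‖f x - g x‖ = ‖iteratedFDeriv ℝ 0 f x - iteratedFDeriv ℝ 0 g x‖ := by
  rw [iteratedFDeriv_zero_eq_comp, iteratedFDeriv_zero_eq_comp, Function.comp_apply,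
    Function.comp_apply, ← map_sub, LinearIsometryEquiv.norm_map]

lemma norm_fderiv_sub_le (f g : E → F) (x : E) :
    ‖fderiv ℝ f x - fderiv ℝ g x‖ ≤ ‖iteratedFDeriv ℝ 1 f x - iteratedFDeriv ℝ 1 g x‖ := by
  refine ContinuousLinearMap.opNorm_le_bound _ (norm_nonneg _) fun v => ?_
  have := (iteratedFDeriv ℝ 1 f x - iteratedFDeriv ℝ 1 g x).le_opNorm fun _ => v
  simpa [iteratedFDeriv_one_apply] using this

lemma Diff.c1AtM [T2Space M] [CompactSpace M] [IsManifold (𝓡 3) ∞ M] [IsManifold (𝓡 3) 1 M]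
    (hr : 1 ≤ r) (f : Diff r M) (x : M) : C1AtM (𝓝 f) (fun g : Diff r M => (g : M → M)) f x := by
  set φ := chartAt E3 x
  set ψ := chartAt E3 (f x)
  have hφ := IsManifold.chart_mem_maximalAtlas (I := 𝓡 3) (n := ∞) x
  have hψ := IsManifold.chart_mem_maximalAtlas (I := 𝓡 3) (n := ∞) (f x)
  have hφ1 := IsManifold.chart_mem_maximalAtlas (I := 𝓡 3) (n := 1) x
  have hψ1 := IsManifold.chart_mem_maximalAtlas (I := 𝓡 3) (n := 1) (f x)
  have hx : x ∈ φ.source := mem_chart_source E3 x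
  have hfx : f x ∈ ψ.source := mem_chart_source E3 (f x)
  have hfc := (f.contMDiffAt hr x).continuousAt
  obtain ⟨K, hKx, hKs, hK⟩ := local_compact_nhds (inter_mem (φ.open_source.mem_nhds hx)
    (hfc.preimage_mem_nhds (ψ.open_source.mem_nhds hfx)))
  have hKφ : K ⊆ φ.source := fun y hy => (hKs hy).1
  have hKψ : MapsTo f K ψ.source := fun y hy => (hKs hy).2
  have h0 := fun {ε : ℝ} (hε : 0 < ε) => basicNhd_mem_nhds (k := 0) hφ hψ hK hKφ hKψ (by simp) hε
  have h1 := fun {ε : ℝ} (hε : 0 < ε) =>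
    basicNhd_mem_nhds (k := 1) hφ hψ hK hKφ hKψ (by simpa using hr) hε
  have hval : Tendsto (fun y : Diff r M × M => ψ (y.1 y.2)) (𝓝 f ×ˢ 𝓝 x) (𝓝 (ψ (f x))) := by
    have e1 : Tendsto (fun y : Diff r M × M => ψ (y.1 y.2) - ψ (f y.2)) (𝓝 f ×ˢ 𝓝 x) (𝓝 0) := by
      refine Metric.tendsto_nhds.2 fun ε hε => ?_
      filter_upwards [prod_mem_prod (h0 hε) hKx] with y hy
      have := hy.1.2 y.2 hy.2
      rw [← norm_sub_eq_iteratedFDeriv_zero, φ.left_inv (hKφ hy.2)] at this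
      rwa [dist_zero_right]
    have e2 : Tendsto (fun y : Diff r M × M => ψ (f y.2)) (𝓝 f ×ˢ 𝓝 x) (𝓝 (ψ (f x))) :=
      (ContinuousAt.comp (f := f) (ψ.continuousAt hfx) hfc).tendsto.comp tendsto_snd
    simpa using e1.add e2
  have hmem : ∀ᶠ y in 𝓝 f ×ˢ 𝓝 x, y.1 y.2 ∈ ψ.source := by
    filter_upwards [prod_mem_prod (h0 one_pos) hKx] with y hy using hy.1.1 hy.2
  have htend : Tendsto (fun y : Diff r M × M => y.1 y.2) (𝓝 f ×ˢ 𝓝 x) (𝓝 (f x)) := by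
    have := (ψ.continuousAt_symm (ψ.map_source hfx)).tendsto.comp hval
    rw [ψ.left_inv hfx] at this
    refine this.congr' ?_
    filter_upwards [hmem] with y hy using ψ.left_inv hy
  have hts := tendsto_chart_symm (l := 𝓝 f) hx
  have hft : ∀ᶠ y in 𝓝 (φ x), y ∈ φ.target := φ.open_target.mem_nhds (φ.map_source hx)
  have hL : ∀ᶠ y in 𝓝 f ×ˢ 𝓝 (φ x), y.2 ∈ φ.target := tendsto_snd.eventually hft
  have hrep := contDiffAt_chart hφ1 hψ1 hx hfx (f.contMDiffAt hr x)
  refine C1AtM.of_chart hφ1 hψ1 hx hfx (f.contMDiffAt hr x) htend ⟨?_, ?_, ?_⟩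
  · filter_upwards [hts.eventually hmem, hL] with y h2 h3
    have e := φ.right_inv h3
    have := (contDiffAt_chart hφ1 hψ1 (φ.map_target h3) h2
      (y.1.contMDiffAt hr _)).differentiableAt one_ne_zero
    rwa [e] at this
  · have := hval.comp hts
    simpa [Function.comp_def, φ.left_inv hx] using this
  · have e1 : Tendsto (fun y : Diff r M × E3 => fderiv ℝ (ψ ∘ y.1 ∘ φ.symm) y.2 -
        fderiv ℝ (ψ ∘ f ∘ φ.symm) y.2) (𝓝 f ×ˢ 𝓝 (φ x)) (𝓝 0) := by
      refine Metric.tendsto_nhds.2 fun ε hε => ?_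
      filter_upwards [hts.eventually (prod_mem_prod (h1 hε) hKx), hL] with y hy h3
      have := hy.1.2 _ hy.2
      rw [φ.right_inv h3] at this
      rw [dist_zero_right]
      exact (norm_fderiv_sub_le _ _ _).trans_lt this
    have e2 : Tendsto (fun y : Diff r M × E3 => fderiv ℝ (ψ ∘ f ∘ φ.symm) y.2)
        (𝓝 f ×ˢ 𝓝 (φ x)) (𝓝 (fderiv ℝ (ψ ∘ f ∘ φ.symm) (φ x))) :=
      (hrep.continuousAt_fderiv one_ne_zero).tendsto.comp tendsto_snd
    simpa using e1.add e2

variable [IsManifold (𝓡 3) 1 M] {B : BlenderData M}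

lemma Diff.isRegularIn (hr : 1 ≤ r) (hB : B.chart ∈ Atlas M) (g : Diff r M) : IsRegularIn B g := by
  intro p hp hgp
  set φ := B.chart
  have e : φ (φ.symm p) = p := φ.right_inv hp
  have h1 := contDiffAt_chart hB hB (φ.map_target hp) hgp (g.contMDiffAt hr _)
  rw [e] at h1
  have h2 := contDiffAt_chart hB hB hgp (f := g.symm)
    (by rw [g.symm_apply_apply]; exact φ.map_target hp) (Diff.contMDiffAt hr g.symm _)
  refine ⟨h1, ?_⟩
  have h3 := fderiv_comp p (g := φ ∘ g.symm ∘ φ.symm) (h2.differentiableAt one_ne_zero)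
    (h1.differentiableAt one_ne_zero)
  have h4 : (φ ∘ g.symm ∘ φ.symm) ∘ φ ∘ g ∘ φ.symm =ᶠ[𝓝 p] id := by
    have hc : ContinuousAt (g ∘ φ.symm) p :=
      ContinuousAt.comp (g.contMDiffAt hr _).continuousAt (φ.continuousAt_symm hp)
    filter_upwards [φ.open_target.mem_nhds hp, hc.eventually (φ.open_source.mem_nhds hgp)] with q k1 k2
    simp only [Function.comp_apply, id] at k2 ⊢
    rw [φ.left_inv k2, g.symm_apply_apply, φ.right_inv k1]
  rw [h4.fderiv_eq, fderiv_id] at h3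
  set L := fderiv ℝ (φ ∘ g ∘ φ.symm) p
  set L' := fderiv ℝ (φ ∘ g.symm ∘ φ.symm) ((φ ∘ g ∘ φ.symm) p)
  refine ⟨(‖L'‖ + 1)⁻¹, by positivity, fun v => ?_⟩
  have h5 : v = L' (L v) := congrArg (fun T => T v) h3
  rw [inv_mul_le_iff₀ (by positivity)]
  calc ‖v‖ = ‖L' (L v)‖ := by rw [← h5]
    _ ≤ ‖L'‖ * ‖L v‖ := L'.le_opNorm _
    _ ≤ (‖L'‖ + 1) * ‖L v‖ := by gcongr; linarith

lemma C1Near.of_diff (hr : 1 ≤ r) (hB : B.chart ∈ Atlas M) {g : ι → Diff r M} {f : Diff r M}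
    (hg : ∀ x, C1AtM l (fun i => (g i : M → M)) f x) :
    C1Near B l (fun i => (g i).toEquiv) f.toEquiv where
  cont := f.continuous
  regular := f.isRegularIn hr hB
  regular_near := fun i => (g i).isRegularIn hr hB
  near := fun p hp hfp => by
    have h1 := (hg _).chart B.chart hB B.chart hB (B.chart.map_target hp) hfp
    have h2 := tendsto_chart_symm (l := l) (B.chart.map_target hp)
    rw [B.chart.right_inv hp] at h1 h2
    exact ⟨h1, ((hg _).val.comp h2).eventually (B.chart.open_source.mem_nhds hfp)⟩

lemma tangency_tube (hr : 1 ≤ r) (f : Diff r M) {Γ T : Set M}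
    (hΓ : IsBlenderHorseshoe f.toEquiv B Γ) (hT : IsUUTubeInBetween f B T) :
    HaveTangency (localStableSet f B.domain) (fun X => X ⊆ T) := by
  obtain ⟨u, Z, rfl, -, hZ, -⟩ := exists_periodic_tube hT (hΓ.lo_lt_hi 2)
  have hf : ∀ x, C1AtM (pure ()) (fun _ : Unit => (f : M → M)) f x := fun x =>
    C1AtM.const (f.contMDiffAt hr x)
  have := eventually_pure.1 (hΓ.eventually_haveTangency (C1Near.of_diff hr hΓ.chart_mem hf) hT
    (hZ.trans hΓ.box_subset) (θi := fun _ => id) (fun p _ => C1At.const contDiffAt_id)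
    (.of_forall fun _ p _ => contDiffAt_id)
    (.of_forall fun _ => injOn_id _))
  simpa using this

end

section

/-! ### Local unstable manifolds -/

lemma dichotomy {e s : ℕ → ℝ} (hs0 : ∀ k, 0 ≤ s k) (he0 : ∀ k, 0 ≤ e k) {C : ℝ}
    (hC : ∀ k, max (e k) (s k) ≤ C)
    (hs : ∀ k, s k ≤ max (max (e k) (s k)) (max (e (k + 1)) (s (k + 1))) / 4)
    (he : ∀ k, e (k + 1) ≤ max (max (e k) (s k)) (max (e (k + 1)) (s (k + 1))) / 4) (k : ℕ) :
    s k ≤ e k ∧ e (k + 1) ≤ e k / 4 := by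
  have h1 : ∀ k, s k ≤ e k := by
    by_contra! hcon
    obtain ⟨k, hk⟩ := hcon
    have h2 : ∀ j, e (k + j) < s (k + j) ∧ s k * 4 ^ j ≤ s (k + j) := by
      intro j
      induction j with
      | zero => simpa using hk
      | succ j ih =>
        have h3 := hs (k + j)
        have h4 := he (k + j)
        rw [max_eq_right ih.1.le] at h3 h4
        have h5 := hs0 (k + j + 1)
        have h6 := he0 (k + j)
        rcases le_total (s (k + j)) (max (e (k + j + 1)) (s (k + j + 1))) with h7 | h7
        · rw [max_eq_right h7] at h3 h4
          rcases le_total (e (k + j + 1)) (s (k + j + 1)) with h8 | h8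
          · rw [max_eq_right h8] at h3 h4
            rw [← add_assoc]
            exact ⟨by linarith, by rw [pow_succ]; linarith⟩
          · rw [max_eq_left h8] at h3 h4
            linarith
        · rw [max_eq_left h7] at h3
          linarith
    obtain ⟨j, hj⟩ := pow_unbounded_of_one_lt (C / s k) (by norm_num : (1 : ℝ) < 4)
    have hpos := (he0 k).trans_lt hk
    rw [div_lt_iff₀ hpos] at hj
    have h3 := (le_max_right _ _).trans (hC (k + j))
    linarith [(h2 j).2]
  refine ⟨h1 k, ?_⟩
  have h2 := he k
  rw [max_eq_left (h1 k), max_eq_left (h1 (k + 1))] at h2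
  rcases le_total (e k) (e (k + 1)) with h3 | h3
  · rw [max_eq_right h3] at h2
    linarith [he0 k]
  · rwa [max_eq_left h3] at h2

/-- `v` and its image `y` are related as by a hyperbolic map that expands `E` and contracts `F`. -/
def IsStep (v y : E × F) : Prop := ‖y.2‖ ≤ ‖v‖ / 4 ∧ ‖v.1‖ ≤ max ‖v‖ ‖y‖ / 4

lemma IsStep.backward {v : ℕ → E × F} (h : ∀ k, IsStep (v (k + 1)) (v k)) {C : ℝ}
    (hC : ∀ k, ‖v k‖ ≤ C) (k : ℕ) : ‖(v k).2‖ ≤ ‖(v k).1‖ ∧ ‖v (k + 1)‖ ≤ ‖v k‖ / 4 := by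
  have h1 := dichotomy (e := fun k => ‖(v k).1‖) (s := fun k => ‖(v k).2‖) (C := C)
    (fun _ => norm_nonneg _) (fun _ => norm_nonneg _) hC
    (fun k => (h k).1.trans (by gcongr; exact le_max_right _ _))
    (fun k => (h k).2.trans (by rw [max_comm]; rfl))
  refine ⟨(h1 k).1, ?_⟩
  rw [Prod.norm_def, Prod.norm_def, max_eq_left (h1 k).1, max_eq_left (h1 (k + 1)).1]
  exact (h1 k).2

lemma IsStep.forward {v : ℕ → E × F} (h : ∀ k, IsStep (v k) (v (k + 1))) {C : ℝ}
    (hC : ∀ k, ‖v k‖ ≤ C) (k : ℕ) : ‖v (k + 1)‖ ≤ ‖v k‖ / 4 := by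
  have h1 := dichotomy (s := fun k => ‖(v k).1‖) (e := fun k => ‖(v k).2‖) (C := C)
    (fun _ => norm_nonneg _) (fun _ => norm_nonneg _)
    (fun k => by rw [max_comm]; exact hC k)
    (fun k => (h k).2.trans (by simp only [Prod.norm_def, max_comm]; rfl))
    (fun k => (h k).1.trans (by rw [max_comm ‖(v k).2‖]; gcongr; exact le_max_left _ _))
  rw [Prod.norm_def, Prod.norm_def, max_eq_right (h1 k).1, max_eq_right (h1 (k + 1)).1]
  exact (h1 k).2

lemma IsStep.of_approx (hu : ‖(Lu.symm : E →L[ℝ] E)‖ ≤ 1 / 8) (hs : ‖Ls‖ ≤ 1 / 8) {v y : E × F}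
    (h : ‖y - (Lu : E →L[ℝ] E).prodMap Ls v‖ ≤ 1 / 8 * ‖v‖) : IsStep v y := by
  have h1 : ‖y.1 - Lu v.1‖ ≤ 1 / 8 * ‖v‖ := (norm_fst_le _).trans h
  have h2 : ‖y.2 - Ls v.2‖ ≤ 1 / 8 * ‖v‖ := (norm_snd_le _).trans h
  have h3 : ‖Ls v.2‖ ≤ 1 / 8 * ‖v‖ := (Ls.le_opNorm _).trans
    (mul_le_mul hs (norm_snd_le v) (norm_nonneg _) (by norm_num))
  have h4 : ‖v.1‖ ≤ 1 / 8 * ‖Lu v.1‖ := by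
    calc ‖v.1‖ = ‖(Lu.symm : E →L[ℝ] E) (Lu v.1)‖ := by simp
      _ ≤ _ := ((Lu.symm : E →L[ℝ] E).le_opNorm _).trans (by gcongr)
  constructor
  · linarith [norm_sub_norm_le y.2 (Ls v.2)]
  · have h5 := norm_sub_norm_le (Lu v.1) y.1
    rw [norm_sub_rev] at h5
    have h6 : ‖y.1‖ ≤ ‖y‖ := norm_fst_le y
    linarith [le_max_left ‖v‖ ‖y‖, le_max_right ‖v‖ ‖y‖, norm_nonneg v]

/-- A map of the ball of radius `r` that is `C^1`-close to a hyperbolic linear map. -/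
structure LocalSaddle (Lu : E ≃L[ℝ] E) (Ls : F →L[ℝ] F) (r : ℝ) (T : E × F → E × F) : Prop where
  norm_u : ‖(Lu.symm : E →L[ℝ] E)‖ ≤ 1 / 8
  norm_s : ‖Ls‖ ≤ 1 / 8
  pos : 0 < r
  smooth : ∀ p, ‖p‖ ≤ r → ContDiffAt ℝ 1 T p
  deriv : ∀ p, ‖p‖ ≤ r → ‖fderiv ℝ T p - (Lu : E →L[ℝ] E).prodMap Ls‖ ≤ 1 / 8
  zero : ‖T 0‖ ≤ r / 8

/-- A backward orbit in the ball. -/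
def IsBackOrbit (T : E × F → E × F) (r : ℝ) (y : ℕ → E × F) : Prop :=
  (∀ k, ‖y k‖ ≤ r) ∧ ∀ k, T (y (k + 1)) = y k

/-- The backward orbit in the ball that starts over `a`. -/
def backOrbit (T : E × F → E × F) (r : ℝ) (a : E) : ℕ → E × F :=
  Classical.epsilon fun y => IsBackOrbit T r y ∧ (y 0).1 = a

namespace LocalSaddle

variable {r : ℝ} (h : LocalSaddle Lu Ls r T)

include h

lemma approx (hp : ‖p‖ ≤ r) (hq : ‖q‖ ≤ r) :
    ‖T p - T q - (Lu : E →L[ℝ] E).prodMap Ls (p - q)‖ ≤ 1 / 8 * ‖p - q‖ :=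
  (convex_closedBall (0 : E × F) r).norm_image_sub_le_of_norm_hasFDerivWithin_le'
    (f' := fderiv ℝ T) (fun y hy => ((h.smooth y (mem_closedBall_zero_iff.1 hy)).differentiableAt
      one_ne_zero).hasFDerivAt.hasFDerivWithinAt)
    (fun y hy => h.deriv y (mem_closedBall_zero_iff.1 hy)) (mem_closedBall_zero_iff.2 hq)
    (mem_closedBall_zero_iff.2 hp)

lemma isStep (hp : ‖p‖ ≤ r) (hq : ‖q‖ ≤ r) : IsStep (p - q) (T p - T q) :=
  IsStep.of_approx h.norm_u h.norm_s (h.approx hp hq)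

lemma isStep_fderiv (hp : ‖p‖ ≤ r) (v : E × F) : IsStep v (fderiv ℝ T p v) :=
  IsStep.of_approx h.norm_u h.norm_s
    ((ContinuousLinearMap.le_opNorm _ v).trans (mul_le_mul_of_nonneg_right (h.deriv p hp) (norm_nonneg _)))

lemma backOrbit_sub {y y' : ℕ → E × F} (hy : IsBackOrbit T r y) (hy' : IsBackOrbit T r y')
    (k : ℕ) : ‖(y k - y' k).2‖ ≤ ‖(y k - y' k).1‖ ∧ ‖y (k + 1) - y' (k + 1)‖ ≤ ‖y k - y' k‖ / 4 := by
  refine IsStep.backward (v := fun k => y k - y' k) (fun k => ?_) (C := r + r)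
    (fun k => (norm_sub_le _ _).trans (add_le_add (hy.1 k) (hy'.1 k))) k
  have := h.isStep (hy.1 (k + 1)) (hy'.1 (k + 1))
  rwa [hy.2, hy'.2] at this

lemma norm_backOrbit_sub_le {y y' : ℕ → E × F} (hy : IsBackOrbit T r y)
    (hy' : IsBackOrbit T r y') (k : ℕ) : ‖y k - y' k‖ ≤ ‖(y 0 - y' 0).1‖ / 4 ^ k := by
  induction k with
  | zero =>
    rw [Prod.norm_def, max_eq_left (h.backOrbit_sub hy hy' 0).1]
    simp
  | succ k ih =>
    rw [pow_succ, ← div_div]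
    linarith [(h.backOrbit_sub hy hy' k).2]

lemma eq_of_isBackOrbit {y y' : ℕ → E × F} (hy : IsBackOrbit T r y) (hy' : IsBackOrbit T r y')
    (h0 : (y 0).1 = (y' 0).1) : y = y' := by
  funext k
  have := h.norm_backOrbit_sub_le hy hy' k
  rw [Prod.fst_sub, h0, sub_self, norm_zero, zero_div] at this
  exact sub_eq_zero.1 (norm_le_zero_iff.1 this)

lemma eq_of_fixed (hp : ‖p‖ ≤ r) (hq : ‖q‖ ≤ r) (hTp : T p = p) (hTq : T q = q) : p = q := by
  have := (h.backOrbit_sub (y := fun _ => p) (y' := fun _ => q) ⟨fun _ => hp, fun _ => hTp⟩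
    ⟨fun _ => hq, fun _ => hTq⟩ 0).2
  exact sub_eq_zero.1 (norm_le_zero_iff.1 (by linarith [norm_nonneg (p - q)]))

lemma norm_image_snd_le (hp : ‖p‖ ≤ r) : ‖(T p).2‖ ≤ r := by
  have h1 := (h.isStep hp (by simpa using h.pos.le : ‖(0 : E × F)‖ ≤ r)).1
  have h2 := (norm_snd_le (T 0)).trans h.zero
  rw [sub_zero, Prod.snd_sub] at h1
  linarith [norm_sub_norm_le (T p).2 (T 0).2, h.pos]

lemma norm_fst_add_le (hp : ‖p‖ ≤ r) (hq : ‖q‖ ≤ r) : ‖p.1 + Lu.symm (q.1 - (T p).1)‖ ≤ r := by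
  have h1 := (norm_fst_le _).trans (h.approx hp (by simpa using h.pos.le : ‖(0 : E × F)‖ ≤ r))
  have h2 := (norm_fst_le (T 0)).trans h.zero
  have e : p.1 + Lu.symm (q.1 - (T p).1) =
      (Lu.symm : E →L[ℝ] E) (q.1 - ((T p - T 0 - (Lu : E →L[ℝ] E).prodMap Ls (p - 0)).1 + (T 0).1)) := by
    simp; abel
  rw [e]
  refine (ContinuousLinearMap.le_opNorm _ _).trans ?_
  have h3 := norm_sub_le q.1 ((T p - T 0 - (Lu : E →L[ℝ] E).prodMap Ls (p - 0)).1 + (T 0).1)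
  have h4 := norm_add_le (T p - T 0 - (Lu : E →L[ℝ] E).prodMap Ls (p - 0)).1 (T 0).1
  have h5 := (norm_fst_le q).trans hq
  rw [sub_zero] at h1 h3 h4 ⊢
  calc _ ≤ 1 / 8 * (8 * r) := mul_le_mul h.norm_u (by linarith [h.pos]) (norm_nonneg _) (by norm_num)
    _ = r := by ring

lemma norm_fst_sub_le {p' q' : E × F} (hp : ‖p‖ ≤ r) (hp' : ‖p'‖ ≤ r) {C : ℝ}
    (hpp : ‖p - p'‖ ≤ C) (hqq : ‖q - q'‖ ≤ C) :
    ‖p.1 + Lu.symm (q.1 - (T p).1) - (p'.1 + Lu.symm (q'.1 - (T p').1))‖ ≤ C / 2 := by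
  have h1 := (norm_fst_le _).trans (h.approx hp hp')
  have e : p.1 + Lu.symm (q.1 - (T p).1) - (p'.1 + Lu.symm (q'.1 - (T p').1)) =
      (Lu.symm : E →L[ℝ] E) ((q - q').1 - (T p - T p' - (Lu : E →L[ℝ] E).prodMap Ls (p - p')).1) := by
    simp; abel
  rw [e]
  refine (ContinuousLinearMap.le_opNorm _ _).trans ?_
  have h3 := norm_sub_le (q - q').1 (T p - T p' - (Lu : E →L[ℝ] E).prodMap Ls (p - p')).1
  have h5 := (norm_fst_le (q - q')).trans hqq
  have h6 := (norm_nonneg _).trans hpp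
  calc _ ≤ 1 / 8 * (4 * C) := mul_le_mul h.norm_u (by linarith) (norm_nonneg _) (by norm_num)
    _ = C / 2 := by ring

lemma exists_fixed [CompleteSpace E] [CompleteSpace F] : ∃ p, ‖p‖ ≤ r ∧ T p = p := by
  set Φ : E × F → E × F := fun p => (p.1 + Lu.symm (p.1 - (T p).1), (T p).2)
  have hm : MapsTo Φ (Metric.closedBall 0 r) (Metric.closedBall 0 r) := fun p hp => by
    rw [mem_closedBall_zero_iff] at hp ⊢
    exact max_le (h.norm_fst_add_le hp hp) (h.norm_image_snd_le hp)
  have hc : ContractingWith (1 / 2) (hm.restrict Φ _ _) := by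
    refine ⟨by norm_num, LipschitzWith.of_dist_le_mul fun p q => ?_⟩
    have hp := mem_closedBall_zero_iff.1 p.2
    have hq := mem_closedBall_zero_iff.1 q.2
    have h1 := h.norm_fst_sub_le hp hq le_rfl le_rfl
    have h2 := (h.isStep hp hq).1
    rw [Subtype.dist_eq, Subtype.dist_eq, dist_eq_norm, dist_eq_norm]
    change max _ _ ≤ _
    push_cast
    exact max_le (h1.trans_eq (by ring)) (h2.trans (by linarith [norm_nonneg ((p : E × F) - q)]))
  obtain ⟨p, hp, hf, -⟩ := hc.exists_fixedPoint' Metric.isClosed_closedBall.isComplete hm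
    (x := 0) (by simpa using h.pos.le) (edist_ne_top _ _)
  have hf' : Φ p = p := hf
  have h1 : p.1 + Lu.symm (p.1 - (T p).1) = p.1 := congrArg Prod.fst hf'
  have h2 : (T p).2 = p.2 := (congrArg Prod.snd hf' :)
  rw [add_eq_left, EmbeddingLike.map_eq_zero_iff, sub_eq_zero] at h1
  exact ⟨p, mem_closedBall_zero_iff.1 hp, Prod.ext h1.symm h2⟩

lemma exists_isBackOrbit [CompleteSpace E] [CompleteSpace F] (ha : ‖a‖ ≤ r) :
    ∃ y, IsBackOrbit T r y ∧ (y 0).1 = a := by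
  let Ψ : (ℕ → E × F) → ℕ → E × F := fun y k => Nat.casesOn k (a, (T (y 1)).2) fun k =>
    ((y (k + 1)).1 + Lu.symm ((y k).1 - (T (y (k + 1))).1), (T (y (k + 2))).2)
  have hball : ∀ y, (∀ k, ‖y k‖ ≤ r) → ∀ k, ‖Ψ y k‖ ≤ r := by
    rintro y hy (_ | k)
    exacts [max_le ha (h.norm_image_snd_le (hy 1)),
      max_le (h.norm_fst_add_le (hy _) (hy _)) (h.norm_image_snd_le (hy _))]
  have hcontr : ∀ y y', (∀ k, ‖y k‖ ≤ r) → (∀ k, ‖y' k‖ ≤ r) → ∀ C, (∀ k, ‖y k - y' k‖ ≤ C) →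
      ∀ k, ‖Ψ y k - Ψ y' k‖ ≤ C / 2 := by
    intro y y' hy hy' C hC k
    have hC0 := (norm_nonneg _).trans (hC 0)
    have h2 : ∀ k, ‖(T (y k)).2 - (T (y' k)).2‖ ≤ C / 2 := fun k =>
      (h.isStep (hy k) (hy' k)).1.trans (by linarith [hC k])
    cases k
    · exact max_le (by simpa [Ψ] using (by linarith : 0 ≤ C / 2)) (h2 _)
    · exact max_le (h.norm_fst_sub_le (hy _) (hy' _) (hC _) (hC _)) (h2 _)
  let Y : ℕ → ℕ → E × F := fun j => Ψ^[j] 0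
  have hY : ∀ j, Y (j + 1) = Ψ (Y j) := fun j => Function.iterate_succ_apply' _ _ _
  have hYr : ∀ j k, ‖Y j k‖ ≤ r := by
    intro j
    induction j with
    | zero => simpa [Y] using h.pos.le
    | succ j ih =>
      rw [hY]
      exact hball _ ih
  have hYd : ∀ j k, ‖Y (j + 1) k - Y j k‖ ≤ 2 * r / 2 / 2 ^ j := by
    intro j
    induction j with
    | zero => intro k; simpa [Y] using hYr 1 k
    | succ j ih =>
      intro k
      rw [hY (j + 1), hY j, pow_succ, ← div_div]
      exact hcontr _ _ (by rw [← hY]; exact hYr _) (hYr j) _ (by rw [← hY]; exact ih) k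
  have hlim : ∀ k, ∃ p, Tendsto (fun j => Y j k) atTop (𝓝 p) := fun k =>
    cauchySeq_tendsto_of_complete (cauchySeq_of_le_geometric_two (C := 2 * r) fun j => by
      rw [dist_comm, dist_eq_norm]
      exact hYd j k)
  choose y hy using hlim
  have hyr : ∀ k, ‖y k‖ ≤ r := fun k => le_of_tendsto (hy k).norm (.of_forall fun j => hYr j k)
  have hT : ∀ k, Tendsto (fun j => T (Y j k)) atTop (𝓝 (T (y k))) := fun k =>
    (h.smooth _ (hyr k)).continuousAt.tendsto.comp (hy k)
  have h0 : y 0 = (a, (T (y 1)).2) := by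
    refine tendsto_nhds_unique ((tendsto_add_atTop_iff_nat 1).2 (hy 0)) ?_
    simp only [hY]
    exact tendsto_const_nhds.prodMk_nhds ((continuous_snd.tendsto _).comp (hT 1))
  have h1 : ∀ k, y (k + 1) =
      ((y (k + 1)).1 + Lu.symm ((y k).1 - (T (y (k + 1))).1), (T (y (k + 2))).2) := by
    intro k
    refine tendsto_nhds_unique ((tendsto_add_atTop_iff_nat 1).2 (hy (k + 1))) ?_
    simp only [hY]
    have t1 := fun k => (continuous_fst.tendsto _).comp (hy k)
    have t2 := (continuous_fst.tendsto _).comp (hT (k + 1))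
    exact ((t1 (k + 1)).add ((Lu.symm.continuous.tendsto _).comp ((t1 k).sub t2))).prodMk_nhds
      ((continuous_snd.tendsto _).comp (hT (k + 2)))
  refine ⟨y, ⟨hyr, fun k => Prod.ext ?_ ?_⟩, by rw [h0]⟩
  · have := congrArg Prod.fst (h1 k)
    simp only [left_eq_add, EmbeddingLike.map_eq_zero_iff, sub_eq_zero] at this
    exact this.symm
  · cases k with
    | zero => exact (congrArg Prod.snd h0).symm
    | succ k => exact (congrArg Prod.snd (h1 k)).symm

lemma backOrbit_spec [CompleteSpace E] [CompleteSpace F] (ha : ‖a‖ ≤ r) :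
    IsBackOrbit T r (backOrbit T r a) ∧ (backOrbit T r a 0).1 = a :=
  Classical.epsilon_spec (h.exists_isBackOrbit ha)

end LocalSaddle

end

section

/-! ### Smoothness of local unstable manifolds -/

section Past

/-- The vectors that have a bounded backward orbit under the operators `A k`. -/
def boundedPast (A : ℕ → E →L[ℝ] E) : Submodule ℝ E where
  carrier := {v | ∃ w : ℕ → E, w 0 = v ∧ (∃ C, ∀ k, ‖w k‖ ≤ C) ∧ ∀ k, A k (w (k + 1)) = w k}
  zero_mem' := ⟨0, rfl, ⟨0, by simp⟩, by simp⟩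
  add_mem' := by
    rintro _ _ ⟨v, rfl, ⟨C, hC⟩, hv⟩ ⟨w, rfl, ⟨C', hC'⟩, hw⟩
    exact ⟨v + w, rfl, ⟨C + C', fun k => (norm_add_le _ _).trans (add_le_add (hC k) (hC' k))⟩,
      fun k => by simp [hv, hw]⟩
  smul_mem' := by
    rintro r _ ⟨v, rfl, ⟨C, hC⟩, hv⟩
    refine ⟨r • v, rfl, ⟨‖r‖ * C, fun k => ?_⟩, fun k => by simp [hv]⟩
    rw [Pi.smul_apply, norm_smul]
    exact mul_le_mul_of_nonneg_left (hC k) (norm_nonneg r)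

/-- The vectors with a bounded forward orbit. -/
def boundedFuture (A : E →L[ℝ] E) : Submodule ℝ E where
  carrier := {v | ∃ C, ∀ k : ℕ, ‖(A ^ k) v‖ ≤ C}
  zero_mem' := ⟨0, by simp⟩
  add_mem' := by
    rintro v w ⟨C, hC⟩ ⟨C', hC'⟩
    exact ⟨C + C', fun k => by rw [map_add]; exact (norm_add_le _ _).trans (add_le_add (hC k) (hC' k))⟩
  smul_mem' := by
    rintro r v ⟨C, hC⟩
    exact ⟨‖r‖ * C, fun k => by
      rw [map_smul, norm_smul]; exact mul_le_mul_of_nonneg_left (hC k) (norm_nonneg r)⟩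

end Past

variable [FiniteDimensional ℝ E] [FiniteDimensional ℝ F]

namespace LocalSaddle

variable {r : ℝ}

lemma tendsto_backOrbit (h : LocalSaddle Lu Ls r T) (hi : ∀ᶠ i in l, LocalSaddle Lu Ls r (Ti i))
    (hC : ∀ p, ‖p‖ ≤ r → C1At l Ti T p) (ha : ‖a‖ < r) (k : ℕ) :
    Tendsto (fun y : ι × E => backOrbit (Ti y.1) r y.2 k) (l ×ˢ 𝓝 a) (𝓝 (backOrbit T r a k)) := by
  rw [tendsto_iff_ultrafilter]
  intro U hU
  have hev : ∀ᶠ y in (U : Filter (ι × E)), IsBackOrbit (Ti y.1) r (backOrbit (Ti y.1) r y.2) ∧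
      (backOrbit (Ti y.1) r y.2 0).1 = y.2 := by
    have h1 : ∀ᶠ b in 𝓝 a, ‖b‖ < r := continuous_norm.continuousAt.eventually (gt_mem_nhds ha)
    have h2 : ∀ᶠ y in l ×ˢ 𝓝 a, LocalSaddle Lu Ls r (Ti y.1) := tendsto_fst.eventually hi
    have h3 : ∀ᶠ y : ι × E in l ×ˢ 𝓝 a, ‖y.2‖ < r := tendsto_snd.eventually h1
    filter_upwards [hU h2, hU h3] with y h4 h5 using h4.backOrbit_spec h5.le
  have hz : ∀ j, ∃ z, ‖z‖ ≤ r ∧ Tendsto (fun y : ι × E => backOrbit (Ti y.1) r y.2 j) U (𝓝 z) := by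
    intro j
    obtain ⟨z, hz, hzl⟩ := exists_tendsto_of_compact (isCompact_closedBall (0 : E × F) r) U
      (p := fun y => backOrbit (Ti y.1) r y.2 j)
      (hev.mono fun y hy => mem_closedBall_zero_iff.2 (hy.1.1 j))
    exact ⟨z, mem_closedBall_zero_iff.1 hz, hzl⟩
  choose z hzr hzl using hz
  have hz0 : IsBackOrbit T r z := by
    refine ⟨hzr, fun j => ?_⟩
    have h1 := (hC _ (hzr (j + 1))).val.comp ((tendsto_fst.mono_left hU).prodMk (hzl (j + 1)))
    exact tendsto_nhds_unique (h1.congr' (hev.mono fun y hy => hy.1.2 j)) (hzl j)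
  have hza : (z 0).1 = a := by
    have h1 := (continuous_fst.tendsto _).comp (hzl 0)
    exact tendsto_nhds_unique (h1.congr' (hev.mono fun y hy => hy.2)) (tendsto_snd.mono_left hU)
  rw [h.eq_of_isBackOrbit (h.backOrbit_spec ha.le).1 hz0 ((h.backOrbit_spec ha.le).2.trans hza.symm)]
  exact hzl k

lemma exists_strict_backOrbit [l.NeBot] (h : LocalSaddle Lu Ls r T)
    (hi : ∀ᶠ i in l, LocalSaddle Lu Ls r (Ti i)) (hC : ∀ p, ‖p‖ ≤ r → C1At l Ti T p)
    (ha : ‖a‖ < r) : ∃ L : E →L[ℝ] E × F, (∀ e,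
      L e ∈ boundedPast (fun k => fderiv ℝ T (backOrbit T r a (k + 1))) ∧ (L e).1 = e) ∧ ∀ η > 0,
      ∀ᶠ p in l ×ˢ (𝓝 a ×ˢ 𝓝 a), ‖backOrbit (Ti p.1) r p.2.1 0 - backOrbit (Ti p.1) r p.2.2 0 -
        L (p.2.1 - p.2.2)‖ ≤ η * ‖p.2.1 - p.2.2‖ := by
  have hO : Metric.ball (0 : E) r ∈ 𝓝 a := Metric.isOpen_ball.mem_nhds (mem_ball_zero_iff.2 ha)
  have hbd : ∀ᶠ i in l, ∀ b ∈ Metric.ball (0 : E) r, ∀ b' ∈ Metric.ball (0 : E) r, ∀ k,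
      ‖backOrbit (Ti i) r b k - backOrbit (Ti i) r b' k‖ ≤ ‖b - b'‖ := by
    filter_upwards [hi] with i h1 b hb b' hb' k
    obtain ⟨h2, h3⟩ := h1.backOrbit_spec (mem_ball_zero_iff.1 hb).le
    obtain ⟨h4, h5⟩ := h1.backOrbit_spec (mem_ball_zero_iff.1 hb').le
    refine (h1.norm_backOrbit_sub_le h2 h4 k).trans ?_
    rw [Prod.fst_sub, h3, h5]
    exact div_le_self (norm_nonneg _) (one_le_pow₀ (by norm_num))
  have hs := h.backOrbit_spec ha.le
  refine exists_strict_of_chords (w := fun i b => backOrbit (Ti i) r b 0) (π := .fst ℝ E F) hO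
    (C := 1) ?_ ?_ _ ?_ ?_
  · filter_upwards [hi] with i h1 b hb using (h1.backOrbit_spec (mem_ball_zero_iff.1 hb).le).2
  · filter_upwards [hbd] with i h1 b hb b' hb'
    simpa using h1 b hb b' hb' 0
  · rintro _ ⟨v, rfl, ⟨C, hvC⟩, hv⟩ h0
    have := (IsStep.backward (v := v) (fun k => hv k ▸ h.isStep_fderiv (hs.1.1 (k + 1)) (v (k + 1)))
      hvC 0).1
    rw [show (v 0).1 = 0 from h0, norm_zero] at this
    exact Prod.ext h0 (norm_le_zero_iff.1 this)
  · intro U hU ρ v hρ hv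
    have t1 : Tendsto (fun p : ι × E × E => (p.1, p.2.1)) U (l ×ˢ 𝓝 a) :=
      (tendsto_fst.prodMk (tendsto_fst.comp tendsto_snd)).mono_left hU
    have t2 : Tendsto (fun p : ι × E × E => (p.1, p.2.2)) U (l ×ˢ 𝓝 a) :=
      (tendsto_fst.prodMk (tendsto_snd.comp tendsto_snd)).mono_left hU
    have b1 : ∀ᶠ p : ι × E × E in U, p.2.1 ∈ Metric.ball (0 : E) r :=
      (tendsto_snd.comp t1).eventually hO
    have b2 : ∀ᶠ p : ι × E × E in U, p.2.2 ∈ Metric.ball (0 : E) r :=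
      (tendsto_snd.comp t2).eventually hO
    have b3 := (tendsto_fst.comp t1).eventually hbd
    have hz : ∀ j, ∃ z, ‖z‖ ≤ 1 ∧ Tendsto (fun p => ρ p • (backOrbit (Ti p.1) r p.2.1 j -
        backOrbit (Ti p.1) r p.2.2 j)) U (𝓝 z) := by
      intro j
      obtain ⟨z, hz, hzl⟩ := exists_tendsto_of_compact (isCompact_closedBall (0 : E × F) 1) U
        (p := fun p => ρ p • (backOrbit (Ti p.1) r p.2.1 j - backOrbit (Ti p.1) r p.2.2 j)) (by
          filter_upwards [hρ, b1, b2, b3] with p h1 h2 h3 h4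
          rw [mem_closedBall_zero_iff, h1.2, norm_smul, norm_inv, norm_norm,
            inv_mul_le_iff₀ (norm_sub_pos_iff.2 h1.1), mul_one]
          exact h4 _ h2 _ h3 j)
      exact ⟨z, mem_closedBall_zero_iff.1 hz, hzl⟩
    choose z hz1 hzl using hz
    refine ⟨z, tendsto_nhds_unique (hzl 0) hv, ⟨1, hz1⟩, fun k => ?_⟩
    have h1 := (hC _ (hs.1.1 (k + 1))).tendsto_smul (tendsto_fst.comp t1)
      ((h.tendsto_backOrbit hi hC ha (k + 1)).comp t1)
      ((h.tendsto_backOrbit hi hC ha (k + 1)).comp t2) (hzl (k + 1))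
    refine tendsto_nhds_unique (h1.congr' ?_) (hzl k)
    filter_upwards [(tendsto_fst.comp t1).eventually hi, b1, b2] with p h2 h3 h4
    have h5 := (h2.backOrbit_spec (mem_ball_zero_iff.1 h3).le).1.2 k
    have h6 := (h2.backOrbit_spec (mem_ball_zero_iff.1 h4).le).1.2 k
    simp only [Function.comp_apply] at h5 h6 ⊢
    rw [h5, h6]

lemma c1At_const (h : LocalSaddle Lu Ls r T) (hp : ‖p‖ ≤ r) :
    C1At (pure ()) (fun _ : Unit => T) T p := C1At.const (h.smooth p hp)

lemma hasFDerivAt_backOrbit (h : LocalSaddle Lu Ls r T) (ha : ‖a‖ < r) : ∃ L : E →L[ℝ] E × F, (∀ e,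
      L e ∈ boundedPast (fun k => fderiv ℝ T (backOrbit T r a (k + 1))) ∧ (L e).1 = e) ∧
      HasFDerivAt (fun b => backOrbit T r b 0) L a := by
  obtain ⟨L, hL, h1⟩ := h.exists_strict_backOrbit (l := pure ()) (.of_forall fun _ => h)
    (fun p hp => h.c1At_const hp) ha
  refine ⟨L, hL, HasStrictFDerivAt.hasFDerivAt (hasStrictFDerivAt_iff_isLittleO.2
    (Asymptotics.isLittleO_iff.2 fun η hη => ?_))⟩
  exact ((tendsto_const_pure (a := 𝓝 (a, a)) (b := ())).prodMk
    (show Tendsto id (𝓝 (a, a)) (𝓝 a ×ˢ 𝓝 a) from nhds_prod_eq.le)).eventually (h1 η hη)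

lemma c1At_backOrbit [l.NeBot] (h : LocalSaddle Lu Ls r T)
    (hi : ∀ᶠ i in l, LocalSaddle Lu Ls r (Ti i)) (hC : ∀ p, ‖p‖ ≤ r → C1At l Ti T p)
    (ha : ‖a‖ < r) :
    C1At l (fun i b => backOrbit (Ti i) r b 0) (fun b => backOrbit T r b 0) a := by
  obtain ⟨L, hL, h1⟩ := h.exists_strict_backOrbit hi hC ha
  obtain ⟨L', hL', h2⟩ := h.hasFDerivAt_backOrbit ha
  have hs := h.backOrbit_spec ha.le
  have hLL : L' = L := by
    ext1 e
    obtain ⟨v, hv0, ⟨C, hvC⟩, hv⟩ := (boundedPast _).sub_mem (hL' e).1 (hL e).1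
    have := (IsStep.backward (v := v) (fun k => hv k ▸ h.isStep_fderiv (hs.1.1 (k + 1)) (v (k + 1)))
      hvC 0).1
    have e1 : (v 0).1 = 0 := by rw [hv0, Prod.fst_sub, (hL' e).2, (hL e).2, sub_self]
    rw [e1, norm_zero] at this
    exact sub_eq_zero.1 (hv0.symm.trans (Prod.ext e1 (norm_le_zero_iff.1 this)))
  refine C1At.of_chord ?_ (h.tendsto_backOrbit hi hC ha 0) (hLL ▸ h2) h1
  have h3 : ∀ᶠ b in 𝓝 a, ‖b‖ < r := continuous_norm.continuousAt.eventually (gt_mem_nhds ha)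
  filter_upwards [tendsto_fst.eventually hi, tendsto_snd.eventually h3] with y h4 h5
  exact (h4.hasFDerivAt_backOrbit h5).choose_spec.2.differentiableAt

lemma contDiffAt_backOrbit (h : LocalSaddle Lu Ls r T) (ha : ‖a‖ < r) :
    ContDiffAt ℝ 1 (fun b => backOrbit T r b 0) a := by
  have h3 : ∀ᶠ b in 𝓝 a, ‖b‖ < r := continuous_norm.continuousAt.eventually (gt_mem_nhds ha)
  exact C1At.contDiffAt (h3.mono fun b hb => (h.hasFDerivAt_backOrbit hb).choose_spec.2.differentiableAt)
    (h3.mono fun b hb => h.c1At_backOrbit (l := pure ()) (.of_forall fun _ => h)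
      (fun p hp => h.c1At_const hp) hb)

end LocalSaddle

end

section

/-! ### Hyperbolic splittings -/

variable {W : Type*} [FiniteDimensional ℝ E] [FiniteDimensional ℝ F] [NormedAddCommGroup W]
  [NormedSpace ℝ W] [FiniteDimensional ℝ W]

section

variable {A : E × F →L[ℝ] E × F} (hA : ∀ v, IsStep v (A v))

include hA

lemma norm_pow_le_of_mem_boundedFuture {v : E × F} (hv : v ∈ boundedFuture A) (k : ℕ) :
    ‖(A ^ k) v‖ ≤ ‖v‖ / 4 ^ k := by
  obtain ⟨C, hC⟩ := hv
  have h1 := IsStep.forward (v := fun k => (A ^ k) v) (fun k => by rw [pow_succ']; exact hA _) hC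
  induction k with
  | zero => simp
  | succ k ih =>
    rw [pow_succ (4 : ℝ), ← div_div]
    linarith [h1 k]

lemma norm_le_pow_of_mem_boundedPast {v : E × F} (hv : v ∈ boundedPast fun _ => A) (k : ℕ) :
    ‖v‖ ≤ ‖(A ^ k) v‖ / 4 ^ k ∧ ‖v.2‖ ≤ ‖v.1‖ := by
  obtain ⟨w, rfl, ⟨C, hC⟩, hw⟩ := hv
  have h1 : ∀ v ∈ boundedPast fun _ => A, ‖v.2‖ ≤ ‖v.1‖ ∧ ‖v‖ ≤ ‖A v‖ / 4 := by
    rintro _ ⟨w, rfl, ⟨C, hC⟩, hw⟩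
    let w' : ℕ → E × F := fun k => Nat.casesOn k (A (w 0)) w
    have := IsStep.backward (v := w') (C := max C ‖A (w 0)‖) (by
        rintro (_ | k)
        · exact hA _
        · have := hA (w (k + 1))
          rwa [hw k] at this)
      (by rintro (_ | k); exacts [le_max_right _ _, (hC k).trans (le_max_left _ _)])
    exact ⟨(this 1).1, (this 0).2⟩
  have h2 : ∀ k, (A ^ k) (w 0) ∈ boundedPast fun _ => A := by
    intro k
    induction k with
    | zero => exact ⟨w, rfl, ⟨C, hC⟩, hw⟩
    | succ k ih =>
      obtain ⟨w', e, ⟨C', hC'⟩, hw'⟩ := ih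
      rw [pow_succ']
      refine ⟨fun k => Nat.casesOn k (A (w' 0)) w', by simp [e], ⟨max C' ‖A (w' 0)‖, ?_⟩, ?_⟩
      · rintro (_ | k); exacts [le_max_right _ _, (hC' k).trans (le_max_left _ _)]
      · rintro (_ | k); exacts [rfl, hw' k]
  refine ⟨?_, (h1 _ (h2 0)).1⟩
  induction k with
  | zero => simp
  | succ k ih =>
    have := (h1 _ (h2 k)).2
    rw [pow_succ' A, pow_succ' (4 : ℝ), ← div_div]
    exact ih.trans (by gcongr; exact this)

lemma exists_mem_boundedFuture (hEF : Module.finrank ℝ F ≠ 0) : ∃ v ∈ boundedFuture A, v ≠ 0 := by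
  have hex : ∀ k : ℕ, ∃ v : E × F, ‖v‖ = 1 ∧ ∀ j ≤ k, ‖(A ^ j) v‖ ≤ 1 := by
    intro k
    obtain ⟨v, hv, hv0⟩ := (Submodule.ne_bot_iff _).1 (LinearMap.ker_ne_bot_of_finrank_lt
      (f := ((ContinuousLinearMap.fst ℝ E F).comp (A ^ k)).toLinearMap)
      (by rw [Module.finrank_prod]; omega))
    have hnot : ∀ j ≤ k, ‖((A ^ j) v).1‖ ≤ ‖((A ^ j) v).2‖ := by
      intro j hj
      by_contra! hcon
      have : ∀ i, ‖((A ^ (j + i)) v).2‖ < ‖((A ^ (j + i)) v).1‖ := by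
        intro i
        induction i with
        | zero => exact hcon
        | succ i ih =>
          rw [← add_assoc, pow_succ']
          set w := (A ^ (j + i)) v
          obtain ⟨h1, h2⟩ := hA w
          change ‖(A w).2‖ < ‖(A w).1‖
          rw [Prod.norm_def w, max_eq_left ih.le] at h1 h2
          have h3 := (norm_nonneg _).trans_lt ih
          by_contra! h4
          rw [Prod.norm_def, max_eq_right h4] at h2
          rcases max_cases ‖w.1‖ ‖(A w).2‖ with h5 | h5 <;> linarith
      have h1 := this (k - j)
      rw [Nat.add_sub_cancel' hj, show ((A ^ k) v).1 = 0 from hv, norm_zero] at h1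
      exact (norm_nonneg _).not_gt h1
    have hle : ∀ j ≤ k, ‖(A ^ j) v‖ ≤ ‖v‖ := by
      intro j
      induction j with
      | zero => simp
      | succ j ih =>
        intro hj
        have h1 := hnot (j + 1) hj
        rw [Prod.norm_def, max_eq_right h1, pow_succ']
        have h2 := (hA ((A ^ j) v)).1
        have h3 := ih (by omega)
        change ‖(A ((A ^ j) v)).2‖ ≤ ‖v‖
        linarith [norm_nonneg v]
    have hpos := norm_pos_iff.2 hv0
    refine ⟨‖v‖⁻¹ • v, norm_smul_inv_norm (𝕜 := ℝ) hv0, fun j hj => ?_⟩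
    rw [map_smul, norm_smul, norm_inv, norm_norm, inv_mul_le_iff₀ hpos, mul_one]
    exact hle j hj
  choose v hv hvk using hex
  set U := Filter.hyperfilter ℕ
  obtain ⟨w, hw, hwl⟩ := exists_tendsto_of_compact (isCompact_sphere (0 : E × F) 1) U
    (.of_forall fun k => mem_sphere_zero_iff_norm.2 (hv k))
  refine ⟨w, ⟨1, fun j => ?_⟩, norm_ne_zero_iff.1 (by simp [mem_sphere_zero_iff_norm.1 hw])⟩
  exact le_of_tendsto ((((A ^ j).continuous.tendsto w).comp hwl).norm)
    (((eventually_ge_atTop j).filter_mono Nat.hyperfilter_le_atTop).mono fun k hk => hvk k j hk)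

end

lemma exists_pow_eq_quarter (hm : m ≠ 0) : ∃ κ : ℝ, 0 < κ ∧ κ < 1 ∧ κ ^ m = 1 / 4 := by
  have h1 : ((1 / 4 : ℝ) ^ ((m : ℝ)⁻¹)) ^ m = 1 / 4 := Real.rpow_inv_natCast_pow (by norm_num) hm
  refine ⟨_, by positivity, ?_, h1⟩
  exact Real.rpow_lt_one (by norm_num) (by norm_num) (by positivity)

/-- An operator a power of which is conjugate to a map close to a hyperbolic one has a hyperbolic
splitting. -/
lemma exists_hyperbolic_splitting {A : E × F →L[ℝ] E × F} (hA : ∀ v, IsStep v (A v))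
    (hex : ∀ a : E, ‖a‖ ≤ 1 → ∃ v ∈ boundedPast fun _ => A, v.1 = a) {D : W →L[ℝ] W}
    {Q : W ≃L[ℝ] E × F} (hm : m ≠ 0) (hQ : ∀ v, Q ((D ^ m) v) = A (Q v))
    (hF : Module.finrank ℝ F = 1) :
    ∃ Es Eu : Submodule ℝ W, IsCompl Es Eu ∧ Module.finrank ℝ Eu = Module.finrank ℝ E ∧
      (∀ v ∈ Es, D v ∈ Es) ∧ (∀ v ∈ Eu, D v ∈ Eu) ∧
      ∃ C κ : ℝ, 0 < C ∧ 0 < κ ∧ κ < 1 ∧ ∀ k : ℕ,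
        (∀ v ∈ Es, ‖(D ^ k) v‖ ≤ C * κ ^ k * ‖v‖) ∧ (∀ v ∈ Eu, ‖v‖ ≤ C * κ ^ k * ‖(D ^ k) v‖) := by
  set Es := (boundedFuture A).comap (Q : W →ₗ[ℝ] E × F)
  set Eu := (boundedPast fun _ => A).comap (Q : W →ₗ[ℝ] E × F)
  have hQk : ∀ q v, Q ((D ^ (m * q)) v) = (A ^ q) (Q v) := by
    intro q v
    induction q with
    | zero => simp
    | succ q ih =>
      rw [Nat.mul_succ, add_comm, pow_add, pow_succ']
      exact (hQ _).trans (congrArg A ih)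
  let D' : E × F →L[ℝ] E × F := (Q : W →L[ℝ] E × F).comp (D.comp (Q.symm : E × F →L[ℝ] W))
  have hD' : ∀ v, D' (Q v) = Q (D v) := fun v => by simp [D']
  have hcomm : ∀ k v, (D ^ k) (D v) = D ((D ^ k) v) := fun k v =>
    congrArg (fun T : W →L[ℝ] W => T v) (((Commute.refl D).pow_left k).eq)
  have hAD : ∀ k v, (A ^ k) (D' v) = D' ((A ^ k) v) := by
    intro k v
    obtain ⟨v, rfl⟩ := Q.surjective v
    rw [hD', ← hQk, ← hQk, hD', hcomm]
  have hdisj : Disjoint Es Eu := by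
    rw [Submodule.disjoint_def]
    intro v h1 h2
    have h3 := norm_pow_le_of_mem_boundedFuture hA h1 1
    have h4 := (norm_le_pow_of_mem_boundedPast hA h2 1).1
    rw [pow_one] at h3 h4
    have h5 : ‖A (Q v)‖ ≤ ‖Q v‖ / 4 ^ 1 := h3
    have h6 : ‖Q v‖ ≤ ‖A (Q v)‖ / 4 ^ 1 := h4
    have h7 : ‖Q v‖ ≤ 0 := by linarith [norm_nonneg (Q v)]
    simpa using h7
  have hEu : Module.finrank ℝ Eu = Module.finrank ℝ E := by
    refine LinearEquiv.finrank_eq (LinearEquiv.ofBijective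
      ((LinearMap.fst ℝ E F ∘ₗ (Q : W →ₗ[ℝ] E × F)).domRestrict Eu) ⟨?_, fun a => ?_⟩)
    · rw [← LinearMap.ker_eq_bot, LinearMap.ker_eq_bot']
      intro v hv
      have h1 : (Q v).1 = 0 := hv
      have h2 := (norm_le_pow_of_mem_boundedPast hA v.2 0).2
      rw [show ((Q : W →ₗ[ℝ] E × F) v).1 = 0 from hv, norm_zero] at h2
      exact Subtype.ext (Q.map_eq_zero_iff.1 (Prod.ext h1 (norm_le_zero_iff.1 h2)))
    · by_cases ha : a = 0
      · exact ⟨0, by simp [ha]⟩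
      obtain ⟨v, hv, e⟩ := hex (‖a‖⁻¹ • a) (norm_smul_inv_norm (𝕜 := ℝ) ha).le
      refine ⟨‖a‖ • ⟨Q.symm v, by simpa [Eu] using hv⟩, ?_⟩
      simp [e, smul_smul, norm_ne_zero_iff.2 ha]
  have hEs : 1 ≤ Module.finrank ℝ Es := by
    obtain ⟨v, hv, hv0⟩ := exists_mem_boundedFuture hA (by omega)
    have : Nontrivial Es := (Submodule.nontrivial_iff_ne_bot).2 ((Submodule.ne_bot_iff _).2
      ⟨Q.symm v, by simpa [Es] using hv, by simpa using hv0⟩)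
    exact Module.finrank_pos
  have hdim : Module.finrank ℝ W = Module.finrank ℝ E + 1 := by
    rw [Q.toLinearEquiv.finrank_eq, Module.finrank_prod, hF]
  have htop : Es ⊔ Eu = ⊤ := by
    refine Submodule.eq_top_of_finrank_eq (le_antisymm (Submodule.finrank_le _) ?_)
    have := Submodule.finrank_sup_add_finrank_inf_eq Es Eu
    rw [hdisj.eq_bot, finrank_bot] at this
    omega
  obtain ⟨κ, hκ0, hκ1, hκ⟩ := exists_pow_eq_quarter hm
  obtain ⟨B, hB0, hB⟩ : ∃ B > 0, ∀ j ≤ m, ‖D ^ j‖ ≤ B := by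
    refine ⟨1 + ∑ j ∈ Finset.range (m + 1), ‖D ^ j‖, by positivity, fun j hj => ?_⟩
    have := Finset.single_le_sum (f := fun j => ‖D ^ j‖) (fun _ _ => norm_nonneg _)
      (Finset.mem_range.2 (Nat.lt_succ_of_le hj))
    linarith
  set c := ‖(Q.symm : E × F →L[ℝ] W)‖ * ‖(Q : W →L[ℝ] E × F)‖
  have hc0 : 0 ≤ c := by positivity
  have hQc : ∀ (v w : W) (t : ℝ), 0 ≤ t → ‖Q v‖ ≤ ‖Q w‖ * t → ‖v‖ ≤ c * t * ‖w‖ := by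
    intro v w t ht h
    calc ‖v‖ = ‖(Q.symm : E × F →L[ℝ] W) (Q v)‖ := by simp
      _ ≤ ‖(Q.symm : E × F →L[ℝ] W)‖ * (‖Q w‖ * t) :=
        (ContinuousLinearMap.le_opNorm _ _).trans (by gcongr)
      _ ≤ ‖(Q.symm : E × F →L[ℝ] W)‖ * (‖(Q : W →L[ℝ] E × F)‖ * ‖w‖ * t) := by
        gcongr; exact (Q : W →L[ℝ] E × F).le_opNorm w
      _ = c * t * ‖w‖ := by ring
  have hdiv : ∀ k, k = m * (k / m) + k % m ∧ k % m < m := fun k =>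
    ⟨(Nat.div_add_mod k m).symm, Nat.mod_lt _ (Nat.pos_of_ne_zero hm)⟩
  have hκk : ∀ k : ℕ, (1 / 4 : ℝ) ^ (k / m + 1) ≤ κ ^ k := by
    intro k
    rw [← hκ, ← pow_mul]
    refine pow_le_pow_of_le_one hκ0.le hκ1.le ?_
    have := hdiv k
    rw [Nat.mul_succ]
    omega
  refine ⟨Es, Eu, ⟨hdisj, codisjoint_iff.2 htop⟩, hEu, ?_, ?_, 4 * B * c + 1, κ, by positivity,
    hκ0, hκ1, fun k => ⟨fun v hv => ?_, fun v hv => ?_⟩⟩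
  · rintro v ⟨C, hC⟩
    refine ⟨‖D'‖ * C, fun k => ?_⟩
    change ‖(A ^ k) (Q (D v))‖ ≤ _
    rw [← hD', hAD]
    exact (D'.le_opNorm _).trans (mul_le_mul_of_nonneg_left (hC k) (norm_nonneg _))
  · rintro v ⟨w, h0, ⟨C, hC⟩, hw⟩
    refine ⟨fun k => D' (w k), by simp only [h0]; exact hD' v, ⟨‖D'‖ * C, fun k =>
      (D'.le_opNorm _).trans (mul_le_mul_of_nonneg_left (hC k) (norm_nonneg _))⟩, fun k => ?_⟩
    have := hAD 1 (w (k + 1))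
    rw [pow_one] at this
    rw [this, hw]
  · have h1 := norm_pow_le_of_mem_boundedFuture hA hv (k / m)
    have h2 := hQc ((D ^ (m * (k / m))) v) v ((1 / 4) ^ (k / m)) (by positivity)
      (by rw [hQk, one_div_pow, ← div_eq_mul_one_div]; exact h1)
    have h3 : (D ^ k) v = (D ^ (k % m)) ((D ^ (m * (k / m))) v) := by
      conv_lhs => rw [(hdiv k).1, add_comm, pow_add]
      rfl
    rw [h3]
    have h4 : (1 / 4 : ℝ) ^ (k / m) ≤ 4 * κ ^ k := by
      have := hκk k
      rw [pow_succ] at this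
      linarith
    calc _ ≤ B * (c * (1 / 4) ^ (k / m) * ‖v‖) :=
          (ContinuousLinearMap.le_opNorm _ _).trans (mul_le_mul (hB _ (hdiv k).2.le) h2
            (norm_nonneg _) hB0.le)
      _ ≤ B * (c * (4 * κ ^ k) * ‖v‖) := by gcongr
      _ = 4 * B * c * (κ ^ k * ‖v‖) := by ring
      _ ≤ (4 * B * c + 1) * (κ ^ k * ‖v‖) := by gcongr; linarith
      _ = _ := by ring
  · have h1 := (norm_le_pow_of_mem_boundedPast hA hv (k / m + 1)).1
    have h2 := hQc v ((D ^ (m * (k / m + 1))) v) ((1 / 4) ^ (k / m + 1)) (by positivity)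
      (by rw [hQk, one_div_pow, ← div_eq_mul_one_div]; exact h1)
    have h3 : (D ^ (m * (k / m + 1))) v = (D ^ (m - k % m)) ((D ^ k) v) := by
      have : m * (k / m + 1) = (m - k % m) + k := by
        have := hdiv k
        rw [Nat.mul_succ]
        omega
      rw [this, pow_add]
      rfl
    rw [h3] at h2
    calc ‖v‖ ≤ c * (1 / 4) ^ (k / m + 1) * (B * ‖(D ^ k) v‖) := h2.trans (by
          gcongr
          exact (ContinuousLinearMap.le_opNorm _ _).trans (by gcongr; exact hB _ (Nat.sub_le _ _)))
      _ ≤ c * κ ^ k * (B * ‖(D ^ k) v‖) := by gcongr; exact hκk k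
      _ = B * c * (κ ^ k * ‖(D ^ k) v‖) := by ring
      _ ≤ (4 * B * c + 1) * (κ ^ k * ‖(D ^ k) v‖) := by
        gcongr
        nlinarith
      _ = _ := by ring

end

section

/-! ### Charts adapted to a splitting -/

variable {W : Type*} [NormedAddCommGroup W] [NormedSpace ℝ W]

/-- A chart followed by an affine isomorphism. -/
def affineChart (φ : OpenPartialHomeomorph M E3) (Q : E3 ≃L[ℝ] W) (c : E3) :
    OpenPartialHomeomorph M W :=
  φ.transHomeomorph ((Homeomorph.subRight c).trans Q.toHomeomorph)

variable (hφ : φ ∈ Atlas M) {Q : E3 ≃L[ℝ] W} {c : E3} {h : M → M}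

lemma affineChart_apply (x : M) : affineChart φ Q c x = Q (φ x - c) := rfl

lemma affineChart_symm_apply (w : W) : (affineChart φ Q c).symm w = φ.symm (Q.symm w + c) := rfl

lemma contDiff_affine : ContDiff ℝ 1 fun y : E3 => Q (y - c) :=
  Q.contDiff.comp (contDiff_id.sub contDiff_const)

lemma contDiff_affine_symm : ContDiff ℝ 1 fun w : W => Q.symm w + c :=
  Q.symm.contDiff.add contDiff_const

lemma affine_symm_affineChart (x : M) : Q.symm (affineChart φ Q c x) + c = φ x := by
  simp [affineChart_apply]

include hφ

lemma contMDiffAt_affineChart (hx : x ∈ φ.source) :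
    ContMDiffAt (𝓡 3) 𝓘(ℝ, W) 1 (affineChart φ Q c) x :=
  (contDiff_affine (Q := Q) (c := c)).contMDiff.contMDiffAt.comp x
    ((contMDiffOn_of_mem_maximalAtlas hφ).contMDiffAt (φ.open_source.mem_nhds hx))

lemma contMDiffAt_affineChart_symm {w : W} (hw : w ∈ (affineChart φ Q c).target) :
    ContMDiffAt 𝓘(ℝ, W) (𝓡 3) 1 (affineChart φ Q c).symm w :=
  ContMDiffAt.comp (g := φ.symm) (f := fun w : W => Q.symm w + c) (I' := 𝓡 3) w
    ((contMDiffOn_symm_of_mem_maximalAtlas hφ).contMDiffAt (φ.open_target.mem_nhds hw))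
    contDiff_affine_symm.contMDiff.contMDiffAt

lemma mdifferentiable_affineChart : (affineChart φ Q c).MDifferentiable (𝓡 3) 𝓘(ℝ, W) :=
  ⟨fun _ hx => ((contMDiffAt_affineChart hφ hx).mdifferentiableAt one_ne_zero).mdifferentiableWithinAt,
    fun _ hw => ((contMDiffAt_affineChart_symm hφ hw).mdifferentiableAt
      one_ne_zero).mdifferentiableWithinAt⟩

lemma contDiffAt_affineChart (hx : x ∈ φ.source) (hhx : h x ∈ φ.source)
    (hh : ContMDiffAt (𝓡 3) (𝓡 3) 1 h x) :
    ContDiffAt ℝ 1 (affineChart φ Q c ∘ h ∘ (affineChart φ Q c).symm) (affineChart φ Q c x) := by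
  have e : (affineChart φ Q c).symm (affineChart φ Q c x) = x := (affineChart φ Q c).left_inv hx
  refine contMDiffAt_iff_contDiffAt.1 (ContMDiffAt.comp _ (I' := 𝓡 3) ?_
    (ContMDiffAt.comp _ (I' := 𝓡 3) (by rwa [e])
      (contMDiffAt_affineChart_symm hφ ((affineChart φ Q c).map_source hx))))
  rw [Function.comp_apply, e]
  exact contMDiffAt_affineChart hφ hhx

/-- The derivative at a fixed point is conjugate to that of the map in an adapted chart. -/
lemma exists_fderiv_affineChart_conj (hx : x ∈ φ.source) (hhx : h x = x)
    (hh : ContMDiffAt (𝓡 3) (𝓡 3) 1 h x) : ∃ Q' : E3 ≃L[ℝ] W, ∀ v : E3,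
      Q' (mfderiv (𝓡 3) (𝓡 3) h x v : E3) = fderiv ℝ (affineChart φ Q c ∘ h ∘ (affineChart φ Q c).symm)
        (affineChart φ Q c x) (Q' v) := by
  set κ := affineChart φ Q c
  have hκ : κ.MDifferentiable (𝓡 3) 𝓘(ℝ, W) := mdifferentiable_affineChart hφ
  let Q' : E3 ≃L[ℝ] W := hκ.mfderiv hx
  have h1 : HasMFDerivAt (𝓡 3) 𝓘(ℝ, W) κ x (Q' : E3 →L[ℝ] W) :=
    ((contMDiffAt_affineChart hφ hx).mdifferentiableAt one_ne_zero).hasMFDerivAt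
  have h2 := (hh.mdifferentiableAt one_ne_zero).hasMFDerivAt
  have h3 : HasMFDerivAt 𝓘(ℝ, W) 𝓘(ℝ, W) (κ ∘ h ∘ κ.symm) (κ x) (fderiv ℝ (κ ∘ h ∘ κ.symm) (κ x)) :=
    ((contDiffAt_affineChart hφ hx (by rwa [hhx]) hh).differentiableAt
      one_ne_zero).hasFDerivAt.hasMFDerivAt
  have h1' : HasMFDerivAt (𝓡 3) 𝓘(ℝ, W) κ (h x) (Q' : E3 →L[ℝ] W) := by rw [hhx]; exact h1
  have h4 := HasMFDerivAt.comp x h1' h2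
  have h5 := (HasMFDerivAt.comp x h3 h1).congr_of_eventuallyEq (f₁ := κ ∘ h) (by
    filter_upwards [κ.open_source.mem_nhds hx] with y hy
    simp only [Function.comp_apply]
    rw [κ.left_inv hy])
  exact ⟨Q', fun v => congrArg (fun T : E3 →L[ℝ] W => T v) (hasMFDerivAt_unique h4 h5)⟩

variable [IsManifold (𝓡 3) 1 M]

lemma C1AtM.c1At_affineChart (h : C1AtM l g f x) (hx : x ∈ φ.source) (hfx : f x ∈ φ.source) :
    C1At l (fun i => affineChart φ Q c ∘ g i ∘ (affineChart φ Q c).symm)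
      (affineChart φ Q c ∘ f ∘ (affineChart φ Q c).symm) (affineChart φ Q c x) := by
  have d := (contDiffAt_chart hφ hφ hx hfx h.smooth).differentiableAt one_ne_zero
  have e := affine_symm_affineChart (φ := φ) (Q := Q) (c := c) x
  have h1 : C1At l (fun _ => fun w : W => Q.symm w + c) (fun w : W => Q.symm w + c)
    (affineChart φ Q c x) := C1At.const contDiff_affine_symm.contDiffAt
  have d1 := (contDiff_affine_symm (Q := Q) (c := c)).contDiffAt.differentiableAt
    (x := affineChart φ Q c x) one_ne_zero
  have h2 := C1At.comp (x := affineChart φ Q c x) (g := fun w : W => Q.symm w + c)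
    (by rw [e]; exact h.chart φ hφ φ hφ hx hfx) h1 d1 (by rwa [e])
  have d2 : DifferentiableAt ℝ ((φ ∘ f ∘ φ.symm) ∘ fun w : W => Q.symm w + c)
    (affineChart φ Q c x) := DifferentiableAt.comp _ (by rwa [e]) d1
  have h3 := C1At.comp (C1At.const (l := l) (contDiff_affine (Q := Q) (c := c)).contDiffAt) h2 d2
    ((contDiff_affine (Q := Q) (c := c)).contDiffAt.differentiableAt one_ne_zero)
  exact h3

/-- Maps close to the identity in an adapted chart are close to the identity. -/
lemma C1AtM.of_affineChart {σ : ι → W → W} (hx : x ∈ φ.source)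
    (h : C1At l σ _root_.id (affineChart φ Q c x)) :
    C1AtM l (fun i => (affineChart φ Q c).symm ∘ σ i ∘ affineChart φ Q c) _root_.id x := by
  set κ := affineChart φ Q c
  have hκ : Tendsto (fun y : ι × M => (y.1, κ y.2)) (l ×ˢ 𝓝 x) (l ×ˢ 𝓝 (κ x)) :=
    tendsto_fst.prodMk ((κ.continuousAt hx).tendsto.comp tendsto_snd)
  have hv := h.val.comp hκ
  have hv' : Tendsto (fun y : ι × M => κ.symm (σ y.1 (κ y.2))) (l ×ˢ 𝓝 x) (𝓝 x) := by
    have := (κ.continuousAt_symm (κ.map_source hx)).tendsto.comp hv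
    rwa [κ.left_inv hx] at this
  refine C1AtM.of_chart hφ hφ hx hx contMDiffAt_id hv' ?_
  have h1 : C1At l (fun _ => fun y : E3 => Q (y - c)) (fun y => Q (y - c)) (φ x) :=
    C1At.const contDiff_affine.contDiffAt
  have d1 := (contDiff_affine (Q := Q) (c := c)).contDiffAt.differentiableAt (x := φ x) one_ne_zero
  have h2 := C1At.comp (x := φ x) (g := fun y => Q (y - c)) h h1 d1 differentiableAt_id
  have h3 := C1At.comp (C1At.const (contDiff_affine_symm (Q := Q) (c := c)).contDiffAt) h2
    (differentiableAt_id.comp _ d1)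
    ((contDiff_affine_symm (Q := Q) (c := c)).contDiffAt.differentiableAt one_ne_zero)
  have ht := φ.open_target.mem_nhds (φ.map_source hx)
  refine h3.congr ?_ ?_
  · filter_upwards [ht] with y hy
    simp [φ.right_inv hy]
  · have h4 : ∀ᶠ y in l ×ˢ 𝓝 (φ x), y.2 ∈ φ.target := tendsto_snd.eventually ht
    have h5 := (h.val.comp (hκ.comp (tendsto_chart_symm hx))).eventually
      (κ.open_target.mem_nhds (κ.map_source hx))
    filter_upwards [h4, h5] with y hy hy'
    simp only [Function.comp_apply] at hy' ⊢
    rw [affineChart_apply, affineChart_symm_apply, φ.right_inv]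
    · rw [φ.right_inv hy]
    · exact hy'

end

section

/-! ### Saddles in adapted charts -/

lemma LocalSaddle.eventually_of_c1At
    (hu : ‖(Lu.symm : E →L[ℝ] E)‖ ≤ 1 / 8) (hs : ‖Ls‖ ≤ 1 / 8) (h0 : T 0 = 0)
    (hT : fderiv ℝ T 0 = (Lu : E →L[ℝ] E).prodMap Ls) (hC : C1At l Ti T 0)
    (hsm : ∀ᶠ y in l ×ˢ 𝓝 (0 : E × F), ContDiffAt ℝ 1 (Ti y.1) y.2) :
    ∃ δ0 > 0, ∀ δ, 0 < δ → δ ≤ δ0 → ∀ᶠ i in l, LocalSaddle Lu Ls δ (Ti i) := by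
  have h1 := hC.deriv.eventually (Metric.closedBall_mem_nhds _ (by norm_num : (0 : ℝ) < 1 / 8))
  obtain ⟨p, hp, q, hq, hpq⟩ := eventually_prod_iff.1 (hsm.and h1)
  obtain ⟨δ, hδ, hδq⟩ := Metric.eventually_nhds_iff.1 hq
  refine ⟨δ / 2, half_pos hδ, fun δ' hδ' hle => ?_⟩
  have h2 : ∀ᶠ i in l, Ti i 0 ∈ Metric.closedBall (T 0) (δ' / 8) :=
    (hC.val.comp (tendsto_id.prodMk (tendsto_const_nhds (x := (0 : E × F))))).eventually
      (Metric.closedBall_mem_nhds _ (by positivity))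
  filter_upwards [hp, h2] with i h3 h4
  have h5 : ∀ x : E × F, ‖x‖ ≤ δ' → q x := fun x hx => hδq (by rw [dist_zero_right]; linarith)
  refine ⟨hu, hs, hδ', fun x hx => (hpq h3 (h5 x hx)).1, fun x hx => ?_, ?_⟩
  · rw [← hT, ← dist_eq_norm]
    exact (hpq h3 (h5 x hx)).2
  · rwa [h0, mem_closedBall_zero_iff] at h4

variable {W : Type*} [NormedAddCommGroup W] [NormedSpace ℝ W] [FiniteDimensional ℝ W]

lemma exists_prod_conj {D : W →L[ℝ] W} {Es Eu : Submodule ℝ W} (hc : IsCompl Es Eu)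
    (hs : ∀ v ∈ Es, D v ∈ Es) (hu : ∀ v ∈ Eu, D v ∈ Eu) {C κ : ℝ} (hκ0 : 0 < κ)
    (hκ1 : κ < 1) (hb : ∀ k : ℕ, (∀ v ∈ Es, ‖(D ^ k) v‖ ≤ C * κ ^ k * ‖v‖) ∧
      ∀ v ∈ Eu, ‖v‖ ≤ C * κ ^ k * ‖(D ^ k) v‖) :
    ∃ (m : ℕ) (Lu : Eu ≃L[ℝ] Eu) (Ls : Es →L[ℝ] Es) (Q : W ≃L[ℝ] Eu × Es), m ≠ 0 ∧
      ‖(Lu.symm : Eu →L[ℝ] Eu)‖ ≤ 1 / 8 ∧ ‖Ls‖ ≤ 1 / 8 ∧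
      ∀ v, Q ((D ^ m) v) = (Lu : Eu →L[ℝ] Eu).prodMap Ls (Q v) := by
  obtain ⟨m, hm0, hm⟩ : ∃ m : ℕ, m ≠ 0 ∧ C * κ ^ m ≤ 1 / 8 := by
    have h1 : Tendsto (fun m : ℕ => C * κ ^ m) atTop (𝓝 (C * 0)) :=
      (tendsto_pow_atTop_nhds_zero_of_lt_one hκ0.le hκ1).const_mul C
    rw [mul_zero] at h1
    obtain ⟨m, h2, h3⟩ := ((h1.eventually (Iic_mem_nhds (by norm_num : (0 : ℝ) < 1 / 8))).and
      (eventually_ge_atTop 1)).exists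
    exact ⟨m, by omega, h2⟩
  have hpow : ∀ {S : Submodule ℝ W}, (∀ v ∈ S, D v ∈ S) → ∀ v ∈ S, (D ^ m) v ∈ S := by
    intro S hS v hv
    clear hm hm0
    induction m with
    | zero => exact hv
    | succ m ih => rw [pow_succ']; exact hS _ ih
  have hbu : ∀ v ∈ Eu, ‖v‖ ≤ 1 / 8 * ‖(D ^ m) v‖ := fun v hv => ((hb m).2 v hv).trans (by gcongr)
  let lu : Eu →ₗ[ℝ] Eu := ((D ^ m : W →L[ℝ] W) : W →ₗ[ℝ] W).restrict (hpow hu)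
  have hlu : Function.Injective lu := by
    rw [← LinearMap.ker_eq_bot, LinearMap.ker_eq_bot']
    intro v hv
    have h1 : (D ^ m) (v : W) = 0 := congrArg Subtype.val hv
    have h2 := hbu v v.2
    rw [h1, norm_zero, mul_zero] at h2
    exact Subtype.ext (norm_le_zero_iff.1 h2)
  let Lu : Eu ≃L[ℝ] Eu := (LinearEquiv.ofInjectiveEndo lu hlu).toContinuousLinearEquiv
  have hLu : ∀ v, ((Lu v : Eu) : W) = (D ^ m) (v : W) := fun v => rfl
  let ls : Es →ₗ[ℝ] Es := ((D ^ m : W →L[ℝ] W) : W →ₗ[ℝ] W).restrict (hpow hs)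
  let Q : W ≃L[ℝ] Eu × Es :=
    (Submodule.prodEquivOfIsCompl Eu Es hc.symm).symm.toContinuousLinearEquiv
  have hQ : ∀ p : Eu × Es, Q.symm p = (p.1 : W) + p.2 := fun p => rfl
  refine ⟨m, Lu, ls.toContinuousLinearMap, Q, hm0, ?_, ?_, fun v => ?_⟩
  · refine ContinuousLinearMap.opNorm_le_bound _ (by norm_num) fun w => ?_
    have := hbu _ (Lu.symm w).2
    rw [← hLu, Lu.apply_symm_apply] at this
    exact this
  · refine ContinuousLinearMap.opNorm_le_bound _ (by norm_num) fun w => ?_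
    exact ((hb m).1 w w.2).trans (by gcongr; exact le_rfl)
  · obtain ⟨p, rfl⟩ := Q.symm.surjective v
    rw [Q.apply_symm_apply]
    apply Q.symm.injective
    rw [Q.symm_apply_apply, hQ, hQ, map_add]
    rfl

variable [FiniteDimensional ℝ E] [FiniteDimensional ℝ F]

/-- The unstable directions at a point of the ball project onto `E`. -/
lemma LocalSaddle.exists_mem_boundedPast {r : ℝ} (h : LocalSaddle Lu Ls r T) (hp : ‖p‖ ≤ r)
    (ha : ‖a‖ ≤ 1) : ∃ v ∈ boundedPast fun _ => fderiv ℝ T p, v.1 = a := by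
  have h1 : LocalSaddle Lu Ls 1 (fderiv ℝ T p) :=
    ⟨h.norm_u, h.norm_s, one_pos, fun _ _ => (fderiv ℝ T p).contDiff.contDiffAt,
      fun q _ => by rw [ContinuousLinearMap.fderiv]; exact h.deriv p hp, by simp⟩
  obtain ⟨h2, h3⟩ := h1.backOrbit_spec ha
  exact ⟨_, ⟨_, rfl, ⟨1, h2.1⟩, h2.2⟩, h3⟩

end

section

/-! ### The continuation of a saddle -/

lemma Diff.contMDiffAt_iterate {r : ℕ∞} (hr : 1 ≤ r) (g : Diff r M) (k : ℕ) (x : M) :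
    ContMDiffAt (𝓡 3) (𝓡 3) 1 g^[k] x := by
  induction k generalizing x with
  | zero => exact contMDiffAt_id
  | succ k ih => exact (ih (g x)).comp x (g.contMDiffAt hr x)

lemma mfderiv_iterate_mul {h : M → M} (hx : h^[n] x = x) (hd : MDifferentiableAt (𝓡 3) (𝓡 3) h^[n] x) (m : ℕ) :
    (mfderiv (𝓡 3) (𝓡 3) h^[n * m] x : E3 →L[ℝ] E3) = iterDeriv h n x ^ m := by
  have h1 : ∀ m, HasMFDerivAt (𝓡 3) (𝓡 3) (h^[n])^[m] x ((iterDeriv h n x ^ m : E3 →L[ℝ] E3)) := by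
    intro m
    induction m with
    | zero => exact hasMFDerivAt_id x
    | succ m ih =>
      have ih' : HasMFDerivAt (𝓡 3) (𝓡 3) (h^[n])^[m] (h^[n] x)
        ((iterDeriv h n x ^ m : E3 →L[ℝ] E3)) := by rw [hx]; exact ih
      exact (HasMFDerivAt.comp x ih' hd.hasMFDerivAt)
  rw [Function.iterate_mul]
  exact (h1 m).mfderiv

/-- A map read in a chart. -/
abbrev chartMap {W : Type*} [TopologicalSpace W] (κ : OpenPartialHomeomorph M W) (h : M → M) : W → W :=
  κ ∘ h ∘ κ.symm

/-- In the chart `κ`, the map `h` is defined and close to a linear saddle on the ball of radius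
`δ`. -/
structure IsAdapted (κ : OpenPartialHomeomorph M (E × F)) (Lu : E ≃L[ℝ] E) (Ls : F →L[ℝ] F) (δ : ℝ)
    (h : M → M) : Prop where
  saddle : LocalSaddle Lu Ls δ (chartMap κ h)
  target : ∀ p, ‖p‖ ≤ δ → p ∈ κ.target
  source : ∀ p, ‖p‖ ≤ δ → h (κ.symm p) ∈ κ.source

/-- The fixed point of `h` in the ball of radius `δ`, in the chart `κ`. -/
def saddlePt (κ : OpenPartialHomeomorph M (E × F)) (δ : ℝ) (h : M → M) : E × F :=
  Classical.epsilon fun p => ‖p‖ ≤ δ ∧ chartMap κ h p = p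

variable {κ : OpenPartialHomeomorph M (E × F)} {δ δ' : ℝ} {h : M → M}

lemma IsAdapted.symm_chartMap (ha : IsAdapted κ Lu Ls δ h) (hp : ‖p‖ ≤ δ) :
    κ.symm (chartMap κ h p) = h (κ.symm p) := κ.left_inv (ha.source p hp)

/-- The conditions on `g` under which the saddle has a continuation. -/
structure HasSaddleNear (κ : OpenPartialHomeomorph M (E × F)) (Lu : E ≃L[ℝ] E) (Ls : F →L[ℝ] F)
    (n m : ℕ) (δ δ' : ℝ) (g : M → M) : Prop where
  big : IsAdapted κ Lu Ls δ g^[n * m]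
  small : IsAdapted κ Lu Ls δ' g^[n * m]
  le : δ' ≤ δ
  near : ∀ p, ‖p‖ ≤ δ' → g^[n] (κ.symm p) ∈ κ.source ∧ ‖κ (g^[n] (κ.symm p))‖ ≤ δ
  period : ∀ p, ‖p‖ ≤ δ' → ∀ j, 0 < j → j < n → g^[j] (κ.symm p) ≠ κ.symm p

section

variable [FiniteDimensional ℝ E] [FiniteDimensional ℝ F]

lemma IsAdapted.saddlePt_spec (ha : IsAdapted κ Lu Ls δ h) :
    ‖saddlePt κ δ h‖ ≤ δ ∧ chartMap κ h (saddlePt κ δ h) = saddlePt κ δ h :=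
  Classical.epsilon_spec ha.saddle.exists_fixed

lemma IsAdapted.apply_saddlePt (ha : IsAdapted κ Lu Ls δ h) :
    h (κ.symm (saddlePt κ δ h)) = κ.symm (saddlePt κ δ h) := by
  rw [← ha.symm_chartMap ha.saddlePt_spec.1, ha.saddlePt_spec.2]

lemma HasSaddleNear.iterate_saddlePt {g : M → M} (hg : HasSaddleNear κ Lu Ls n m δ δ' g) :
    g^[n] (κ.symm (saddlePt κ δ' g^[n * m])) = κ.symm (saddlePt κ δ' g^[n * m]) := by
  obtain ⟨h1, h2⟩ := hg.small.saddlePt_spec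
  have h3 := hg.small.apply_saddlePt
  set p := saddlePt κ δ' g^[n * m]
  obtain ⟨h4, h5⟩ := hg.near p h1
  have h6 : chartMap κ g^[n * m] (κ (g^[n] (κ.symm p))) = κ (g^[n] (κ.symm p)) := by
    simp only [Function.comp_apply]
    rw [κ.left_inv h4, (Function.Commute.iterate_iterate_self g (n * m) n).eq, h3]
  rw [← κ.left_inv h4, hg.big.saddle.eq_of_fixed h5 (h1.trans hg.le) h6 h2]

variable [IsManifold (𝓡 3) 1 M] (hφ : φ ∈ Atlas M) {Q : E3 ≃L[ℝ] E × F} {c : E3}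

include hφ

lemma IsAdapted.c1At {hi : ι → M → M}
    (ha : IsAdapted (affineChart φ Q c) Lu Ls δ h) (hC : ∀ x, C1AtM l hi h x)
    (hp : ‖p‖ ≤ δ) :
    C1At l (fun i => chartMap (affineChart φ Q c) (hi i)) (chartMap (affineChart φ Q c) h) p := by
  have e := (affineChart φ Q c).right_inv (ha.target p hp)
  have := (hC _).c1At_affineChart hφ (Q := Q) (c := c)
    ((affineChart φ Q c).map_target (ha.target p hp)) (ha.source p hp)
  rwa [e] at this

lemma HasSaddleNear.isSaddleOfIndexTwo {g : M → M} (hn : 0 < n) (hm : m ≠ 0)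
    (hE : Module.finrank ℝ E = 2) (hF : Module.finrank ℝ F = 1)
    (hsm : ∀ k x, ContMDiffAt (𝓡 3) (𝓡 3) 1 g^[k] x)
    (hg : HasSaddleNear (affineChart φ Q c) Lu Ls n m δ δ' g) :
    IsSaddleOfIndexTwo g n ((affineChart φ Q c).symm (saddlePt (affineChart φ Q c) δ' g^[n * m])) := by
  obtain ⟨h1, h2⟩ := hg.small.saddlePt_spec
  have h3 := hg.small.apply_saddlePt
  have h4 := hg.iterate_saddlePt
  have h5 := hg.small.target _ h1
  have hper := hg.period _ h1
  set κ := affineChart φ Q c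
  set p := saddlePt κ δ' g^[n * m]
  refine ⟨hn, ?_, ?_⟩
  · have h6 : Function.IsPeriodicPt g n (κ.symm p) := h4
    refine le_antisymm (h6.minimalPeriod_le hn) ?_
    by_contra! hlt
    exact hper _ (h6.minimalPeriod_pos hn) hlt (Function.isPeriodicPt_minimalPeriod g _)
  · obtain ⟨Q', hQ'⟩ := exists_fderiv_affineChart_conj hφ (Q := Q) (c := c) (κ.map_target h5) h3
      (hsm _ _)
    rw [mfderiv_iterate_mul h4 ((hsm _ _).mdifferentiableAt one_ne_zero)] at hQ'
    change ∀ v, _ = fderiv ℝ (chartMap κ g^[n * m]) (κ (κ.symm p)) (Q' v) at hQ'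
    rw [κ.right_inv h5] at hQ'
    obtain ⟨Es, Eu, hc, hd, hs, hu, hb⟩ := exists_hyperbolic_splitting (W := E3) (Q := Q')
      (D := iterDeriv g n (κ.symm p)) (A := fderiv ℝ (chartMap κ g^[n * m]) p) (m := m)
      (hg.small.saddle.isStep_fderiv h1) (fun a ha => hg.small.saddle.exists_mem_boundedPast h1 ha)
      hm hQ' hF
    exact ⟨Es, Eu, hc, hd.trans hE, hs, hu, hb⟩

/-- The fixed point depends continuously on the map. -/
lemma tendsto_saddlePt {hi : ι → M → M}
    (ha : IsAdapted (affineChart φ Q c) Lu Ls δ h) (hC : ∀ x, C1AtM l hi h x)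
    (hai : ∀ᶠ i in l, IsAdapted (affineChart φ Q c) Lu Ls δ (hi i)) :
    Tendsto (fun i => saddlePt (affineChart φ Q c) δ (hi i)) l (𝓝 (saddlePt (affineChart φ Q c) δ h)) := by
  set κ := affineChart φ Q c
  rw [tendsto_iff_ultrafilter]
  intro U hU
  have h1 : ∀ᶠ i in (U : Filter ι), IsAdapted κ Lu Ls δ (hi i) := hU hai
  obtain ⟨z, hz, hzl⟩ := exists_tendsto_of_compact (isCompact_closedBall (0 : E × F) δ) U
    (p := fun i => saddlePt κ δ (hi i))
    (h1.mono fun i h2 => mem_closedBall_zero_iff.2 h2.saddlePt_spec.1)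
  rw [mem_closedBall_zero_iff] at hz
  have h2 : Tendsto (fun i => (i, saddlePt κ δ (hi i))) U (l ×ˢ 𝓝 z) :=
    Tendsto.prodMk (show Tendsto id (U : Filter ι) l from hU) hzl
  have h5 : C1At l (fun i => chartMap κ (hi i)) (chartMap κ h) z := ha.c1At hφ hC hz
  have h3 := h5.val.comp h2
  have h4 := tendsto_nhds_unique hzl (h3.congr' (h1.mono fun i h2 => h2.saddlePt_spec.2))
  rwa [ha.saddle.eq_of_fixed ha.saddlePt_spec.1 hz ha.saddlePt_spec.2 h4.symm]

end

/-- A chart centered at the periodic point `R`, in which the derivative of an iterate is a linear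
saddle. -/
structure IsSaddleChart (f : M → M) (n m : ℕ) (R : M) (φ : OpenPartialHomeomorph M E3)
    (Q : E3 ≃L[ℝ] E × F) (Lu : E ≃L[ℝ] E) (Ls : F →L[ℝ] F) : Prop where
  mem_source : R ∈ φ.source
  iterate : f^[n] R = R
  period : ∀ j, 0 < j → j < n → f^[j] R ≠ R
  norm_u : ‖(Lu.symm : E →L[ℝ] E)‖ ≤ 1 / 8
  norm_s : ‖Ls‖ ≤ 1 / 8
  deriv : fderiv ℝ (chartMap (affineChart φ Q (φ R)) f^[n * m]) 0 = (Lu : E →L[ℝ] E).prodMap Ls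

lemma iterate_mul_fixed (h : f^[n] R = R) (k : ℕ) : f^[n * k] R = R := by
  rw [Function.iterate_mul]; exact Function.iterate_fixed h k

lemma exists_isSaddleChart [IsManifold (𝓡 3) 1 M]
    (hsm : ∀ k x, ContMDiffAt (𝓡 3) (𝓡 3) 1 f^[k] x) (hR : IsSaddleOfIndexTwo f n R) :
    ∃ (Es Eu : Submodule ℝ E3) (m : ℕ) (Q : E3 ≃L[ℝ] Eu × Es) (Lu : Eu ≃L[ℝ] Eu) (Ls : Es →L[ℝ] Es),
      Module.finrank ℝ Eu = 2 ∧ Module.finrank ℝ Es = 1 ∧ m ≠ 0 ∧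
      IsSaddleChart f n m R (chartAt E3 R) Q Lu Ls := by
  obtain ⟨hn, hper, Es, Eu, hc, hEu, hs, hu, C, ξ, -, hξ0, hξ1, hb⟩ := hR
  obtain ⟨m, Lu, Ls, Q0, hm, h1, h2, hQ0⟩ := exists_prod_conj hc hs hu hξ0 hξ1 hb
  have hφ := IsManifold.chart_mem_maximalAtlas (I := 𝓡 3) (n := 1) R
  have hx := mem_chart_source E3 R
  have hfix : f^[n] R = R := by rw [← hper]; exact Function.isPeriodicPt_minimalPeriod f R
  have hfix' : f^[n * m] R = R := iterate_mul_fixed hfix m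
  set φ := chartAt E3 R
  obtain ⟨Q1, hQ1⟩ := exists_fderiv_affineChart_conj hφ (Q := ContinuousLinearEquiv.refl ℝ E3) (c := φ R)
    hx hfix' (hsm _ _)
  rw [mfderiv_iterate_mul hfix ((hsm _ _).mdifferentiableAt one_ne_zero)] at hQ1
  let Q : E3 ≃L[ℝ] Eu × Es := Q1.symm.trans Q0
  refine ⟨Es, Eu, m, Q, Lu, Ls, hEu, ?_, hm, hx, hfix, fun j h3 h4 h5 => ?_, h1, h2, ?_⟩
  · have h3 := Submodule.finrank_add_eq_of_isCompl hc
    rw [finrank_euclideanSpace_fin] at h3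
    omega
  · have h6 : Function.IsPeriodicPt f j R := h5
    have := h6.minimalPeriod_le h3
    omega
  · have e0 : (affineChart φ (ContinuousLinearEquiv.refl ℝ E3) (φ R)) R = 0 := by
      simp [affineChart_apply]
    have hd := (contDiffAt_affineChart hφ (Q := ContinuousLinearEquiv.refl ℝ E3) (c := φ R) hx
      (by rwa [hfix']) (hsm (n * m) R)).differentiableAt one_ne_zero
    rw [e0] at hd hQ1
    set G := affineChart φ (ContinuousLinearEquiv.refl ℝ E3) (φ R) ∘ f^[n * m] ∘
      (affineChart φ (ContinuousLinearEquiv.refl ℝ E3) (φ R)).symm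
    have e : chartMap (affineChart φ Q (φ R)) f^[n * m] = Q ∘ G ∘ Q.symm := rfl
    have h3 : HasFDerivAt G (fderiv ℝ G 0) (Q.symm 0) := by rw [map_zero]; exact hd.hasFDerivAt
    have h4 := (Q.hasFDerivAt.comp (0 : Eu × Es) (h3.comp 0 Q.symm.hasFDerivAt)).fderiv
    rw [e, h4]
    refine ContinuousLinearMap.ext fun w => ?_
    obtain ⟨v, rfl⟩ := Q0.surjective w
    have h5 := hQ1 v
    change Q0 (Q1.symm (fderiv ℝ G 0 (Q1 (Q0.symm (Q0 v))))) = _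
    rw [Q0.symm_apply_apply, ← h5]
    exact (congrArg Q0 (Q1.symm_apply_apply _)).trans (hQ0 v)

end

section

lemma eventually_forall_norm_le {P : ι × E → Prop} (h : ∀ᶠ y in l ×ˢ 𝓝 (0 : E), P y) :
    ∃ δ > 0, ∀ᶠ i in l, ∀ p, ‖p‖ ≤ δ → P (i, p) := by
  obtain ⟨p, hp, q, hq, hpq⟩ := eventually_prod_iff.1 h
  obtain ⟨δ, hδ, hδq⟩ := Metric.eventually_nhds_iff.1 hq
  exact ⟨δ / 2, half_pos hδ, hp.mono fun i hi x hx =>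
    hpq hi (hδq (by rw [dist_zero_right]; linarith))⟩

variable [T2Space M] [CompactSpace M] [IsManifold (𝓡 3) ∞ M] [IsManifold (𝓡 3) 1 M] {r : ℕ∞} {Q : E3 ≃L[ℝ] E × F} {f : Diff r M}

lemma affineChart_self : affineChart φ Q (φ R) R = 0 := by simp [affineChart_apply]

lemma tendsto_iterate_affineChart_symm (hr : 1 ≤ r) (hx : R ∈ φ.source) (k : ℕ) :
    Tendsto (fun y : Diff r M × (E × F) => y.1^[k] ((affineChart φ Q (φ R)).symm y.2))
      (𝓝 f ×ˢ 𝓝 0) (𝓝 (f^[k] R)) := by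
  have h1 := tendsto_chart_symm (l := 𝓝 f) (φ := affineChart φ Q (φ R)) hx
  rw [affineChart_self] at h1
  exact (C1AtM.iterate (Diff.c1AtM hr f) k R).val.comp h1

lemma IsSaddleChart.exists_isAdapted (hr : 1 ≤ r) (hφ : φ ∈ Atlas M)
    (h : IsSaddleChart f n m R φ Q Lu Ls) : ∃ δ0 > 0, ∀ δ, 0 < δ → δ ≤ δ0 →
      ∀ᶠ g : Diff r M in 𝓝 f, IsAdapted (affineChart φ Q (φ R)) Lu Ls δ g^[n * m] := by
  have hx := h.mem_source
  have hfix := iterate_mul_fixed h.iterate m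
  have h0 : affineChart φ Q (φ R) R = 0 := affineChart_self
  set κ := affineChart φ Q (φ R)
  have hsrc : ∀ᶠ y in 𝓝 f ×ˢ 𝓝 (0 : E × F), y.2 ∈ κ.target ∧ y.1^[n * m] (κ.symm y.2) ∈ κ.source := by
    have h1 : ∀ᶠ p in 𝓝 (0 : E × F), p ∈ κ.target := by
      rw [← h0]; exact κ.open_target.mem_nhds (κ.map_source hx)
    have h2 := (tendsto_iterate_affineChart_symm (Q := Q) (f := f) hr hx (n * m)).eventually
      (κ.open_source.mem_nhds (by rw [hfix]; exact hx))
    exact (tendsto_snd.eventually h1).and h2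
  have hsm : ∀ᶠ y in 𝓝 f ×ˢ 𝓝 (0 : E × F), ContDiffAt ℝ 1 (chartMap κ y.1^[n * m]) y.2 := by
    filter_upwards [hsrc] with y hy
    have := contDiffAt_affineChart hφ (Q := Q) (c := φ R) (κ.map_target hy.1) hy.2
      (Diff.contMDiffAt_iterate hr y.1 (n * m) _)
    rwa [show affineChart φ Q (φ R) (κ.symm y.2) = y.2 from κ.right_inv hy.1] at this
  have hC : C1At (𝓝 f) (fun g : Diff r M => chartMap κ g^[n * m]) (chartMap κ f^[n * m]) 0 := by
    have := (C1AtM.iterate (Diff.c1AtM hr f) (n * m) R).c1At_affineChart hφ (Q := Q) (c := φ R) hx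
      (by rw [hfix]; exact hx)
    rwa [show affineChart φ Q (φ R) R = 0 from h0] at this
  obtain ⟨δ1, hδ1, h1⟩ := LocalSaddle.eventually_of_c1At h.norm_u h.norm_s
    (by simp only [Function.comp_apply]; rw [← h0, κ.left_inv hx, hfix]) h.deriv hC hsm
  obtain ⟨δ2, hδ2, h2⟩ := eventually_forall_norm_le hsrc
  refine ⟨min δ1 δ2, lt_min hδ1 hδ2, fun δ hδ hle => ?_⟩
  filter_upwards [h1 δ hδ (hle.trans (min_le_left _ _)), h2] with g h3 h4
  exact ⟨h3, fun p hp => (h4 p (hp.trans (hle.trans (min_le_right _ _)))).1,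
    fun p hp => (h4 p (hp.trans (hle.trans (min_le_right _ _)))).2⟩

lemma IsSaddleChart.exists_hasSaddleNear (hr : 1 ≤ r)
    (hφ : φ ∈ Atlas M) (h : IsSaddleChart f n m R φ Q Lu Ls) :
    ∃ δ > 0, ∃ δ' > 0, ∀ᶠ g : Diff r M in 𝓝 f,
      HasSaddleNear (affineChart φ Q (φ R)) Lu Ls n m δ δ' g := by
  obtain ⟨δ, hδ, h1⟩ := h.exists_isAdapted hr hφ
  have hx := h.mem_source
  have hn : Tendsto _ _ _ := tendsto_iterate_affineChart_symm (Q := Q) (f := f) hr hx n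
  rw [h.iterate] at hn
  have h0 : affineChart φ Q (φ R) R = 0 := affineChart_self
  have hk := fun k => tendsto_iterate_affineChart_symm (Q := Q) (f := f) hr hx k
  set κ := affineChart φ Q (φ R)
  have h2 : ∀ᶠ y in 𝓝 f ×ˢ 𝓝 (0 : E × F), y.1^[n] (κ.symm y.2) ∈ κ.source :=
    hn.eventually (κ.open_source.mem_nhds hx)
  have h3 : ∀ᶠ y in 𝓝 f ×ˢ 𝓝 (0 : E × F), ‖κ (y.1^[n] (κ.symm y.2))‖ ≤ δ := by
    have h4 : Tendsto (fun x => ‖κ x‖) (𝓝 R) (𝓝 ‖κ R‖) := (κ.continuousAt hx).norm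
    rw [h0, norm_zero] at h4
    exact hn.eventually (h4.eventually (Iic_mem_nhds hδ))
  have h4 : ∀ᶠ y in 𝓝 f ×ˢ 𝓝 (0 : E × F), ∀ j ∈ Finset.Ioo 0 n,
      y.1^[j] (κ.symm y.2) ≠ κ.symm y.2 := by
    exact (eventually_all_finset _).2 fun j hj => ((hk j).prodMk_nhds (hk 0)).eventually
      (isClosed_diagonal.isOpen_compl.mem_nhds
        (h.period j (Finset.mem_Ioo.1 hj).1 (Finset.mem_Ioo.1 hj).2))
  obtain ⟨δ1, hδ1, h5⟩ := eventually_forall_norm_le ((h2.and h3).and h4)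
  have hpos := lt_min hδ hδ1
  refine ⟨δ, hδ, min δ δ1, hpos, ?_⟩
  filter_upwards [h1 δ hδ le_rfl, h1 _ hpos (min_le_left _ _), h5] with g h6 h7 h8
  exact ⟨h6, h7, min_le_left _ _, fun p hp => (h8 p (hp.trans (min_le_right _ _))).1,
    fun p hp j h9 h10 => (h8 p (hp.trans (min_le_right _ _))).2 j (Finset.mem_Ioo.2 ⟨h9, h10⟩)⟩

variable [FiniteDimensional ℝ E] [FiniteDimensional ℝ F]

lemma IsSaddleChart.isContinuation (hr : 1 ≤ r) (hφ : φ ∈ Atlas M)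
    (h : IsSaddleChart f n m R φ Q Lu Ls) (hn : 0 < n) (hm : m ≠ 0) (hE : Module.finrank ℝ E = 2)
    (hF : Module.finrank ℝ F = 1) {δ δ' : ℝ} {V : Set (Diff r M)} (hV : IsOpen V) (hfV : f ∈ V)
    (hVs : ∀ g ∈ V, HasSaddleNear (affineChart φ Q (φ R)) Lu Ls n m δ δ' g) :
    IsContinuation f n R V fun g =>
      (affineChart φ Q (φ R)).symm (saddlePt (affineChart φ Q (φ R)) δ' g^[n * m]) := by
  have h0 : affineChart φ Q (φ R) R = 0 := affineChart_self
  refine ⟨?_, fun g hg => ContinuousAt.continuousWithinAt ?_, fun g hg =>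
    (hVs g hg).isSaddleOfIndexTwo hφ hn hm hE hF (Diff.contMDiffAt_iterate hr g)⟩
  · have h1 := (hVs f hfV).small
    obtain ⟨h2, h3⟩ := h1.saddlePt_spec
    beta_reduce
    rw [h1.saddle.eq_of_fixed h2 (q := 0) (by simpa using h1.saddle.pos.le) h3, ← h0]
    · exact (affineChart φ Q (φ R)).left_inv h.mem_source
    · simp only [Function.comp_apply]
      conv_lhs => rw [← h0, (affineChart φ Q (φ R)).left_inv h.mem_source,
        iterate_mul_fixed h.iterate, h0]
  · have h1 := (hVs g hg).small
    have h2 := tendsto_saddlePt hφ (l := 𝓝 g) (hi := fun g : Diff r M => g^[n * m]) h1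
      (C1AtM.iterate (Diff.c1AtM hr g) (n * m))
      (eventually_of_mem (hV.mem_nhds hg) fun g hg => (hVs g hg).small)
    exact ((affineChart φ Q (φ R)).continuousAt_symm
      (h1.target _ h1.saddlePt_spec.1)).tendsto.comp h2

end

section

/-! ### Moving a piece of an unstable manifold -/

variable [FiniteDimensional ℝ E] [FiniteDimensional ℝ F] {δ : ℝ}

/-- The vertical translation that takes the local unstable manifold of `T` to that of `T'`. -/
def unstableShift (T T' : E × F → E × F) (δ : ℝ) (q : E × F) : E × F :=
  q + (backOrbit T' δ q.1 0 - backOrbit T δ q.1 0)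

lemma unstableShift_backOrbit {T' : E × F → E × F} (h : LocalSaddle Lu Ls δ T)
    (ha : ‖a‖ ≤ δ) : unstableShift T T' δ (backOrbit T δ a 0) = backOrbit T' δ a 0 := by
  rw [unstableShift, (h.backOrbit_spec ha).2]
  abel

lemma contDiffAt_unstableShift {T' : E × F → E × F} (h : LocalSaddle Lu Ls δ T)
    (h' : LocalSaddle Lu Ls δ T') (hq : ‖q‖ < δ) :
    ContDiffAt ℝ 1 (unstableShift T T' δ) q := by
  have hq1 := (norm_fst_le q).trans_lt hq
  exact contDiffAt_id.add (((h'.contDiffAt_backOrbit hq1).comp q contDiffAt_fst).sub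
    ((h.contDiffAt_backOrbit hq1).comp q contDiffAt_fst))

lemma c1At_unstableShift [l.NeBot] (h : LocalSaddle Lu Ls δ T) (hi : ∀ᶠ i in l, LocalSaddle Lu Ls δ (Ti i))
    (hC : ∀ p, ‖p‖ ≤ δ → C1At l Ti T p) (hq : ‖q‖ < δ) :
    C1At l (fun i => unstableShift T (Ti i) δ) id q := by
  have hq1 := (norm_fst_le q).trans_lt hq
  have hd := (h.contDiffAt_backOrbit hq1).differentiableAt one_ne_zero
  have h1 : C1At l (fun i (p : E × F) => backOrbit (Ti i) δ p.1 0) (fun p => backOrbit T δ p.1 0) q :=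
    C1At.comp (g := Prod.fst) (h.c1At_backOrbit hi hC hq1) (C1At.const contDiffAt_fst)
      differentiableAt_fst hd
  have h2 : C1At l (fun _ (p : E × F) => backOrbit T δ p.1 0) (fun p => backOrbit T δ p.1 0) q :=
    C1At.const ((h.contDiffAt_backOrbit hq1).comp q contDiffAt_fst)
  have hsub : ∀ {f : ι → E × F → E × F} {g : E × F → E × F},
      C1At l f g q → C1At l (fun _ => g) g q → C1At l (fun i p => p + (f i p - g p)) id q := by
    intro f g hf hg
    refine ⟨?_, ?_, ?_⟩
    · filter_upwards [hf.diff, hg.diff] with y k1 k2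
      exact differentiableAt_id.add (k1.sub k2)
    · have h3 : Tendsto (fun y : ι × (E × F) => y.2) (l ×ˢ 𝓝 q) (𝓝 q) := tendsto_snd
      simpa using h3.add (hf.val.sub hg.val)
    · have h3 := (tendsto_const_nhds (x := ContinuousLinearMap.id ℝ (E × F))).add
        (hf.deriv.sub hg.deriv)
      rw [sub_self, add_zero, ← fderiv_id (x := q)] at h3
      refine h3.congr' ?_
      filter_upwards [hf.diff, hg.diff] with y k1 k2
      rw [fderiv_id]
      exact ((hasFDerivAt_id y.2).add (k1.hasFDerivAt.sub k2.hasFDerivAt)).fderiv.symm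
  exact hsub h1 h2

variable {κ : OpenPartialHomeomorph M (E × F)} {h : M → M}

/-- A point whose backward orbit stays near the saddle is on the local unstable manifold. -/
lemma IsAdapted.eq_backOrbit {h' : M → M} (ha : IsAdapted κ Lu Ls δ h)
    (hh : ∀ x, h (h' x) = x) (hx : ∀ j, h'^[j] x ∈ κ.source ∧ ‖κ (h'^[j] x)‖ ≤ δ) :
    κ x = backOrbit (chartMap κ h) δ (κ x).1 0 := by
  have h1 : IsBackOrbit (chartMap κ h) δ fun j => κ (h'^[j] x) := ⟨fun j => (hx j).2, fun j => by
    simp only [Function.comp_apply]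
    rw [κ.left_inv (hx _).1, Function.iterate_succ_apply', hh]⟩
  obtain ⟨h2, h3⟩ := ha.saddle.backOrbit_spec ((norm_fst_le _).trans (hx 0).2)
  exact congrFun (ha.saddle.eq_of_isBackOrbit h1 h2 h3.symm) 0

/-- The local unstable manifold, as a subset of `M`. -/
def localUnstable (κ : OpenPartialHomeomorph M (E × F)) (δ : ℝ) (h : M → M) : Set M :=
  (fun a => κ.symm (backOrbit (chartMap κ h) δ a 0)) '' {a | ‖a‖ ≤ δ}

lemma IsAdapted.tendsto_localUnstable {h' : M → M} (ha : IsAdapted κ Lu Ls δ h)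
    (hh : ∀ x, h' (h x) = x) (hp : ‖p‖ ≤ δ) (hhp : chartMap κ h p = p) {U : Set M}
    (hU : U ∈ 𝓝 (κ.symm p)) : ∀ᶠ j : ℕ in atTop, ∀ x ∈ localUnstable κ δ h, h'^[j] x ∈ U := by
  obtain ⟨ε, hε, hεU⟩ := Metric.mem_nhds_iff.1 ((κ.continuousAt_symm (ha.target p hp)) hU)
  have h1 : Tendsto (fun j : ℕ => (δ + δ) * (1 / 4 : ℝ) ^ j) atTop (𝓝 ((δ + δ) * 0)) :=
    (tendsto_pow_atTop_nhds_zero_of_lt_one (by norm_num) (by norm_num)).const_mul _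
  rw [mul_zero] at h1
  filter_upwards [h1.eventually (gt_mem_nhds hε)] with j hj
  rintro _ ⟨a, hna, rfl⟩
  obtain ⟨h2, h3⟩ := ha.saddle.backOrbit_spec hna
  set y := backOrbit (chartMap κ h) δ a
  have h4 : h'^[j] (κ.symm (y 0)) = κ.symm (y j) := by
    clear hj
    induction j with
    | zero => rfl
    | succ j ih =>
      rw [Function.iterate_succ_apply', ih, ← h2.2 j, ha.symm_chartMap (h2.1 _), hh]
  change h'^[j] (κ.symm (y 0)) ∈ U
  rw [h4]
  refine hεU (mem_ball_iff_norm.2 (lt_of_le_of_lt ?_ hj))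
  have h5 := ha.saddle.norm_backOrbit_sub_le h2 (y' := fun _ => p) ⟨fun _ => hp, fun _ => hhp⟩ j
  rw [one_div_pow, mul_one_div]
  refine h5.trans ?_
  gcongr
  exact (norm_fst_le _).trans ((norm_sub_le _ _).trans (add_le_add (h2.1 0) hp))

lemma inUnstableManifold_image {g : Equiv.Perm M} (hg : Continuous g.symm) (hm : 0 < m)
    (N : ℕ) (hR : g^[n] R = R) {X : Set M}
    (hX : ∀ U ∈ 𝓝 R, ∀ᶠ j : ℕ in atTop, ∀ x ∈ X, (g.symm^[n * m])^[j] x ∈ U) :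
    InUnstableManifold g n R (g^[n * m * N] '' X) := by
  have hinv : ∀ k, Function.LeftInverse g.symm^[k] g^[k] := fun k =>
    Function.LeftInverse.iterate g.symm_apply_apply k
  have hR' : ∀ i, g.symm^[n * i] R = R := fun i => by
    conv_lhs => rw [← iterate_mul_fixed hR i]
    exact hinv _ R
  intro U hU
  have h1 : ∀ᶠ x in 𝓝 R, ∀ i ∈ Finset.range m, g.symm^[n * i] x ∈ U :=
    (eventually_all_finset _).2 fun i _ =>
      ((hg.iterate (n * i)).tendsto R).eventually (by rw [hR']; exact hU)
  obtain ⟨J, hJ⟩ := eventually_atTop.1 (hX _ h1)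
  refine eventually_atTop.2 ⟨m * (J + N), ?_⟩
  rintro k hk _ ⟨x, hx, rfl⟩
  have h2 : J + N ≤ k / m := (Nat.le_div_iff_mul_le hm).2 (by rwa [mul_comm])
  obtain ⟨j, hj⟩ := Nat.exists_eq_add_of_le h2
  have h3 : n * k = n * (k % m) + (n * m * (J + j) + n * m * N) := by
    conv_lhs => rw [← Nat.div_add_mod k m, hj]
    ring
  rw [h3, Function.iterate_add_apply, Function.iterate_add_apply, hinv, Function.iterate_mul _ (n * m)]
  exact hJ _ (Nat.le_add_right _ _) x hx _ (Finset.mem_range.2 (Nat.mod_lt _ hm))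

end

section

lemma InUnstableManifold.mono {g : Equiv.Perm M}
    {X Y : Set M} (h : InUnstableManifold g n R Y) (hXY : X ⊆ Y) : InUnstableManifold g n R X :=
  fun U hU => (h U hU).mono fun _ hk x hx => hk x (hXY hx)

variable [T2Space M] [CompactSpace M] [IsManifold (𝓡 3) ∞ M] [IsManifold (𝓡 3) 1 M] {r : ℕ∞}
  [FiniteDimensional ℝ E] [FiniteDimensional ℝ F]
  {χ : OpenPartialHomeomorph M E3} {Q : E3 ≃L[ℝ] E × F} {f : Diff r M}

/-- A compact piece of the unstable manifold moves continuously with the diffeomorphism. -/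
lemma IsSaddleChart.exists_moves (hr : 1 ≤ r) (hφ : φ ∈ Atlas M)
    (h : IsSaddleChart f n m R φ Q Lu Ls) (hm : 0 < m) {δ δ' : ℝ}
    (hg : ∀ᶠ g : Diff r M in 𝓝 f, HasSaddleNear (affineChart φ Q (φ R)) Lu Ls n m δ δ' g)
    (hχ : χ ∈ Atlas M) {Z : Set E3} (hZ : IsCompact Z)
    (hZχ : Z ⊆ χ.target) (hT : InUnstableManifold f.toEquiv n R (χ.symm '' Z)) :
    ∃ θ : Diff r M → E3 → E3, (∀ p ∈ Z, C1At (𝓝 f) θ id p) ∧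
      (∀ᶠ g in 𝓝 f, ∀ p ∈ Z, ContDiffAt ℝ 1 (θ g) p) ∧ (∀ᶠ g in 𝓝 f, InjOn (θ g) Z) ∧
      ∀ᶠ g : Diff r M in 𝓝 f, InUnstableManifold g.toEquiv n
        ((affineChart φ Q (φ R)).symm (saddlePt (affineChart φ Q (φ R)) δ' g^[n * m]))
        (χ.symm '' (θ g '' Z)) := by
  set κ := affineChart φ Q (φ R) with hκ
  have hf := hg.self_of_nhds.big
  have hinv : ∀ (g : Diff r M) k, Function.LeftInverse g^[k] g.symm^[k] := fun g k =>
    Function.LeftInverse.iterate g.apply_symm_apply k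
  have hinv' : ∀ (g : Diff r M) k, Function.LeftInverse g.symm^[k] g^[k] := fun g k =>
    Function.LeftInverse.iterate g.symm_apply_apply k
  obtain ⟨N, hN⟩ : ∃ N, ∀ x ∈ χ.symm '' Z, ∀ j, (f.symm^[n * m])^[j] (f.symm^[n * m * N] x) ∈ κ.source ∧
      ‖κ ((f.symm^[n * m])^[j] (f.symm^[n * m * N] x))‖ < δ := by
    have h1 : ∀ᶠ x in 𝓝 R, x ∈ κ.source ∧ ‖κ x‖ < δ := by
      have h3 : ∀ᶠ x in 𝓝 R, x ∈ κ.source := κ.open_source.mem_nhds h.mem_source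
      refine h3.and ?_
      have h2 : Tendsto (fun x => ‖κ x‖) (𝓝 R) (𝓝 ‖κ R‖) := (κ.continuousAt h.mem_source).norm
      rw [hκ, affineChart_self, norm_zero] at h2
      exact h2.eventually (gt_mem_nhds hf.saddle.pos)
    obtain ⟨N, hN⟩ := eventually_atTop.1 (hT _ h1)
    refine ⟨N, fun x hx j => ?_⟩
    have h2 := hN (m * (j + N)) (by nlinarith) x hx
    rw [show n * (m * (j + N)) = n * m * j + n * m * N by ring, Function.iterate_add_apply,
      Function.iterate_mul _ (n * m)] at h2
    exact h2
  set K := n * m * N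
  have hN0 : ∀ x ∈ χ.symm '' Z, f.symm^[K] x ∈ κ.source ∧ ‖κ (f.symm^[K] x)‖ < δ := fun x hx => hN x hx 0
  have hbo : ∀ x ∈ χ.symm '' Z, κ (f.symm^[K] x) =
      backOrbit (chartMap κ f^[n * m]) δ (κ (f.symm^[K] x)).1 0 := fun x hx =>
    hf.eq_backOrbit (hinv f _) fun j => ⟨(hN x hx j).1, (hN x hx j).2.le⟩
  have hfst : ∀ x ∈ χ.symm '' Z, ‖(κ (f.symm^[K] x)).1‖ ≤ δ := fun x hx =>
    (norm_fst_le _).trans (hN0 x hx).2.le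
  let σ : Diff r M → E × F → E × F := fun g =>
    unstableShift (chartMap κ f^[n * m]) (chartMap κ g^[n * m]) δ
  have hσ : ∀ g, ∀ x ∈ χ.symm '' Z, σ g (κ (f.symm^[K] x)) =
      backOrbit (chartMap κ g^[n * m]) δ (κ (f.symm^[K] x)).1 0 := fun g x hx => by
    conv_lhs => rw [hbo x hx]
    exact unstableShift_backOrbit hf.saddle (hfst x hx)
  have hσt : ∀ {g : Diff r M}, HasSaddleNear κ Lu Ls n m δ δ' g → ∀ x ∈ χ.symm '' Z,
      σ g (κ (f.symm^[K] x)) ∈ κ.target := fun {g} hg x hx => by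
    rw [hσ g x hx]
    exact hg.big.target _ ((hg.big.saddle.backOrbit_spec (hfst x hx)).1.1 0)
  let Θ : Diff r M → M → M := fun g => g^[K] ∘ (κ.symm ∘ σ g ∘ κ) ∘ f.symm^[K]
  have hC : ∀ x ∈ χ.symm '' Z, C1AtM (𝓝 f) Θ id x := by
    intro x hx
    have h1 : C1At (𝓝 f) σ id (κ (f.symm^[K] x)) := c1At_unstableShift hf.saddle
      (hg.mono fun g hg => hg.big.saddle) (fun p hp => hf.c1At hφ
        (C1AtM.iterate (Diff.c1AtM hr f) (n * m)) hp) (hN0 x hx).2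
    have h2 := (C1AtM.of_affineChart hφ (hN0 x hx).1 h1).comp
      (C1AtM.const (l := 𝓝 f) (Diff.contMDiffAt_iterate hr f.symm K x))
    have h3 := (C1AtM.iterate (Diff.c1AtM hr f) K _).comp h2
    rwa [show f^[K] ∘ id ∘ f.symm^[K] = id from funext (hinv f K)] at h3
  have hmem : ∀ {p}, p ∈ Z → χ.symm p ∈ χ.source ∧ χ (χ.symm p) = p ∧ χ.symm p ∈ χ.symm '' Z :=
    fun hp => ⟨χ.map_target (hZχ hp), χ.right_inv (hZχ hp), mem_image_of_mem _ hp⟩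
  have hsrc : ∀ᶠ g in 𝓝 f, ∀ p ∈ Z, Θ g (χ.symm p) ∈ χ.source := by
    refine hZ.eventually_forall_of_forall_eventually fun p hp => ?_
    obtain ⟨h1, h2, h3⟩ := hmem hp
    have h4 := tendsto_chart_symm (l := 𝓝 f) h1
    rw [h2] at h4
    rw [nhds_prod_eq]
    exact ((hC _ h3).val.comp h4).eventually (χ.open_source.mem_nhds h1)
  refine ⟨fun g => χ ∘ Θ g ∘ χ.symm, fun p hp => ?_, ?_, ?_, ?_⟩
  · obtain ⟨h1, h2, h3⟩ := hmem hp
    have h4 := (hC _ h3).chart χ hχ χ hχ h1 h1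
    rw [h2] at h4
    refine h4.congr ?_ (.of_forall fun _ => rfl)
    filter_upwards [χ.open_target.mem_nhds (hZχ hp)] with q hq using χ.right_inv hq
  · filter_upwards [hsrc, hg] with g h1 h2 p hp
    obtain ⟨h3, h4, h5⟩ := hmem hp
    have h6 : ContMDiffAt (𝓡 3) (𝓡 3) 1 (κ.symm ∘ σ g ∘ κ) (f.symm^[K] (χ.symm p)) :=
      ContMDiffAt.comp (I' := 𝓘(ℝ, E × F)) _
        (contMDiffAt_affineChart_symm (Q := Q) (c := φ R) hφ (hσt h2 _ h5))
        (ContMDiffAt.comp (I' := 𝓘(ℝ, E × F)) (g := σ g) _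
          (contDiffAt_unstableShift hf.saddle h2.big.saddle (hN0 _ h5).2).contMDiffAt
          (contMDiffAt_affineChart hφ (hN0 _ h5).1))
    have h7 := contDiffAt_chart hχ hχ h3 (h1 p hp) ((Diff.contMDiffAt_iterate hr g K _).comp _
      (h6.comp _ (Diff.contMDiffAt_iterate hr f.symm K _)))
    rwa [h4] at h7
  · filter_upwards [hsrc, hg] with g h1 h2 p hp q hq hpq
    have h3 := (hinv' g K).injective (χ.injOn (h1 p hp) (h1 q hq) hpq)
    have hp' := (hmem hp).2.2
    have hq' := (hmem hq).2.2
    have h4 := κ.symm.injOn (hσt h2 _ hp') (hσt h2 _ hq') h3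
    rw [hσ g _ hp', hσ g _ hq'] at h4
    have h5 := congrArg Prod.fst h4
    rw [(h2.big.saddle.backOrbit_spec (hfst _ hp')).2,
      (h2.big.saddle.backOrbit_spec (hfst _ hq')).2] at h5
    have h6 : κ (f.symm^[K] (χ.symm p)) = κ (f.symm^[K] (χ.symm q)) := by
      rw [hbo _ hp', hbo _ hq', h5]
    exact χ.symm.injOn (hZχ hp) (hZχ hq) ((hinv f K).injective
      (κ.injOn (hN0 _ hp').1 (hN0 _ hq').1 h6))
  · filter_upwards [hsrc, hg] with g h1 h2
    obtain ⟨h3, h4⟩ := h2.small.saddlePt_spec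
    refine InUnstableManifold.mono (inUnstableManifold_image (g := g.toEquiv) g.symm.continuous hm N
      h2.iterate_saddlePt (X := localUnstable κ δ g^[n * m]) fun U hU =>
        h2.big.tendsto_localUnstable (hinv' g _) (h3.trans h2.le) h4 hU) ?_
    rintro _ ⟨_, ⟨p, hp, rfl⟩, rfl⟩
    have h5 := (hmem hp).2.2
    refine ⟨κ.symm (σ g (κ (f.symm^[K] (χ.symm p)))), ⟨_, hfst _ h5, by rw [hσ g _ h5]⟩, ?_⟩
    exact (χ.left_inv (h1 p hp)).symm

end

end

end

end BlenderTube

end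

open BlenderTube in
theorem propositionp {M : Type*} [TopologicalSpace M] [T2Space M] [CompactSpace M]
    [ChartedSpace E3 M] [IsManifold (𝓡 3) ∞ M]
    (r : ℕ∞) (hr : 1 ≤ r) (f : Diff r M) (𝔅 : BlenderData M) (Γ : Set M)
    (hΓ : IsBlenderHorseshoe f.toEquiv 𝔅 Γ) (T : Set M) (hT : IsUUTubeInBetween f 𝔅 T) :
    HaveTangency (localStableSet f 𝔅.domain) (fun X => X ⊆ T) ∧
    ∀ (n : ℕ) (R : M), IsSaddleOfIndexTwo f n R → InUnstableManifold f.toEquiv n R T →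
      ∃ V ∈ 𝓝 f, ∃ ρ : Diff r M → M, IsContinuation f n R V ρ ∧
        ∀ g ∈ V, HaveTangency (localStableSet g 𝔅.domain)
          (InUnstableManifold g.toEquiv n (ρ g)) := by
  haveI : IsManifold (𝓡 3) 1 M := IsManifold.of_le (n := ∞) (by exact_mod_cast le_top)
  refine ⟨tangency_tube hr f hΓ hT, fun n R hR hTR => ?_⟩
  obtain ⟨u, Z, rfl, hZc, hZ, -⟩ := exists_periodic_tube hT (hΓ.lo_lt_hi 2)
  obtain ⟨Es, Eu, m, Q, Lu, Ls, hEu, hEs, hm, hch⟩ :=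
    exists_isSaddleChart (Diff.contMDiffAt_iterate hr f) hR
  have hφ := IsManifold.chart_mem_maximalAtlas (I := 𝓡 3) (n := 1) R
  obtain ⟨δ, -, δ', -, hg⟩ := hch.exists_hasSaddleNear hr hφ
  obtain ⟨θ, h1, h2, h3, h4⟩ := hch.exists_moves hr hφ (Nat.pos_of_ne_zero hm) hg hΓ.chart_mem
    ((isCompact_cbox 𝔅.lo 𝔅.hi).of_isClosed_subset hZc hZ) (hZ.trans hΓ.box_subset) hTR
  have h5 := hΓ.eventually_haveTangency (C1Near.of_diff hr hΓ.chart_mem (Diff.c1AtM hr f)) hT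
    (hZ.trans hΓ.box_subset) h1 h2 h3
  obtain ⟨V, hV, hVo, hfV⟩ := eventually_nhds_iff.1 ((hg.and h4).and h5)
  exact ⟨V, hVo.mem_nhds hfV, _, hch.isContinuation hr hφ hR.1 hm hEu hEs hVo hfV
    fun g hg => (hV g hg).1.1, fun g hg => (hV g hg).2.mono fun X hX => (hV g hg).1.2.mono hX⟩
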